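/- Let $M$ be a (Hausdorff, finite-dimensional, smooth) manifold with base point $x_0$. Let $\mathcal{HG}$ be its hoop group: piecewise smooth loops based at $x_0$, modulo the equivalence relation generated by monotone reparametrization and by $P_1\circ P_2\circ P_2^*\circ P_3\sim P_1\circ P_3$. Let $\mathcal F_I$ be the set of subgroups $F\subset\mathcal{HG}$ generated by finitely many simple (non-selfintersecting) loops that pairwise meet at $x_0$ only, ordered by inclusion. For each $F\in\mathcal F_I$ choose such generating loops $L^F_1,\dots,L^F_{n(F)}$. Let $G$ be a compact Lie group of matrices with normalized Haar measure $\mu$ and a left and right invariant Riemannian metric, let $e_1,\dots,e_d$ be an orthonormal basis of $T_{\mathrm{id}}G$, and let $e^k_l$ ($1\le k\le n$, $1\le l\le d$) be the orthonormal frame of $TG^n$ given by the left invariant field $e_l$ in the $k$-th component. Let $W=\mathbb C^\kappa$ be a finite-dimensional coefficient space, and let $H_n=L^2(G^n,Cl(TG^n)\otimes W)$ with respect to $\mu^n$, where $Cl$ is the complexified Clifford algebra with $uv+vu=-2\langle u,v\rangle$ and the products $e_{i_1}\cdots e_{i_k}$ ($i_1<\dots<i_k$) of an orthonormal basis are orthonormal.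 On smooth sections of $Cl(TG^n)\otimes W$ let $\mathcal D_n\xi=\sum_a e_a\cdot\nabla_{e_a}\xi$, where $(e_a)$ is the above frame and $\nabla$ is the Levi-Civita connection. Then: 1. For every $n\ge 0$, $\mathcal D_n$ maps smooth sections to smooth sections, is densely defined on $H_n$, and under the identification $e_{i_1}\cdots e_{i_k}\leftrightarrow e_{i_1}\wedge\cdots\wedge e_{i_k}$ of Clifford sections with $W$-valued differential forms it equals $d+d^*$, where $d$ is the exterior derivative and $d^*$ its formal $L^2$-adjoint. 2. If $F_1\subset F_2$ in $\mathcal F_I$, then every $L^{F_1}_j$ is, as a hoop, equal to $L^{F_2}_{\sigma(j)}$ or to its inverse, for a unique injection $\sigma$ and a unique choice of signs. Hence the structure map $P_{F_1,F_2}:G^{n(F_2)}\to G^{n(F_1)}$ given by these data (delete some coordinates, invert some of the remaining ones) is the one induced by restriction of homomorphisms: $P_{F_1,F_2}\big((\varphi(L^{F_2}_i))_i\big)=(\varphi(L^{F_1}_j))_j$ for every $\varphi\in\mathrm{Hom}(F_2,G)$. 3. For every map $P:G^n\to G^m$ that selects coordinates by an injection and inverts some of them, the pull-back $(P^*\xi)(g)=Cl(A_g)\,\xi(P(g))$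 is an isometric embedding $H_m\to H_n$. Here $A_g:T_{P(g)}G^m\to T_gG^n$ is the isometry that is the inclusion on the non-inverted coordinates and the differential of the inversion on the inverted ones. It maps the smooth sections to smooth sections, and $\mathcal D_nP^*=P^*\mathcal D_m$ on them. In particular this holds for all $P^*_{F_1,F_2}$, including those that involve inversions. 4. Let $\mathcal H_{alg}=\bigoplus_{F\in\mathcal F_I}H_{n(F)}/N$, where $N$ is spanned by the elements $v-P^*_{F_1,F_2}v$. Call $v\in H_n$ pure if it is orthogonal to everything pulled back from fewer than $n$ coordinates (for $W=\mathbb C$: if it lies in $\mathcal H_2\otimes\cdots\otimes\mathcal H_2$, where $\mathcal H_2=\{1\}^\perp\subset L^2(G,Cl(TG))$). There is exactly one inner product on $\mathcal H_{alg}$ such that, for pure $v_1\in H_{n(F_1)}$ and $v_2\in H_{n(F_2)}$, $\langle v_1,v_2\rangle=\langle P^*_{F_1,F_3}v_1,P^*_{F_2,F_3}v_2\rangle$ for all $F_3\in\mathcal F_I$ with $F_3\supset F_1,F_2$, and $\langle v_1,v_2\rangle=0$ if there is no such $F_3$. 5. Let $\mathcal H$ be the completion of $\mathcal H_{alg}$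 for this inner product; it is the inductive limit, namely $\mathcal H'_{si}$ if $W=\mathbb C$ and $\mathcal H_{si}$ if $W=M_N(\mathbb C)$. The operators $\mathcal D_{n(F)}$ descend to $\mathcal H$: there is exactly one linear operator $\mathcal D$ in $\mathcal H$ whose domain is the linear span of the images of the smooth sections of all $H_{n(F)}$ and which satisfies $\mathcal D[\xi]=[\mathcal D_{n(F)}\xi]$ for these; its domain is dense. -/

import Mathlib

open scoped Manifold ContDiff unitInterval
open MeasureTheory

noncomputable section

/-! ### The hoop group -/

section Hoops

variable {k : ℕ} {M : Type*} [TopologicalSpace M] [ChartedSpace (EuclideanSpace ℝ (Fin k)) M]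

/-- A path is piecewise smooth if `[0,1]` has a finite subdivision such that the path is smooth,
up to the end points, on every interval of the subdivision. -/
def PwSmooth (k : ℕ) {M : Type*} [TopologicalSpace M] [ChartedSpace (EuclideanSpace ℝ (Fin k)) M]
    {x y : M} (γ : Path x y) : Prop :=
  ∃ s : Finset ℝ, ∀ a b : ℝ, 0 ≤ a → a < b → b ≤ 1 → (∀ c ∈ s, c ∉ Set.Ioo a b) →
    ContMDiffOn 𝓘(ℝ, ℝ) (𝓡 k) ∞ γ.extend (Set.Icc a b)

theorem PwSmooth.refl (x : M) : PwSmooth k (Path.refl x) :=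
  ⟨∅, fun a b _ _ _ _ => by
    have : ((Path.refl x).extend : ℝ → M) = fun _ => x := by
      funext t; simp
    rw [this]; exact contMDiffOn_const⟩

theorem PwSmooth.symm {x y : M} {γ : Path x y} (h : PwSmooth k γ) : PwSmooth k γ.symm := by
  obtain ⟨s, hs⟩ := h
  refine ⟨s.image (fun c => 1 - c), fun a b ha hab hb hc => ?_⟩
  have h1 := hs (1 - b) (1 - a) (by linarith) (by linarith) (by linarith) (fun c hcs hmem => by
    refine hc (1 - c) (Finset.mem_image_of_mem _ hcs) ⟨?_, ?_⟩
    · linarith [hmem.2]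
    · linarith [hmem.1])
  have h2 : ContMDiffOn 𝓘(ℝ, ℝ) 𝓘(ℝ, ℝ) ∞ (fun t : ℝ => 1 - t) (Set.Icc a b) := by
    rw [contMDiffOn_iff_contDiffOn]; fun_prop
  have h3 := h1.comp h2 (fun t ht => ⟨by linarith [ht.2], by linarith [ht.1]⟩)
  refine h3.congr (fun t _ => ?_)
  simp [Path.extend_symm_apply]

theorem PwSmooth.trans {x y z : M} {γ : Path x y} {δ : Path y z} (h : PwSmooth k γ)
    (h' : PwSmooth k δ) : PwSmooth k (γ.trans δ) := by
  obtain ⟨s, hs⟩ := h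
  obtain ⟨s', hs'⟩ := h'
  refine ⟨insert (1 / 2) (s.image (fun c => c / 2) ∪ s'.image (fun c => (c + 1) / 2)),
    fun a b ha hab hb hc => ?_⟩
  have hhalf : ¬ (a < 1 / 2 ∧ 1 / 2 < b) := fun hh => hc (1 / 2) (by simp) hh
  by_cases hb2 : b ≤ 1 / 2
  · have h1 := hs (2 * a) (2 * b) (by linarith) (by linarith) (by linarith) (fun c hcs hmem => by
      refine hc (c / 2) ?_ ⟨?_, ?_⟩
      · exact Finset.mem_insert_of_mem (Finset.mem_union_left _ (Finset.mem_image_of_mem _ hcs))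
      · linarith [hmem.1]
      · linarith [hmem.2])
    have h2 : ContMDiffOn 𝓘(ℝ, ℝ) 𝓘(ℝ, ℝ) ∞ (fun t : ℝ => 2 * t) (Set.Icc a b) := by
      rw [contMDiffOn_iff_contDiffOn]; fun_prop
    have h3 := h1.comp h2 (fun t ht => ⟨by linarith [ht.1], by linarith [ht.2]⟩)
    refine h3.congr (fun t ht => ?_)
    have ht0 : 0 ≤ t := ha.trans ht.1
    have ht1 : t ≤ 1 / 2 := ht.2.trans hb2
    have hI : t ∈ Set.Icc (0 : ℝ) 1 := ⟨ht0, by linarith⟩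
    have hI' : 2 * t ∈ Set.Icc (0 : ℝ) 1 := ⟨by linarith, by linarith⟩
    simp only [Function.comp]
    rw [Path.extend_apply _ hI, Path.extend_apply _ hI', Path.trans_apply, dif_pos ht1]
  · have ha2 : 1 / 2 ≤ a := by
      by_contra hcon
      exact hhalf ⟨not_le.mp hcon, not_le.mp hb2⟩
    have h1 := hs' (2 * a - 1) (2 * b - 1) (by linarith) (by linarith) (by linarith)
      (fun c hcs hmem => by
        refine hc ((c + 1) / 2) ?_ ⟨?_, ?_⟩
        · exact Finset.mem_insert_of_mem
            (Finset.mem_union_right _ (Finset.mem_image_of_mem (fun c => (c + 1) / 2) hcs))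
        · linarith [hmem.1]
        · linarith [hmem.2])
    have h2 : ContMDiffOn 𝓘(ℝ, ℝ) 𝓘(ℝ, ℝ) ∞ (fun t : ℝ => 2 * t - 1) (Set.Icc a b) := by
      rw [contMDiffOn_iff_contDiffOn]; fun_prop
    have h3 := h1.comp h2 (fun t ht => ⟨by linarith [ht.1], by linarith [ht.2]⟩)
    refine h3.congr (fun t ht => ?_)
    have ht0 : 1 / 2 ≤ t := ha2.trans ht.1
    have hI : t ∈ Set.Icc (0 : ℝ) 1 := ⟨by linarith, ht.2.trans hb⟩
    have hI' : 2 * t - 1 ∈ Set.Icc (0 : ℝ) 1 := ⟨by linarith, by linarith [hI.2]⟩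
    simp only [Function.comp]
    rw [Path.extend_apply _ hI, Path.extend_apply _ hI', Path.trans_apply]
    split_ifs with hle
    · have : t = 1 / 2 := le_antisymm hle ht0
      subst this
      have e1 : (⟨2 * (1 / 2), by norm_num⟩ : I) = 1 := by ext; norm_num
      have e2 : (⟨2 * (1 / 2) - 1, by norm_num⟩ : I) = 0 := by ext; norm_num
      simp only [e1, e2]; simp
    · rfl

/-- `γ` is obtained from `γ'` by a monotone continuous change of parameter. -/
def IsReparam {X : Type*} [TopologicalSpace X] {x y : X} (γ γ' : Path x y) : Prop :=
  ∃ φ : Path (0 : I) 1, Monotone φ ∧ ∀ t, γ t = γ' (φ t)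

section Reparam

variable {X : Type*} [TopologicalSpace X] {x y z w : X}

theorem IsReparam.rfl (γ : Path x y) : IsReparam γ γ :=
  ⟨Path.id, fun _ _ h => h, fun _ => by simp⟩

theorem IsReparam.comp {γ γ' γ'' : Path x y} (h : IsReparam γ γ') (h' : IsReparam γ' γ'') :
    IsReparam γ γ'' := by
  obtain ⟨φ, hφ, h⟩ := h
  obtain ⟨ψ, hψ, h'⟩ := h'
  refine ⟨⟨⟨fun t => ψ (φ t), by fun_prop⟩, by simp, by simp⟩, fun a b hab => hψ (hφ hab), ?_⟩
  intro t; rw [h, h']; simp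

theorem IsReparam.symm {γ γ' : Path x y} (h : IsReparam γ γ') :
    IsReparam γ.symm γ'.symm := by
  obtain ⟨φ, hφ, h⟩ := h
  refine ⟨⟨⟨fun t => σ (φ (σ t)), by fun_prop⟩, by simp, by simp⟩, fun a b hab => ?_, ?_⟩
  · have : φ (σ b) ≤ φ (σ a) := hφ (unitInterval.symm_le_symm.2 hab)
    exact unitInterval.symm_le_symm.2 this
  · intro t; simp [Path.symm_apply, h]

theorem IsReparam.trans {γ γ' : Path x y} {δ δ' : Path y z} (h : IsReparam γ γ')
    (h' : IsReparam δ δ') : IsReparam (γ.trans δ) (γ'.trans δ') := by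
  obtain ⟨φ, hφ, h⟩ := h
  obtain ⟨ψ, hψ, h'⟩ := h'
  let f : I → I := fun t => if h : (t : ℝ) ≤ 1 / 2
    then ⟨(φ ⟨2 * t, by constructor <;> linarith [t.2.1]⟩ : ℝ) / 2,
      by have := (φ ⟨2 * t, by constructor <;> linarith [t.2.1]⟩).2
         constructor <;> linarith [this.1, this.2]⟩
    else ⟨((ψ ⟨2 * t - 1, by constructor <;> linarith [t.2.2]⟩ : ℝ) + 1) / 2,
      by have := (ψ ⟨2 * t - 1, by constructor <;> linarith [t.2.2]⟩).2
         constructor <;> linarith [this.1, this.2]⟩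
  have hf : Monotone f := by
    intro a b hab
    have hab' : (a : ℝ) ≤ b := hab
    simp only [f]
    rw [← Subtype.coe_le_coe]
    split_ifs with ha hb hb
    · have := hφ (a := ⟨2 * a, by constructor <;> linarith [a.2.1]⟩)
        (b := ⟨2 * b, by constructor <;> linarith [b.2.1]⟩)
        (Subtype.mk_le_mk.2 (by linarith))
      have := Subtype.coe_le_coe.2 this
      simp only; linarith
    · have h1 := (φ ⟨2 * a, by constructor <;> linarith [a.2.1]⟩).2.2
      have h2 := (ψ ⟨2 * b - 1, by constructor <;> linarith [b.2.2]⟩).2.1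
      simp only; linarith
    · exact absurd (hab'.trans hb) ha
    · have := hψ (a := ⟨2 * a - 1, by constructor <;> linarith [a.2.2]⟩)
        (b := ⟨2 * b - 1, by constructor <;> linarith [b.2.2]⟩)
        (Subtype.mk_le_mk.2 (by linarith))
      have := Subtype.coe_le_coe.2 this
      simp only; linarith
  have hfc : Continuous f := by
    have e : ∀ t, (f t : ℝ) = (fun t : ℝ => if t ≤ 1 / 2 then (φ.extend (2 * t) : ℝ) / 2
        else ((ψ.extend (2 * t - 1) : ℝ) + 1) / 2) (t : ℝ) := by
      intro t
      simp only [f]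
      split_ifs with ht
      · rw [Path.extend_apply _ ⟨by linarith [t.2.1], by linarith⟩]
      · rw [Path.extend_apply _ ⟨by linarith, by linarith [t.2.2]⟩]
    rw [continuous_induced_rng]
    have : (Subtype.val ∘ f) = (fun t : ℝ => if t ≤ 1 / 2 then (φ.extend (2 * t) : ℝ) / 2
        else ((ψ.extend (2 * t - 1) : ℝ) + 1) / 2) ∘ Subtype.val := funext e
    rw [this]
    refine Continuous.comp ?_ continuous_subtype_val
    refine Continuous.if_le (by fun_prop) (by fun_prop) continuous_id continuous_const ?_
    intro t ht
    subst ht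
    norm_num
  refine ⟨⟨⟨f, hfc⟩, ?_, ?_⟩, hf, ?_⟩
  · ext
    simp [f]
  · ext
    have : (⟨2 * ((1 : I) : ℝ) - 1, by norm_num⟩ : I) = 1 := by ext; norm_num
    have h2 : ¬ ((1 : I) : ℝ) ≤ 1 / 2 := by norm_num
    simp only [f]
    rw [dif_neg h2, this]; simp
  · intro t
    change _ = (γ'.trans δ') (f t)
    rw [Path.trans_apply, Path.trans_apply]
    by_cases ht : (t : ℝ) ≤ 1 / 2
    · have hft : (f t : ℝ) = (φ ⟨2 * t, by constructor <;> linarith [t.2.1]⟩ : ℝ) / 2 := by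
        simp only [f]; rw [dif_pos ht]
      have hle : (f t : ℝ) ≤ 1 / 2 := by
        rw [hft]
        have := (φ ⟨2 * t, by constructor <;> linarith [t.2.1]⟩).2.2
        linarith
      rw [dif_pos ht, dif_pos hle, h]
      congr 1
      ext; simp only [hft]; ring
    · have hft : (f t : ℝ) = ((ψ ⟨2 * t - 1, by constructor <;> linarith [t.2.2]⟩ : ℝ) + 1) / 2 := by
        simp only [f]; rw [dif_neg ht]
      rw [dif_neg ht]
      split_ifs with hle
      · have h0 : (ψ ⟨2 * t - 1, by constructor <;> linarith [t.2.2]⟩ : ℝ) = 0 := by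
          have := (ψ ⟨2 * t - 1, by constructor <;> linarith [t.2.2]⟩).2.1
          rw [hft] at hle; linarith
        have h0' : ψ ⟨2 * t - 1, by constructor <;> linarith [t.2.2]⟩ = 0 := Subtype.ext h0
        have e1 : (⟨2 * (f t : ℝ), by rw [hft, h0]; norm_num⟩ : I) = 1 := by
          ext; simp only [hft, h0]; norm_num
        rw [h', h0', e1]; simp
      · rw [h']
        congr 1
        ext; simp only [hft]; ring

theorem IsReparam.assoc (p : Path x y) (q : Path y z) (r : Path z w) :
    IsReparam ((p.trans q).trans r) (p.trans (q.trans r)) := by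
  rw [Path.Homotopy.trans_assoc_reparam]
  refine ⟨⟨⟨fun t => ⟨Path.Homotopy.transAssocReparamAux t,
    Path.Homotopy.transAssocReparamAux_mem_I t⟩, by fun_prop⟩,
    Subtype.ext Path.Homotopy.transAssocReparamAux_zero,
    Subtype.ext Path.Homotopy.transAssocReparamAux_one⟩, ?_, ?_⟩
  · intro a b hab
    have hab' : (a : ℝ) ≤ b := hab
    change (⟨_, _⟩ : I) ≤ ⟨_, _⟩
    rw [Subtype.mk_le_mk]
    unfold Path.Homotopy.transAssocReparamAux
    split_ifs <;> linarith
  · intro t; rfl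

theorem IsReparam.trans_refl (p : Path x y) : IsReparam (p.trans (Path.refl y)) p := by
  rw [Path.Homotopy.trans_refl_reparam]
  refine ⟨⟨⟨fun t => ⟨Path.Homotopy.transReflReparamAux t,
    Path.Homotopy.transReflReparamAux_mem_I t⟩, by fun_prop⟩,
    Subtype.ext Path.Homotopy.transReflReparamAux_zero,
    Subtype.ext Path.Homotopy.transReflReparamAux_one⟩, ?_, ?_⟩
  · intro a b hab
    have hab' : (a : ℝ) ≤ b := hab
    change (⟨_, _⟩ : I) ≤ ⟨_, _⟩
    rw [Subtype.mk_le_mk]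
    unfold Path.Homotopy.transReflReparamAux
    split_ifs <;> linarith
  · intro t; rfl

theorem IsReparam.refl_trans (p : Path x y) : IsReparam ((Path.refl x).trans p) p := by
  have h := (IsReparam.trans_refl p.symm).symm
  rwa [Path.trans_symm, Path.symm_symm, Path.refl_symm] at h

end Reparam

/-- A piecewise smooth loop based at `x₀`. -/
structure BasedLoop (k : ℕ) {M : Type*} [TopologicalSpace M]
    [ChartedSpace (EuclideanSpace ℝ (Fin k)) M] (x₀ : M) where
  path : Path x₀ x₀
  smooth : PwSmooth k path

variable {x₀ : M}

/-- The two elementary identifications of loops: change of parameter, and the removal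
of a retracing, `P₁ ∘ P₂ ∘ P₂* ∘ P₃ ∼ P₁ ∘ P₃`. -/
inductive HoopStep : BasedLoop k x₀ → BasedLoop k x₀ → Prop
  | reparam (L L' : BasedLoop k x₀) (h : IsReparam L.path L'.path) : HoopStep L L'
  | retrace {y z : M} (P₁ : Path x₀ y) (P₂ : Path y z) (P₃ : Path y x₀)
      (h₁ : PwSmooth k P₁) (h₂ : PwSmooth k P₂) (h₃ : PwSmooth k P₃) (L L' : BasedLoop k x₀)
      (hL : L.path = P₁.trans (P₂.trans (P₂.symm.trans P₃))) (hL' : L'.path = P₁.trans P₃) :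
      HoopStep L L'

instance hoopSetoid (k : ℕ) {M : Type*} [TopologicalSpace M]
    [ChartedSpace (EuclideanSpace ℝ (Fin k)) M] (x₀ : M) : Setoid (BasedLoop k x₀) :=
  Relation.EqvGen.setoid HoopStep

/-- Hoops: based loops up to the equivalence relation generated by change of parameter and
retracings. -/
def Hoop (k : ℕ) {M : Type*} [TopologicalSpace M]
    [ChartedSpace (EuclideanSpace ℝ (Fin k)) M] (x₀ : M) : Type _ :=
  Quotient (hoopSetoid k x₀)

namespace BasedLoop

def mul (L L' : BasedLoop k x₀) : BasedLoop k x₀ := ⟨L.path.trans L'.path, L.smooth.trans L'.smooth⟩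

def inv (L : BasedLoop k x₀) : BasedLoop k x₀ := ⟨L.path.symm, L.smooth.symm⟩

def one (k : ℕ) {M : Type*} [TopologicalSpace M]
    [ChartedSpace (EuclideanSpace ℝ (Fin k)) M] (x₀ : M) : BasedLoop k x₀ :=
  ⟨Path.refl x₀, PwSmooth.refl x₀⟩

theorem equiv_of_reparam {L L' : BasedLoop k x₀} (h : IsReparam L.path L'.path) : L ≈ L' :=
  Relation.EqvGen.rel _ _ (HoopStep.reparam _ _ h)

theorem equiv_of_retrace {y z : M} (P₁ : Path x₀ y) (P₂ : Path y z) (P₃ : Path y x₀)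
    (h₁ : PwSmooth k P₁) (h₂ : PwSmooth k P₂) (h₃ : PwSmooth k P₃) {L L' : BasedLoop k x₀}
    (hL : IsReparam L.path (P₁.trans (P₂.trans (P₂.symm.trans P₃))) ∨
      IsReparam (P₁.trans (P₂.trans (P₂.symm.trans P₃))) L.path)
    (hL' : IsReparam L'.path (P₁.trans P₃) ∨ IsReparam (P₁.trans P₃) L'.path) : L ≈ L' := by
  let A : BasedLoop k x₀ := ⟨P₁.trans (P₂.trans (P₂.symm.trans P₃)),
    h₁.trans (h₂.trans (h₂.symm.trans h₃))⟩
  let A' : BasedLoop k x₀ := ⟨P₁.trans P₃, h₁.trans h₃⟩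
  have hAA' : A ≈ A' := Relation.EqvGen.rel _ _ (HoopStep.retrace P₁ P₂ P₃ h₁ h₂ h₃ _ _ rfl rfl)
  have hLA : L ≈ A := by
    rcases hL with h | h
    · exact equiv_of_reparam (L' := A) h
    · exact Setoid.symm (equiv_of_reparam (L := A) h)
  have hLA' : L' ≈ A' := by
    rcases hL' with h | h
    · exact equiv_of_reparam (L' := A') h
    · exact Setoid.symm (equiv_of_reparam (L := A') h)
  exact Setoid.trans hLA (Setoid.trans hAA' (Setoid.symm hLA'))

theorem mul_right_congr {L L' : BasedLoop k x₀} (K : BasedLoop k x₀) (h : L ≈ L') :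
    L.mul K ≈ L'.mul K := by
  induction h with
  | rel L L' h =>
    cases h with
    | reparam _ _ h => exact equiv_of_reparam (h.trans (IsReparam.rfl _))
    | retrace P₁ P₂ P₃ h₁ h₂ h₃ _ _ hL hL' =>
      refine equiv_of_retrace P₁ P₂ (P₃.trans K.path) h₁ h₂ (h₃.trans K.smooth)
        (Or.inl ?_) (Or.inl ?_)
      · change IsReparam (L.path.trans K.path) _
        rw [hL]
        refine (IsReparam.assoc _ _ _).comp ((IsReparam.rfl _).trans ?_)
        refine (IsReparam.assoc _ _ _).comp ((IsReparam.rfl _).trans ?_)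
        exact IsReparam.assoc _ _ _
      · change IsReparam (L'.path.trans K.path) _
        rw [hL']
        exact IsReparam.assoc _ _ _
  | refl => exact Setoid.refl _
  | symm _ _ _ ih => exact Setoid.symm ih
  | trans _ _ _ _ _ ih ih' => exact Setoid.trans ih ih'

theorem inv_congr {L L' : BasedLoop k x₀} (h : L ≈ L') : L.inv ≈ L'.inv := by
  induction h with
  | rel L L' h =>
    cases h with
    | reparam _ _ h => exact equiv_of_reparam h.symm
    | retrace P₁ P₂ P₃ h₁ h₂ h₃ _ _ hL hL' =>
      refine equiv_of_retrace P₃.symm P₂ P₁.symm h₃.symm h₂ h₁.symm (Or.inl ?_) (Or.inl ?_)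
      · change IsReparam L.path.symm _
        rw [hL]
        simp only [Path.trans_symm, Path.symm_symm]
        exact (IsReparam.assoc _ _ _).comp (IsReparam.assoc _ _ _)
      · change IsReparam L'.path.symm _
        rw [hL', Path.trans_symm]
        exact IsReparam.rfl _
  | refl => exact Setoid.refl _
  | symm _ _ _ ih => exact Setoid.symm ih
  | trans _ _ _ _ _ ih ih' => exact Setoid.trans ih ih'

theorem mul_left_congr {L L' : BasedLoop k x₀} (K : BasedLoop k x₀) (h : L ≈ L') :
    K.mul L ≈ K.mul L' := by
  have h1 := inv_congr (mul_right_congr K.inv (inv_congr h))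
  simpa [mul, inv, Path.trans_symm] using h1

end BasedLoop

/-- The hoop group: product and inverse are induced by composition and reversal of loops. -/
instance (k : ℕ) {M : Type*} [TopologicalSpace M] [ChartedSpace (EuclideanSpace ℝ (Fin k)) M]
    (x₀ : M) : Group (Hoop k x₀) where
  mul := Quotient.map₂ BasedLoop.mul fun _ _ h _ _ h' =>
    Setoid.trans (BasedLoop.mul_right_congr _ h) (BasedLoop.mul_left_congr _ h')
  one := Quotient.mk _ (BasedLoop.one k x₀)
  inv := Quotient.map BasedLoop.inv fun _ _ h => BasedLoop.inv_congr h
  mul_assoc := by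
    rintro ⟨a⟩ ⟨b⟩ ⟨c⟩
    exact Quotient.sound (BasedLoop.equiv_of_reparam (IsReparam.assoc _ _ _))
  one_mul := by
    rintro ⟨a⟩
    exact Quotient.sound (BasedLoop.equiv_of_reparam (IsReparam.refl_trans _))
  mul_one := by
    rintro ⟨a⟩
    exact Quotient.sound (BasedLoop.equiv_of_reparam (IsReparam.trans_refl _))
  inv_mul_cancel := by
    rintro ⟨a⟩
    refine Quotient.sound (BasedLoop.equiv_of_retrace (Path.refl x₀) a.path.symm (Path.refl x₀)
      (PwSmooth.refl _) a.smooth.symm (PwSmooth.refl _) (Or.inr ?_) (Or.inr ?_))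
    · rw [Path.symm_symm]
      exact (IsReparam.refl_trans _).comp ((IsReparam.rfl _).trans (IsReparam.trans_refl _))
    · exact IsReparam.refl_trans _

/-- The hoop of a based loop. -/
def BasedLoop.hoop (L : BasedLoop k x₀) : Hoop k x₀ := Quotient.mk _ L

/-- A loop is simple (non-selfintersecting) if it takes the same value twice only at its
two ends; in particular it meets the base point at its ends only. -/
def BasedLoop.IsSimple (L : BasedLoop k x₀) : Prop :=
  ∀ s t : I, L.path s = L.path t → s = t ∨ (s = 0 ∧ t = 1) ∨ (s = 1 ∧ t = 0)

/-- A system of simple loops that pairwise meet at the base point only, generating `F`. -/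
structure LoopSystem (F : Subgroup (Hoop k x₀)) where
  /-- the number `n(F)` of loops -/
  n : ℕ
  loop : Fin n → BasedLoop k x₀
  simple : ∀ i, (loop i).IsSimple
  disjoint : ∀ i j, i ≠ j → ∀ s t : I, (loop i).path s = (loop j).path t → (loop i).path s = x₀
  generates : Subgroup.closure (Set.range fun i => (loop i).hoop) = F

variable (k x₀) in
/-- The set `𝓕_I` of subgroups of the hoop group generated by finitely many simple loops
that have no common points or segments apart from the base point, ordered by inclusion. -/
def LoopSubgroup : Type _ := {F : Subgroup (Hoop k x₀) // Nonempty (LoopSystem F)}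

instance : PartialOrder (LoopSubgroup k x₀) := inferInstanceAs (PartialOrder (Subtype _))

end Hoops

/-! ### Clifford algebras -/

section Clifford

/-- The quadratic form `z ↦ -∑ zᵢ²`, complexification of the one of the Clifford relation
`u v + v u = -2⟨u,v⟩` on the Euclidean space with orthonormal basis indexed by `ι`. -/
def cliffForm (ι : Type*) [Fintype ι] : QuadraticForm ℂ (ι → ℂ) :=
  QuadraticMap.weightedSumSquares ℂ (fun _ : ι => (-1 : ℂ))

abbrev Cliff (ι : Type*) [Fintype ι] : Type _ := CliffordAlgebra (cliffForm ι)

variable {ι : Type*} [Fintype ι] [LinearOrder ι]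

def cliffGen (i : ι) : Cliff ι := CliffordAlgebra.ι (cliffForm ι) (Pi.single i 1)

/-- The product `e_{i₁} ⋯ e_{iₖ}` with `i₁ < ⋯ < iₖ` the elements of `S`. -/
def cliffProd (S : Finset ι) : Cliff ι := ((S.sort (· ≤ ·)).map cliffGen).prod

theorem cliffGen_mul_self (i : ι) : cliffGen i * cliffGen i = (-1 : Cliff ι) := by
  unfold cliffGen
  rw [CliffordAlgebra.ι_sq_scalar]
  have : cliffForm ι (Pi.single i 1) = -1 := by
    simp [cliffForm, QuadraticMap.weightedSumSquares_apply, Pi.single_apply]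
  rw [this, map_neg, map_one]

theorem cliffGen_mul_comm {i j : ι} (h : i ≠ j) :
    cliffGen i * cliffGen j = -(cliffGen j * cliffGen i : Cliff ι) := by
  unfold cliffGen
  apply CliffordAlgebra.ι_mul_ι_comm_of_isOrtho
  rw [QuadraticMap.isOrtho_def]
  simp only [cliffForm, QuadraticMap.weightedSumSquares_apply, ← Finset.sum_add_distrib]
  refine Finset.sum_congr rfl fun a _ => ?_
  by_cases h1 : a = i
  · subst h1; simp [h]
  · simp [h1]

theorem cliffGen_mul_list (i : ι) (l : List ι) :
    l.SortedLT → ∃ (c : ℂ) (S : Finset ι), (∀ j ∈ S, j = i ∨ j ∈ l) ∧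
      cliffGen i * (l.map cliffGen).prod = c • cliffProd S := by
  induction l with
  | nil => exact fun _ => ⟨1, {i}, by simp, by simp [cliffProd]⟩
  | cons a l ih =>
    intro hl
    have hl' : l.SortedLT := by
      have := hl.pairwise; exact (List.pairwise_cons.1 this).2.sortedLT
    have ha : ∀ j ∈ l, a < j := (List.pairwise_cons.1 hl.pairwise).1
    have key : ∀ l : List ι, l.SortedLT → cliffProd l.toFinset = (l.map cliffGen).prod := by
      intro l hl
      unfold cliffProd
      rw [(List.toFinset_sort (· ≤ ·) hl.nodup).2 (hl.pairwise.imp le_of_lt)]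
    rcases lt_trichotomy i a with h | h | h
    · refine ⟨1, (i :: a :: l).toFinset, by simp, ?_⟩
      rw [key]
      · simp
      · apply List.Pairwise.sortedLT
        rw [List.pairwise_cons]
        refine ⟨?_, hl.pairwise⟩
        intro j hj
        rcases List.mem_cons.1 hj with rfl | hj
        · exact h
        · exact h.trans (ha j hj)
    · subst h
      refine ⟨-1, l.toFinset, by simp +contextual, ?_⟩
      rw [key l hl', List.map_cons, List.prod_cons, ← mul_assoc, cliffGen_mul_self]
      simp
    · obtain ⟨c, S, hI, he⟩ := ih hl'
      have haI : ∀ j ∈ S, a < j := fun j hj => (hI j hj).elim (fun e => e ▸ h) (ha j)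
      refine ⟨-c, insert a S, ?_, ?_⟩
      · intro j hj
        rcases Finset.mem_insert.1 hj with rfl | hj
        · simp
        · rcases hI j hj with h | h <;> simp [h]
      · have hs : cliffProd (insert a S) = cliffGen a * cliffProd S := by
          have : insert a S = (a :: S.sort (· ≤ ·)).toFinset := by simp
          rw [this, key]
          · simp [cliffProd]
          · apply List.Pairwise.sortedLT
            rw [List.pairwise_cons]
            refine ⟨fun j hj => haI j (by simpa using hj), ?_⟩
            exact (Finset.sortedLT_sort S).pairwise
        rw [List.map_cons, List.prod_cons, ← mul_assoc, cliffGen_mul_comm h.ne', neg_mul,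
          mul_assoc, he, hs]
        simp

theorem cliffProd_span : ⊤ ≤ Submodule.span ℂ (Set.range (cliffProd : Finset ι → Cliff ι)) := by
  have hmul : ∀ (v : ι → ℂ) (x : Cliff ι), x ∈ Submodule.span ℂ (Set.range cliffProd) →
      CliffordAlgebra.ι (cliffForm ι) v * x ∈ Submodule.span ℂ (Set.range cliffProd) := by
    intro v x hx
    have hv : v = ∑ i, v i • Pi.single i (1 : ℂ) := by
      ext j; simp [Finset.sum_apply, Pi.single_apply]
    rw [hv, map_sum, Finset.sum_mul]
    refine Submodule.sum_mem _ fun i _ => ?_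
    rw [map_smul, smul_mul_assoc]
    refine Submodule.smul_mem _ _ ?_
    induction hx using Submodule.span_induction with
    | mem x hx =>
      obtain ⟨S, rfl⟩ := hx
      obtain ⟨c, J, -, h⟩ := cliffGen_mul_list i (S.sort (· ≤ ·)) (Finset.sortedLT_sort S)
      change cliffGen i * _ ∈ _
      rw [cliffProd, h]
      exact Submodule.smul_mem _ _ (Submodule.subset_span ⟨J, rfl⟩)
    | zero => simp
    | add x y _ _ hx hy => rw [mul_add]; exact Submodule.add_mem _ hx hy
    | smul c x _ hx => rw [mul_smul_comm]; exact Submodule.smul_mem _ _ hx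
  intro x _
  induction x using CliffordAlgebra.left_induction with
  | algebraMap r =>
    rw [Algebra.algebraMap_eq_smul_one]
    exact Submodule.smul_mem _ _ (Submodule.subset_span ⟨∅, by simp [cliffProd]⟩)
  | add x y hx hy => exact Submodule.add_mem _ (hx trivial) (hy trivial)
  | ι_mul x v hx => exact hmul v x (hx trivial)

theorem cliff_finrank : Fintype.card (Finset ι) = Module.finrank ℂ (Cliff ι) := by
  have : Invertible (2 : ℂ) := invertibleOfNonzero two_ne_zero
  rw [(CliffordAlgebra.equivExterior (cliffForm ι)).finrank_eq,
    Module.finrank_eq_card_basis (Pi.basisFun ℂ ι).ExteriorAlgebra]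

/-- The basis `e_{i₁} ⋯ e_{iₖ}`, `i₁ < ⋯ < iₖ`, of the (complexified) Clifford algebra. -/
def cliffBasis (ι : Type*) [Fintype ι] [LinearOrder ι] : Module.Basis (Finset ι) ℂ (Cliff ι) :=
  basisOfTopLeSpanOfCardEqFinrank cliffProd cliffProd_span cliff_finrank

theorem cliffBasis_apply (S : Finset ι) : cliffBasis ι S = cliffProd S := by
  simp [cliffBasis]

/-- The algebra homomorphism `Cl(A)`, `e_{i₁} ⋯ e_{iₖ} ↦ A e_{i₁} ⋯ A e_{iₖ}`, induced by an
isometry of Euclidean spaces given by a matrix `A` with `AᵀA = 1`. -/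
def cliffMap {ι ι' : Type*} [Fintype ι] [DecidableEq ι] [Fintype ι'] (A : Matrix ι' ι ℝ)
    (hA : A.transpose * A = 1) : Cliff ι →ₐ[ℂ] Cliff ι' :=
  CliffordAlgebra.map
    { (Matrix.toLin' (A.map (fun r : ℝ => (r : ℂ)))) with
      map_app' := fun v => by
        have h1 : ∀ a a', ∑ b, (A b a : ℂ) * (A b a' : ℂ) = if a = a' then 1 else 0 := by
          intro a a'
          have := congrFun (congrFun hA a) a'
          rw [Matrix.mul_apply, Matrix.one_apply] at this
          simp only [Matrix.transpose_apply] at this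
          by_cases haa : a = a'
          · rw [if_pos haa] at this ⊢
            exact_mod_cast this
          · rw [if_neg haa] at this ⊢
            exact_mod_cast this
        have h2 : ∑ b, (∑ a, (A b a : ℂ) * v a) * (∑ a, (A b a : ℂ) * v a) = ∑ a, v a * v a := by
          have : ∀ b, (∑ a, (A b a : ℂ) * v a) * (∑ a, (A b a : ℂ) * v a)
              = ∑ a, ∑ a', ((A b a : ℂ) * (A b a' : ℂ)) * (v a * v a') := by
            intro b
            rw [Finset.sum_mul_sum]
            refine Finset.sum_congr rfl fun a _ => Finset.sum_congr rfl fun a' _ => ?_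
            ring
          simp only [this]
          rw [Finset.sum_comm]
          refine Finset.sum_congr rfl fun a _ => ?_
          rw [Finset.sum_comm]
          simp only [← Finset.sum_mul, h1]
          simp
        simp only [cliffForm, QuadraticMap.weightedSumSquares_apply]
        simp only [AddHom.toFun_eq_coe, LinearMap.coe_toAddHom, Matrix.toLin'_apply,
          Matrix.mulVec, dotProduct, Matrix.map_apply, neg_smul, one_smul,
          Finset.sum_neg_distrib]
        rw [h2] }

/-- For a matrix `A`, the value of the derivation extending `A` on `e_{i₁} ⋯ e_{iₖ}`, that is
`∑ₗ e_{i₁} ⋯ A e_{iₗ} ⋯ e_{iₖ}`. -/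
def cliffDerivList {ι : Type*} [Fintype ι] [LinearOrder ι] (A : Matrix ι ι ℝ) :
    List ι → Cliff ι
  | [] => 0
  | i :: l => CliffordAlgebra.ι (cliffForm ι) (fun j => (A j i : ℂ)) * (l.map cliffGen).prod
      + cliffGen i * cliffDerivList A l

/-- The extension of a (skew-symmetric) endomorphism of Euclidean space to the Clifford algebra. -/
def cliffDeriv {ι : Type*} [Fintype ι] [LinearOrder ι] (A : Matrix ι ι ℝ) :
    Cliff ι →ₗ[ℂ] Cliff ι :=
  (cliffBasis ι).constr ℂ fun S => cliffDerivList A (S.sort (· ≤ ·))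

/-- The Hilbert space `Cl ⊗ ℂ^κ` in which the `e_{i₁} ⋯ e_{iₖ}` (times the unit vectors of `ℂ^κ`)
are orthonormal. Coordinates are taken with respect to `cliffBasis`. A one-point set `κ` gives `Cl`
itself, and `κ = Fin N × Fin N` gives `Cl ⊗ M_N(ℂ)`. -/
abbrev Fib (ι κ : Type*) : Type _ := EuclideanSpace ℂ (Finset ι × κ)

/-- The action `T ⊗ 1` on `Cl ⊗ ℂ^κ` of a linear map `T` between Clifford algebras. -/
def onFib {ι ι' : Type*} [Fintype ι] [LinearOrder ι] [Fintype ι'] [LinearOrder ι'] {κ : Type*}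
    (T : Cliff ι →ₗ[ℂ] Cliff ι') : Fib ι κ →ₗ[ℂ] Fib ι' κ where
  toFun x := WithLp.toLp 2 fun p =>
    (cliffBasis ι').repr (T (∑ S, x (S, p.2) • cliffBasis ι S)) p.1
  map_add' x y := by
    ext p
    simp only [PiLp.add_apply, add_smul, Finset.sum_add_distrib, map_add, Finsupp.add_apply]
  map_smul' c x := by
    ext p
    simp only [PiLp.smul_apply, smul_assoc, ← Finset.smul_sum, map_smul, Finsupp.smul_apply,
      RingHom.id_apply]

end Clifford

/-! ### The Lie group `G` -/

section LieGroup

variable {A : Type*} [NormedRing A] [NormedAlgebra ℝ A] {G : Type*} [Group G]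

/-- The smooth structure of a compact group `G` with a faithful matrix representation `ρ` is that
of the closed subgroup `ρ(G)` of the general linear group.
Its Lie algebra `T_{id} G` is the space of all velocities at time `0` of curves in `G` that pass
through the identity at time `0`. -/
def lieAlg (ρ : G →* A) : Submodule ℝ A where
  carrier := {X | ∃ γ : ℝ → G, γ 0 = 1 ∧ HasDerivAt (fun t => ρ (γ t)) X 0}
  zero_mem' := ⟨fun _ => 1, rfl, hasDerivAt_const _ _⟩
  add_mem' := by
    rintro X Y ⟨γ, hγ, hX⟩ ⟨δ, hδ, hY⟩
    refine ⟨fun t => γ t * δ t, by simp [hγ, hδ], ?_⟩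
    have := hX.mul hY
    simpa [hγ, hδ, Pi.mul_def] using this
  smul_mem' := by
    rintro c X ⟨γ, hγ, hX⟩
    refine ⟨fun t => γ (c * t), by simp [hγ], ?_⟩
    have h0 : HasDerivAt (fun t : ℝ => c * t) c 0 := by
      simpa using (hasDerivAt_id (0 : ℝ)).const_mul c
    have hX' : HasDerivAt (fun t => ρ (γ t)) X (c * 0) := by simpa using hX
    exact HasDerivAt.scomp (0 : ℝ) hX' h0

variable {ρ : G →* A}

theorem lieAlg_conj_mem (h : G) {X : A} (hX : X ∈ lieAlg ρ) : ρ h * X * ρ h⁻¹ ∈ lieAlg ρ := by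
  obtain ⟨γ, hγ, hX⟩ := hX
  refine ⟨fun t => h * γ t * h⁻¹, by simp [hγ], ?_⟩
  have := (hX.const_mul (ρ h)).mul_const (ρ h⁻¹)
  simpa [mul_assoc] using this

variable [FiniteDimensional ℝ A]

theorem lieAlg_bracket_mem {X Y : A} (hX : X ∈ lieAlg ρ) (hY : Y ∈ lieAlg ρ) :
    X * Y - Y * X ∈ lieAlg ρ := by
  have : CompleteSpace A := FiniteDimensional.complete ℝ A
  obtain ⟨γ, hγ, hX⟩ := hX
  have hinv : ∀ t, ρ (γ t)⁻¹ = Ring.inverse (ρ (γ t)) := by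
    intro t
    let u : (Aˣ) := ⟨ρ (γ t), ρ (γ t)⁻¹, by rw [← map_mul]; simp, by rw [← map_mul]; simp⟩
    exact (Ring.inverse_unit u).symm
  have hd : HasDerivAt (fun t => ρ (γ t)⁻¹) (-X) 0 := by
    have h1 := hasFDerivAt_ringInverse (𝕜 := ℝ) (1 : (Aˣ))
    have h2 : ((1 : (Aˣ)) : A) = ρ (γ 0) := by simp [hγ]
    rw [h2] at h1
    have h3 := h1.comp_hasDerivAt (0 : ℝ) hX
    have e2 : (fun t => ρ (γ t)⁻¹) = Ring.inverse ∘ fun t => ρ (γ t) := funext hinv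
    rw [e2]
    simpa using h3
  have hf : HasDerivAt (fun t => ρ (γ t) * Y * ρ (γ t)⁻¹) (X * Y - Y * X) 0 := by
    have := (hX.mul_const Y).mul hd
    have e : X * Y * ρ (γ 0)⁻¹ + ρ (γ 0) * Y * -X = X * Y - Y * X := by
      simp [hγ, sub_eq_add_neg]
    rw [e] at this
    exact this
  have hclosed : IsClosed (lieAlg ρ : Set A) := Submodule.closed_of_finiteDimensional _
  refine hclosed.mem_of_tendsto (hasDerivAt_iff_tendsto_slope.1 hf) (Filter.Eventually.of_forall ?_)
  intro t
  rw [slope_def_module]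
  exact (lieAlg ρ).smul_mem _ ((lieAlg ρ).sub_mem (lieAlg_conj_mem _ hY) (lieAlg_conj_mem _ hY))

/-- The Lie bracket of `lieAlg ρ`, the commutator. It is the bracket of left invariant vector
fields. -/
def lieBr (X Y : lieAlg ρ) : lieAlg ρ :=
  ⟨(X : A) * Y - Y * X, lieAlg_bracket_mem X.2 Y.2⟩

variable (ρ) in
/-- The adjoint action of `G` on its Lie algebra. -/
def lieAd (h : G) : lieAlg ρ →ₗ[ℝ] lieAlg ρ where
  toFun X := ⟨ρ h * X * ρ h⁻¹, lieAlg_conj_mem h X.2⟩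
  map_add' X Y := by ext1; simp [mul_add, add_mul]
  map_smul' c X := by ext1; simp

/-- A left and right invariant Riemannian metric on `G`: a left invariant metric is given by its
value at the identity, an inner product on the Lie algebra, and it is right invariant as well
if and only if this inner product is invariant under the adjoint action. -/
structure BiinvariantMetric (ρ : G →* A) where
  form : LinearMap.BilinForm ℝ (lieAlg ρ)
  symm : ∀ X Y, form X Y = form Y X
  pos : ∀ X, X ≠ 0 → 0 < form X X
  ad_invariant : ∀ h X Y, form (lieAd ρ h X) (lieAd ρ h Y) = form X Y

/-- An orthonormal basis of the Lie algebra. -/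
structure OrthonormalFrame (B : BiinvariantMetric ρ) (d : ℕ) where
  basis : Module.Basis (Fin d) ℝ (lieAlg ρ)
  orthonormal : ∀ i j, B.form (basis i) (basis j) = if i = j then 1 else 0

variable {B : BiinvariantMetric ρ} {d : ℕ} (e : OrthonormalFrame B d)

/-- The matrix of the adjoint action in the orthonormal basis. -/
def OrthonormalFrame.adMatrix (h : G) : Matrix (Fin d) (Fin d) ℝ :=
  Matrix.of fun i j => e.basis.repr (lieAd ρ h (e.basis j)) i

theorem OrthonormalFrame.form_eq (X Y : lieAlg ρ) :
    B.form X Y = ∑ i, e.basis.repr X i * e.basis.repr Y i := by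
  conv_lhs => rw [← e.basis.sum_repr X, ← e.basis.sum_repr Y]
  simp only [map_sum, LinearMap.sum_apply, map_smul, LinearMap.smul_apply, e.orthonormal,
    smul_eq_mul, mul_ite, mul_one, mul_zero, Finset.sum_ite_eq', Finset.mem_univ, if_true]
  exact Finset.sum_congr rfl fun i _ => mul_comm _ _

theorem OrthonormalFrame.adMatrix_orthogonal (h : G) :
    (e.adMatrix h).transpose * e.adMatrix h = 1 := by
  ext i j
  rw [Matrix.mul_apply, Matrix.one_apply]
  have := B.ad_invariant h (e.basis i) (e.basis j)
  rw [e.form_eq, e.orthonormal] at this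
  simpa [adMatrix] using this

/-- The index set of the orthonormal frame `e_l^k` of the tangent bundle of `Gⁿ`, where `e_l^k` is
the left invariant vector field `e_l` in the `k`-th component. -/
abbrev Idx (n d : ℕ) : Type := Fin n ×ₗ Fin d

variable {n : ℕ}

/-- The structure constants of the frame of `Gⁿ`, `[e_a, e_b] = ∑_c (structConst a b c) e_c`. -/
def OrthonormalFrame.structConst (a b c : Idx n d) : ℝ :=
  if (ofLex a).1 = (ofLex b).1 ∧ (ofLex b).1 = (ofLex c).1 then
    e.basis.repr (lieBr (e.basis (ofLex a).2) (e.basis (ofLex b).2)) (ofLex c).2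
  else 0

/-- The Christoffel symbols of the Levi-Civita connection of `Gⁿ` in the orthonormal frame,
`∇_{e_a} e_b = ∑_c (leviCivita a c b) e_c`, as given by the Koszul formula. -/
def OrthonormalFrame.leviCivita (a : Idx n d) : Matrix (Idx n d) (Idx n d) ℝ :=
  Matrix.of fun c b =>
    (e.structConst a b c - e.structConst b c a + e.structConst c a b) / 2

theorem OrthonormalFrame.structConst_skew (a b c : Idx n d) :
    e.structConst a b c = - e.structConst b a c := by
  unfold structConst
  have : ∀ X Y : lieAlg ρ, lieBr X Y = - lieBr Y X := fun X Y => by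
    ext1; simp [lieBr]
  by_cases h : (ofLex a).1 = (ofLex b).1
  · rw [this]
    simp only [h, map_neg, Finsupp.neg_apply, true_and]
    split_ifs <;> simp
  · simp [h, Ne.symm h]

/-- The connection is torsion free. -/
theorem OrthonormalFrame.leviCivita_torsion (a b c : Idx n d) :
    e.leviCivita a c b - e.leviCivita b c a = e.structConst a b c := by
  simp only [leviCivita, Matrix.of_apply]
  rw [e.structConst_skew b a c, e.structConst_skew a c b, e.structConst_skew c b a]
  ring

/-- The connection is metric. -/
theorem OrthonormalFrame.leviCivita_metric (a b c : Idx n d) :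
    e.leviCivita a c b + e.leviCivita a b c = 0 := by
  simp only [leviCivita, Matrix.of_apply]
  rw [e.structConst_skew c b a, e.structConst_skew a c b, e.structConst_skew b a c]
  ring

/-- The point of the space of `n`-tuples of operators given by a point of `Gⁿ`. -/
def toOps (ρ : G →* A) (g : Fin n → G) : Fin n → A := fun i => ρ (g i)

/-- A function is smooth along `Gⁿ` if it is smooth at all points of `Gⁿ`. -/
def SmoothAlong {W : Type*} [NormedAddCommGroup W] [NormedSpace ℝ W] (ρ : G →* A)
    (F : (Fin n → A) → W) : Prop :=
  ∀ g : Fin n → G, ContDiffAt ℝ ∞ F (toOps ρ g)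

/-- The smooth functions on `Gⁿ` with values in `W`: the restrictions to the submanifold `Gⁿ` of
functions that are smooth along it. With `W = Fib (Idx n d) κ`, these are the smooth sections of
`Cl(TGⁿ) ⊗ ℂ^κ`, where `Cl(TGⁿ)` is trivialized by the orthonormal frame `e_l^k`. -/
def smoothFun (n : ℕ) (W : Type*) [NormedAddCommGroup W] [NormedSpace ℂ W] (ρ : G →* A) :
    Submodule ℂ ((Fin n → G) → W) where
  carrier := {ξ | ∃ F : (Fin n → A) → W, SmoothAlong ρ F ∧ ∀ g, ξ g = F (toOps ρ g)}
  zero_mem' := ⟨fun _ => 0, fun _ => contDiffAt_const, fun _ => rfl⟩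
  add_mem' := by
    rintro ξ η ⟨F, hF, hξ⟩ ⟨F', hF', hη⟩
    exact ⟨fun x => F x + F' x, fun g => (hF g).add (hF' g), fun g => by simp [hξ, hη]⟩
  smul_mem' := by
    rintro c ξ ⟨F, hF, hξ⟩
    exact ⟨fun x => c • F x, fun g => (hF g).const_smul c, fun g => by simp [hξ]⟩

variable {κ : Type*}

/-- The derivative of `ξ` at `g` along the vector field `e_a`, that is, along the curve
that moves in one component only, as `g_k γ(t)` with a curve `γ` in `G` of velocity `e_l`. -/
def OrthonormalFrame.frameDeriv {W : Type*} [NormedAddCommGroup W] [NormedSpace ℝ W]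
    (ξ : (Fin n → G) → W) (a : Idx n d) (g : Fin n → G) : W :=
  deriv (fun t : ℝ => ξ (Function.update g (ofLex a).1
    (g (ofLex a).1 * (e.basis (ofLex a).2).2.choose t))) 0

/-- The Levi-Civita connection in `Cl(TGⁿ) ⊗ ℂ^κ`: the covariant derivative `∇_{e_a}`. -/
def OrthonormalFrame.covDeriv [Fintype κ] (ξ : (Fin n → G) → Fib (Idx n d) κ) (a : Idx n d)
    (g : Fin n → G) : Fib (Idx n d) κ :=
  e.frameDeriv ξ a g + onFib (cliffDeriv (e.leviCivita a)) (ξ g)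

/-- The Euler-Dirac operator `ξ ↦ ∑_a e_a · ∇_{e_a} ξ`. -/
def OrthonormalFrame.eulerDirac [Fintype κ] (ξ : (Fin n → G) → Fib (Idx n d) κ)
    (g : Fin n → G) : Fib (Idx n d) κ :=
  ∑ a : Idx n d, onFib (LinearMap.mulLeft ℂ (cliffGen a)) (e.covDeriv ξ a g)

/-- The vector field `e_a` on `Gⁿ`, as a tuple of operators. -/
def OrthonormalFrame.frameField (a : Idx n d) (g : Fin n → G) : Fin n → A :=
  Pi.single (ofLex a).1 (ρ (g (ofLex a).1) * (e.basis (ofLex a).2 : A))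

/-- The section of `Cl(TGⁿ) ⊗ ℂ^κ` that corresponds to the restriction to `Gⁿ` of a differential
form `θ` of degree `p` with values in `ℂ^κ`: the component at `e_{a₁} ⋯ e_{aₚ}`, `a₁ < ⋯ < aₚ`, is
`θ(e_{a₁}, …, e_{aₚ})`. -/
def OrthonormalFrame.formSection [Fintype κ] {p : ℕ}
    (θ : (Fin n → A) → (Fin n → A) [⋀^Fin p]→L[ℝ] EuclideanSpace ℂ κ)
    (g : Fin n → G) : Fib (Idx n d) κ :=
  WithLp.toLp 2 fun q =>
    if h : q.1.card = p then
      θ (toOps ρ g) (fun i => e.frameField (q.1.orderEmbOfFin h i) g) q.2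
    else 0

/-! ### The structure maps -/

/-- The combinatorial part of a structure map `Gⁿ → Gᵐ`: which coordinates are kept, and which of
these are inverted. -/
structure SignedInj (m n : ℕ) where
  idx : Fin m ↪ Fin n
  inverted : Fin m → Bool

variable {m : ℕ}

/-- The structure map `Gⁿ → Gᵐ`, deleting some coordinates and inverting some coordinates. -/
def SignedInj.map (τ : SignedInj m n) (g : Fin n → G) : Fin m → G :=
  fun j => if τ.inverted j then (g (τ.idx j))⁻¹ else g (τ.idx j)

/-- The isometric lift of tangent vectors along `P = τ.map`, from `T_{P(g)} Gᵐ` to `T_g Gⁿ`, in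
the orthonormal frames: a vector in a coordinate which is not inverted goes to the same vector;
in an inverted coordinate, the differential of `h ↦ h⁻¹` maps the vector `X` at `h` to the vector
`-Ad(h) X` at `h⁻¹` (in left invariant frames), where `h = P(g)_j`. -/
def OrthonormalFrame.tangentMatrix (τ : SignedInj m n) (g : Fin n → G) :
    Matrix (Idx n d) (Idx m d) ℝ :=
  Matrix.of fun b a =>
    if (ofLex b).1 = τ.idx (ofLex a).1 then
      (if τ.inverted (ofLex a).1 then
        -e.adMatrix (τ.map g (ofLex a).1) (ofLex b).2 (ofLex a).2
      else (1 : Matrix (Fin d) (Fin d) ℝ) (ofLex b).2 (ofLex a).2)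
    else 0

theorem OrthonormalFrame.tangentMatrix_orthogonal (τ : SignedInj m n) (g : Fin n → G) :
    (e.tangentMatrix τ g).transpose * e.tangentMatrix τ g = 1 := by
  ext a a'
  rw [Matrix.mul_apply, Matrix.one_apply]
  have hsum : ∀ f : Idx n d → ℝ, ∑ b, f b = ∑ i : Fin n, ∑ l : Fin d, f (toLex (i, l)) := by
    intro f
    rw [← Fintype.sum_prod_type', ← Equiv.sum_comp toLex]
  rw [hsum]
  simp only [Matrix.transpose_apply, tangentMatrix, Matrix.of_apply, ofLex_toLex]
  by_cases hj : (ofLex a).1 = (ofLex a').1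
  · rw [Finset.sum_eq_single (τ.idx (ofLex a).1)]
    · have hiff : a = a' ↔ (ofLex a).2 = (ofLex a').2 :=
        ⟨fun h => by rw [h], fun h => ofLex.injective (Prod.ext hj h)⟩
      simp only [← hj, if_true]
      by_cases hs : τ.inverted (ofLex a).1
      · have := congrFun (congrFun (e.adMatrix_orthogonal (τ.map g (ofLex a).1))
          (ofLex a).2) (ofLex a').2
        rw [Matrix.mul_apply, Matrix.one_apply] at this
        simp only [Matrix.transpose_apply] at this
        simp only [hs, if_true, neg_mul_neg, this, hiff]
      · have := congrFun (congrFun (show (1 : Matrix (Fin d) (Fin d) ℝ).transpose * 1 = 1 by simp)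
          (ofLex a).2) (ofLex a').2
        rw [Matrix.mul_apply, Matrix.one_apply (i := (ofLex a).2) (j := (ofLex a').2)] at this
        simp only [Matrix.transpose_apply] at this
        simp only [hs, Bool.false_eq_true, if_false, hiff]
        exact this
    · intro i _ hi
      simp [hi]
    · simp
  · have hne : a ≠ a' := fun h => hj (by rw [h])
    rw [if_neg hne]
    refine Finset.sum_eq_zero fun i _ => Finset.sum_eq_zero fun l _ => ?_
    by_cases h1 : i = τ.idx (ofLex a).1
    · have : i ≠ τ.idx (ofLex a').1 := fun h2 => hj (τ.idx.injective (h1.symm.trans h2))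
      simp [this]
    · simp [h1]

/-- The pull-back of sections along `P = τ.map`,
`(P^* ξ)(g) = Cl(A_g) (ξ(P g))` with the isometry `A_g : T_{P(g)} Gᵐ → T_g Gⁿ` above. -/
def OrthonormalFrame.pullback [Fintype κ] (τ : SignedInj m n)
    (ξ : (Fin m → G) → Fib (Idx m d) κ) (g : Fin n → G) : Fib (Idx n d) κ :=
  onFib (cliffMap (e.tangentMatrix τ g) (e.tangentMatrix_orthogonal τ g)).toLinearMap (ξ (τ.map g))

/-! ### The Hilbert spaces -/

variable [MeasurableSpace G]

/-- The Hilbert space `L²(Gⁿ, Cl(TGⁿ) ⊗ ℂ^κ)`, for the product measure `μⁿ`. -/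
abbrev SpinorL2 (μ : Measure G) (n d : ℕ) (κ : Type*) [Fintype κ] : Type _ :=
  Lp (Fib (Idx n d) κ) 2 (Measure.pi fun _ : Fin n => μ)

/-- `D` is the Euler-Dirac operator of `L²(Gⁿ, Cl(TGⁿ) ⊗ ℂ^κ)` with the smooth sections as its
domain. -/
def OrthonormalFrame.IsEulerDirac [Fintype κ] (μ : Measure G)
    (D : SpinorL2 μ n d κ →ₗ.[ℂ] SpinorL2 μ n d κ) : Prop :=
  (∀ v : SpinorL2 μ n d κ, v ∈ D.domain ↔
    ∃ ξ ∈ smoothFun n (Fib (Idx n d) κ) ρ, v =ᵐ[Measure.pi fun _ => μ] ξ) ∧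
  ∀ v : D.domain, ∀ ξ ∈ smoothFun n (Fib (Idx n d) κ) ρ,
    (v : SpinorL2 μ n d κ) =ᵐ[Measure.pi fun _ => μ] ξ →
      D v =ᵐ[Measure.pi fun _ => μ] e.eulerDirac ξ

/-- The subspace `𝓗₂ ⊗ ⋯ ⊗ 𝓗₂` of `L²(Gⁿ, Cl(TGⁿ))`, where `𝓗₂ ⊆ L²(G, Cl(TG))` is the
orthogonal complement of the constant function `1` (with coefficients in `ℂ^κ`): the sections that
are orthogonal to everything which is pulled back from fewer coordinates, that is, to all tensors
with a factor `1`. -/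
def OrthonormalFrame.pureSubspace (μ : Measure G) (n : ℕ) (κ : Type*) [Fintype κ] :
    Submodule ℂ (SpinorL2 μ n d κ) :=
  (Submodule.span ℂ {u | ∃ m, m < n ∧ ∃ (τ : SignedInj m n) (w : SpinorL2 μ m d κ),
    u =ᵐ[Measure.pi fun _ => μ] e.pullback τ w})ᗮ

/-! ### The inductive limit -/

section Limit

variable {k : ℕ} {M : Type*} [TopologicalSpace M] [ChartedSpace (EuclideanSpace ℝ (Fin k)) M]
  {x₀ : M}

/-- `τ.map : G^{n(F₂)} → G^{n(F₁)}` is the structure map induced by the inclusion `F₁ ⊆ F₂`: the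
`j`-th generating loop of `F₁` is the `τ.idx j`-th generating loop of `F₂` or its inverse. -/
def SignedInj.Induced {F₁ F₂ : Subgroup (Hoop k x₀)} (S₁ : LoopSystem F₁) (S₂ : LoopSystem F₂)
    (τ : SignedInj S₁.n S₂.n) : Prop :=
  ∀ j, (S₁.loop j).hoop =
    if τ.inverted j then ((S₂.loop (τ.idx j)).hoop)⁻¹ else (S₂.loop (τ.idx j)).hoop

variable (gen : ∀ F : LoopSubgroup k x₀, LoopSystem F.1) (μ : Measure G) (κ) [Fintype κ]

/-- The direct sum of the spaces `L²(G^{n(F)}, Cl(TG^{n(F)}) ⊗ ℂ^κ)`, `F ∈ 𝓕_I`. -/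
abbrev LimitSum (d : ℕ) : Type _ :=
  DirectSum (LoopSubgroup k x₀) fun F => SpinorL2 μ (gen F).n d κ

open Classical in
/-- The subspace generated by the `v - P^* v`, for the structure maps `P` of the system. -/
def OrthonormalFrame.limitRel : Submodule ℂ (LimitSum κ gen μ d) :=
  Submodule.span ℂ {x | ∃ F₁ F₂ : LoopSubgroup k x₀, F₁ ≤ F₂ ∧
    ∃ τ : SignedInj (gen F₁).n (gen F₂).n, τ.Induced (gen F₁) (gen F₂) ∧
    ∃ (v : SpinorL2 μ (gen F₁).n d κ) (u : SpinorL2 μ (gen F₂).n d κ),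
      u =ᵐ[Measure.pi fun _ => μ] e.pullback τ v ∧
      x = DirectSum.lof ℂ _ (fun F => SpinorL2 μ (gen F).n d κ) F₁ v
        - DirectSum.lof ℂ _ (fun F => SpinorL2 μ (gen F).n d κ) F₂ u}

/-- The algebraic inductive limit `𝓗_alg`. -/
abbrev OrthonormalFrame.AlgLimit : Type _ := LimitSum κ gen μ d ⧸ e.limitRel κ gen μ

open Classical in
/-- The class in `𝓗_alg` of a vector of `L²(G^{n(F)}, Cl(TG^{n(F)}) ⊗ ℂ^κ)`. -/
def OrthonormalFrame.toAlgLimit (F : LoopSubgroup k x₀) :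
    SpinorL2 μ (gen F).n d κ →ₗ[ℂ] e.AlgLimit κ gen μ :=
  (e.limitRel κ gen μ).mkQ ∘ₗ DirectSum.lof ℂ _ (fun F => SpinorL2 μ (gen F).n d κ) F

variable {gen μ κ}

/-- The inner product of `𝓗_alg`: for `v₁`, `v₂` in the subspaces `𝓗₂ ⊗ ⋯ ⊗ 𝓗₂` belonging to `F₁`
and `F₂`, it is the inner product of the pull-backs of `v₁` and `v₂` to any `F₃ ⊇ F₁, F₂`, and zero
if there is no such `F₃`. -/
def OrthonormalFrame.IsLimitInner (c : InnerProductSpace.Core ℂ (e.AlgLimit κ gen μ)) : Prop :=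
  ∀ (F₁ F₂ : LoopSubgroup k x₀), ∀ v₁ ∈ e.pureSubspace μ (gen F₁).n κ,
    ∀ v₂ ∈ e.pureSubspace μ (gen F₂).n κ,
    (∀ F₃, F₁ ≤ F₃ → F₂ ≤ F₃ →
      ∀ (τ₁ : SignedInj (gen F₁).n (gen F₃).n) (τ₂ : SignedInj (gen F₂).n (gen F₃).n),
      τ₁.Induced (gen F₁) (gen F₃) → τ₂.Induced (gen F₂) (gen F₃) →
      ∀ u₁ u₂ : SpinorL2 μ (gen F₃).n d κ,
        u₁ =ᵐ[Measure.pi fun _ => μ] e.pullback τ₁ v₁ →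
        u₂ =ᵐ[Measure.pi fun _ => μ] e.pullback τ₂ v₂ →
        c.inner (e.toAlgLimit κ gen μ F₁ v₁) (e.toAlgLimit κ gen μ F₂ v₂) = inner ℂ u₁ u₂) ∧
    ((¬ ∃ F₃, F₁ ≤ F₃ ∧ F₂ ≤ F₃) →
      c.inner (e.toAlgLimit κ gen μ F₁ v₁) (e.toAlgLimit κ gen μ F₂ v₂) = 0)

variable {e} in
/-- `𝓗_alg` with the inner product `c`. -/
def PreLimit (_c : InnerProductSpace.Core ℂ (e.AlgLimit κ gen μ)) : Type _ :=
  e.AlgLimit κ gen μ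

variable {e} (c : InnerProductSpace.Core ℂ (e.AlgLimit κ gen μ))

instance : NormedAddCommGroup (PreLimit c) :=
  @InnerProductSpace.Core.toNormedAddCommGroup ℂ (e.AlgLimit κ gen μ) _ _ _ c

instance : InnerProductSpace ℂ (PreLimit c) :=
  @InnerProductSpace.ofCore ℂ (e.AlgLimit κ gen μ) _ _ _ c.toCore

/-- The inductive limit Hilbert space, the completion of `𝓗_alg`. -/
abbrev HilbertLimit : Type _ := UniformSpace.Completion (PreLimit c)

/-- The vector of the inductive limit given by an element of
`L²(G^{n(F)}, Cl(TG^{n(F)}) ⊗ ℂ^κ)`. -/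
def toHilbertLimit (F : LoopSubgroup k x₀) (v : SpinorL2 μ (gen F).n d κ) : HilbertLimit c :=
  ((show PreLimit c from e.toAlgLimit κ gen μ F v : PreLimit c) : UniformSpace.Completion _)

end Limit

end LieGroup

/-- The algebra of complex `N × N` matrices, as operators on `ℂ^N` with the operator norm. -/
abbrev MatrixOp (N : ℕ) : Type := EuclideanSpace ℂ (Fin N) →L[ℂ] EuclideanSpace ℂ (Fin N)

end

/-!
The smooth sections, the Euler-Dirac operator and the structure maps are treated in the left
invariant frame `e_a` of `Gⁿ`, in which a section is a function with values in `Cl ⊗ ℂ^κ`.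

*The operator is `d + d^*`.* For a biinvariant metric the Levi-Civita connection is half of the
bracket in a left invariant frame. As it is torsion free, `∑ e_a ∧ ∇_{e_a}` is the exterior
derivative (`OrthonormalFrame.extD_formSection`). The flow of a left invariant field consists of
right translations, so that the derivative of a function along it has integral zero
(`OrthonormalFrame.integral_frameDeriv`), and `-∑ e_a ⌟ ∇_{e_a}` is the formal adjoint
(`OrthonormalFrame.integral_inner_extDAdj`). The Clifford multiplication by `e_a` is the sum of the
exterior multiplication and minus the interior one.

*Inclusions of hoop groups.* The line integral of `f dg` along a loop, for functions `f` and `g` on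
the manifold, is invariant under reparametrization and cancels on `P₂ ∘ P₂^*`, so it is a
homomorphism on the hoop group (`hoopIntegral`). With bump functions it detects where a
simple loop runs: a simple loop that lies in the group generated by a system runs inside the union of
the loops of the system, and inside a single one of them because these meet at the base point only.
Hence it is that loop or its inverse (`LoopSystem.exists_hoop_eq`), which gives the injection and the
signs (`SignedInj.exists_induced`, `Induced.unique`).

*Pull-backs.* The differential of the inversion is `-Ad` in the left invariant frames, and its
derivative is compensated by the two connections: the isometries `A_g` are parallel
(`OrthonormalFrame.hasDerivAt_tangentMatrix_move`). Therefore the Euler-Dirac operator commutes with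
the pull-backs (`OrthonormalFrame.eulerDirac_pullback`).

*The inner product on the limit.* Products of functions of single coordinates with the `e_S` span a
dense subspace, by the Stone-Weierstrass theorem. On these it is plain that the projections which
forget coordinates commute (`OrthonormalFrame.projL2_projL2`). So every vector is a sum of
pull-backs of pure ones (`OrthonormalFrame.span_pullbackL2_pure`), and the pull-back of a pure
vector is orthogonal to everything that does not depend on all of its coordinates
(`OrthonormalFrame.inner_pullbackL2_eq_zero`). By these two properties the algebraic limit is the
direct sum of the spaces of pure vectors, as in every `PureSystem`, and it inherits the inner
product of the Hilbert sum (`PureSystem.exists_core`). Uniqueness holds because pure vectors span.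

*The limit operator.* A linear relation between the classes of smooth vectors has to persist for
their images under the operators. This follows because these operators are symmetric and preserve
purity, and because the smooth pure vectors are dense in the pure ones
(`PureSystem.existsUnique_limitOperator`).
-/

set_option linter.unusedSectionVars false

/-! ### Line integrals of piecewise smooth paths -/

section Stieltjes

open Set

theorem lipschitzOnWith_Icc_union {b : ℝ → ℝ} {K₁ K₂ : NNReal} {p c q : ℝ}
    (h₁ : LipschitzOnWith K₁ b (Icc p c)) (h₂ : LipschitzOnWith K₂ b (Icc c q)) :
    LipschitzOnWith (max K₁ K₂) b (Icc p q) := by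
  have h₁' := h₁.weaken (le_max_left K₁ K₂)
  have h₂' := h₂.weaken (le_max_right K₁ K₂)
  have key : ∀ x ∈ Icc p q, ∀ y ∈ Icc p q, x ≤ y →
      dist (b x) (b y) ≤ (max K₁ K₂ : NNReal) * dist x y := by
    intro x hx y hy hxy
    rcases le_total y c with hy' | hy'
    · exact h₁'.dist_le_mul x ⟨hx.1, hxy.trans hy'⟩ y ⟨hy.1, hy'⟩
    rcases le_total c x with hx' | hx'
    · exact h₂'.dist_le_mul x ⟨hx', hx.2⟩ y ⟨hy', hy.2⟩
    · have e₁ := h₁'.dist_le_mul x ⟨hx.1, hx'⟩ c ⟨hx.1.trans hx', le_rfl⟩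
      have e₂ := h₂'.dist_le_mul c ⟨le_rfl, hy'.trans hy.2⟩ y ⟨hy', hy.2⟩
      have e₃ : dist x y = dist x c + dist c y := by
        simp only [Real.dist_eq]
        rw [abs_of_nonpos (by linarith), abs_of_nonpos (by linarith),
          abs_of_nonpos (by linarith)]
        ring
      rw [e₃, mul_add]
      exact (dist_triangle _ (b c) _).trans (add_le_add e₁ e₂)
  refine LipschitzOnWith.of_dist_le_mul fun x hx y hy => ?_
  rcases le_total x y with h | h
  · exact key x hx y hy h
  · rw [dist_comm, dist_comm x]; exact key y hy x hx h

/-- A function that is smooth up to the end points on the intervals of a finite subdivision is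
Lipschitz; the induction is over the number `N` of break points. -/
theorem exists_lipschitzOnWith_of_pieces {b : ℝ → ℝ} (N : ℕ) : ∀ s : Finset ℝ, s.card = N →
    ∀ p q : ℝ, (∀ u v, p ≤ u → u < v → v ≤ q → (∀ c ∈ s, c ∉ Ioo u v) →
      ContDiffOn ℝ ∞ b (Icc u v)) → ∃ K, LipschitzOnWith K b (Icc p q) := by
  induction N with
  | zero =>
    intro s hs p q h
    rcases lt_or_ge p q with hpq | hpq
    · refine (h p q le_rfl hpq le_rfl ?_).exists_lipschitzOnWith (by simp) (convex_Icc _ _)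
        isCompact_Icc
      rw [Finset.card_eq_zero.1 hs]; simp
    · refine ⟨0, fun x hx y hy => ?_⟩
      have : x = y := by
        have := hx.1; have := hx.2; have := hy.1; have := hy.2; linarith
      simp [this]
  | succ N ih =>
    intro s hs p q h
    obtain ⟨c, hc⟩ : s.Nonempty := Finset.card_pos.1 (by omega)
    have hcard : (s.erase c).card = N := by rw [Finset.card_erase_of_mem hc, hs]; rfl
    by_cases hcpq : c ∈ Ioo p q
    · obtain ⟨K₁, h₁⟩ := ih (s.erase c) hcard p c fun u v hu huv hv hn =>
        h u v hu huv (hv.trans hcpq.2.le) fun c' hc' hmem => by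
          by_cases e : c' = c
          · subst e; exact absurd hmem.2 (not_lt.2 hv)
          · exact hn c' (Finset.mem_erase.2 ⟨e, hc'⟩) hmem
      obtain ⟨K₂, h₂⟩ := ih (s.erase c) hcard c q fun u v hu huv hv hn =>
        h u v (hcpq.1.le.trans hu) huv hv fun c' hc' hmem => by
          by_cases e : c' = c
          · subst e; exact absurd hmem.1 (not_lt.2 hu)
          · exact hn c' (Finset.mem_erase.2 ⟨e, hc'⟩) hmem
      exact ⟨_, lipschitzOnWith_Icc_union h₁ h₂⟩
    · exact ih (s.erase c) hcard p q fun u v hu huv hv hn =>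
        h u v hu huv hv fun c' hc' hmem => by
          by_cases e : c' = c
          · subst e
            exact hcpq ⟨hu.trans_lt hmem.1, hmem.2.trans_le hv⟩
          · exact hn c' (Finset.mem_erase.2 ⟨e, hc'⟩) hmem

/-- Riemann-Stieltjes sums approximate `∫ a db`. -/
theorem abs_integral_sub_stieltjes_sum_le {a b : ℝ → ℝ} {K : NNReal} (ha : Continuous a)
    (hb : LipschitzWith K b) {ε δ : ℝ}
    (hδ : ∀ s ∈ Icc (0 : ℝ) 1, ∀ t ∈ Icc (0 : ℝ) 1, |s - t| ≤ δ → |a s - a t| ≤ ε)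
    {n : ℕ} {τ : ℕ → ℝ} (h0 : τ 0 = 0) (h1 : τ n = 1)
    (hmem : ∀ i ≤ n, τ i ∈ Icc (0 : ℝ) 1) (hmono : ∀ i < n, τ i ≤ τ (i + 1))
    (hstep : ∀ i < n, τ (i + 1) - τ i ≤ δ) :
    |(∫ t in (0 : ℝ)..1, a t * deriv b t) -
      ∑ i ∈ Finset.range n, a (τ i) * (b (τ (i + 1)) - b (τ i))| ≤ ε * K := by
  have hbi : ∀ p q : ℝ, IntervalIntegrable (deriv b) volume p q := fun p q =>
    (LipschitzOnWith.absolutelyContinuousOnInterval hb.lipschitzOnWith).intervalIntegrable_deriv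
  have hft : ∀ p q : ℝ, ∫ t in p..q, deriv b t = b q - b p := fun p q =>
    (LipschitzOnWith.absolutelyContinuousOnInterval
      hb.lipschitzOnWith).integral_deriv_eq_sub
  have hint : ∀ p q : ℝ, IntervalIntegrable (fun t => a t * deriv b t) volume p q := fun p q =>
    (hbi p q).continuousOn_mul ha.continuousOn
  have hsum := intervalIntegral.sum_integral_adjacent_intervals (μ := volume)
    (f := fun t => a t * deriv b t) (a := τ) (n := n) (fun i _ => hint _ _)
  rw [h0, h1] at hsum
  rw [← hsum, ← Finset.sum_sub_distrib]
  have hterm : ∀ i ∈ Finset.range n,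
      |(∫ t in τ i..τ (i + 1), a t * deriv b t) - a (τ i) * (b (τ (i + 1)) - b (τ i))|
        ≤ ε * K * (τ (i + 1) - τ i) := by
    intro i hi
    have hi := Finset.mem_range.1 hi
    rw [← hft, ← intervalIntegral.integral_const_mul,
      ← intervalIntegral.integral_sub (hint _ _) ((hbi _ _).const_mul _)]
    have := intervalIntegral.norm_integral_le_of_norm_le_const (a := τ i) (b := τ (i + 1))
      (C := ε * K) (f := fun t => a t * deriv b t - a (τ i) * deriv b t) ?_
    · rwa [Real.norm_eq_abs, abs_of_nonneg (sub_nonneg.2 (hmono i hi))] at this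
    · intro t ht
      rw [uIoc_of_le (hmono i hi)] at ht
      have hm0 := hmem i hi.le
      have hm1 := hmem (i + 1) hi
      rw [← sub_mul, norm_mul]
      refine mul_le_mul ?_ (norm_deriv_le_of_lipschitz hb) (norm_nonneg _) ?_
      · refine hδ _ ⟨hm0.1.trans ht.1.le, ht.2.trans hm1.2⟩ _ hm0 ?_
        rw [abs_of_nonneg (by linarith [ht.1])]
        linarith [ht.2, hstep i hi]
      · exact (abs_nonneg _).trans (hδ _ hm0 _ hm0 (by
          rw [sub_self, abs_zero]; linarith [hmono i hi, hstep i hi]))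
  refine (Finset.abs_sum_le_sum_abs _ _).trans ((Finset.sum_le_sum hterm).trans ?_)
  rw [← Finset.mul_sum, Finset.sum_range_sub, h0, h1]
  simp

/-- The integral `∫ a db` is invariant under a monotone continuous change of parameter `φ`. As `φ`
need not be absolutely continuous, the substitution rule is not available; instead the
Riemann-Stieltjes sum of a uniform subdivision equals that of its image under `φ`. -/
theorem integral_stieltjes_comp_monotone {a b a' b' : ℝ → ℝ} {K K' : NNReal} (ha : Continuous a)
    (hb : LipschitzWith K b) (ha' : Continuous a') (hb' : LipschitzWith K' b')
    (φ : Path (0 : I) 1) (hφ : Monotone φ)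
    (haφ : ∀ t ∈ Icc (0 : ℝ) 1, a t = a' (φ.extend t))
    (hbφ : ∀ t ∈ Icc (0 : ℝ) 1, b t = b' (φ.extend t)) :
    ∫ t in (0 : ℝ)..1, a t * deriv b t = ∫ t in (0 : ℝ)..1, a' t * deriv b' t := by
  have huc : ∀ {c : ℝ → ℝ}, Continuous c → ∀ ε > 0, ∃ δ > 0, ∀ s ∈ Icc (0 : ℝ) 1,
      ∀ t ∈ Icc (0 : ℝ) 1, |s - t| ≤ δ → |c s - c t| ≤ ε := by
    intro c hc ε hε
    have := isCompact_Icc (a := (0 : ℝ)) (b := 1) |>.uniformContinuousOn_of_continuous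
      hc.continuousOn
    obtain ⟨δ, hδ, h⟩ := Metric.uniformContinuousOn_iff.1 this ε hε
    exact ⟨δ / 2, by positivity, fun s hs t ht hst =>
      (h s hs t ht (by rw [Real.dist_eq]; linarith)).le⟩
  have hφc : Continuous (fun t : ℝ => (φ.extend t : ℝ)) := by fun_prop
  have hφm : ∀ s t : ℝ, s ≤ t → (φ.extend s : ℝ) ≤ φ.extend t := fun s t hst =>
    hφ (monotone_projIcc _ hst)
  rw [← sub_eq_zero, ← abs_eq_zero]
  refine le_antisymm (le_of_forall_pos_le_add fun ε hε => ?_) (abs_nonneg _)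
  rw [zero_add]
  -- `η` is the oscillation allowed on an interval of the subdivisions
  set η : ℝ := ε / (K + K' + 1) with hη
  have hη0 : 0 < η := by positivity
  obtain ⟨δ, hδ, h⟩ := huc ha η hη0
  obtain ⟨δ', hδ', h'⟩ := huc ha' η hη0
  -- a uniform subdivision that is finer than `δ`, and whose image under `φ` is finer than `δ'`
  obtain ⟨δ'', hδ'', h''⟩ := huc hφc δ' hδ'
  obtain ⟨n, hn⟩ := exists_nat_gt (max (1 / δ) (1 / δ''))
  have hn0 : (0 : ℝ) < n := lt_of_le_of_lt (by positivity) ((le_max_left _ _).trans_lt hn)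
  have hn1 : 1 / (n : ℝ) ≤ δ := by
    rw [div_le_iff₀ hn0]; have := (le_max_left (1/δ) (1/δ'')).trans_lt hn
    rw [div_lt_iff₀ hδ] at this; linarith
  have hn2 : 1 / (n : ℝ) ≤ δ'' := by
    rw [div_le_iff₀ hn0]; have := (le_max_right (1/δ) (1/δ'')).trans_lt hn
    rw [div_lt_iff₀ hδ''] at this; linarith
  have hmem : ∀ i ≤ n, (i : ℝ) / n ∈ Icc (0 : ℝ) 1 := fun i hi =>
    ⟨by positivity, by rw [div_le_one hn0]; exact_mod_cast hi⟩
  have hst : ∀ i : ℕ, ((i + 1 : ℕ) : ℝ) / n - (i : ℝ) / n = 1 / n := fun i => by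
    push_cast; ring
  have hle : ∀ i : ℕ, (i : ℝ) / n ≤ ((i + 1 : ℕ) : ℝ) / n := fun i => by
    gcongr; simp
  have e₁ := abs_integral_sub_stieltjes_sum_le ha hb h (n := n) (τ := fun i => (i : ℝ) / n)
    (by simp) (div_self hn0.ne') hmem (fun i _ => hle i) (fun i _ => by rw [hst]; exact hn1)
  have e₂ := abs_integral_sub_stieltjes_sum_le ha' hb' h' (n := n)
    (τ := fun i => (φ.extend ((i : ℝ) / n) : ℝ))
    (by simp) (by simp [div_self hn0.ne']) (fun i _ => (φ.extend _).2) (fun i _ => hφm _ _ (hle i))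
    (fun i hi => (le_abs_self _).trans (h'' _ (hmem _ hi) _ (hmem _ hi.le) (by
      rw [hst, abs_of_nonneg (by positivity)]; exact hn2)))
  have hsum : ∑ i ∈ Finset.range n, a ((i : ℝ) / n) * (b (((i + 1 : ℕ) : ℝ) / n) - b ((i : ℝ) / n))
      = ∑ i ∈ Finset.range n, a' (φ.extend ((i : ℝ) / n)) *
        (b' (φ.extend (((i + 1 : ℕ) : ℝ) / n)) - b' (φ.extend ((i : ℝ) / n))) := by
    refine Finset.sum_congr rfl fun i hi => ?_
    have hi := Finset.mem_range.1 hi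
    rw [haφ _ (hmem i hi.le), hbφ _ (hmem i hi.le), hbφ _ (hmem (i + 1) hi)]
  rw [hsum] at e₁
  have htot : η * K + η * K' ≤ ε := by
    rw [← mul_add, hη, div_mul_eq_mul_div, div_le_iff₀ (by positivity)]
    nlinarith
  refine le_trans ?_ htot
  rw [abs_sub_comm] at e₂
  refine le_trans (le_of_eq ?_) ((abs_add_le _ _).trans (add_le_add e₁ e₂))
  congr 1; ring

end Stieltjes

section LineIntegral

variable {k : ℕ} {M : Type*} [TopologicalSpace M] [ChartedSpace (EuclideanSpace ℝ (Fin k)) M]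

/-- The line integral `∫ f dg` along a path. The composition of `g` with a piecewise smooth path is
Lipschitz, so its derivative exists almost everywhere and its value elsewhere does not matter. -/
noncomputable def lineIntegral (f g : M → ℝ) {x y : M} (γ : Path x y) : ℝ :=
  ∫ t in (0 : ℝ)..1, f (γ.extend t) * deriv (fun t => g (γ.extend t)) t

variable {f g : M → ℝ} {x y z : M}

theorem PwSmooth.exists_lipschitzWith (hg : ContMDiff (𝓡 k) 𝓘(ℝ, ℝ) ∞ g) {γ : Path x y}
    (h : PwSmooth k γ) : ∃ K, LipschitzWith K (fun t => g (γ.extend t)) := by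
  obtain ⟨s, hs⟩ := h
  obtain ⟨K, hK⟩ := exists_lipschitzOnWith_of_pieces (b := fun t => g (γ.extend t)) _ s rfl 0 1
    fun u v hu huv hv hc => by
      have := hg.comp_contMDiffOn (hs u v hu huv hv hc)
      rwa [contMDiffOn_iff_contDiffOn] at this
  refine ⟨K * 1, ?_⟩
  have e : (fun t => g (γ.extend t)) =
      fun t => g (γ.extend (Set.projIcc (0 : ℝ) 1 zero_le_one t)) := by
    funext t
    rw [Path.extend_extends']
    rfl
  rw [e]
  exact lipschitzOnWith_univ.1 (hK.comp (s := Set.univ)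
    (LipschitzWith.projIcc (a := (0 : ℝ)) (b := 1) zero_le_one).lipschitzOnWith
    fun t _ => (Set.projIcc (0 : ℝ) 1 zero_le_one t).2)

theorem lineIntegral_integrable (hf : Continuous f) (hg : ContMDiff (𝓡 k) 𝓘(ℝ, ℝ) ∞ g)
    {γ : Path x y} (h : PwSmooth k γ) (p q : ℝ) :
    IntervalIntegrable (fun t => f (γ.extend t) * deriv (fun t => g (γ.extend t)) t)
      volume p q := by
  obtain ⟨K, hK⟩ := h.exists_lipschitzWith hg
  have hbi : IntervalIntegrable (deriv (fun t => g (γ.extend t))) volume p q :=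
    (LipschitzOnWith.absolutelyContinuousOnInterval hK.lipschitzOnWith).intervalIntegrable_deriv
  exact hbi.continuousOn_mul (by fun_prop)

theorem lineIntegral_symm (γ : Path x y) : lineIntegral f g γ.symm = -lineIntegral f g γ := by
  unfold lineIntegral
  have : ∀ t, f (γ.symm.extend t) * deriv (fun t => g (γ.symm.extend t)) t =
      (fun u => -(f (γ.extend u) * deriv (fun t => g (γ.extend t)) u)) (1 - t) := by
    intro t
    simp only [Path.extend_symm_apply]
    rw [deriv_comp_const_sub (f := fun t => g (γ.extend t))]
    ring
  simp only [this]
  rw [intervalIntegral.integral_comp_sub_left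
    (fun u => -(f (γ.extend u) * deriv (fun t => g (γ.extend t)) u))]
  simp

theorem lineIntegral_trans (hf : Continuous f) (hg : ContMDiff (𝓡 k) 𝓘(ℝ, ℝ) ∞ g) {γ : Path x y}
    {δ : Path y z} (h : PwSmooth k γ) (h' : PwSmooth k δ) :
    lineIntegral f g (γ.trans δ) = lineIntegral f g γ + lineIntegral f g δ := by
  have h'' := h.trans h'
  unfold lineIntegral
  rw [← intervalIntegral.integral_add_adjacent_intervals
    (lineIntegral_integrable hf hg h'' 0 (1 / 2)) (lineIntegral_integrable hf hg h'' (1 / 2) 1)]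
  congr 1
  · have := intervalIntegral.smul_integral_comp_mul_left (a := 0) (b := 1 / 2)
      (f := fun t => f (γ.extend t) * deriv (fun t => g (γ.extend t)) t) (2 : ℝ)
    norm_num at this
    rw [← this, ← intervalIntegral.integral_const_mul]
    refine intervalIntegral.integral_congr_Ioo_of_le
      (by norm_num : (0 : ℝ) ≤ 1 / 2) fun t ht => ?_
    have hev : (fun t => g ((γ.trans δ).extend t)) =ᶠ[nhds t] fun t => g (γ.extend (2 * t)) := by
      filter_upwards [Iio_mem_nhds ht.2] with s hs
      rw [Path.extend_trans_of_le_half _ _ hs.le]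
    rw [hev.deriv_eq, Path.extend_trans_of_le_half _ _ ht.2.le,
      deriv_comp_mul_left (2 : ℝ) (fun t => g (γ.extend t)), smul_eq_mul]
    ring
  · have := intervalIntegral.smul_integral_comp_mul_sub (a := 1 / 2) (b := 1)
      (f := fun t => f (δ.extend t) * deriv (fun t => g (δ.extend t)) t) (2 : ℝ) 1
    norm_num at this
    rw [← this, ← intervalIntegral.integral_const_mul]
    refine intervalIntegral.integral_congr_Ioo_of_le
      (by norm_num : (1 / 2 : ℝ) ≤ 1) fun t ht => ?_
    have hev : (fun t => g ((γ.trans δ).extend t)) =ᶠ[nhds t]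
        fun t => g (δ.extend (2 * t - 1)) := by
      filter_upwards [Ioi_mem_nhds ht.1] with s hs
      rw [Path.extend_trans_of_half_le _ _ (by norm_num; exact hs.le)]
    rw [hev.deriv_eq, Path.extend_trans_of_half_le _ _ (by norm_num; exact ht.1.le),
      deriv_comp_mul_left (2 : ℝ) (fun t => g (δ.extend (t - 1))),
      deriv_comp_sub_const (f := fun t => g (δ.extend t)), smul_eq_mul]
    ring

theorem lineIntegral_reparam (hf : Continuous f) (hg : ContMDiff (𝓡 k) 𝓘(ℝ, ℝ) ∞ g)
    {γ γ' : Path x y} (h : PwSmooth k γ) (h' : PwSmooth k γ') (hr : IsReparam γ γ') :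
    lineIntegral f g γ = lineIntegral f g γ' := by
  obtain ⟨φ, hφ, e⟩ := hr
  obtain ⟨K, hK⟩ := h.exists_lipschitzWith hg
  obtain ⟨K', hK'⟩ := h'.exists_lipschitzWith hg
  have hext : ∀ t ∈ Set.Icc (0 : ℝ) 1, γ.extend t = γ'.extend (φ.extend t) := by
    intro t ht
    rw [Path.extend_apply _ ht, e, Path.extend_extends', Path.extend_apply _ ht]
  exact integral_stieltjes_comp_monotone (by fun_prop) hK (by fun_prop) hK' φ hφ
    (fun t ht => by rw [hext t ht]) (fun t ht => by simp only [hext t ht])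

variable {x₀ : M}

theorem lineIntegral_hoopStep (hf : Continuous f) (hg : ContMDiff (𝓡 k) 𝓘(ℝ, ℝ) ∞ g)
    {L L' : BasedLoop k x₀} (h : HoopStep L L') :
    lineIntegral f g L.path = lineIntegral f g L'.path := by
  cases h with
  | reparam _ _ h => exact lineIntegral_reparam hf hg L.smooth L'.smooth h
  | retrace P₁ P₂ P₃ h₁ h₂ h₃ _ _ hL hL' =>
    rw [hL, hL', lineIntegral_trans hf hg h₁ (h₂.trans (h₂.symm.trans h₃)),
      lineIntegral_trans hf hg h₂ (h₂.symm.trans h₃), lineIntegral_trans hf hg h₂.symm h₃,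
      lineIntegral_trans hf hg h₁ h₃, lineIntegral_symm]
    ring

theorem lineIntegral_eqvGen (hf : Continuous f) (hg : ContMDiff (𝓡 k) 𝓘(ℝ, ℝ) ∞ g)
    {L L' : BasedLoop k x₀} (h : Relation.EqvGen HoopStep L L') :
    lineIntegral f g L.path = lineIntegral f g L'.path := by
  induction h with
  | rel _ _ h => exact lineIntegral_hoopStep hf hg h
  | refl => rfl
  | symm _ _ _ ih => exact ih.symm
  | trans _ _ _ _ _ ih ih' => exact ih.trans ih'

/-- The line integral as a homomorphism from the hoop group to the additive group of reals. -/
noncomputable def hoopIntegral (hf : Continuous f) (hg : ContMDiff (𝓡 k) 𝓘(ℝ, ℝ) ∞ g) (x₀ : M) :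
    Hoop k x₀ →* Multiplicative ℝ :=
  MonoidHom.mk' (Quotient.lift (fun L : BasedLoop k x₀ =>
      Multiplicative.ofAdd (lineIntegral f g L.path)) fun _ _ h =>
    congrArg Multiplicative.ofAdd (lineIntegral_eqvGen hf hg h)) (by
    rintro ⟨L⟩ ⟨L'⟩
    exact congrArg Multiplicative.ofAdd (lineIntegral_trans hf hg L.smooth L'.smooth))

theorem hoopIntegral_hoop (hf : Continuous f) (hg : ContMDiff (𝓡 k) 𝓘(ℝ, ℝ) ∞ g)
    (L : BasedLoop k x₀) :
    hoopIntegral hf hg x₀ L.hoop = Multiplicative.ofAdd (lineIntegral f g L.path) := rfl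

end LineIntegral

/-! ### Simple loops in the hoop group -/

section SimpleLoops

open Set Topology Filter

variable {k : ℕ} {M : Type*} [TopologicalSpace M] [ChartedSpace (EuclideanSpace ℝ (Fin k)) M]
  {x₀ : M}

theorem BasedLoop.IsSimple.extend_inj {L : BasedLoop k x₀} (hL : L.IsSimple) {s t : ℝ}
    (hs : s ∈ Icc (0 : ℝ) 1) (ht : t ∈ Ioo (0 : ℝ) 1) (h : L.path.extend s = L.path.extend t) :
    s = t := by
  have ht' : t ∈ Icc (0 : ℝ) 1 := ⟨ht.1.le, ht.2.le⟩
  rw [Path.extend_apply _ hs, Path.extend_apply _ ht'] at h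
  rcases hL _ _ h with h | ⟨-, h⟩ | ⟨-, h⟩
  · exact congrArg Subtype.val h
  · exact absurd (congrArg Subtype.val h) ht.2.ne
  · exact absurd (congrArg Subtype.val h) ht.1.ne'

theorem BasedLoop.IsSimple.extend_ne {L : BasedLoop k x₀} (hL : L.IsSimple) {t : ℝ}
    (ht : t ∈ Ioo (0 : ℝ) 1) : L.path.extend t ≠ x₀ := fun h => by
  have : (0 : ℝ) = t := hL.extend_inj (by simp) ht (by rw [h]; simp)
  exact ht.1.ne this

/-- A simple loop that meets an open set `U` away from the base point is detected by a line
integral of a one-form supported in `U`: the form is `f dg` with a local coordinate `g` whose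
derivative along the loop does not vanish at some time, and a bump function `f` that sees no other
part of the loop. -/
theorem BasedLoop.IsSimple.exists_hom_ne_one [T2Space M] [IsManifold (𝓡 k) ∞ M]
    {L : BasedLoop k x₀} (hL : L.IsSimple) {U : Set M} (hU : IsOpen U) {t₁ : ℝ}
    (ht₁ : t₁ ∈ Ioo (0 : ℝ) 1) (htU : L.path.extend t₁ ∈ U) :
    ∃ ψ : Hoop k x₀ →* Multiplicative ℝ, ψ L.hoop ≠ 1 ∧
      ∀ K : BasedLoop k x₀, (∀ s, K.path s ∉ U) → ψ K.hoop = 1 := by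
  obtain ⟨s, hs⟩ := L.smooth
  set γ : C(ℝ, M) := L.path.extend with hγ
  have hγc : Continuous γ := γ.continuous
  obtain ⟨f₀⟩ := (inferInstance : Nonempty (SmoothBumpFunction (𝓡 k) (γ t₁)))
  -- a small interval `[t₁, b]` without break points, which `γ` maps to where `f₀ = 1`
  have hev : ∀ᶠ v in 𝓝 t₁, (f₀ (γ v) = 1 ∧ γ v ∈ (chartAt (EuclideanSpace ℝ (Fin k)) (γ t₁)).source)
      ∧ v ∈ Ioo (0 : ℝ) 1 ∧ γ v ∈ U ∧ v ∉ s.erase t₁ := by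
    refine ((hγc.continuousAt.eventually f₀.eventuallyEq_one).and
      (hγc.continuousAt.eventually ((chartAt _ (γ t₁)).open_source.mem_nhds
        (mem_chart_source _ _)))).and ((isOpen_Ioo.eventually_mem ht₁).and
      ((hγc.continuousAt.eventually (hU.mem_nhds htU)).and ?_))
    exact ((s.erase t₁).finite_toSet.isClosed.isOpen_compl.mem_nhds (by simp))
  obtain ⟨l, u, htlu, hlu⟩ := mem_nhds_iff_exists_Ioo_subset.1 hev
  set b := (t₁ + u) / 2 with hb
  have htb : t₁ < b := by rw [hb]; linarith [htlu.2]
  have hin : ∀ v ∈ Icc t₁ b, (f₀ (γ v) = 1 ∧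
      γ v ∈ (chartAt (EuclideanSpace ℝ (Fin k)) (γ t₁)).source)
      ∧ v ∈ Ioo (0 : ℝ) 1 ∧ γ v ∈ U ∧ v ∉ s.erase t₁ := fun v hv =>
    hlu ⟨htlu.1.trans_le hv.1, hv.2.trans_lt (by rw [hb]; linarith [htlu.2])⟩
  have hsm : ContMDiffOn 𝓘(ℝ, ℝ) (𝓡 k) ∞ γ (Icc t₁ b) :=
    hs t₁ b ht₁.1.le htb (hin b ⟨htb.le, le_rfl⟩).2.1.2.le fun c hc hcI =>
      (hin c ⟨hcI.1.le, hcI.2.le⟩).2.2.2 (Finset.mem_erase.2 ⟨hcI.1.ne', hc⟩)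
  -- the local coordinates, cut off by `f₀`; if the derivatives of all of them vanished along
  -- `[t₁, b]`, then the loop would be constant there and not simple
  let g : Fin k → M → ℝ := fun i x => (f₀ x • extChartAt (𝓡 k) (γ t₁) x) i
  have hg : ∀ i, ContMDiff (𝓡 k) 𝓘(ℝ, ℝ) ∞ (g i) := fun i =>
    ((EuclideanSpace.proj i : EuclideanSpace ℝ (Fin k) →L[ℝ] ℝ).contMDiff).comp
      (f₀.contMDiff_smul contMDiffOn_extChartAt)
  have hgd : ∀ i, ContDiffOn ℝ ∞ (fun v => g i (γ v)) (Ioo t₁ b) := fun i => by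
    have := (hg i).comp_contMDiffOn hsm
    rw [contMDiffOn_iff_contDiffOn] at this
    exact this.mono Ioo_subset_Icc_self
  have hgdd : ∀ i, DifferentiableOn ℝ (fun v => g i (γ v)) (Ioo t₁ b) := fun i =>
    (hgd i).differentiableOn (by simp)
  obtain ⟨i, t₀, ht₀, hne⟩ : ∃ i, ∃ t₀ ∈ Ioo t₁ b, deriv (fun v => g i (γ v)) t₀ ≠ 0 := by
    by_contra hcon
    push Not at hcon
    have hp : t₁ + (b - t₁) / 3 ∈ Ioo t₁ b := ⟨by linarith, by linarith⟩
    have hq : t₁ + (b - t₁) / 2 ∈ Ioo t₁ b := ⟨by linarith, by linarith⟩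
    have heq : ∀ i, g i (γ (t₁ + (b - t₁) / 3)) = g i (γ (t₁ + (b - t₁) / 2)) := fun i =>
      isOpen_Ioo.is_const_of_deriv_eq_zero isPreconnected_Ioo (hgdd i)
        (fun v hv => hcon i v hv) hp hq
    have hp' := hin _ ⟨hp.1.le, hp.2.le⟩
    have hq' := hin _ ⟨hq.1.le, hq.2.le⟩
    have hchart : extChartAt (𝓡 k) (γ t₁) (γ (t₁ + (b - t₁) / 3)) =
        extChartAt (𝓡 k) (γ t₁) (γ (t₁ + (b - t₁) / 2)) := by
      ext i
      have := heq i
      simp only [g, hp'.1.1, hq'.1.1, one_smul] at this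
      exact this
    have h2 := (extChartAt (𝓡 k) (γ t₁)).injOn (by rw [extChartAt_source]; exact hp'.1.2)
      (by rw [extChartAt_source]; exact hq'.1.2) hchart
    have := hL.extend_inj ⟨hp'.2.1.1.le, hp'.2.1.2.le⟩ hq'.2.1 h2
    linarith
  set h : ℝ → ℝ := fun v => g i (γ v) with hh
  have hcd : ContinuousOn (deriv h) (Ioo t₁ b) :=
    (hgd i).continuousOn_deriv_of_isOpen isOpen_Ioo (by simp)
  -- near `t₀` the derivative keeps its sign
  have hev' : ∀ᶠ v in 𝓝 t₀, v ∈ Ioo t₁ b ∧ 0 < deriv h v * deriv h t₀ := by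
    refine (isOpen_Ioo.eventually_mem ht₀).and ?_
    exact ((hcd.continuousAt (isOpen_Ioo.mem_nhds ht₀)).mul_const _).eventually
      (lt_mem_nhds (mul_self_pos.2 hne))
  obtain ⟨p, q, htpq, hpq⟩ := mem_nhds_iff_exists_Ioo_subset.1 hev'
  have ht₀I : t₀ ∈ Ioo (0 : ℝ) 1 := (hin _ ⟨ht₀.1.le, ht₀.2.le⟩).2.1
  -- `f` is supported in `U`, near `γ t₀` and away from the rest of the loop
  have hC : IsClosed (γ '' (Icc 0 1 \ Ioo p q)) :=
    ((isCompact_Icc.diff isOpen_Ioo).image hγc).isClosed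
  have hnC : γ t₀ ∉ γ '' (Icc 0 1 \ Ioo p q) := by
    rintro ⟨v, ⟨hv, hv'⟩, e⟩
    rw [hL.extend_inj hv ht₀I e] at hv'
    exact hv' htpq
  have hbasis : (𝓝 (γ t₀)).HasBasis (fun _ : SmoothBumpFunction (𝓡 k) (γ t₀) => True)
      fun f => tsupport f := SmoothBumpFunction.nhds_basis_tsupport _
  obtain ⟨f, -, hf⟩ := hbasis.mem_iff.1 (Filter.inter_mem
    (hU.mem_nhds (hin _ ⟨ht₀.1.le, ht₀.2.le⟩).2.2.1) (hC.isOpen_compl.mem_nhds hnC))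
  have hf0 : ∀ x, x ∉ U ∩ (γ '' (Icc 0 1 \ Ioo p q))ᶜ → f x = 0 := fun x hx => by
    by_contra hne
    exact hx (hf (subset_tsupport _ hne))
  refine ⟨hoopIntegral f.continuous (hg i) x₀, ?_, fun K hK => ?_⟩
  · rw [hoopIntegral_hoop, Ne, ofAdd_eq_one]
    intro h0
    -- the integrand is nonnegative, and positive near `t₀`
    have hpos : 0 < ∫ t in (0 : ℝ)..1, (f (γ t) * deriv h t) * deriv h t₀ := by
      rw [intervalIntegral.integral_pos_iff_support_of_nonneg_ae']
      · refine ⟨zero_lt_one, ?_⟩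
        have hopen : IsOpen (Ioo p q ∩ Ioo 0 1 ∩ {v | f (γ v) ≠ 0}) :=
          (isOpen_Ioo.inter isOpen_Ioo).inter
            (isOpen_ne_fun (f.continuous.comp hγc) continuous_const)
        refine (hopen.measure_pos volume ⟨t₀, ⟨htpq, ht₀I⟩, ?_⟩).trans_le (measure_mono ?_)
        · simp
        · rintro v ⟨⟨hv, hv1⟩, hv2⟩
          refine ⟨?_, hv1.1, hv1.2.le⟩
          rw [Function.mem_support, mul_assoc]
          exact mul_ne_zero hv2 (hpq hv).2.ne'
      · refine (ae_restrict_iff' measurableSet_uIoc).2 (Eventually.of_forall fun v hv => ?_)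
        rw [uIoc_of_le zero_le_one] at hv
        by_cases hv' : v ∈ Ioo p q
        · simp only [Pi.zero_apply]
          rw [mul_assoc]
          exact mul_nonneg f.nonneg (hpq hv').2.le
        · have hz := hf0 (γ v) fun hx => hx.2 ⟨v, ⟨⟨hv.1.le, hv.2⟩, hv'⟩, rfl⟩
          simp [hz]
      · exact (lineIntegral_integrable f.continuous (hg i) L.smooth 0 1).mul_const _
    rw [intervalIntegral.integral_mul_const] at hpos
    change 0 < lineIntegral f (g i) L.path * _ at hpos
    rw [h0, zero_mul] at hpos
    exact hpos.false
  · rw [hoopIntegral_hoop, ofAdd_eq_one]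
    have : ∀ t, f (K.path.extend t) = 0 := fun t => hf0 _ fun hx => by
      have h1 : K.path.extend t = K.path (projIcc 0 1 zero_le_one t) := rfl
      exact hK _ (h1 ▸ hx.1)
    simp [lineIntegral, this]

variable {F : Subgroup (Hoop k x₀)}

theorem LoopSystem.isClosed_range [T2Space M] (S : LoopSystem F) (i : Fin S.n) :
    IsClosed (range (S.loop i).path) :=
  (isCompact_range (S.loop i).path.continuous).isClosed

/-- Each loop of a system is separated from the others by a homomorphism to the reals. -/
theorem LoopSystem.exists_hom_ne_one [T2Space M] [IsManifold (𝓡 k) ∞ M] (S : LoopSystem F)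
    (i : Fin S.n) : ∃ ψ : Hoop k x₀ →* Multiplicative ℝ, ψ (S.loop i).hoop ≠ 1 ∧
      ∀ j, j ≠ i → ψ (S.loop j).hoop = 1 := by
  have hcl : IsClosed (⋃ j ∈ {j | j ≠ i}, range (S.loop j).path) :=
    Set.Finite.isClosed_biUnion (toFinite _) fun j _ => S.isClosed_range j
  have h2 : (1 / 2 : ℝ) ∈ Ioo (0 : ℝ) 1 := by norm_num
  obtain ⟨ψ, h1, h⟩ := (S.simple i).exists_hom_ne_one hcl.isOpen_compl h2 (by
    simp only [mem_compl_iff, mem_iUnion, mem_ofPred_eq, not_exists]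
    rintro j hj ⟨s, hs⟩
    have := S.disjoint j i hj s ⟨1 / 2, by norm_num, by norm_num⟩ (by
      rw [hs, Path.extend_apply _ ⟨h2.1.le, h2.2.le⟩])
    exact (S.simple i).extend_ne h2 (hs ▸ this))
  refine ⟨ψ, h1, fun j hj => h _ fun s hs => hs ?_⟩
  simp only [mem_iUnion, mem_ofPred_eq]
  exact ⟨j, hj, s, rfl⟩

/-- A strictly monotone change of parameter between the open loops extends to the end points: as
`K` is simple, it takes the base point at the end points only. -/
theorem isReparam_of_strictMono [T2Space M] {L K : BasedLoop k x₀} (hK : K.IsSimple)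
    {φ : Ioo (0 : ℝ) 1 → ℝ} (hφc : Continuous φ) (hφ : StrictMono φ)
    (hmem : ∀ t, φ t ∈ Ioo (0 : ℝ) 1) (h : ∀ t, K.path.extend (φ t) = L.path.extend t) :
    IsReparam L.path K.path := by
  classical
  -- the extension of `φ` by `0` to the left and by `1` to the right
  let Ψ : ℝ → ℝ := fun t => if ht : t ∈ Ioo (0 : ℝ) 1 then φ ⟨t, ht⟩ else if t ≤ 0 then 0 else 1
  have hΨI : ∀ t (ht : t ∈ Ioo (0 : ℝ) 1), Ψ t = φ ⟨t, ht⟩ := fun t ht => dif_pos ht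
  have hΨ0 : ∀ t ≤ 0, Ψ t = 0 := fun t ht => by
    simp only [Ψ]; rw [dif_neg (fun h => absurd h.1 (not_lt.2 ht)), if_pos ht]
  have hΨ1 : ∀ t, 1 ≤ t → Ψ t = 1 := fun t ht => by
    simp only [Ψ]
    rw [dif_neg (fun h => absurd h.2 (not_lt.2 ht)), if_neg (by linarith)]
  have hcases : ∀ t : ℝ, t ≤ 0 ∨ t ∈ Ioo (0 : ℝ) 1 ∨ 1 ≤ t := fun t => by
    rcases le_or_gt t 0 with h | h
    · exact Or.inl h
    rcases le_or_gt 1 t with h' | h'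
    · exact Or.inr (Or.inr h')
    · exact Or.inr (Or.inl ⟨h, h'⟩)
  have hΨmem : ∀ t, Ψ t ∈ Icc (0 : ℝ) 1 := fun t => by
    rcases hcases t with h | h | h
    · rw [hΨ0 t h]; simp
    · rw [hΨI t h]; exact ⟨(hmem _).1.le, (hmem _).2.le⟩
    · rw [hΨ1 t h]; simp
  have hmono : Monotone Ψ := by
    intro a b hab
    rcases hcases a with ha | ha | ha
    · rw [hΨ0 a ha]; exact (hΨmem b).1
    · rcases hcases b with hb | hb | hb
      · exact absurd (ha.1.trans_le hab) (not_lt.2 hb)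
      · rw [hΨI a ha, hΨI b hb]; exact hφ.monotone hab
      · rw [hΨ1 b hb]; exact (hΨmem a).2
    · rw [hΨ1 a ha, hΨ1 b (ha.trans hab)]
  have hKΨ : ∀ t, K.path.extend (Ψ t) = L.path.extend t := fun t => by
    rcases hcases t with ht | ht | ht
    · rw [hΨ0 t ht, Path.extend_of_le_zero _ ht]; simp
    · rw [hΨI t ht, h]
    · rw [hΨ1 t ht, Path.extend_of_one_le _ ht]; simp
  have hKc := K.path.extend.continuous
  have hLc := L.path.extend.continuous
  -- a one-sided limit of `Ψ` at an end point is mapped to the base point, so it is an end point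
  have hend : ∀ m ∈ Icc (0 : ℝ) 1, K.path.extend m = x₀ → m = 0 ∨ m = 1 := fun m hm e => by
    by_contra hcon
    push Not at hcon
    exact hK.extend_ne ⟨lt_of_le_of_ne hm.1 hcon.1.symm, lt_of_le_of_ne hm.2 hcon.2⟩ e
  have hhalf : (1 / 2 : ℝ) ∈ Ioo (0 : ℝ) 1 := by norm_num
  have hc0 : ContinuousAt Ψ 0 := by
    rw [continuousAt_iff_continuous_left'_right']
    constructor
    · refine ContinuousWithinAt.congr (continuousWithinAt_const (b := (0 : ℝ))) ?_ (hΨ0 0 le_rfl)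
      exact fun t ht => hΨ0 t (le_of_lt ht)
    · have hl := hmono.tendsto_nhdsGT 0
      have hm : sInf (Ψ '' Ioi 0) ∈ Icc (0 : ℝ) (Ψ (1 / 2)) := by
        have hbdd : BddBelow (Ψ '' Ioi 0) := ⟨0, by rintro _ ⟨t, -, rfl⟩; exact (hΨmem t).1⟩
        refine ⟨le_csInf ⟨_, 1, mem_Ioi.2 zero_lt_one, rfl⟩ ?_, csInf_le hbdd ⟨_, hhalf.1, rfl⟩⟩
        rintro _ ⟨t, -, rfl⟩; exact (hΨmem t).1
      have hlt : Ψ (1 / 2) < 1 := by rw [hΨI _ hhalf]; exact (hmem _).2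
      have e : K.path.extend (sInf (Ψ '' Ioi 0)) = x₀ := by
        have h1 := (hKc.tendsto _).comp hl
        have h2 : Tendsto (K.path.extend ∘ Ψ) (𝓝[>] 0) (𝓝 x₀) := by
          have := (hLc.tendsto 0).mono_left (nhdsWithin_le_nhds (s := Ioi 0))
          simpa [Function.comp_def, hKΨ] using this
        exact tendsto_nhds_unique h1 h2
      rcases hend _ ⟨hm.1, hm.2.trans hlt.le⟩ e with h0 | h1
      · rw [ContinuousWithinAt, hΨ0 0 le_rfl]
        rwa [h0] at hl
      · linarith [hm.2]
  have hc1 : ContinuousAt Ψ 1 := by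
    rw [continuousAt_iff_continuous_left'_right']
    constructor
    · have hl := hmono.tendsto_nhdsLT 1
      have hm : sSup (Ψ '' Iio 1) ∈ Icc (Ψ (1 / 2)) 1 := by
        have hbdd : BddAbove (Ψ '' Iio 1) := ⟨1, by rintro _ ⟨t, -, rfl⟩; exact (hΨmem t).2⟩
        refine ⟨le_csSup hbdd ⟨_, hhalf.2, rfl⟩, csSup_le ⟨_, 0, mem_Iio.2 zero_lt_one, rfl⟩ ?_⟩
        rintro _ ⟨t, -, rfl⟩; exact (hΨmem t).2
      have hlt : 0 < Ψ (1 / 2) := by rw [hΨI _ hhalf]; exact (hmem _).1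
      have e : K.path.extend (sSup (Ψ '' Iio 1)) = x₀ := by
        have h1 := (hKc.tendsto _).comp hl
        have h2 : Tendsto (K.path.extend ∘ Ψ) (𝓝[<] 1) (𝓝 x₀) := by
          have := (hLc.tendsto 1).mono_left (nhdsWithin_le_nhds (s := Iio 1))
          simpa [Function.comp_def, hKΨ] using this
        exact tendsto_nhds_unique h1 h2
      rcases hend _ ⟨hlt.le.trans hm.1, hm.2⟩ e with h0 | h1
      · linarith [hm.1]
      · rw [ContinuousWithinAt, hΨ1 1 le_rfl]
        rwa [h1] at hl
    · refine ContinuousWithinAt.congr (continuousWithinAt_const (b := (1 : ℝ))) ?_ (hΨ1 1 le_rfl)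
      exact fun t ht => hΨ1 t (le_of_lt ht)
  have hcI : ContinuousOn Ψ (Ioo 0 1) := by
    rw [continuousOn_iff_continuous_domRestrict]
    convert hφc using 1
    funext t
    exact hΨI t t.2
  have hcont : ContinuousOn Ψ (Icc 0 1) := by
    intro t ht
    refine ContinuousAt.continuousWithinAt ?_
    rcases ht.1.eq_or_lt with rfl | h0
    · exact hc0
    rcases ht.2.eq_or_lt with rfl | h1
    · exact hc1
    · exact hcI.continuousAt (isOpen_Ioo.mem_nhds ⟨h0, h1⟩)
  have hcont' : Continuous (fun t : I => Ψ t) :=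
    hcont.comp_continuous continuous_subtype_val fun t => t.2
  refine ⟨⟨⟨fun t => ⟨Ψ t, hΨmem t⟩, hcont'.subtype_mk _⟩, ?_, ?_⟩, ?_, ?_⟩
  · ext; simpa using hΨ0 0 le_rfl
  · ext; simpa using hΨ1 1 le_rfl
  · intro a b hab; exact hmono (Subtype.coe_le_coe.2 hab)
  · intro t
    have := hKΨ t
    rw [Path.extend_apply _ (hΨmem t), Path.extend_apply _ t.2] at this
    exact this.symm

/-- A simple loop that runs inside the image of another one is, up to a change of parameter,
the same loop or the reversed loop. -/
theorem hoop_eq_or_eq_inv_of_subset [T2Space M] {L K : BasedLoop k x₀} (hL : L.IsSimple)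
    (hK : K.IsSimple) (h : ∀ t ∈ Ioo (0 : ℝ) 1, L.path.extend t ∈ range K.path) :
    L.hoop = K.hoop ∨ L.hoop = K.hoop⁻¹ := by
  have hex : ∀ t : Ioo (0 : ℝ) 1, ∃ s ∈ Ioo (0 : ℝ) 1, K.path.extend s = L.path.extend t := by
    intro t
    obtain ⟨s, hs⟩ := h t t.2
    have hne := hL.extend_ne t.2
    refine ⟨s, ⟨lt_of_le_of_ne s.2.1 fun e => ?_, lt_of_le_of_ne s.2.2 fun e => ?_⟩, ?_⟩
    · have : s = 0 := Subtype.ext e.symm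
      rw [this, K.path.source] at hs
      exact hne hs.symm
    · have : s = 1 := Subtype.ext e
      rw [this, K.path.target] at hs
      exact hne hs.symm
    · rw [Path.extend_apply _ s.2]; exact hs
  -- `φ` assigns to a time of `L` the time at which `K` is at the same point
  choose φ hφ e using hex
  have hinj : Function.Injective φ := fun s t hst => Subtype.ext
    (hL.extend_inj ⟨s.2.1.le, s.2.2.le⟩ t.2 (by rw [← e, ← e, hst]))
  -- `φ` is continuous, since `K` maps closed subsets of `[0, 1]` to closed sets
  have hφc : Continuous φ := by
    rw [continuous_iff_isClosed]
    intro C hC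
    have : φ ⁻¹' C = (fun t : Ioo (0 : ℝ) 1 => L.path.extend t) ⁻¹'
        (K.path.extend '' (Icc 0 1 ∩ C)) := by
      ext t
      constructor
      · intro ht
        exact ⟨φ t, ⟨⟨(hφ t).1.le, (hφ t).2.le⟩, ht⟩, e t⟩
      · rintro ⟨s, ⟨hs, hsC⟩, hst⟩
        have : s = φ t := hK.extend_inj hs (hφ t) (by rw [e]; exact hst)
        rw [mem_preimage, ← this]
        exact hsC
    rw [this]
    exact ((isCompact_Icc.inter_right hC).image K.path.extend.continuous).isClosed.preimage
      (by fun_prop)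
  let _ : Inhabited (Ioo (0 : ℝ) 1) := ⟨⟨1 / 2, by norm_num⟩⟩
  -- a continuous injection of an interval is strictly monotone; the decreasing case gives `K⁻¹`
  rcases hφc.strictMono_of_inj hinj with hm | hm
  · exact Or.inl (Quotient.sound (BasedLoop.equiv_of_reparam
      (isReparam_of_strictMono hK hφc hm hφ e)))
  · right
    have hK' : K.inv.IsSimple := fun s t hst => by
      have := hK (σ s) (σ t) hst
      simpa [unitInterval.symm_eq_one, unitInterval.symm_eq_zero, or_comm] using this
    refine Quotient.sound (BasedLoop.equiv_of_reparam (L' := K.inv)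
      (isReparam_of_strictMono hK' (φ := fun t => 1 - φ t) (by fun_prop)
        (fun s t hst => sub_lt_sub_left (hm hst) _)
        (fun t => ⟨by linarith [(hφ t).2], by linarith [(hφ t).1]⟩) fun t => ?_))
    rw [← e t, BasedLoop.inv, Path.extend_symm_apply]
    congr 1
    ring

theorem LoopSystem.hoop_mem (S : LoopSystem F) (i : Fin S.n) : (S.loop i).hoop ∈ F :=
  S.generates.le (Subgroup.subset_closure ⟨i, rfl⟩)

/-- A simple loop whose hoop lies in the group generated by a system is one of the loops of the
system, up to orientation. -/
theorem LoopSystem.exists_hoop_eq [T2Space M] [IsManifold (𝓡 k) ∞ M] (S : LoopSystem F)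
    {L : BasedLoop k x₀} (hL : L.IsSimple) (hF : L.hoop ∈ F) :
    ∃ i, L.hoop = (S.loop i).hoop ∨ L.hoop = ((S.loop i).hoop)⁻¹ := by
  -- a part of `L` outside of the loops of the system would be detected by a line integral that
  -- vanishes on the whole group
  have hcov : ∀ t ∈ Ioo (0 : ℝ) 1, ∃ i, L.path.extend t ∈ range (S.loop i).path := by
    intro t ht
    by_contra hcon
    have hcl : IsClosed (⋃ i, range (S.loop i).path) :=
      isClosed_iUnion_of_finite S.isClosed_range
    obtain ⟨ψ, h1, h⟩ := hL.exists_hom_ne_one hcl.isOpen_compl ht (by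
      simpa only [mem_compl_iff, mem_iUnion] using hcon)
    refine h1 ?_
    have hle : Subgroup.closure (range fun i => (S.loop i).hoop) ≤ ψ.ker := by
      rw [Subgroup.closure_le]
      rintro _ ⟨i, rfl⟩
      exact h _ fun s hs => hs (mem_iUnion.2 ⟨i, s, rfl⟩)
    exact hle (S.generates.symm ▸ hF)
  have hhalf : (1 / 2 : ℝ) ∈ Ioo (0 : ℝ) 1 := by norm_num
  obtain ⟨i, hi⟩ := hcov _ hhalf
  refine ⟨i, hoop_eq_or_eq_inv_of_subset hL (S.simple i) fun t ht => ?_⟩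
  by_contra hnot
  obtain ⟨j, hj⟩ := hcov t ht
  have hji : j ≠ i := fun e => hnot (e ▸ hj)
  have hLc := L.path.extend.continuous
  have hcl₂ : IsClosed (⋃ j ∈ {j | j ≠ i}, range (S.loop j).path) :=
    Set.Finite.isClosed_biUnion (toFinite _) fun j _ => S.isClosed_range j
  -- by connectedness, `L` would otherwise pass through a common point of two loops of the system,
  -- which is the base point
  obtain ⟨u, hu, hu₁, hu₂⟩ := isPreconnected_closed_iff.1 (isPreconnected_Ioo (a := (0 : ℝ)) (b := 1))
    (L.path.extend ⁻¹' range (S.loop i).path) _ ((S.isClosed_range i).preimage hLc)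
    (hcl₂.preimage hLc) (fun u hu => by
      obtain ⟨l, hl⟩ := hcov u hu
      by_cases hli : l = i
      · exact Or.inl (hli ▸ hl)
      · right
        simp only [mem_preimage, mem_iUnion, mem_ofPred_eq]
        exact ⟨l, hli, hl⟩) ⟨_, hhalf, hi⟩ ⟨t, ht, by
        simp only [mem_preimage, mem_iUnion, mem_ofPred_eq]; exact ⟨j, hji, hj⟩⟩
  simp only [mem_preimage, mem_iUnion, mem_ofPred_eq] at hu₂
  obtain ⟨s, hs⟩ := hu₁
  obtain ⟨l, hli, s', hs'⟩ := hu₂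
  have := S.disjoint i l (Ne.symm hli) s s' (by rw [hs, hs'])
  exact hL.extend_ne hu (hs ▸ this)

/-- The hoops of a system and their inverses are pairwise different. -/
theorem LoopSystem.hoop_injective_sign [T2Space M] [IsManifold (𝓡 k) ∞ M] (S : LoopSystem F)
    {i j : Fin S.n} {b c : Bool}
    (h : (if b then ((S.loop i).hoop)⁻¹ else (S.loop i).hoop) =
      if c then ((S.loop j).hoop)⁻¹ else (S.loop j).hoop) : i = j ∧ b = c := by
  obtain ⟨ψ, h1, h2⟩ := S.exists_hom_ne_one i
  have hψ := congrArg ψ h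
  have hij : i = j := by
    by_contra hne
    have := h2 j (Ne.symm hne)
    cases b <;> cases c <;> simp [this, h1] at hψ
  subst hij
  refine ⟨rfl, ?_⟩
  have hsq : ψ (S.loop i).hoop ≠ (ψ (S.loop i).hoop)⁻¹ := fun e => h1 (by
    have : Multiplicative.toAdd (ψ (S.loop i).hoop) = -Multiplicative.toAdd (ψ (S.loop i).hoop) :=
      congrArg Multiplicative.toAdd e
    exact Multiplicative.toAdd.injective (by rw [toAdd_one]; linarith))
  cases b <;> cases c <;> simp only [map_inv, Bool.false_eq_true, if_false, if_true] at hψ ⊢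
  · exact absurd hψ hsq
  · exact absurd hψ.symm hsq

theorem SignedInj.eq_iff {m n : ℕ} {τ τ' : SignedInj m n} :
    τ = τ' ↔ ∀ j, τ.idx j = τ'.idx j ∧ τ.inverted j = τ'.inverted j := by
  constructor
  · rintro rfl j; exact ⟨rfl, rfl⟩
  · intro h
    obtain ⟨f, b⟩ := τ
    obtain ⟨f', b'⟩ := τ'
    congr
    · ext j; exact congrArg Fin.val (h j).1
    · funext j; exact (h j).2

theorem SignedInj.Induced.unique [T2Space M] [IsManifold (𝓡 k) ∞ M] {F₁ F₂ : Subgroup (Hoop k x₀)}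
    {S₁ : LoopSystem F₁} {S₂ : LoopSystem F₂} {τ τ' : SignedInj S₁.n S₂.n}
    (h : τ.Induced S₁ S₂) (h' : τ'.Induced S₁ S₂) : τ = τ' :=
  SignedInj.eq_iff.2 fun j => S₂.hoop_injective_sign ((h j).symm.trans (h' j))

theorem SignedInj.exists_induced [T2Space M] [IsManifold (𝓡 k) ∞ M] {F₁ F₂ : Subgroup (Hoop k x₀)}
    (S₁ : LoopSystem F₁) (S₂ : LoopSystem F₂) (hF : F₁ ≤ F₂) :
    ∃ τ : SignedInj S₁.n S₂.n, τ.Induced S₁ S₂ := by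
  have hex : ∀ j, ∃ p : Fin S₂.n × Bool, (S₁.loop j).hoop =
      if p.2 then ((S₂.loop p.1).hoop)⁻¹ else (S₂.loop p.1).hoop := by
    intro j
    obtain ⟨i, h | h⟩ := S₂.exists_hoop_eq (S₁.simple j)
      (hF (S₁.hoop_mem j))
    · exact ⟨(i, false), by simpa using h⟩
    · exact ⟨(i, true), by simpa using h⟩
  choose p hp using hex
  refine ⟨⟨⟨fun j => (p j).1, fun j j' hjj => ?_⟩, fun j => (p j).2⟩, hp⟩
  have h1 := hp j
  rw [show (p j).1 = (p j').1 from hjj] at h1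
  have h2 := hp j'
  by_cases hb : (p j).2 = (p j').2
  · rw [hb, ← h2] at h1
    exact (S₁.hoop_injective_sign (b := false) (c := false) (by simpa using h1)).1
  · have : (S₁.loop j).hoop = ((S₁.loop j').hoop)⁻¹ := by
      rw [h1, h2]
      cases hb1 : (p j).2 <;> cases hb2 : (p j').2 <;> simp_all
    exact (S₁.hoop_injective_sign (b := false) (c := true) (by simpa using this)).1

theorem SignedInj.Induced.map_hom {G : Type*} [Group G] {F₁ F₂ : Subgroup (Hoop k x₀)}
    {S₁ : LoopSystem F₁} {S₂ : LoopSystem F₂} {τ : SignedInj S₁.n S₂.n}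
    (h : τ.Induced S₁ S₂) (hF : F₁ ≤ F₂) (φ : F₂ →* G) (L₁ : Fin S₁.n → F₁) (L₂ : Fin S₂.n → F₂)
    (h₁ : ∀ j, (L₁ j : Hoop k x₀) = (S₁.loop j).hoop)
    (h₂ : ∀ i, (L₂ i : Hoop k x₀) = (S₂.loop i).hoop) :
    τ.map (fun i => φ (L₂ i)) = fun j => φ (Subgroup.inclusion hF (L₁ j)) := by
  funext j
  have : Subgroup.inclusion hF (L₁ j) =
      if τ.inverted j then (L₂ (τ.idx j))⁻¹ else L₂ (τ.idx j) := by
    apply Subtype.ext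
    rw [Subgroup.coe_inclusion, h₁, h j]
    split_ifs <;> simp [h₂]
  rw [this, SignedInj.map]
  split_ifs <;> simp

end SimpleLoops

/-! ### Exterior and interior multiplication on the Clifford algebra -/

section CliffordOps

variable {ι : Type*} [Fintype ι]

/-- Interior multiplication by a vector, as the contraction with the dual vector `x ↦ ∑ vᵢ xᵢ`. -/
noncomputable def intMul : (ι → ℂ) →ₗ[ℂ] Module.End ℂ (Cliff ι) :=
  CliffordAlgebra.contractLeft ∘ₗ dotProductBilin ℂ ℂ

/-- Exterior multiplication by a vector, under the identification of the Clifford algebra with the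
exterior algebra: Clifford multiplication by `v` is exterior minus interior multiplication. -/
noncomputable def extMul : (ι → ℂ) →ₗ[ℂ] Module.End ℂ (Cliff ι) :=
  LinearMap.mul ℂ (Cliff ι) ∘ₗ CliffordAlgebra.ι (cliffForm ι) + intMul

theorem extMul_apply (v : ι → ℂ) (x : Cliff ι) :
    extMul v x = CliffordAlgebra.ι (cliffForm ι) v * x + intMul v x := rfl

theorem intMul_one (v : ι → ℂ) : intMul v (1 : Cliff ι) = 0 :=
  CliffordAlgebra.contractLeft_one (Q := cliffForm ι) _

theorem intMul_ι_mul (v w : ι → ℂ) (x : Cliff ι) :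
    intMul v (CliffordAlgebra.ι (cliffForm ι) w * x) =
      (v ⬝ᵥ w) • x - CliffordAlgebra.ι (cliffForm ι) w * intMul v x :=
  CliffordAlgebra.contractLeft_ι_mul _ _ _

theorem intMul_comm (v w : ι → ℂ) (x : Cliff ι) :
    intMul v (intMul w x) = -intMul w (intMul v x) :=
  CliffordAlgebra.contractLeft_comm _ _ _

theorem cliff_ι_mul_comm (v w : ι → ℂ) (x : Cliff ι) :
    CliffordAlgebra.ι (cliffForm ι) v * (CliffordAlgebra.ι (cliffForm ι) w * x) =
      -(CliffordAlgebra.ι (cliffForm ι) w * (CliffordAlgebra.ι (cliffForm ι) v * x))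
        - (2 * (v ⬝ᵥ w)) • x := by
  have h := CliffordAlgebra.ι_mul_ι_add_swap (Q := cliffForm ι) v w
  have hp : QuadraticMap.polar (cliffForm ι) v w = -(2 * (v ⬝ᵥ w)) := by
    simp only [QuadraticMap.polar, cliffForm, QuadraticMap.weightedSumSquares_apply, dotProduct,
      Finset.mul_sum, ← Finset.sum_sub_distrib, ← Finset.sum_neg_distrib]
    refine Finset.sum_congr rfl fun i _ => ?_
    simp only [Pi.add_apply, smul_eq_mul]
    ring
  rw [hp, ← eq_sub_iff_add_eq] at h
  rw [← mul_assoc, h, sub_mul, mul_assoc, Algebra.algebraMap_eq_smul_one, smul_mul_assoc, one_mul,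
    neg_smul]
  abel

theorem intMul_extMul (v w : ι → ℂ) (x : Cliff ι) :
    intMul v (extMul w x) = (v ⬝ᵥ w) • x - extMul w (intMul v x) := by
  rw [extMul_apply, map_add, intMul_ι_mul, extMul_apply, intMul_comm v w]
  abel

theorem extMul_comm (v w : ι → ℂ) (x : Cliff ι) :
    extMul v (extMul w x) = -extMul w (extMul v x) := by
  simp only [extMul_apply, map_add, intMul_ι_mul, cliff_ι_mul_comm v w,
    intMul_comm v w, dotProduct_comm w v, two_mul, add_smul]
  abel

theorem extMul_ι_mul (v w : ι → ℂ) (x : Cliff ι) :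
    extMul v (CliffordAlgebra.ι (cliffForm ι) w * x) =
      -(CliffordAlgebra.ι (cliffForm ι) w * extMul v x) - (v ⬝ᵥ w) • x := by
  simp only [extMul_apply, intMul_ι_mul, cliff_ι_mul_comm v w, mul_add, two_mul, add_smul]
  abel

theorem intMul_extMul_self_of_intMul_eq_zero {v w : ι → ℂ} {x : Cliff ι} (h : intMul v x = 0) :
    intMul v (extMul w x) = (v ⬝ᵥ w) • x := by
  rw [intMul_extMul, h, map_zero, sub_zero]

variable [LinearOrder ι]

/-- The sign `(-1)^r`, where `r` is the number of elements of `S` below `i`: it arises when `e_i` is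
moved to its place in the product of the `e_j`, `j ∈ S`. -/
noncomputable def insertSign (i : ι) (S : Finset ι) : ℂ := (-1) ^ (S.filter (· < i)).card

theorem cliffProd_empty : cliffProd (∅ : Finset ι) = 1 := by simp [cliffProd]

theorem cliffProd_insert_min {a : ι} {S : Finset ι} (h : ∀ x ∈ S, a < x) :
    cliffProd (insert a S) = cliffGen a * cliffProd S := by
  have hs : (insert a S).sort (· ≤ ·) = a :: S.sort (· ≤ ·) := by
    have e : insert a S = (a :: S.sort (· ≤ ·)).toFinset := by simp
    have hl : (a :: S.sort (· ≤ ·)).SortedLT := by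
      apply List.Pairwise.sortedLT
      rw [List.pairwise_cons]
      exact ⟨fun j hj => h j (by simpa using hj), (Finset.sortedLT_sort S).pairwise⟩
    rw [e, (List.toFinset_sort (· ≤ ·) hl.nodup).2 (hl.pairwise.imp le_of_lt)]
  rw [cliffProd, hs, List.map_cons, List.prod_cons, cliffProd]

theorem cliffGen_mul_cliffProd {i : ι} {S : Finset ι} (hi : i ∉ S) :
    cliffGen i * cliffProd S = insertSign i S • cliffProd (insert i S) := by
  induction S using Finset.induction_on_min with
  | empty =>
    rw [cliffProd_insert_min (by simp)]
    simp [insertSign, cliffProd_empty]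
  | insert a S ha ih =>
    rw [Finset.mem_insert, not_or] at hi
    have haS : a ∉ S := fun h => (ha a h).false
    rcases lt_or_gt_of_ne hi.1 with h | h
    · have hmin : ∀ x ∈ insert a S, i < x := fun x hx => by
        rcases Finset.mem_insert.1 hx with rfl | hx
        · exact h
        · exact h.trans (ha x hx)
      have h0 : (insert a S).filter (· < i) = ∅ :=
        Finset.filter_eq_empty_iff.2 fun x hx => (hmin x hx).asymm
      rw [cliffProd_insert_min hmin, insertSign, h0]
      simp
    · have hmin : ∀ x ∈ insert i S, a < x := fun x hx => by
        rcases Finset.mem_insert.1 hx with rfl | hx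
        · exact h
        · exact ha x hx
      have hs : insertSign i (insert a S) = -insertSign i S := by
        rw [insertSign, Finset.filter_insert, if_pos h, Finset.card_insert_of_notMem (by simp [haS]),
          pow_succ, insertSign]
        ring
      rw [cliffProd_insert_min ha, ← mul_assoc, cliffGen_mul_comm h.ne', neg_mul, mul_assoc,
        ih hi.2, hs, Finset.insert_comm, cliffProd_insert_min hmin, mul_smul_comm, neg_smul]

theorem insertSign_mul_self (i : ι) (S : Finset ι) : insertSign i S * insertSign i S = 1 := by
  rw [insertSign, ← mul_pow]; simp

theorem insertSign_erase (i : ι) (S : Finset ι) : insertSign i (S.erase i) = insertSign i S := by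
  unfold insertSign
  congr 2
  ext x
  simp only [Finset.mem_filter, Finset.mem_erase]
  exact ⟨fun h => ⟨h.1.2, h.2⟩, fun h => ⟨⟨h.2.ne, h.1⟩, h.2⟩⟩

theorem insertSign_insert (i : ι) (S : Finset ι) : insertSign i (insert i S) = insertSign i S := by
  rw [← insertSign_erase i (insert i S), ← insertSign_erase i S, Finset.erase_insert_eq_erase]

theorem insertSign_conj (i : ι) (S : Finset ι) :
    (starRingEnd ℂ) (insertSign i S) = insertSign i S := by
  simp [insertSign]

/-- `intMul` of a unit vector kills the products of the other unit vectors. -/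
theorem intMul_cliffProd_of_notMem {i : ι} {S : Finset ι} (hi : i ∉ S) :
    intMul (Pi.single i 1) (cliffProd S) = 0 := by
  induction S using Finset.induction_on_min with
  | empty => rw [cliffProd_empty, intMul_one]
  | insert a S ha ih =>
    rw [Finset.mem_insert, not_or] at hi
    rw [cliffProd_insert_min ha, cliffGen, intMul_ι_mul, ih hi.2, mul_zero, sub_zero]
    simp [hi.1]

theorem extMul_cliffProd_of_notMem {i : ι} {S : Finset ι} (hi : i ∉ S) :
    extMul (Pi.single i 1) (cliffProd S) = insertSign i S • cliffProd (insert i S) := by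
  rw [extMul_apply, intMul_cliffProd_of_notMem hi, add_zero, ← cliffGen_mul_cliffProd hi]
  rfl

theorem cliffProd_eq_extMul {i : ι} {S : Finset ι} (hi : i ∈ S) :
    cliffProd S = insertSign i S • extMul (Pi.single i 1) (cliffProd (S.erase i)) := by
  rw [extMul_cliffProd_of_notMem (Finset.notMem_erase i S), Finset.insert_erase hi,
    insertSign_erase, smul_smul, insertSign_mul_self, one_smul]

theorem extMul_cliffProd_of_mem {i : ι} {S : Finset ι} (hi : i ∈ S) :
    extMul (Pi.single i 1) (cliffProd S) = 0 := by
  rw [cliffProd_eq_extMul hi, map_smul]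
  have h := extMul_comm (Pi.single i 1) (Pi.single i 1) (cliffProd (S.erase i))
  rw [eq_neg_iff_add_eq_zero, ← two_smul ℂ] at h
  rw [(smul_eq_zero.1 h).resolve_left two_ne_zero, smul_zero]

theorem intMul_cliffProd_of_mem {i : ι} {S : Finset ι} (hi : i ∈ S) :
    intMul (Pi.single i 1) (cliffProd S) = insertSign i S • cliffProd (S.erase i) := by
  conv_lhs => rw [cliffProd_eq_extMul hi]
  rw [map_smul, intMul_extMul_self_of_intMul_eq_zero
    (intMul_cliffProd_of_notMem (Finset.notMem_erase i S))]
  simp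

/-- The coordinate of an element of the Clifford algebra at `e_{i₁} ⋯ e_{iₖ}`. -/
noncomputable def cliffCoord (S : Finset ι) : Cliff ι →ₗ[ℂ] ℂ := (cliffBasis ι).coord S

theorem cliffCoord_apply (S : Finset ι) (x : Cliff ι) :
    cliffCoord S x = (cliffBasis ι).repr x S := rfl

theorem cliffCoord_cliffProd (S T : Finset ι) :
    cliffCoord S (cliffProd T) = if T = S then 1 else 0 := by
  rw [cliffCoord_apply, ← cliffBasis_apply, Module.Basis.repr_self, Finsupp.single_apply]

theorem cliff_ext {x y : Cliff ι} (h : ∀ S, cliffCoord S x = cliffCoord S y) : x = y :=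
  (cliffBasis ι).repr.injective (Finsupp.ext h)

theorem cliff_sum_coord (x : Cliff ι) : ∑ S, cliffCoord S x • cliffProd S = x := by
  simp only [← cliffBasis_apply]
  exact (cliffBasis ι).sum_repr x

theorem cliff_linearMap_ext {V : Type*} [AddCommMonoid V] [Module ℂ V] {f g : Cliff ι →ₗ[ℂ] V}
    (h : ∀ S, f (cliffProd S) = g (cliffProd S)) : f = g :=
  (cliffBasis ι).ext fun S => by rw [cliffBasis_apply, h]

/-- The hermitian inner product in which the `e_{i₁} ⋯ e_{iₖ}` are orthonormal. -/
noncomputable def cliffInner (x y : Cliff ι) : ℂ :=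
  ∑ S, (starRingEnd ℂ) (cliffCoord S x) * cliffCoord S y

theorem cliffInner_conj (x y : Cliff ι) :
    (starRingEnd ℂ) (cliffInner x y) = cliffInner y x := by
  simp only [cliffInner, map_sum, map_mul, Complex.conj_conj, mul_comm]

theorem cliffInner_add_left (x x' y : Cliff ι) :
    cliffInner (x + x') y = cliffInner x y + cliffInner x' y := by
  simp only [cliffInner, map_add, add_mul, Finset.sum_add_distrib]

theorem cliffInner_smul_left (c : ℂ) (x y : Cliff ι) :
    cliffInner (c • x) y = (starRingEnd ℂ) c * cliffInner x y := by
  simp only [cliffInner, map_smul, smul_eq_mul, map_mul, mul_assoc, Finset.mul_sum]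

theorem cliffInner_add_right (x y y' : Cliff ι) :
    cliffInner x (y + y') = cliffInner x y + cliffInner x y' := by
  simp only [cliffInner, map_add, mul_add, Finset.sum_add_distrib]

theorem cliffInner_smul_right (c : ℂ) (x y : Cliff ι) :
    cliffInner x (c • y) = c * cliffInner x y := by
  simp only [cliffInner, map_smul, smul_eq_mul, Finset.mul_sum, mul_left_comm]

theorem cliffInner_zero_left (y : Cliff ι) : cliffInner 0 y = 0 := by simp [cliffInner]

theorem cliffInner_zero_right (x : Cliff ι) : cliffInner x 0 = 0 := by simp [cliffInner]

theorem cliffInner_sum_left {α : Type*} (s : Finset α) (f : α → Cliff ι) (y : Cliff ι) :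
    cliffInner (∑ a ∈ s, f a) y = ∑ a ∈ s, cliffInner (f a) y := by
  classical
  induction s using Finset.induction_on with
  | empty => simp [cliffInner_zero_left]
  | insert a s ha ih => simp [Finset.sum_insert ha, cliffInner_add_left, ih]

theorem cliffInner_sum_right {α : Type*} (s : Finset α) (x : Cliff ι) (f : α → Cliff ι) :
    cliffInner x (∑ a ∈ s, f a) = ∑ a ∈ s, cliffInner x (f a) := by
  classical
  induction s using Finset.induction_on with
  | empty => simp [cliffInner_zero_right]
  | insert a s ha ih => simp [Finset.sum_insert ha, cliffInner_add_right, ih]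

theorem cliffInner_cliffProd (S T : Finset ι) :
    cliffInner (cliffProd S) (cliffProd T) = if S = T then 1 else 0 := by
  simp only [cliffInner, cliffCoord_cliffProd]
  by_cases h : S = T
  · subst h; simp [apply_ite]
  · rw [if_neg h, Finset.sum_eq_zero]
    intro U _
    split_ifs with h1 h2 <;> simp_all

/-- Sesquilinear identities need to be checked on the basis only. -/
theorem cliffInner_eq_of_basis {κ : Type*} [Fintype κ] [LinearOrder κ] {f : Cliff ι →ₗ[ℂ] Cliff κ}
    {ι' : Type*} [Fintype ι'] [LinearOrder ι'] {g : Cliff ι' →ₗ[ℂ] Cliff κ}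
    {κ' : Type*} [Fintype κ'] [LinearOrder κ'] {f₂ : Cliff ι →ₗ[ℂ] Cliff κ'}
    {g₂ : Cliff ι' →ₗ[ℂ] Cliff κ'}
    (h : ∀ S T, cliffInner (f (cliffProd S)) (g (cliffProd T)) =
      cliffInner (f₂ (cliffProd S)) (g₂ (cliffProd T))) (x : Cliff ι) (y : Cliff ι') :
    cliffInner (f x) (g y) = cliffInner (f₂ x) (g₂ y) := by
  rw [← cliff_sum_coord x, ← cliff_sum_coord y]
  simp only [map_sum, map_smul, cliffInner_sum_left, cliffInner_sum_right, cliffInner_smul_left,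
    cliffInner_smul_right, h]

theorem cliffInner_extMul_single (i : ι) (x y : Cliff ι) :
    cliffInner (extMul (Pi.single i 1) x) y = cliffInner x (intMul (Pi.single i 1) y) := by
  refine cliffInner_eq_of_basis (f := extMul (Pi.single i 1))
    (g := LinearMap.id) (f₂ := LinearMap.id)
    (g₂ := intMul (Pi.single i 1)) (fun S T => ?_) x y
  simp only [LinearMap.id_apply]
  by_cases hS : i ∈ S
  · rw [extMul_cliffProd_of_mem hS, cliffInner_zero_left]
    by_cases hT : i ∈ T
    · rw [intMul_cliffProd_of_mem hT, cliffInner_smul_right, cliffInner_cliffProd, if_neg, mul_zero]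
      intro e; exact Finset.notMem_erase i T (e ▸ hS)
    · rw [intMul_cliffProd_of_notMem hT, cliffInner_zero_right]
  · rw [extMul_cliffProd_of_notMem hS, cliffInner_smul_left, cliffInner_cliffProd, insertSign_conj]
    by_cases hT : i ∈ T
    · rw [intMul_cliffProd_of_mem hT, cliffInner_smul_right, cliffInner_cliffProd]
      by_cases e : S = T.erase i
      · rw [if_pos e, if_pos (by rw [e, Finset.insert_erase hT]), e, insertSign_erase]
      · rw [if_neg e, if_neg, mul_zero, mul_zero]
        rintro rfl; exact e (Finset.erase_insert hS).symm
    · rw [intMul_cliffProd_of_notMem hT, cliffInner_zero_right, if_neg, mul_zero]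
      rintro rfl; exact hT (Finset.mem_insert_self _ _)

theorem vec_eq_sum_single (v : ι → ℂ) : v = ∑ i, v i • Pi.single i (1 : ℂ) := by
  ext j; simp [Finset.sum_apply, Pi.single_apply]

/-- Exterior and interior multiplication by a real vector are adjoint to each other. -/
theorem cliffInner_extMul (v : ι → ℝ) (x y : Cliff ι) :
    cliffInner (extMul (fun i => (v i : ℂ)) x) y = cliffInner x (intMul (fun i => (v i : ℂ)) y) := by
  rw [vec_eq_sum_single fun i => (v i : ℂ)]
  simp only [map_sum, map_smul, LinearMap.sum_apply, LinearMap.smul_apply, cliffInner_sum_left,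
    cliffInner_sum_right, cliffInner_smul_left, cliffInner_smul_right, cliffInner_extMul_single,
    Complex.conj_ofReal]

theorem cliffInner_intMul (v : ι → ℝ) (x y : Cliff ι) :
    cliffInner (intMul (fun i => (v i : ℂ)) x) y = cliffInner x (extMul (fun i => (v i : ℂ)) y) := by
  rw [← cliffInner_conj, ← cliffInner_extMul, cliffInner_conj]

end CliffordOps

/-! ### Derivations and isometries of the Clifford algebra -/

section CliffordMaps

variable {ι : Type*} [Fintype ι] [LinearOrder ι] {ι' : Type*} [Fintype ι'] [LinearOrder ι']
  {ι'' : Type*} [Fintype ι''] [LinearOrder ι'']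

/-- A column of a real matrix as a complex vector. -/
noncomputable def colVec (A : Matrix ι' ι ℝ) (i : ι) : ι' → ℂ := fun j => (A j i : ℂ)

/-- The derivation of the exterior algebra that extends a matrix. -/
noncomputable def extDerivation (A : Matrix ι ι ℝ) : Module.End ℂ (Cliff ι) :=
  ∑ i, extMul (colVec A i) * intMul (Pi.single i 1)

theorem extDerivation_apply (A : Matrix ι ι ℝ) (x : Cliff ι) :
    extDerivation A x = ∑ i, extMul (colVec A i) (intMul (Pi.single i 1) x) := by
  simp [extDerivation, LinearMap.sum_apply]

theorem extDerivation_one (A : Matrix ι ι ℝ) : extDerivation A (1 : Cliff ι) = 0 := by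
  simp [extDerivation_apply, intMul_one]

theorem extDerivation_extMul (A : Matrix ι ι ℝ) (i : ι) (x : Cliff ι) :
    extDerivation A (extMul (Pi.single i 1) x) =
      extMul (colVec A i) x + extMul (Pi.single i 1) (extDerivation A x) := by
  simp only [extDerivation_apply, intMul_extMul, map_sub, map_smul,
    extMul_comm (colVec A _) (Pi.single i 1), sub_neg_eq_add, map_sum, Finset.sum_add_distrib]
  congr 1
  rw [Finset.sum_eq_single i]
  · simp
  · intro j _ hj; simp [hj.symm]
  · simp

theorem sum_colVec_dotProduct_intMul {A : Matrix ι ι ℝ} (hA : ∀ i j, A i j = -A j i) (i : ι)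
    (x : Cliff ι) : ∑ j, (colVec A j ⬝ᵥ Pi.single i 1) • intMul (Pi.single j 1) x =
      -intMul (colVec A i) x := by
  conv_rhs => rw [vec_eq_sum_single (colVec A i)]
  simp only [map_sum, map_smul, LinearMap.sum_apply, LinearMap.smul_apply, ← Finset.sum_neg_distrib,
    ← neg_smul]
  refine Finset.sum_congr rfl fun j _ => ?_
  congr 1
  simp only [dotProduct_single, mul_one, colVec]
  rw [hA i j]
  push_cast
  ring

/-- For a skew-symmetric matrix, the derivation of the exterior algebra is also a derivation for
the Clifford multiplication. -/
theorem extDerivation_ι_mul {A : Matrix ι ι ℝ} (hA : ∀ i j, A i j = -A j i) (i : ι) (x : Cliff ι) :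
    extDerivation A (cliffGen i * x) =
      CliffordAlgebra.ι (cliffForm ι) (colVec A i) * x + cliffGen i * extDerivation A x := by
  simp only [extDerivation_apply, cliffGen, intMul_ι_mul, map_sub, map_smul,
    Finset.sum_sub_distrib, extMul_ι_mul, Finset.sum_neg_distrib,
    sum_colVec_dotProduct_intMul hA, Finset.mul_sum]
  rw [Finset.sum_eq_single i]
  · simp only [dotProduct_single, mul_one, Pi.single_eq_same, one_smul]
    rw [extMul_apply]
    abel
  · intro j _ hj; simp [hj.symm]
  · simp

theorem cliffDeriv_cliffProd (A : Matrix ι ι ℝ) (S : Finset ι) :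
    cliffDeriv A (cliffProd S) = cliffDerivList A (S.sort (· ≤ ·)) := by
  rw [cliffDeriv, ← cliffBasis_apply, Module.Basis.constr_basis]

theorem cliffDeriv_eq_extDerivation {A : Matrix ι ι ℝ} (hA : ∀ i j, A i j = -A j i) :
    cliffDeriv A = extDerivation A := by
  refine cliff_linearMap_ext fun S => ?_
  rw [cliffDeriv_cliffProd, cliffProd]
  induction S.sort (· ≤ ·) with
  | nil => simp [cliffDerivList, extDerivation_one]
  | cons i l ih =>
    rw [List.map_cons, List.prod_cons, extDerivation_ι_mul hA, ← ih]
    rfl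

theorem cliffDeriv_ι_mul {A : Matrix ι ι ℝ} (hA : ∀ i j, A i j = -A j i) (v : ι → ℝ) (x : Cliff ι) :
    cliffDeriv A (CliffordAlgebra.ι (cliffForm ι) (fun j => (v j : ℂ)) * x) =
      CliffordAlgebra.ι (cliffForm ι) (fun j => ((A.mulVec v) j : ℂ)) * x +
        CliffordAlgebra.ι (cliffForm ι) (fun j => (v j : ℂ)) * cliffDeriv A x := by
  have h1 : (fun j => ((A.mulVec v) j : ℂ)) = ∑ i, (v i : ℂ) • colVec A i := by
    ext j
    simp only [Matrix.mulVec, dotProduct, Complex.ofReal_sum, Complex.ofReal_mul, Finset.sum_apply,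
      Pi.smul_apply, colVec, smul_eq_mul, mul_comm]
  rw [h1, vec_eq_sum_single fun j => (v j : ℂ), cliffDeriv_eq_extDerivation hA]
  simp only [map_sum, map_smul, Finset.sum_mul, smul_mul_assoc]
  rw [← Finset.sum_add_distrib]
  refine Finset.sum_congr rfl fun i _ => ?_
  rw [← smul_add]
  congr 1
  exact extDerivation_ι_mul hA i x

theorem cliffDeriv_one {A : Matrix ι ι ℝ} (hA : ∀ i j, A i j = -A j i) :
    cliffDeriv A (1 : Cliff ι) = 0 := by
  rw [cliffDeriv_eq_extDerivation hA, extDerivation_one]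

theorem cliffInner_cliffDeriv {A : Matrix ι ι ℝ} (hA : ∀ i j, A i j = -A j i) (x y : Cliff ι) :
    cliffInner (cliffDeriv A x) y = -cliffInner x (cliffDeriv A y) := by
  rw [cliffDeriv_eq_extDerivation hA, extDerivation_apply, extDerivation_apply,
    cliffInner_sum_left, cliffInner_sum_right, ← Finset.sum_neg_distrib]
  have hs : ∀ i, (Pi.single i 1 : ι → ℂ) = fun j => ((Pi.single i 1 : ι → ℝ) j : ℂ) := by
    intro i; ext j; by_cases h : j = i
    · subst h; simp
    · simp [h]
  have h1 : ∀ i, cliffInner (extMul (colVec A i) (intMul (Pi.single i 1) x)) y =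
      cliffInner x (extMul (Pi.single i 1) (intMul (colVec A i) y)) := by
    intro i
    rw [show colVec A i = fun j => ((A j i : ℝ) : ℂ) from rfl, cliffInner_extMul, hs,
      cliffInner_intMul]
  simp only [h1]
  have h2 : ∀ (i : ι) (f : (ι → ℂ) →ₗ[ℂ] Module.End ℂ (Cliff ι)) (z : Cliff ι), f (colVec A i) z =
      ∑ j, (A j i : ℂ) • f (Pi.single j 1) z := by
    intro i f z
    conv_lhs => rw [vec_eq_sum_single (colVec A i)]
    simp [LinearMap.sum_apply, colVec]
  simp only [h2, map_sum, map_smul, cliffInner_sum_right, ← Finset.sum_neg_distrib]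
  rw [Finset.sum_comm]
  refine Finset.sum_congr rfl fun i _ => Finset.sum_congr rfl fun j _ => ?_
  rw [hA, cliffInner_smul_right, cliffInner_smul_right]
  push_cast
  ring

/-- The linear extension of `e_{i₁} ⋯ e_{iₖ} ↦ A e_{i₁} ⋯ A e_{iₖ}`, for any matrix `A`. -/
noncomputable def cliffMapLin (A : Matrix ι' ι ℝ) : Cliff ι →ₗ[ℂ] Cliff ι' :=
  (cliffBasis ι).constr ℂ fun S =>
    ((S.sort (· ≤ ·)).map fun i => CliffordAlgebra.ι (cliffForm ι') (colVec A i)).prod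

theorem cliffMapLin_cliffProd (A : Matrix ι' ι ℝ) (S : Finset ι) : cliffMapLin A (cliffProd S) =
    ((S.sort (· ≤ ·)).map fun i => CliffordAlgebra.ι (cliffForm ι') (colVec A i)).prod := by
  rw [cliffMapLin, ← cliffBasis_apply, Module.Basis.constr_basis]

theorem cliffMap_ι (A : Matrix ι' ι ℝ) (hA : A.transpose * A = 1) (v : ι → ℂ) :
    cliffMap A hA (CliffordAlgebra.ι (cliffForm ι) v) =
      CliffordAlgebra.ι (cliffForm ι') ((A.map (fun r : ℝ => (r : ℂ))).mulVec v) := by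
  rw [cliffMap, CliffordAlgebra.map_apply_ι]
  rfl

theorem cliffMap_cliffGen (A : Matrix ι' ι ℝ) (hA : A.transpose * A = 1) (i : ι) :
    cliffMap A hA (cliffGen i) = CliffordAlgebra.ι (cliffForm ι') (colVec A i) := by
  rw [cliffGen, cliffMap_ι]
  congr 1
  ext j
  simp [colVec]

theorem cliffMap_toLinearMap (A : Matrix ι' ι ℝ) (hA : A.transpose * A = 1) :
    (cliffMap A hA).toLinearMap = cliffMapLin A := by
  refine cliff_linearMap_ext fun S => ?_
  rw [cliffMapLin_cliffProd, AlgHom.toLinearMap_apply, cliffProd, map_list_prod, List.map_map]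
  congr 2
  funext i
  exact cliffMap_cliffGen A hA i

theorem cliffMapLin_ι_mul (A : Matrix ι' ι ℝ) (hA : A.transpose * A = 1) (v : ι → ℂ) (x : Cliff ι) :
    cliffMapLin A (CliffordAlgebra.ι (cliffForm ι) v * x) =
      CliffordAlgebra.ι (cliffForm ι') ((A.map (fun r : ℝ => (r : ℂ))).mulVec v) *
        cliffMapLin A x := by
  rw [← cliffMap_toLinearMap A hA, AlgHom.toLinearMap_apply, map_mul, cliffMap_ι]
  rfl

theorem cliffMapLin_one (A : Matrix ι' ι ℝ) : cliffMapLin A (1 : Cliff ι) = 1 := by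
  rw [← cliffProd_empty, cliffMapLin_cliffProd]; simp

theorem intMul_cliffMapLin (A : Matrix ι' ι ℝ) (hA : A.transpose * A = 1) (w : ι' → ℂ)
    (x : Cliff ι) : intMul w (cliffMapLin A x) =
      cliffMapLin A (intMul ((A.map (fun r : ℝ => (r : ℂ))).transpose.mulVec w) x) := by
  induction x using CliffordAlgebra.left_induction with
  | algebraMap r =>
    rw [Algebra.algebraMap_eq_smul_one, map_smul, cliffMapLin_one, map_smul, intMul_one, map_smul,
      intMul_one]
    simp
  | add x y hx hy => simp only [map_add, hx, hy]
  | ι_mul x v hx =>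
    rw [cliffMapLin_ι_mul A hA, intMul_ι_mul, intMul_ι_mul, hx, map_sub, map_smul,
      cliffMapLin_ι_mul A hA, Matrix.dotProduct_mulVec, Matrix.mulVec_transpose]

theorem complexMatrix_transpose_mul {A : Matrix ι' ι ℝ} (hA : A.transpose * A = 1) :
    (A.map (fun r : ℝ => (r : ℂ))).transpose * A.map (fun r : ℝ => (r : ℂ)) = 1 := by
  have := congrArg (fun B : Matrix ι ι ℝ => B.map (Complex.ofRealHom)) hA
  simp only [Matrix.map_mul, Matrix.map_one Complex.ofRealHom (map_zero _) (map_one _)] at this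
  exact this

theorem cliffMapLin_intMul (A : Matrix ι' ι ℝ) (hA : A.transpose * A = 1) (v : ι → ℂ)
    (x : Cliff ι) : cliffMapLin A (intMul v x) =
      intMul ((A.map (fun r : ℝ => (r : ℂ))).mulVec v) (cliffMapLin A x) := by
  rw [intMul_cliffMapLin A hA, Matrix.mulVec_mulVec, complexMatrix_transpose_mul hA,
    Matrix.one_mulVec]

theorem cliffMapLin_extMul (A : Matrix ι' ι ℝ) (hA : A.transpose * A = 1) (v : ι → ℂ)
    (x : Cliff ι) : cliffMapLin A (extMul v x) =
      extMul ((A.map (fun r : ℝ => (r : ℂ))).mulVec v) (cliffMapLin A x) := by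
  rw [extMul_apply, map_add, cliffMapLin_ι_mul A hA, cliffMapLin_intMul A hA, extMul_apply]

theorem cliffMapLin_extMul_single (A : Matrix ι' ι ℝ) (hA : A.transpose * A = 1) (i : ι)
    (x : Cliff ι) : cliffMapLin A (extMul (Pi.single i 1) x) =
      extMul (colVec A i) (cliffMapLin A x) := by
  rw [cliffMapLin_extMul A hA]
  congr 2
  ext j
  simp [colVec]

theorem cliffProd_insert_min' {a : ι} {S : Finset ι} (h : ∀ x ∈ S, a < x) :
    cliffProd (insert a S) = extMul (Pi.single a 1) (cliffProd S) := by
  have ha : a ∉ S := fun h' => (h a h').false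
  rw [extMul_cliffProd_of_notMem ha, ← cliffGen_mul_cliffProd ha, cliffProd_insert_min h]

theorem cliffInner_one_extMul (v : ι → ℝ) (x : Cliff ι) :
    cliffInner 1 (extMul (fun i => (v i : ℂ)) x) = 0 := by
  rw [← cliffInner_intMul, intMul_one, cliffInner_zero_left]

theorem cliffInner_one (x : Cliff ι) : cliffInner 1 x = cliffCoord ∅ x := by
  rw [← cliffProd_empty]
  simp only [cliffInner, cliffCoord_cliffProd]
  rw [Finset.sum_eq_single ∅] <;> simp +contextual [eq_comm]

theorem cliffCoord_empty_cliffMapLin (A : Matrix ι' ι ℝ) (hA : A.transpose * A = 1) (x : Cliff ι) :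
    cliffCoord ∅ (cliffMapLin A x) = cliffCoord ∅ x := by
  have : cliffCoord ∅ ∘ₗ cliffMapLin A = cliffCoord (∅ : Finset ι) := by
    refine cliff_linearMap_ext fun S => ?_
    rw [LinearMap.comp_apply]
    induction S using Finset.induction_on_min with
    | empty => rw [cliffProd_empty, cliffMapLin_one, ← cliffProd_empty, cliffCoord_cliffProd,
        ← cliffProd_empty, cliffCoord_cliffProd]; simp
    | insert a S ha ih =>
      rw [cliffCoord_cliffProd, if_neg (Finset.insert_ne_empty a S), cliffProd_insert_min' ha,
        cliffMapLin_extMul_single A hA, ← cliffInner_one]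
      exact cliffInner_one_extMul _ _
  exact LinearMap.congr_fun this x

/-- `Cl(A)` is isometric: it intertwines exterior multiplications, whose adjoints are the interior
multiplications, and it fixes `1`. -/
theorem cliffInner_cliffMapLin (A : Matrix ι' ι ℝ) (hA : A.transpose * A = 1) (x y : Cliff ι) :
    cliffInner (cliffMapLin A x) (cliffMapLin A y) = cliffInner x y := by
  refine cliffInner_eq_of_basis (f₂ := LinearMap.id) (g₂ := LinearMap.id) (fun S T => ?_) x y
  simp only [LinearMap.id_apply]
  induction S using Finset.induction_on_min generalizing y T with
  | empty =>
    rw [cliffProd_empty, cliffMapLin_one, cliffInner_one, cliffInner_one,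
      cliffCoord_empty_cliffMapLin A hA]
  | insert a S ha ih =>
    have h : ∀ z, cliffInner (cliffMapLin A (cliffProd S)) (cliffMapLin A z) =
        cliffInner (cliffProd S) z := fun z => by
      rw [← cliff_sum_coord z]
      simp only [map_sum, map_smul, cliffInner_sum_right, cliffInner_smul_right, ih 0]
    rw [cliffProd_insert_min' ha, cliffMapLin_extMul_single A hA,
      show colVec A a = fun j => ((A j a : ℝ) : ℂ) from rfl, cliffInner_extMul,
      cliffInner_extMul_single, ← h, cliffMapLin_intMul A hA]
    congr 3
    ext j
    simp

end CliffordMaps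

/-! ### Functoriality and variation of `Cl(A)` -/

section CliffordMaps

variable {ι : Type*} [Fintype ι] [LinearOrder ι] {ι' : Type*} [Fintype ι'] [LinearOrder ι']
  {ι'' : Type*} [Fintype ι''] [LinearOrder ι'']

theorem mulVec_colVec (B : Matrix ι'' ι' ℝ) (A : Matrix ι' ι ℝ) (i : ι) :
    (B.map (fun r : ℝ => (r : ℂ))).mulVec (colVec A i) = colVec (B * A) i := by
  ext j
  simp [Matrix.mulVec, dotProduct, colVec, Matrix.mul_apply]

theorem cliffMapLin_list_prod (B : Matrix ι'' ι' ℝ) (hB : B.transpose * B = 1) (A : Matrix ι' ι ℝ)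
    (l : List ι) :
    cliffMapLin B ((l.map fun i => CliffordAlgebra.ι (cliffForm ι') (colVec A i)).prod) =
      (l.map fun i => CliffordAlgebra.ι (cliffForm ι'') (colVec (B * A) i)).prod := by
  induction l with
  | nil => simp [cliffMapLin_one]
  | cons i l ih =>
    rw [List.map_cons, List.prod_cons, cliffMapLin_ι_mul B hB, ih, mulVec_colVec, List.map_cons,
      List.prod_cons]

theorem cliffMapLin_mul (B : Matrix ι'' ι' ℝ) (hB : B.transpose * B = 1) (A : Matrix ι' ι ℝ) :
    cliffMapLin (B * A) = cliffMapLin B ∘ₗ cliffMapLin A := by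
  refine cliff_linearMap_ext fun S => ?_
  rw [LinearMap.comp_apply, cliffMapLin_cliffProd, cliffMapLin_cliffProd,
    cliffMapLin_list_prod B hB]

theorem colVec_one (i : ι) : colVec (1 : Matrix ι ι ℝ) i = Pi.single i 1 := by
  ext j
  by_cases h : j = i
  · subst h; simp [colVec]
  · simp [colVec, h]

theorem cliffMapLin_one_matrix : cliffMapLin (1 : Matrix ι ι ℝ) = LinearMap.id := by
  refine cliff_linearMap_ext fun S => ?_
  rw [cliffMapLin_cliffProd, LinearMap.id_apply, cliffProd]
  congr 2
  funext i
  rw [colVec_one, cliffGen]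

/-- The value of a derivation along `Cl(A)`, given by `e ↦ Q e` on vectors, on `e_{i₁} ⋯ e_{iₖ}`:
the sum `∑ₗ A e_{i₁} ⋯ Q e_{iₗ} ⋯ A e_{iₖ}`. -/
noncomputable def cliffTwistList (A Q : Matrix ι' ι ℝ) : List ι → Cliff ι'
  | [] => 0
  | i :: l => CliffordAlgebra.ι (cliffForm ι') (colVec Q i) *
        (l.map fun i => CliffordAlgebra.ι (cliffForm ι') (colVec A i)).prod +
      CliffordAlgebra.ι (cliffForm ι') (colVec A i) * cliffTwistList A Q l

/-- The derivation along `Cl(A)` given by `Q` on vectors. It is the derivative of `Cl(A)` when `A`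
moves with velocity `Q`. -/
noncomputable def cliffTwist (A Q : Matrix ι' ι ℝ) : Cliff ι →ₗ[ℂ] Cliff ι' :=
  (cliffBasis ι).constr ℂ fun S => cliffTwistList A Q (S.sort (· ≤ ·))

theorem cliffTwist_cliffProd (A Q : Matrix ι' ι ℝ) (S : Finset ι) :
    cliffTwist A Q (cliffProd S) = cliffTwistList A Q (S.sort (· ≤ ·)) := by
  rw [cliffTwist, ← cliffBasis_apply, Module.Basis.constr_basis]

theorem cliffTwistList_add (A Q Q' : Matrix ι' ι ℝ) (l : List ι) :
    cliffTwistList A (Q + Q') l = cliffTwistList A Q l + cliffTwistList A Q' l := by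
  induction l with
  | nil => simp [cliffTwistList]
  | cons i l ih =>
    have : colVec (Q + Q') i = colVec Q i + colVec Q' i := by ext j; simp [colVec]
    simp only [cliffTwistList, ih, this, map_add, add_mul, mul_add]
    abel

theorem cliffTwistList_smul (A Q : Matrix ι' ι ℝ) (c : ℝ) (l : List ι) :
    cliffTwistList A (c • Q) l = (c : ℂ) • cliffTwistList A Q l := by
  induction l with
  | nil => simp [cliffTwistList]
  | cons i l ih =>
    have : colVec (c • Q) i = (c : ℂ) • colVec Q i := by ext j; simp [colVec]
    simp only [cliffTwistList, ih, this, map_smul, smul_mul_assoc, mul_smul_comm, smul_add]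

theorem cliffTwist_add (A Q Q' : Matrix ι' ι ℝ) :
    cliffTwist A (Q + Q') = cliffTwist A Q + cliffTwist A Q' :=
  cliff_linearMap_ext fun S => by
    rw [LinearMap.add_apply, cliffTwist_cliffProd, cliffTwist_cliffProd, cliffTwist_cliffProd,
      cliffTwistList_add]

theorem cliffTwist_smul (A Q : Matrix ι' ι ℝ) (c : ℝ) :
    cliffTwist A (c • Q) = (c : ℂ) • cliffTwist A Q :=
  cliff_linearMap_ext fun S => by
    rw [LinearMap.smul_apply, cliffTwist_cliffProd, cliffTwist_cliffProd, cliffTwistList_smul]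

theorem cliffTwist_sum {α : Type*} (s : Finset α) (A : Matrix ι' ι ℝ) (c : α → ℝ)
    (Q : α → Matrix ι' ι ℝ) :
    cliffTwist A (∑ a ∈ s, c a • Q a) = ∑ a ∈ s, (c a : ℂ) • cliffTwist A (Q a) := by
  classical
  induction s using Finset.induction_on with
  | empty =>
    have := cliffTwist_smul A (0 : Matrix ι' ι ℝ) 0
    simpa using this
  | insert a s ha ih => rw [Finset.sum_insert ha, Finset.sum_insert ha, cliffTwist_add,
      cliffTwist_smul, ih]

/-- A derivation, followed by or applied after `Cl(A)`, is a derivation along `Cl(A)`. Hence two such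
compositions can be compared by their matrices on vectors. -/
theorem cliffMapLin_comp_cliffDeriv (A : Matrix ι' ι ℝ) (hA : A.transpose * A = 1)
    (Z : Matrix ι ι ℝ) : cliffMapLin A ∘ₗ cliffDeriv Z = cliffTwist A (A * Z) := by
  refine cliff_linearMap_ext fun S => ?_
  rw [LinearMap.comp_apply, cliffDeriv_cliffProd, cliffTwist_cliffProd]
  induction S.sort (· ≤ ·) with
  | nil => simp [cliffTwistList, cliffDerivList]
  | cons i l ih =>
    have h1 : ∀ l : List ι, cliffMapLin A ((l.map cliffGen).prod) =
        (l.map fun i => CliffordAlgebra.ι (cliffForm ι') (colVec A i)).prod := by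
      intro l
      have := cliffMapLin_list_prod A hA 1 l
      simp only [colVec_one, Matrix.mul_one] at this
      exact this
    have h2 : (A.map (fun r : ℝ => (r : ℂ))).mulVec (Pi.single i 1) = colVec A i := by
      rw [← colVec_one, mulVec_colVec, Matrix.mul_one]
    rw [cliffDerivList, map_add, cliffTwistList, cliffGen, cliffMapLin_ι_mul A hA,
      cliffMapLin_ι_mul A hA, ih, h1, ← mulVec_colVec, h2]
    rfl

theorem cliffDeriv_comp_cliffMapLin (A : Matrix ι' ι ℝ) {Z : Matrix ι' ι' ℝ}
    (hZ : ∀ i j, Z i j = -Z j i) : cliffDeriv Z ∘ₗ cliffMapLin A = cliffTwist A (Z * A) := by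
  refine cliff_linearMap_ext fun S => ?_
  rw [LinearMap.comp_apply, cliffMapLin_cliffProd, cliffTwist_cliffProd]
  induction S.sort (· ≤ ·) with
  | nil => simp [cliffTwistList, cliffDeriv_one hZ]
  | cons i l ih =>
    rw [List.map_cons, List.prod_cons, cliffTwistList, ← ih]
    exact cliffDeriv_ι_mul hZ (fun j => A j i) _

/-! ### Sections with coefficients -/

variable {κ : Type*}

/-- The component in the Clifford algebra at a unit vector of the coefficient space. -/
noncomputable def fibSlice (s : κ) : Fib ι κ →ₗ[ℂ] Cliff ι where
  toFun x := ∑ S, x (S, s) • cliffBasis ι S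
  map_add' x y := by simp [add_smul, Finset.sum_add_distrib]
  map_smul' c x := by simp [mul_smul, Finset.smul_sum]

theorem cliffCoord_fibSlice (S : Finset ι) (s : κ) (x : Fib ι κ) :
    cliffCoord S (fibSlice s x) = x (S, s) := by
  change cliffCoord S (∑ T, x (T, s) • cliffBasis ι T) = _
  simp only [map_sum, map_smul, cliffBasis_apply, cliffCoord_cliffProd]
  simp

theorem fib_ext {x y : Fib ι κ} (h : ∀ s, fibSlice s x = fibSlice s y) : x = y := by
  ext ⟨S, s⟩
  rw [← cliffCoord_fibSlice, h, cliffCoord_fibSlice]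

theorem onFib_apply (T : Cliff ι →ₗ[ℂ] Cliff ι') (x : Fib ι κ) (S : Finset ι') (s : κ) :
    onFib T x (S, s) = cliffCoord S (T (fibSlice s x)) := rfl

theorem onFib_apply_sum (T : Cliff ι →ₗ[ℂ] Cliff ι') (x : Fib ι κ) (S : Finset ι') (s : κ) :
    onFib T x (S, s) = ∑ U, x (U, s) * cliffCoord S (T (cliffProd U)) := by
  rw [onFib_apply, ← cliff_sum_coord (fibSlice s x)]
  simp only [map_sum, map_smul, smul_eq_mul, cliffCoord_fibSlice]

theorem fibSlice_onFib (T : Cliff ι →ₗ[ℂ] Cliff ι') (x : Fib ι κ) (s : κ) :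
    fibSlice s (onFib T x) = T (fibSlice s x) :=
  cliff_ext fun S => by rw [cliffCoord_fibSlice, onFib_apply]

theorem onFib_comp (T : Cliff ι →ₗ[ℂ] Cliff ι') (T' : Cliff ι' →ₗ[ℂ] Cliff ι'') (x : Fib ι κ) :
    onFib (T' ∘ₗ T) x = onFib T' (onFib T x) :=
  fib_ext fun s => by simp only [fibSlice_onFib, LinearMap.comp_apply]

theorem onFib_id (x : Fib ι κ) : onFib (LinearMap.id : Cliff ι →ₗ[ℂ] Cliff ι) x = x :=
  fib_ext fun s => by simp only [fibSlice_onFib, LinearMap.id_apply]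

theorem onFib_add (T T' : Cliff ι →ₗ[ℂ] Cliff ι') (x : Fib ι κ) :
    onFib (T + T') x = onFib T x + onFib T' x :=
  fib_ext fun s => by simp only [fibSlice_onFib, LinearMap.add_apply, map_add]

theorem onFib_smul (c : ℂ) (T : Cliff ι →ₗ[ℂ] Cliff ι') (x : Fib ι κ) :
    onFib (c • T) x = c • onFib T x :=
  fib_ext fun s => by simp only [fibSlice_onFib, LinearMap.smul_apply, map_smul]

theorem onFib_sum {α : Type*} (s : Finset α) (T : α → Cliff ι →ₗ[ℂ] Cliff ι') (x : Fib ι κ) :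
    onFib (∑ a ∈ s, T a) x = ∑ a ∈ s, onFib (T a) x :=
  fib_ext fun s => by simp only [fibSlice_onFib, LinearMap.sum_apply, map_sum]

variable [Fintype κ]

theorem inner_fib (x y : Fib ι κ) :
    inner ℂ x y = ∑ s, cliffInner (fibSlice s x) (fibSlice s y) := by
  rw [PiLp.inner_apply, Fintype.sum_prod_type_right]
  refine Finset.sum_congr rfl fun s _ => Finset.sum_congr rfl fun S _ => ?_
  rw [cliffCoord_fibSlice, cliffCoord_fibSlice, RCLike.inner_apply, mul_comm]

theorem inner_onFib_of_adjoint {T : Cliff ι →ₗ[ℂ] Cliff ι'} {T' : Cliff ι' →ₗ[ℂ] Cliff ι}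
    (h : ∀ x y, cliffInner (T x) y = cliffInner x (T' y)) (x : Fib ι κ) (y : Fib ι' κ) :
    inner ℂ (onFib T x) y = inner ℂ x (onFib T' y) := by
  simp only [inner_fib, fibSlice_onFib, h]

theorem inner_onFib_cliffMapLin (A : Matrix ι' ι ℝ) (hA : A.transpose * A = 1) (x y : Fib ι κ) :
    inner ℂ (onFib (cliffMapLin A) x) (onFib (cliffMapLin A) y) = inner ℂ x y := by
  simp only [inner_fib, fibSlice_onFib, cliffInner_cliffMapLin A hA]

theorem norm_onFib_cliffMapLin (A : Matrix ι' ι ℝ) (hA : A.transpose * A = 1) (x : Fib ι κ) :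
    ‖onFib (cliffMapLin A) x‖ = ‖x‖ := by
  rw [@norm_eq_sqrt_re_inner ℂ, @norm_eq_sqrt_re_inner ℂ, inner_onFib_cliffMapLin A hA]

/-! ### Dependence of `Cl(A)` on `A` -/

theorem cliffCoord_ι_mul (T : Finset ι) (v : ι → ℂ) (y : Cliff ι) :
    cliffCoord T (CliffordAlgebra.ι (cliffForm ι) v * y) =
      ∑ j, ∑ U, v j * cliffCoord U y * cliffCoord T (cliffGen j * cliffProd U) := by
  conv_lhs => rw [vec_eq_sum_single v, ← cliff_sum_coord y]
  simp only [map_sum, map_smul, Finset.sum_mul, Finset.mul_sum, smul_mul_assoc, mul_smul_comm,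
    smul_eq_mul]
  rw [Finset.sum_comm]
  refine Finset.sum_congr rfl fun j _ => Finset.sum_congr rfl fun U _ => ?_
  rw [cliffGen]
  ring

theorem contDiff_cliffCoord_list_prod (T : Finset ι') (l : List ι) :
    ContDiff ℝ ∞ fun A : ι' → ι → ℝ => cliffCoord T
      ((l.map fun i => CliffordAlgebra.ι (cliffForm ι') (colVec (Matrix.of A) i)).prod) := by
  induction l generalizing T with
  | nil => exact contDiff_const (c := cliffCoord T (1 : Cliff ι'))
  | cons i l ih =>
    simp only [List.map_cons, List.prod_cons, cliffCoord_ι_mul]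
    refine ContDiff.sum fun j _ => ContDiff.sum fun U _ => ?_
    refine (ContDiff.mul ?_ (ih U)).mul contDiff_const
    have : ContDiff ℝ ∞ fun A : ι' → ι → ℝ => A j i := by fun_prop
    exact Complex.ofRealCLM.contDiff.comp this

/-- The matrix entries of `Cl(A)` are smooth functions of `A`. -/
theorem contDiff_cliffCoord_cliffMapLin (T : Finset ι') (S : Finset ι) :
    ContDiff ℝ ∞ fun A : ι' → ι → ℝ => cliffCoord T (cliffMapLin (Matrix.of A) (cliffProd S)) := by
  simp only [cliffMapLin_cliffProd]
  exact contDiff_cliffCoord_list_prod T _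

theorem ContDiffAt.onFib_cliffMapLin {E : Type*} [NormedAddCommGroup E] [NormedSpace ℝ E]
    {A : E → Matrix ι' ι ℝ} {u : E → Fib ι κ} {x : E}
    (hA : ∀ j i, ContDiffAt ℝ ∞ (fun x => A x j i) x) (hu : ContDiffAt ℝ ∞ u x) :
    ContDiffAt ℝ ∞ (fun x => onFib (cliffMapLin (A x)) (u x)) x := by
  rw [contDiffAt_piLp 2]
  rintro ⟨T, s⟩
  simp only [onFib_apply_sum]
  refine ContDiffAt.sum fun S _ => ((contDiffAt_piLp 2).1 hu (S, s)).mul ?_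
  have hA' : ContDiffAt ℝ ∞ (fun x => (fun j i => A x j i : ι' → ι → ℝ)) x :=
    contDiffAt_pi.2 fun j => contDiffAt_pi.2 fun i => hA j i
  exact (contDiff_cliffCoord_cliffMapLin T S).contDiffAt.comp x hA'

theorem Continuous.onFib_cliffMapLin {E : Type*} [TopologicalSpace E]
    {A : E → Matrix ι' ι ℝ} {u : E → Fib ι κ}
    (hA : ∀ j i, Continuous fun x => A x j i) (hu : Continuous u) :
    Continuous fun x => onFib (cliffMapLin (A x)) (u x) := by
  refine (PiLp.continuous_toLp 2 _).comp (continuous_pi ?_)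
  rintro ⟨T, s⟩
  change Continuous fun x => onFib (cliffMapLin (A x)) (u x) (T, s)
  simp only [onFib_apply_sum]
  refine continuous_finsetSum _ fun S _ => ?_
  refine Continuous.mul (by fun_prop) ?_
  have hA' : Continuous (fun x => (fun j i => A x j i : ι' → ι → ℝ)) :=
    continuous_pi fun j => continuous_pi fun i => hA j i
  exact (contDiff_cliffCoord_cliffMapLin T S).continuous.comp hA'

theorem hasDerivAt_euclideanSpace {α : Type*} [Fintype α] {f : ℝ → EuclideanSpace ℂ α}
    {f' : EuclideanSpace ℂ α} {t : ℝ} :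
    HasDerivAt f f' t ↔ ∀ p, HasDerivAt (fun t => f t p) (f' p) t := by
  have h := hasDerivAt_pi (𝕜 := ℝ) (φ := fun t p => f t p) (φ' := fun p => f' p) (x := t)
  rw [← h]
  exact ⟨fun h => (PiLp.continuousLinearEquiv 2 ℝ
      (fun _ : α => ℂ)).toContinuousLinearMap.hasFDerivAt.comp_hasDerivAt t h,
    fun h => (PiLp.continuousLinearEquiv 2 ℝ
      (fun _ : α => ℂ)).symm.toContinuousLinearMap.hasFDerivAt.comp_hasDerivAt t h⟩

theorem hasDerivAt_cliffCoord_list_prod {A : ℝ → Matrix ι' ι ℝ} {A' : Matrix ι' ι ℝ} {t : ℝ}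
    (hA : ∀ j i, HasDerivAt (fun t => A t j i) (A' j i) t) (T : Finset ι') (l : List ι) :
    HasDerivAt (fun t => cliffCoord T
      ((l.map fun i => CliffordAlgebra.ι (cliffForm ι') (colVec (A t) i)).prod))
      (cliffCoord T (cliffTwistList (A t) A' l)) t := by
  induction l generalizing T with
  | nil => simpa [cliffTwistList] using hasDerivAt_const t _
  | cons i l ih =>
    simp only [List.map_cons, List.prod_cons, cliffTwistList, map_add]
    simp only [cliffCoord_ι_mul]
    simp only [← Finset.sum_add_distrib, ← add_mul]
    refine HasDerivAt.fun_sum fun j _ => HasDerivAt.fun_sum fun U _ => ?_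
    exact (HasDerivAt.fun_mul (hA j i).ofReal_comp (ih U)).mul_const _

theorem HasDerivAt.onFib_cliffMapLin {A : ℝ → Matrix ι' ι ℝ} {A' : Matrix ι' ι ℝ} {t : ℝ}
    {u : ℝ → Fib ι κ} {u' : Fib ι κ} (hA : ∀ j i, HasDerivAt (fun t => A t j i) (A' j i) t)
    (hu : HasDerivAt u u' t) :
    HasDerivAt (fun t => onFib (cliffMapLin (A t)) (u t))
      (onFib (cliffTwist (A t) A') (u t) + onFib (cliffMapLin (A t)) u') t := by
  rw [hasDerivAt_euclideanSpace]
  rintro ⟨T, s⟩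
  rw [PiLp.add_apply]
  simp only [onFib_apply_sum]
  rw [← Finset.sum_add_distrib]
  refine HasDerivAt.fun_sum fun S _ => ?_
  simp only [cliffMapLin_cliffProd, cliffTwist_cliffProd]
  rw [add_comm]
  exact HasDerivAt.fun_mul (hasDerivAt_euclideanSpace.1 hu (S, s))
    (hasDerivAt_cliffCoord_list_prod hA T _)

end CliffordMaps

/-! ### Calculus along `Gⁿ` -/

section LieCalculus

variable {A : Type*} [NormedRing A] [NormedAlgebra ℝ A] {G : Type*} [Group G] {ρ : G →* A}

/-- The image of a group element as a unit of the algebra of operators. -/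
def repUnit (ρ : G →* A) (h : G) : Aˣ :=
  ⟨ρ h, ρ h⁻¹, by rw [← map_mul]; simp, by rw [← map_mul]; simp⟩

theorem ringInverse_rep (h : G) : Ring.inverse (ρ h) = ρ h⁻¹ :=
  Ring.inverse_unit (repUnit ρ h)

theorem rep_inv_mul_rep (h : G) : ρ h⁻¹ * ρ h = 1 := by rw [← map_mul]; simp

theorem rep_mul_rep_inv (h : G) : ρ h * ρ h⁻¹ = 1 := by rw [← map_mul]; simp

variable [FiniteDimensional ℝ A] {n m : ℕ}

theorem contDiffAt_ringInverse_rep (h : G) : ContDiffAt ℝ ∞ (Ring.inverse : A → A) (ρ h) := by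
  have : CompleteSpace A := FiniteDimensional.complete ℝ A
  exact contDiffAt_ringInverse ℝ (repUnit ρ h)

theorem hasDerivAt_rep_inv {γ : ℝ → G} {X : A} (hγ : γ 0 = 1)
    (hX : HasDerivAt (fun t => ρ (γ t)) X 0) : HasDerivAt (fun t => ρ (γ t)⁻¹) (-X) 0 := by
  have : CompleteSpace A := FiniteDimensional.complete ℝ A
  have h1 := hasFDerivAt_ringInverse (𝕜 := ℝ) (1 : Aˣ)
  have h2 : ((1 : Aˣ) : A) = ρ (γ 0) := by simp [hγ]
  rw [h2] at h1
  have h3 := h1.comp_hasDerivAt (0 : ℝ) hX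
  have e2 : (fun t => ρ (γ t)⁻¹) = Ring.inverse ∘ fun t => ρ (γ t) :=
    funext fun t => (ringInverse_rep _).symm
  rw [e2]
  simpa using h3

variable {B : BiinvariantMetric ρ} {d : ℕ} (e : OrthonormalFrame B d)

namespace OrthonormalFrame

/-- The curve in `G` along which `frameDeriv` differentiates in the direction `e_l`. -/
noncomputable def curve (l : Fin d) : ℝ → G := (e.basis l).2.choose

theorem curve_zero (l : Fin d) : e.curve l 0 = 1 := (e.basis l).2.choose_spec.1

theorem hasDerivAt_curve (l : Fin d) : HasDerivAt (fun t => ρ (e.curve l t)) (e.basis l : A) 0 :=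
  (e.basis l).2.choose_spec.2

/-- The point of `Gⁿ` reached from `g` at time `t` along the curve used for `e_a`. -/
noncomputable def move (a : Idx n d) (g : Fin n → G) (t : ℝ) : Fin n → G :=
  Function.update g (ofLex a).1 (g (ofLex a).1 * e.curve (ofLex a).2 t)

theorem move_zero (a : Idx n d) (g : Fin n → G) : e.move a g 0 = g := by
  simp [move, curve_zero]

theorem frameDeriv_def {W : Type*} [NormedAddCommGroup W] [NormedSpace ℝ W]
    (ξ : (Fin n → G) → W) (a : Idx n d) (g : Fin n → G) :
    e.frameDeriv ξ a g = deriv (fun t => ξ (e.move a g t)) 0 := rfl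

theorem toOps_move (a : Idx n d) (g : Fin n → G) (t : ℝ) :
    toOps ρ (e.move a g t) = Function.update (toOps ρ g) (ofLex a).1
      (ρ (g (ofLex a).1) * ρ (e.curve (ofLex a).2 t)) := by
  funext i
  by_cases h : i = (ofLex a).1
  · subst h; simp [toOps, move]
  · simp [toOps, move, h]

theorem hasDerivAt_toOps_move (a : Idx n d) (g : Fin n → G) :
    HasDerivAt (fun t => toOps ρ (e.move a g t)) (e.frameField a g) 0 := by
  rw [hasDerivAt_pi]
  intro i
  simp only [toOps_move, frameField]
  by_cases h : i = (ofLex a).1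
  · subst h
    simpa using (e.hasDerivAt_curve (ofLex a).2).const_mul (ρ (g (ofLex a).1))
  · simpa [h] using hasDerivAt_const (0 : ℝ) (toOps ρ g i)

/-- The vector field `e_a`, extended to a linear vector field on the space of tuples of
operators. -/
noncomputable def linField (a : Idx n d) : (Fin n → A) →L[ℝ] (Fin n → A) :=
  (ContinuousLinearMap.single ℝ (fun _ : Fin n => A) (ofLex a).1) ∘L
    ((ContinuousLinearMap.mul ℝ A).flip (e.basis (ofLex a).2 : A)) ∘L
      ContinuousLinearMap.proj (ofLex a).1

theorem linField_apply (a : Idx n d) (x : Fin n → A) :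
    e.linField a x = Pi.single (ofLex a).1 (x (ofLex a).1 * (e.basis (ofLex a).2 : A)) := rfl

theorem linField_toOps (a : Idx n d) (g : Fin n → G) :
    e.linField a (toOps ρ g) = e.frameField a g := rfl

section

variable {W : Type*} [NormedAddCommGroup W] [NormedSpace ℝ W]

theorem hasDerivAt_move {F : (Fin n → A) → W} {g : Fin n → G}
    (hF : DifferentiableAt ℝ F (toOps ρ g)) (a : Idx n d) :
    HasDerivAt (fun t => F (toOps ρ (e.move a g t)))
      (fderiv ℝ F (toOps ρ g) (e.frameField a g)) 0 := by
  have h1 : HasFDerivAt F (fderiv ℝ F (toOps ρ g)) (toOps ρ (e.move a g 0)) := by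
    rw [move_zero]; exact hF.hasFDerivAt
  exact h1.comp_hasDerivAt (0 : ℝ) (e.hasDerivAt_toOps_move a g)

theorem frameDeriv_eq_fderiv {F : (Fin n → A) → W} {ξ : (Fin n → G) → W}
    (hξ : ∀ g, ξ g = F (toOps ρ g)) {g : Fin n → G} (hF : DifferentiableAt ℝ F (toOps ρ g))
    (a : Idx n d) : e.frameDeriv ξ a g = fderiv ℝ F (toOps ρ g) (e.linField a (toOps ρ g)) := by
  rw [frameDeriv_def]
  simp only [hξ]
  exact (e.hasDerivAt_move hF a).deriv

theorem _root_.SmoothAlong.differentiableAt {F : (Fin n → A) → W} (hF : SmoothAlong ρ F)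
    (g : Fin n → G) : DifferentiableAt ℝ F (toOps ρ g) :=
  (hF g).differentiableAt (by simp)

theorem _root_.SmoothAlong.fderiv_linField {F : (Fin n → A) → W} (hF : SmoothAlong ρ F)
    (a : Idx n d) : SmoothAlong ρ fun x => fderiv ℝ F x (e.linField a x) := fun g =>
  ((hF g).fderiv_right (m := ∞) (by simp)).clm_apply (e.linField a).contDiff.contDiffAt

end

section

variable {W : Type*} [NormedAddCommGroup W] [NormedSpace ℂ W]

theorem hasDerivAt_frameDeriv {ξ : (Fin n → G) → W} (hξ : ξ ∈ smoothFun n W ρ) (a : Idx n d)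
    (g : Fin n → G) : HasDerivAt (fun t => ξ (e.move a g t)) (e.frameDeriv ξ a g) 0 := by
  obtain ⟨F, hF, hξF⟩ := hξ
  have h := e.hasDerivAt_move (hF.differentiableAt g) a
  rw [e.frameDeriv_eq_fderiv hξF (hF.differentiableAt g)]
  simp only [hξF]
  exact h

theorem frameDeriv_mem {ξ : (Fin n → G) → W} (hξ : ξ ∈ smoothFun n W ρ) (a : Idx n d) :
    e.frameDeriv ξ a ∈ smoothFun n W ρ := by
  obtain ⟨F, hF, hξF⟩ := hξ
  exact ⟨_, hF.fderiv_linField e a, fun g =>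
    e.frameDeriv_eq_fderiv hξF (hF.differentiableAt g) a⟩

theorem frameDeriv_add {ξ η : (Fin n → G) → W} (hξ : ξ ∈ smoothFun n W ρ)
    (hη : η ∈ smoothFun n W ρ) (a : Idx n d) (g : Fin n → G) :
    e.frameDeriv (ξ + η) a g = e.frameDeriv ξ a g + e.frameDeriv η a g :=
  ((e.hasDerivAt_frameDeriv hξ a g).add (e.hasDerivAt_frameDeriv hη a g)).deriv

theorem frameDeriv_smul {ξ : (Fin n → G) → W} (hξ : ξ ∈ smoothFun n W ρ) (c : ℂ)
    (a : Idx n d) (g : Fin n → G) : e.frameDeriv (c • ξ) a g = c • e.frameDeriv ξ a g :=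
  ((e.hasDerivAt_frameDeriv hξ a g).const_smul c).deriv

end

end OrthonormalFrame

theorem smoothFun_comp_clm {W W' : Type*} [NormedAddCommGroup W] [NormedSpace ℂ W]
    [NormedAddCommGroup W'] [NormedSpace ℂ W'] (T : W →L[ℂ] W') {ξ : (Fin n → G) → W}
    (hξ : ξ ∈ smoothFun n W ρ) : (fun g => T (ξ g)) ∈ smoothFun n W' ρ := by
  obtain ⟨F, hF, hξF⟩ := hξ
  exact ⟨fun x => T (F x), fun g => (T.restrictScalars ℝ).contDiff.contDiffAt.comp _ (hF g),
    fun g => congrArg T (hξF g)⟩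

theorem OrthonormalFrame.frameDeriv_comp_clm {W W' : Type*} [NormedAddCommGroup W]
    [NormedSpace ℂ W] [NormedAddCommGroup W'] [NormedSpace ℂ W'] (T : W →L[ℂ] W')
    {ξ : (Fin n → G) → W} (hξ : ξ ∈ smoothFun n W ρ) (a : Idx n d) (g : Fin n → G) :
    e.frameDeriv (fun g => T (ξ g)) a g = T (e.frameDeriv ξ a g) :=
  ((T.restrictScalars ℝ).hasFDerivAt.comp_hasDerivAt (0 : ℝ)
    (e.hasDerivAt_frameDeriv hξ a g)).deriv

theorem smoothFun_continuous [TopologicalSpace G] {W : Type*} [NormedAddCommGroup W]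
    [NormedSpace ℂ W] (hρ : Continuous ρ) {ξ : (Fin n → G) → W} (hξ : ξ ∈ smoothFun n W ρ) :
    Continuous ξ := by
  obtain ⟨F, hF, hξF⟩ := hξ
  have hc : Continuous (toOps (n := n) ρ) :=
    continuous_pi fun i => hρ.comp (continuous_apply i)
  have : ξ = F ∘ toOps ρ := funext hξF
  rw [this, continuous_iff_continuousAt]
  exact fun g => (hF g).continuousAt.comp hc.continuousAt

/-! ### Coordinates of the Lie algebra -/

namespace OrthonormalFrame

/-- A linear functional on the algebra of operators that extends the `l`-th coordinate of the
Lie algebra. -/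
noncomputable def coordExt (l : Fin d) : A →L[ℝ] ℝ :=
  LinearMap.toContinuousLinearMap (LinearMap.exists_extend (e.basis.coord l)).choose

theorem coordExt_coe (l : Fin d) (X : lieAlg ρ) : e.coordExt l X = e.basis.repr X l :=
  LinearMap.congr_fun (LinearMap.exists_extend (e.basis.coord l)).choose_spec X

theorem adMatrix_apply (h : G) (i j : Fin d) :
    e.adMatrix h i j = e.coordExt i (ρ h * (e.basis j : A) * ρ h⁻¹) :=
  (e.coordExt_coe i (lieAd ρ h (e.basis j))).symm

/-- The structure constants of the Lie algebra. -/
noncomputable def lieStruct (i j k : Fin d) : ℝ := e.basis.repr (lieBr (e.basis i) (e.basis j)) k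

theorem hasDerivAt_coordExt_conj (l i : Fin d) (Y : A) :
    HasDerivAt (fun t => e.coordExt i (ρ (e.curve l t) * Y * ρ (e.curve l t)⁻¹))
      (e.coordExt i ((e.basis l : A) * Y - Y * e.basis l)) 0 := by
  have h1 := ((e.hasDerivAt_curve l).mul_const Y).fun_mul
    (hasDerivAt_rep_inv (e.curve_zero l) (e.hasDerivAt_curve l))
  have h2 := (e.coordExt i).hasFDerivAt.comp_hasDerivAt (0 : ℝ) h1
  have h3 : (e.basis l : A) * Y * ρ (e.curve l 0)⁻¹ + ρ (e.curve l 0) * Y * -(e.basis l : A)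
      = (e.basis l : A) * Y - Y * e.basis l := by
    simp [e.curve_zero, sub_eq_add_neg]
  rw [h3] at h2
  exact h2

theorem hasDerivAt_adMatrix_curve (l i j : Fin d) :
    HasDerivAt (fun t => e.adMatrix (e.curve l t) i j) (e.lieStruct l j i) 0 := by
  simp only [adMatrix_apply]
  have := e.hasDerivAt_coordExt_conj l i (e.basis j : A)
  rwa [show (e.basis l : A) * e.basis j - e.basis j * e.basis l
    = (lieBr (e.basis l) (e.basis j) : lieAlg ρ) from rfl, coordExt_coe] at this

theorem adMatrix_one : e.adMatrix 1 = 1 := by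
  ext i j
  rw [adMatrix_apply]
  simp only [map_one, inv_one, one_mul, mul_one, coordExt_coe, Module.Basis.repr_self,
    Finsupp.single_apply, Matrix.one_apply]
  simp [eq_comm]

/-- The invariance of the metric makes `ad` skew-symmetric. -/
theorem lieStruct_skew (i j k : Fin d) : e.lieStruct i j k = - e.lieStruct i k j := by
  -- differentiate the orthogonality relation for `Ad` along a curve with velocity `e_i`
  have h1 : ∀ t, ∑ c, e.adMatrix (e.curve i t) c j * e.adMatrix (e.curve i t) c k
      = (1 : Matrix (Fin d) (Fin d) ℝ) j k := by
    intro t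
    have := congrFun (congrFun (e.adMatrix_orthogonal (e.curve i t)) j) k
    rwa [Matrix.mul_apply] at this
  have h2 : HasDerivAt (fun t => ∑ c, e.adMatrix (e.curve i t) c j * e.adMatrix (e.curve i t) c k)
      (∑ c, (e.lieStruct i j c * e.adMatrix (e.curve i 0) c k
        + e.adMatrix (e.curve i 0) c j * e.lieStruct i k c)) 0 :=
    HasDerivAt.fun_sum fun c _ =>
      (e.hasDerivAt_adMatrix_curve i c j).fun_mul (e.hasDerivAt_adMatrix_curve i c k)
  simp only [h1] at h2
  have h3 := h2.unique (hasDerivAt_const _ _)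
  simp only [curve_zero, adMatrix_one, Matrix.one_apply, mul_ite, mul_one, mul_zero, ite_mul,
    one_mul, zero_mul, Finset.sum_add_distrib, Finset.sum_ite_eq', Finset.mem_univ, if_true] at h3
  linarith

theorem structConst_eq (a b c : Idx n d) : e.structConst a b c =
    if (ofLex a).1 = (ofLex b).1 ∧ (ofLex b).1 = (ofLex c).1 then
      e.lieStruct (ofLex a).2 (ofLex b).2 (ofLex c).2 else 0 := rfl

theorem structConst_skew' (a b c : Idx n d) : e.structConst a b c = - e.structConst a c b := by
  rw [structConst_eq, structConst_eq]
  by_cases h : (ofLex a).1 = (ofLex b).1 ∧ (ofLex b).1 = (ofLex c).1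
  · rw [if_pos h, if_pos ⟨h.1.trans h.2, h.2.symm⟩, lieStruct_skew]
  · rw [if_neg h, if_neg fun h' => h ⟨h'.1.trans h'.2, h'.2.symm⟩, neg_zero]

/-- For a biinvariant metric, the Levi-Civita connection is `½ ad`. -/
theorem leviCivita_eq (a c b : Idx n d) : e.leviCivita a c b = e.structConst a b c / 2 := by
  simp only [leviCivita, Matrix.of_apply]
  rw [e.structConst_skew' b c a, e.structConst_skew b a c, e.structConst_skew c a b,
    e.structConst_skew' a c b]
  ring

theorem leviCivita_skew (a : Idx n d) (i j : Idx n d) :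
    e.leviCivita a i j = - e.leviCivita a j i := by
  linarith [e.leviCivita_metric a i j]

theorem leviCivita_self (a c : Idx n d) : e.leviCivita a c a = 0 := by
  have := e.structConst_skew a a c
  rw [leviCivita_eq]
  linarith

/-! ### The Euler-Dirac operator on smooth sections -/

variable {κ : Type*} [Fintype κ]

theorem frameDeriv_onFib {ι : Type*} [Fintype ι] [LinearOrder ι]
    (T : Cliff (Idx n d) →ₗ[ℂ] Cliff ι)
    {ξ : (Fin n → G) → Fib (Idx n d) κ} (hξ : ξ ∈ smoothFun n (Fib (Idx n d) κ) ρ) (a : Idx n d)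
    (g : Fin n → G) : e.frameDeriv (fun g => onFib T (ξ g)) a g = onFib T (e.frameDeriv ξ a g) :=
  e.frameDeriv_comp_clm (LinearMap.toContinuousLinearMap (onFib T)) hξ a g

theorem smoothFun_onFib {ι ι' : Type*} [Fintype ι] [LinearOrder ι] [Fintype ι'] [LinearOrder ι']
    (T : Cliff ι →ₗ[ℂ] Cliff ι')
    {ξ : (Fin n → G) → Fib ι κ} (hξ : ξ ∈ smoothFun n (Fib ι κ) ρ) :
    (fun g => onFib T (ξ g)) ∈ smoothFun n (Fib ι' κ) ρ :=
  smoothFun_comp_clm (LinearMap.toContinuousLinearMap (onFib T)) hξ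

theorem covDeriv_mem {ξ : (Fin n → G) → Fib (Idx n d) κ}
    (hξ : ξ ∈ smoothFun n (Fib (Idx n d) κ) ρ) (a : Idx n d) :
    e.covDeriv ξ a ∈ smoothFun n (Fib (Idx n d) κ) ρ :=
  add_mem (e.frameDeriv_mem hξ a) (smoothFun_onFib _ hξ)

theorem covDeriv_add {ξ η : (Fin n → G) → Fib (Idx n d) κ}
    (hξ : ξ ∈ smoothFun n (Fib (Idx n d) κ) ρ) (hη : η ∈ smoothFun n (Fib (Idx n d) κ) ρ)
    (a : Idx n d) (g : Fin n → G) :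
    e.covDeriv (ξ + η) a g = e.covDeriv ξ a g + e.covDeriv η a g := by
  have := e.frameDeriv_add hξ hη a g
  simp only [covDeriv, Pi.add_apply, map_add]
  rw [this]; abel

theorem covDeriv_smul {ξ : (Fin n → G) → Fib (Idx n d) κ}
    (hξ : ξ ∈ smoothFun n (Fib (Idx n d) κ) ρ) (c : ℂ) (a : Idx n d) (g : Fin n → G) :
    e.covDeriv (c • ξ) a g = c • e.covDeriv ξ a g := by
  have := e.frameDeriv_smul hξ c a g
  simp only [covDeriv, Pi.smul_apply, map_smul, smul_add]
  rw [this]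

/-- The operator `ξ ↦ ∑_a T_a ∇_{e_a} ξ` on smooth sections, for constant endomorphisms `T_a` of
the Clifford algebra. -/
noncomputable def symbolOp (T : Idx n d → Cliff (Idx n d) →ₗ[ℂ] Cliff (Idx n d)) :
    smoothFun n (Fib (Idx n d) κ) ρ →ₗ[ℂ] smoothFun n (Fib (Idx n d) κ) ρ where
  toFun ξ := ⟨∑ a, fun g => onFib (T a) (e.covDeriv ξ.1 a g),
    sum_mem fun a _ => smoothFun_onFib (T a) (e.covDeriv_mem ξ.2 a)⟩
  map_add' ξ η := by
    ext1
    funext g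
    simp [e.covDeriv_add ξ.2 η.2, Finset.sum_add_distrib]
  map_smul' c ξ := by
    ext1
    funext g
    simp [e.covDeriv_smul ξ.2, Finset.smul_sum]

theorem symbolOp_apply (T : Idx n d → Cliff (Idx n d) →ₗ[ℂ] Cliff (Idx n d))
    (ξ : smoothFun n (Fib (Idx n d) κ) ρ) (g : Fin n → G) :
    (e.symbolOp T ξ : (Fin n → G) → Fib (Idx n d) κ) g =
      ∑ a, onFib (T a) (e.covDeriv ξ.1 a g) := by
  simp [symbolOp]

/-- The exterior derivative `d = ∑_a e_a ∧ ∇_{e_a}` on smooth sections. -/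
noncomputable def extD : smoothFun n (Fib (Idx n d) κ) ρ →ₗ[ℂ] smoothFun n (Fib (Idx n d) κ) ρ :=
  e.symbolOp fun a => extMul (Pi.single a 1)

/-- The codifferential `d^* = -∑_a e_a ⌟ ∇_{e_a}` on smooth sections. -/
noncomputable def extDAdj :
    smoothFun n (Fib (Idx n d) κ) ρ →ₗ[ℂ] smoothFun n (Fib (Idx n d) κ) ρ :=
  e.symbolOp fun a => -intMul (Pi.single a 1)

theorem eulerDirac_eq (ξ : smoothFun n (Fib (Idx n d) κ) ρ) :
    e.eulerDirac (ξ : (Fin n → G) → Fib (Idx n d) κ) =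
      ((e.extD ξ + e.extDAdj ξ : smoothFun n (Fib (Idx n d) κ) ρ) :
        (Fin n → G) → Fib (Idx n d) κ) := by
  funext g
  simp only [eulerDirac, Submodule.coe_add, Pi.add_apply, extD, extDAdj, symbolOp_apply]
  rw [← Finset.sum_add_distrib]
  refine Finset.sum_congr rfl fun a _ => ?_
  rw [← onFib_add]
  congr 1
  congr 1
  ext x
  simp [extMul_apply, cliffGen]

end OrthonormalFrame

end LieCalculus

/-! ### Integration over `Gⁿ` -/

section HaarIntegration

variable {G : Type*} [Group G] [TopologicalSpace G] [IsTopologicalGroup G] [CompactSpace G]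
  [MeasurableSpace G] [BorelSpace G] (μ : Measure G) [μ.IsHaarMeasure] [IsProbabilityMeasure μ]

/-- A compact group is unimodular. -/
theorem isMulRightInvariant_of_compactSpace : μ.IsMulRightInvariant where
  map_mul_right_eq_self g := by
    have : IsProbabilityMeasure (μ.map (· * g)) :=
      Measure.isProbabilityMeasure_map (measurable_mul_const g).aemeasurable
    have : (μ.map (· * g)).IsHaarMeasure := by infer_instance
    exact Measure.isHaarMeasure_eq_of_isProbabilityMeasure _ _

theorem isInvInvariant_of_compactSpace : μ.IsInvInvariant where
  inv_eq_self := by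
    have : IsProbabilityMeasure μ.inv :=
      Measure.isProbabilityMeasure_map measurable_inv.aemeasurable
    have := isMulRightInvariant_of_compactSpace μ
    have : μ.inv.IsMulLeftInvariant := inferInstance
    have : μ.inv.IsHaarMeasure :=
      Measure.isHaarMeasure_of_isCompact_nonempty_interior μ.inv Set.univ isCompact_univ (by simp)
        (by simp) (by simp)
    exact Measure.isHaarMeasure_eq_of_isProbabilityMeasure _ _

variable {n : ℕ}

theorem measurePreserving_update_mul (k : Fin n) (h : G) :
    MeasurePreserving (fun g : Fin n → G => Function.update g k (g k * h))
      (Measure.pi fun _ => μ) (Measure.pi fun _ => μ) := by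
  have := isMulRightInvariant_of_compactSpace μ
  have h1 := measurePreserving_pi (fun _ : Fin n => μ) (fun _ => μ)
    (f := fun i => if i = k then (· * h) else id) (fun i => by
      split_ifs
      · exact measurePreserving_mul_right μ h
      · exact MeasurePreserving.id μ)
  convert h1 using 2 with g
  funext i
  by_cases hi : i = k
  · subst hi; simp
  · simp [hi]

variable [SecondCountableTopology G]

theorem integrable_of_continuous {W : Type*} [NormedAddCommGroup W] {f : (Fin n → G) → W}
    (hf : Continuous f) : Integrable f (Measure.pi fun _ => μ) := by
  have : OpensMeasurableSpace (Fin n → G) := inferInstance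
  exact hf.integrable_of_hasCompactSupport (HasCompactSupport.of_compactSpace f)

end HaarIntegration

section Adjoint

variable {A : Type*} [NormedRing A] [NormedAlgebra ℝ A] {G : Type*} [Group G] {ρ : G →* A}
  [FiniteDimensional ℝ A] {n : ℕ} {B : BiinvariantMetric ρ} {d : ℕ} (e : OrthonormalFrame B d)
  [TopologicalSpace G] [IsTopologicalGroup G] [CompactSpace G] [SecondCountableTopology G]
  [MeasurableSpace G] [BorelSpace G] (μ : Measure G) [μ.IsHaarMeasure] [IsProbabilityMeasure μ]

theorem continuous_toOps (hρ : Continuous ρ) : Continuous (toOps (n := n) ρ) :=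
  continuous_pi fun i => hρ.comp (continuous_apply i)

/-- A function that is smooth along the compact set `Gⁿ` is Lipschitz on it. -/
theorem SmoothAlong.exists_lipschitz {W : Type*} [NormedAddCommGroup W] [NormedSpace ℝ W]
    (hρ : Continuous ρ) {F : (Fin n → A) → W} (hF : SmoothAlong ρ F) :
    ∃ C : NNReal, ∀ g g' : Fin n → G,
      ‖F (toOps ρ g) - F (toOps ρ g')‖ ≤ C * ‖toOps ρ g - toOps ρ g'‖ := by
  have hK : IsCompact (Set.range (toOps (n := n) ρ)) := isCompact_range (continuous_toOps hρ)
  obtain ⟨C, hC⟩ := LocallyLipschitzOn.exists_lipschitzOnWith_of_compact hK (f := F) (by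
    rintro _ ⟨g, rfl⟩
    obtain ⟨K, t, ht, hKt⟩ := ((hF g).of_le (m := 1) (by simp)).exists_lipschitzOnWith
    exact ⟨K, t, mem_nhdsWithin_of_mem_nhds ht, hKt⟩)
  exact ⟨C, fun g g' => by
    simpa [dist_eq_norm] using hC.dist_le_mul _ ⟨g, rfl⟩ _ ⟨g', rfl⟩⟩

/-- The curves `e.move a g` leave their starting points with a speed that is bounded uniformly in
`g`, as `ρ(G)` is bounded. -/
theorem OrthonormalFrame.norm_toOps_move_sub_le (hρ : Continuous ρ) (a : Idx n d) :
    ∃ C : ℝ, ∀ᶠ t in nhds (0 : ℝ), ∀ g : Fin n → G,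
      ‖toOps ρ (e.move a g t) - toOps ρ g‖ ≤ C * ‖t - 0‖ := by
  obtain ⟨K, hK⟩ := (isCompact_range hρ).isBounded.exists_norm_le
  obtain ⟨C, hC⟩ := (e.hasDerivAt_curve (ofLex a).2).differentiableAt.isBigO_sub.bound
  have hK0 : 0 ≤ K := (norm_nonneg _).trans (hK (ρ 1) ⟨1, rfl⟩)
  refine ⟨K * C, hC.mono fun t ht g => ?_⟩
  have h0 : 0 ≤ K * C * ‖t - 0‖ := by
    have := (norm_nonneg _).trans ht
    rw [mul_assoc]; positivity
  rw [pi_norm_le_iff_of_nonneg h0]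
  intro i
  rw [e.toOps_move]
  by_cases hi : i = (ofLex a).1
  · subst hi
    rw [Pi.sub_apply, Function.update_self]
    have h1 : ρ (g (ofLex a).1) * ρ (e.curve (ofLex a).2 t) - toOps ρ g (ofLex a).1
        = ρ (g (ofLex a).1) * (ρ (e.curve (ofLex a).2 t) - ρ (e.curve (ofLex a).2 0)) := by
      rw [e.curve_zero, map_one, mul_sub, mul_one]; rfl
    rw [h1, mul_assoc]
    exact (norm_mul_le _ _).trans (mul_le_mul (hK _ ⟨_, rfl⟩) ht (norm_nonneg _) hK0)
  · simpa [hi] using h0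

/-- Divergence theorem on `Gⁿ`: the derivative along a left invariant vector field, whose flow
consists of right translations, has integral zero. -/
theorem OrthonormalFrame.integral_frameDeriv (hρ : Continuous ρ) {f : (Fin n → G) → ℂ}
    (hf : f ∈ smoothFun n ℂ ρ) (a : Idx n d) :
    ∫ g, e.frameDeriv f a g ∂(Measure.pi fun _ => μ) = 0 := by
  have hfc := smoothFun_continuous hρ hf
  have hfd := smoothFun_continuous hρ (e.frameDeriv_mem hf a)
  have hmp := fun t => measurePreserving_update_mul (n := n) μ (ofLex a).1 (e.curve (ofLex a).2 t)
  have hcont : ∀ t, Continuous fun g : Fin n → G => e.move a g t := fun t =>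
    Continuous.update continuous_id _ ((continuous_apply _).mul continuous_const)
  -- translations preserve the measure, so the integral does not depend on `t`
  have hconst : ∀ t, ∫ g, f (e.move a g t) ∂(Measure.pi fun _ => μ)
      = ∫ g, f g ∂(Measure.pi fun _ => μ) := by
    intro t
    have h := integral_map (μ := Measure.pi fun _ : Fin n => μ) (hmp t).measurable.aemeasurable (f := f)
      (hfc.aestronglyMeasurable)
    rw [(hmp t).map_eq] at h
    exact h.symm
  obtain ⟨C', hC'⟩ := e.norm_toOps_move_sub_le (n := n) hρ a
  obtain ⟨F, hF, hfF⟩ := hf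
  obtain ⟨C, hC⟩ := hF.exists_lipschitz hρ
  -- differentiation under the integral sign, with the product of the Lipschitz constant of `f` and
  -- the bound on the speed as the dominating constant
  have key := hasFDerivAt_integral_of_dominated_loc_of_lip' (𝕜 := ℝ)
    (μ := Measure.pi fun _ : Fin n => μ) (F := fun t g => f (e.move a g t)) (x₀ := (0 : ℝ))
    (F' := fun g => ContinuousLinearMap.toSpanSingleton ℝ (e.frameDeriv f a g))
    (bound := fun _ => C * C') hC'
    (fun t _ => (hfc.comp (hcont t)).aestronglyMeasurable)
    (integrable_of_continuous μ (hfc.comp (hcont 0)))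
    (Continuous.aestronglyMeasurable
      ((ContinuousLinearMap.toSpanSingletonCLE (𝕜 := ℝ) (E := ℂ)).continuous.comp hfd))
    (Filter.Eventually.of_forall fun g t ht => by
      simp only [hfF]
      refine (hC _ _).trans ?_
      rw [mul_assoc, e.move_zero]
      exact mul_le_mul_of_nonneg_left (ht g) C.2)
    (integrable_const _)
    (Filter.Eventually.of_forall fun g =>
      (e.hasDerivAt_frameDeriv ⟨F, hF, hfF⟩ a g).hasFDerivAt)
  have h1 := key.2
  simp only [hconst] at h1
  have h2 := h1.unique (hasFDerivAt_const _ _)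
  have h3 := ContinuousLinearMap.integral_apply (integrable_of_continuous μ
    ((ContinuousLinearMap.toSpanSingletonCLE (𝕜 := ℝ) (E := ℂ)).continuous.comp hfd)) (1 : ℝ)
  simp only [Function.comp_def] at h3
  have h4 : ∀ g, (ContinuousLinearMap.toSpanSingletonCLE (𝕜 := ℝ) (E := ℂ))
      (e.frameDeriv f a g) = ContinuousLinearMap.toSpanSingleton ℝ (e.frameDeriv f a g) :=
    fun g => rfl
  simp only [h4, h2] at h3
  simpa using h3.symm

theorem smoothFun_inner {W : Type*} [NormedAddCommGroup W] [InnerProductSpace ℂ W]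
    {ξ η : (Fin n → G) → W} (hξ : ξ ∈ smoothFun n W ρ) (hη : η ∈ smoothFun n W ρ) :
    (fun g => inner ℂ (ξ g) (η g)) ∈ smoothFun n ℂ ρ := by
  obtain ⟨F, hF, hξF⟩ := hξ
  obtain ⟨F', hF', hηF⟩ := hη
  exact ⟨fun x => inner ℂ (F x) (F' x), fun g => ContDiffAt.inner ℂ (hF g) (hF' g),
    fun g => by simp only [hξF, hηF]⟩

theorem OrthonormalFrame.frameDeriv_inner {W : Type*} [NormedAddCommGroup W]
    [InnerProductSpace ℂ W] {ξ η : (Fin n → G) → W} (hξ : ξ ∈ smoothFun n W ρ)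
    (hη : η ∈ smoothFun n W ρ) (a : Idx n d) (g : Fin n → G) :
    e.frameDeriv (fun g => inner ℂ (ξ g) (η g)) a g =
      inner ℂ (ξ g) (e.frameDeriv η a g) + inner ℂ (e.frameDeriv ξ a g) (η g) := by
  have h := (e.hasDerivAt_frameDeriv hξ a g).inner ℂ (e.hasDerivAt_frameDeriv hη a g)
  rw [e.move_zero] at h
  exact h.deriv

variable {κ : Type*} [Fintype κ]

theorem inner_onFib_extMul {ι : Type*} [Fintype ι] [LinearOrder ι] (a : ι) (x y : Fib ι κ) :
    inner ℂ x (onFib (extMul (Pi.single a 1)) y) = inner ℂ (onFib (intMul (Pi.single a 1)) x) y := by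
  have h : ∀ x y : Cliff ι, cliffInner (extMul (Pi.single a 1) x) y
      = cliffInner x (intMul (Pi.single a 1) y) := fun x y => by
    have := cliffInner_extMul (Pi.single a 1) x y
    have e : (fun i => ((Pi.single a 1 : ι → ℝ) i : ℂ)) = Pi.single a 1 := by
      funext i
      by_cases hi : i = a
      · subst hi; simp
      · simp [hi]
    rwa [e] at this
  rw [← inner_conj_symm, inner_onFib_of_adjoint h, inner_conj_symm]

theorem inner_onFib_cliffDeriv {ι : Type*} [Fintype ι] [LinearOrder ι] {Z : Matrix ι ι ℝ}
    (hZ : ∀ i j, Z i j = -Z j i) (x y : Fib ι κ) :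
    inner ℂ (onFib (cliffDeriv Z) x) y = - inner ℂ x (onFib (cliffDeriv Z) y) := by
  simp only [inner_fib, fibSlice_onFib, cliffInner_cliffDeriv hZ, Finset.sum_neg_distrib]

/-- `∇_{e_a} e_a = 0`, hence `∇_{e_a}` commutes with the exterior product by `e_a`. -/
theorem OrthonormalFrame.cliffDeriv_leviCivita_extMul (a : Idx n d) (x : Cliff (Idx n d)) :
    cliffDeriv (e.leviCivita a) (extMul (Pi.single a 1) x) =
      extMul (Pi.single a 1) (cliffDeriv (e.leviCivita a) x) := by
  have h0 : colVec (e.leviCivita a) a = 0 := by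
    funext c
    simp [colVec, e.leviCivita_self]
  rw [cliffDeriv_eq_extDerivation (e.leviCivita_skew a), extDerivation_extMul, h0]
  simp

/-- Pointwise form of the adjointness of `e_a ∧ ∇_{e_a}` and `-e_a ⌟ ∇_{e_a}`: the two sides differ
by the derivative of a function along `e_a`. -/
theorem OrthonormalFrame.inner_ext_covDeriv {ξ η : (Fin n → G) → Fib (Idx n d) κ}
    (hξ : ξ ∈ smoothFun n (Fib (Idx n d) κ) ρ) (hη : η ∈ smoothFun n (Fib (Idx n d) κ) ρ)
    (a : Idx n d) (g : Fin n → G) :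
    inner ℂ (ξ g) (onFib (extMul (Pi.single a 1)) (e.covDeriv η a g)) =
      inner ℂ (onFib (-intMul (Pi.single a 1)) (e.covDeriv ξ a g)) (η g)
        + e.frameDeriv (fun g => inner ℂ (onFib (intMul (Pi.single a 1)) (ξ g)) (η g)) a g := by
  have hneg : ∀ x : Fib (Idx n d) κ, onFib (-intMul (Pi.single a 1)) x
      = - onFib (intMul (Pi.single a 1)) x := fun x =>
    fib_ext fun s => by simp only [fibSlice_onFib, LinearMap.neg_apply, map_neg]
  have hcomm : onFib (extMul (Pi.single a 1)) (onFib (cliffDeriv (e.leviCivita a)) (η g))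
      = onFib (cliffDeriv (e.leviCivita a)) (onFib (extMul (Pi.single a 1)) (η g)) :=
    fib_ext fun s => by simp only [fibSlice_onFib, e.cliffDeriv_leviCivita_extMul]
  rw [e.frameDeriv_inner (smoothFun_onFib _ hξ) hη, e.frameDeriv_onFib _ hξ, hneg,
    inner_neg_left]
  simp only [covDeriv, map_add, inner_add_right, inner_add_left]
  rw [hcomm, inner_onFib_extMul, ← inner_onFib_extMul, ← inner_onFib_extMul]
  have := inner_onFib_cliffDeriv (e.leviCivita_skew a) (ξ g) (onFib (extMul (Pi.single a 1)) (η g))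
  rw [← inner_onFib_extMul]
  rw [this]
  ring

/-- The codifferential is the formal adjoint of the exterior derivative. -/
theorem OrthonormalFrame.integral_inner_extDAdj (hρ : Continuous ρ)
    (ξ η : smoothFun n (Fib (Idx n d) κ) ρ) :
    ∫ g, inner ℂ ((e.extDAdj ξ : (Fin n → G) → Fib (Idx n d) κ) g)
        ((η : (Fin n → G) → Fib (Idx n d) κ) g) ∂(Measure.pi fun _ => μ) =
      ∫ g, inner ℂ ((ξ : (Fin n → G) → Fib (Idx n d) κ) g)
        ((e.extD η : (Fin n → G) → Fib (Idx n d) κ) g) ∂(Measure.pi fun _ => μ) := by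
  have hsm : ∀ a, (fun g => inner ℂ (onFib (intMul (Pi.single a 1)) (ξ.1 g)) (η.1 g))
      ∈ smoothFun n ℂ ρ := fun a => smoothFun_inner (smoothFun_onFib _ ξ.2) η.2
  have h1 : ∀ g, inner ℂ (ξ.1 g) ((e.extD η).1 g) = inner ℂ ((e.extDAdj ξ).1 g) (η.1 g) +
      ∑ a, e.frameDeriv (fun g => inner ℂ (onFib (intMul (Pi.single a 1)) (ξ.1 g)) (η.1 g)) a g := by
    intro g
    simp only [extD, extDAdj, symbolOp_apply, inner_sum, sum_inner]
    rw [← Finset.sum_add_distrib]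
    exact Finset.sum_congr rfl fun a _ => e.inner_ext_covDeriv ξ.2 η.2 a g
  simp only [h1]
  have hc : ∀ {f : (Fin n → G) → ℂ}, f ∈ smoothFun n ℂ ρ →
      Integrable f (Measure.pi fun _ => μ) := fun hf =>
    integrable_of_continuous μ (smoothFun_continuous hρ hf)
  rw [integral_add (hc (smoothFun_inner (e.extDAdj ξ).2 η.2))
    (integrable_finsetSum _ fun a _ => hc (e.frameDeriv_mem (hsm a) a)),
    integral_finsetSum _ fun a _ => hc (e.frameDeriv_mem (hsm a) a)]
  simp only [e.integral_frameDeriv μ hρ (hsm _) _, Finset.sum_const_zero, add_zero]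

/-- The Euler-Dirac operator is symmetric. -/
theorem OrthonormalFrame.integral_inner_eulerDirac (hρ : Continuous ρ)
    {ξ η : (Fin n → G) → Fib (Idx n d) κ} (hξ : ξ ∈ smoothFun n (Fib (Idx n d) κ) ρ)
    (hη : η ∈ smoothFun n (Fib (Idx n d) κ) ρ) :
    ∫ g, inner ℂ (e.eulerDirac ξ g) (η g) ∂(Measure.pi fun _ => μ) =
      ∫ g, inner ℂ (ξ g) (e.eulerDirac η g) ∂(Measure.pi fun _ => μ) := by
  have hc : ∀ {f f' : (Fin n → G) → Fib (Idx n d) κ}, f ∈ smoothFun n _ ρ → f' ∈ smoothFun n _ ρ →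
      Integrable (fun g => inner ℂ (f g) (f' g)) (Measure.pi fun _ => μ) := fun hf hf' =>
    integrable_of_continuous μ (smoothFun_continuous hρ (smoothFun_inner hf hf'))
  have h1 := e.eulerDirac_eq ⟨ξ, hξ⟩
  have h2 := e.eulerDirac_eq ⟨η, hη⟩
  simp only at h1 h2
  rw [h1, h2]
  simp only [Submodule.coe_add, Pi.add_apply, inner_add_left, inner_add_right]
  rw [integral_add (hc (Subtype.property _) hη) (hc (Subtype.property _) hη),
    integral_add (hc hξ (Subtype.property _)) (hc hξ (Subtype.property _)),
    e.integral_inner_extDAdj μ hρ ⟨ξ, hξ⟩ ⟨η, hη⟩]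
  have h3 := congrArg (starRingEnd ℂ) (e.integral_inner_extDAdj μ hρ ⟨η, hη⟩ ⟨ξ, hξ⟩)
  simp only [← integral_conj, inner_conj_symm] at h3
  rw [h3, add_comm]

end Adjoint

/-! ### Differential forms and the exterior derivative -/

section FormComponents

variable {ι : Type*} [Fintype ι] [LinearOrder ι] {κ : Type*}

theorem onFib_extMul_single_apply (b : ι) (x : Fib ι κ) (q : Finset ι) (s : κ) :
    onFib (extMul (Pi.single b 1)) x (q, s) =
      if b ∈ q then insertSign b (q.erase b) * x (q.erase b, s) else 0 := by
  rw [onFib_apply_sum]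
  split_ifs with hb
  · rw [Finset.sum_eq_single (q.erase b)]
    · rw [extMul_cliffProd_of_notMem (Finset.notMem_erase b q), map_smul, Finset.insert_erase hb,
        cliffCoord_cliffProd]
      simp [mul_comm]
    · intro U _ hU
      by_cases hbU : b ∈ U
      · simp [extMul_cliffProd_of_mem hbU]
      · rw [extMul_cliffProd_of_notMem hbU, map_smul, cliffCoord_cliffProd, if_neg, smul_zero,
          mul_zero]
        intro h
        exact hU (by rw [← h, Finset.erase_insert hbU])
    · simp
  · refine Finset.sum_eq_zero fun U _ => ?_
    by_cases hbU : b ∈ U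
    · simp [extMul_cliffProd_of_mem hbU]
    · rw [extMul_cliffProd_of_notMem hbU, map_smul, cliffCoord_cliffProd, if_neg, smul_zero,
        mul_zero]
      intro h
      exact hb (by rw [← h]; simp)

theorem onFib_intMul_single_apply (a : ι) (x : Fib ι κ) (q : Finset ι) (s : κ) :
    onFib (intMul (Pi.single a 1)) x (q, s) =
      if a ∈ q then 0 else insertSign a q * x (insert a q, s) := by
  rw [onFib_apply_sum]
  split_ifs with ha
  · refine Finset.sum_eq_zero fun U _ => ?_
    by_cases haU : a ∈ U
    · rw [intMul_cliffProd_of_mem haU, map_smul, cliffCoord_cliffProd, if_neg, smul_zero, mul_zero]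
      intro h
      exact Finset.notMem_erase a U (h ▸ ha)
    · simp [intMul_cliffProd_of_notMem haU]
  · rw [Finset.sum_eq_single (insert a q)]
    · rw [intMul_cliffProd_of_mem (Finset.mem_insert_self a q), map_smul,
        Finset.erase_insert ha, cliffCoord_cliffProd]
      simp [mul_comm, insertSign_insert]
    · intro U _ hU
      by_cases haU : a ∈ U
      · rw [intMul_cliffProd_of_mem haU, map_smul, cliffCoord_cliffProd, if_neg, smul_zero,
          mul_zero]
        intro h
        exact hU (by rw [← h, Finset.insert_erase haU])
      · simp [intMul_cliffProd_of_notMem haU]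
    · simp

theorem orderEmbOfFin_erase {q : Finset ι} {p : ℕ} (h : q.card = p + 1) (i : Fin (p + 1))
    (h' : (q.erase (q.orderEmbOfFin h i)).card = p) (j : Fin p) :
    (q.erase (q.orderEmbOfFin h i)).orderEmbOfFin h' j = q.orderEmbOfFin h (i.succAbove j) := by
  have := Finset.orderEmbOfFin_unique h' (f := fun j => q.orderEmbOfFin h (i.succAbove j))
    (fun j => Finset.mem_erase.2 ⟨fun he => Fin.succAbove_ne i j
      ((q.orderEmbOfFin h).injective he), Finset.orderEmbOfFin_mem q h _⟩)
    ((q.orderEmbOfFin h).strictMono.comp (Fin.strictMono_succAbove i))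
  exact (congrFun this j).symm

theorem card_erase_orderEmbOfFin {q : Finset ι} {p : ℕ} (h : q.card = p + 1) (i : Fin (p + 1)) :
    (q.erase (q.orderEmbOfFin h i)).card = p := by
  rw [Finset.card_erase_of_mem (Finset.orderEmbOfFin_mem q h i), h]; rfl

/-- The sign of moving `e_a` in front is the sign in the alternating sum that defines `d`, when `a` is
the `i`-th element of `q`. -/
theorem insertSign_orderEmbOfFin {q : Finset ι} {p : ℕ} (h : q.card = p + 1) (i : Fin (p + 1)) :
    insertSign (q.orderEmbOfFin h i) (q.erase (q.orderEmbOfFin h i)) = (-1) ^ (i : ℕ) := by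
  unfold insertSign
  congr 1
  have : (q.erase (q.orderEmbOfFin h i)).filter (· < q.orderEmbOfFin h i)
      = (Finset.Iio i).map (q.orderEmbOfFin h).toEmbedding := by
    ext x
    simp only [Finset.mem_filter, Finset.mem_erase, Finset.mem_map, Finset.mem_Iio]
    constructor
    · rintro ⟨⟨hx, hq⟩, hlt⟩
      obtain ⟨j, rfl⟩ : x ∈ Set.range (q.orderEmbOfFin h) := by simpa using hq
      exact ⟨j, by simpa using hlt, rfl⟩
    · rintro ⟨j, hj, rfl⟩
      have : q.orderEmbOfFin h j < q.orderEmbOfFin h i := by simpa using hj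
      exact ⟨⟨this.ne, Finset.orderEmbOfFin_mem q h _⟩, this⟩
  rw [this, Finset.card_map, Fin.card_Iio]

/-- The components of `∑_b e_b ∧ x_b` in degree `p + 1`. -/
theorem sum_onFib_extMul_apply (x : ι → Fib ι κ) {q : Finset ι} {p : ℕ} (h : q.card = p + 1)
    (s : κ) : (∑ b, onFib (extMul (Pi.single b 1)) (x b)) (q, s) =
      ∑ i : Fin (p + 1), (-1) ^ (i : ℕ) *
        x (q.orderEmbOfFin h i) (q.erase (q.orderEmbOfFin h i), s) := by
  have h0 : (∑ b, onFib (extMul (Pi.single b 1)) (x b)) (q, s)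
      = ∑ b, onFib (extMul (Pi.single b 1)) (x b) (q, s) := by
    simp
  rw [h0]
  simp only [onFib_extMul_single_apply]
  rw [← Finset.sum_filter]
  have h1 : Finset.univ.filter (· ∈ q) = Finset.univ.map (q.orderEmbOfFin h).toEmbedding := by
    ext b
    simp only [Finset.mem_filter, Finset.mem_univ, true_and, Finset.mem_map]
    rw [← Finset.mem_coe, ← Finset.range_orderEmbOfFin q h]
    rfl
  rw [h1, Finset.sum_map]
  refine Finset.sum_congr rfl fun i _ => ?_
  change insertSign (q.orderEmbOfFin h i) (q.erase (q.orderEmbOfFin h i)) * _ = _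
  rw [insertSign_orderEmbOfFin]
  rfl

theorem neg_one_pow_smul_apply (m : ℕ) (y : EuclideanSpace ℂ κ) (s : κ) :
    ((-1 : ℤ) ^ m • y) s = (-1 : ℂ) ^ m * y s := by
  rcases Nat.even_or_odd m with h | h <;> simp [h.neg_one_pow]

variable {E : Type*}

/-- The element of `Cl ⊗ ℂ^κ` whose components in degree `p` are the values of `φ` on the tuples
of vectors `v_{a₁}, …, v_{aₚ}`, `a₁ < ⋯ < aₚ`. -/
noncomputable def formFib {p : ℕ} (φ : (Fin p → E) → EuclideanSpace ℂ κ) (v : ι → E) : Fib ι κ :=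
  WithLp.toLp 2 fun q => if h : q.1.card = p then φ (fun i => v (q.1.orderEmbOfFin h i)) q.2 else 0

theorem formFib_apply {p : ℕ} (φ : (Fin p → E) → EuclideanSpace ℂ κ) (v : ι → E) {q : Finset ι}
    (h : q.card = p) (s : κ) : formFib φ v (q, s) = φ (fun i => v (q.orderEmbOfFin h i)) s := by
  simp [formFib, h]

theorem formFib_apply_of_ne {p : ℕ} (φ : (Fin p → E) → EuclideanSpace ℂ κ) (v : ι → E)
    {q : Finset ι} (h : q.card ≠ p) (s : κ) : formFib φ v (q, s) = 0 := by
  simp [formFib, h]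

theorem sum_onFib_extMul_formFib_of_ne {p : ℕ} (φ : ι → (Fin p → E) → EuclideanSpace ℂ κ)
    (v : ι → E) {q : Finset ι} (h : q.card ≠ p + 1) (s : κ) :
    (∑ b, onFib (extMul (Pi.single b 1)) (formFib (φ b) v)) (q, s) = 0 := by
  have h0 : (∑ b, onFib (extMul (Pi.single b 1)) (formFib (φ b) v)) (q, s)
      = ∑ b, onFib (extMul (Pi.single b 1)) (formFib (φ b) v) (q, s) := by
    simp
  rw [h0]
  refine Finset.sum_eq_zero fun b _ => ?_
  rw [onFib_extMul_single_apply]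
  split_ifs with hb
  · rw [formFib_apply_of_ne, mul_zero]
    intro hc
    have := Finset.card_erase_add_one hb
    omega
  · rfl

theorem sum_onFib_extMul_formFib_apply {p : ℕ} (φ : ι → (Fin p → E) → EuclideanSpace ℂ κ)
    (v : ι → E) {q : Finset ι} (h : q.card = p + 1) (s : κ) :
    (∑ b, onFib (extMul (Pi.single b 1)) (formFib (φ b) v)) (q, s) =
      ∑ i : Fin (p + 1), (-1) ^ (i : ℕ) *
        φ (q.orderEmbOfFin h i) (i.removeNth fun j => v (q.orderEmbOfFin h j)) s := by
  rw [sum_onFib_extMul_apply _ h]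
  refine Finset.sum_congr rfl fun i _ => ?_
  rw [formFib_apply _ _ (card_erase_orderEmbOfFin h i)]
  simp only [orderEmbOfFin_erase]
  rfl

variable [NormedAddCommGroup E] [NormedSpace ℝ E]

/-- Interior multiplication of forms. -/
theorem onFib_intMul_formFib {p : ℕ} [Fintype κ] (φ : E [⋀^Fin (p + 1)]→L[ℝ] EuclideanSpace ℂ κ)
    (v : ι → E) (a : ι) : onFib (intMul (Pi.single a 1)) (formFib φ v) =
      formFib (fun w => φ (Matrix.vecCons (v a) w)) v := by
  ext ⟨q, s⟩
  rw [onFib_intMul_single_apply]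
  by_cases hq : q.card = p
  · rw [formFib_apply _ _ hq]
    split_ifs with ha
    · obtain ⟨j, hj⟩ : a ∈ Set.range (q.orderEmbOfFin hq) := by simpa using ha
      rw [φ.map_eq_zero_of_eq (i := 0) (j := j.succ) _ _ (Fin.succ_ne_zero j).symm]
      · rfl
      · simp [hj]
    · have hc : (insert a q).card = p + 1 := by rw [Finset.card_insert_of_notMem ha, hq]
      obtain ⟨r, hr⟩ : a ∈ Set.range ((insert a q).orderEmbOfFin hc) := by simp
      have hqe : q = (insert a q).erase ((insert a q).orderEmbOfFin hc r) := by
        rw [hr, Finset.erase_insert ha]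
      have hs : insertSign a q = (-1) ^ (r : ℕ) := by
        rw [← insertSign_orderEmbOfFin hc r, ← hqe, hr]
      have he : ∀ j, q.orderEmbOfFin hq j = (insert a q).orderEmbOfFin hc (r.succAbove j) := by
        intro j
        rw [← orderEmbOfFin_erase hc r (card_erase_orderEmbOfFin hc r) j]
        congr 1
        simp only [← hqe]
      have hv : (fun i => v ((insert a q).orderEmbOfFin hc i))
          = r.insertNth (v a) (fun j => v (q.orderEmbOfFin hq j)) := by
        rw [Fin.eq_insertNth_iff]
        refine ⟨by rw [hr], ?_⟩
        funext j
        rw [he]; rfl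
      rw [formFib_apply _ _ hc, hv, φ.map_insertNth, hs]
      rw [neg_one_pow_smul_apply, ← mul_assoc, ← mul_pow]
      simp
  · rw [formFib_apply_of_ne _ _ hq]
    split_ifs with ha
    · rfl
    · rw [formFib_apply_of_ne, mul_zero]
      rw [Finset.card_insert_of_notMem ha]
      omega

/-- Summing exterior products of the contractions of a form with `u_b` replaces the arguments of
the form, one at a time. -/
theorem sum_onFib_extMul_contract {p : ℕ} (φ : E [⋀^Fin (p + 1)]→L[ℝ] EuclideanSpace ℂ κ)
    [Fintype κ] (v u : ι → E) {q : Finset ι} (h : q.card = p + 1) (s : κ) :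
    (∑ b, onFib (extMul (Pi.single b 1)) (formFib (fun w => φ (Matrix.vecCons (u b) w)) v)) (q, s) =
      ∑ i : Fin (p + 1), φ (Function.update (fun j => v (q.orderEmbOfFin h j)) i
        (u (q.orderEmbOfFin h i))) s := by
  rw [sum_onFib_extMul_formFib_apply _ _ h]
  refine Finset.sum_congr rfl fun i _ => ?_
  rw [← Fin.insertNth_removeNth, φ.map_insertNth]
  rw [neg_one_pow_smul_apply]

end FormComponents

section ExteriorDerivative

variable {A : Type*} [NormedRing A] [NormedAlgebra ℝ A] {G : Type*} [Group G] {ρ : G →* A}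
  [FiniteDimensional ℝ A] {n : ℕ} {B : BiinvariantMetric ρ} {d : ℕ} (e : OrthonormalFrame B d)
  {κ : Type*} [Fintype κ]

namespace OrthonormalFrame

theorem formSection_eq {p : ℕ}
    (θ : (Fin n → A) → (Fin n → A) [⋀^Fin p]→L[ℝ] EuclideanSpace ℂ κ) (g : Fin n → G) :
    e.formSection θ g = formFib (θ (toOps ρ g)) (fun a => e.frameField a g) := rfl

theorem frameDeriv_apply {ξ : (Fin n → G) → Fib (Idx n d) κ}
    (hξ : ξ ∈ smoothFun n (Fib (Idx n d) κ) ρ) (b : Idx n d) (g : Fin n → G)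
    {z : ℂ} {q : Finset (Idx n d)} {s : κ}
    (h : HasDerivAt (fun t => ξ (e.move b g t) (q, s)) z 0) : e.frameDeriv ξ b g (q, s) = z :=
  (hasDerivAt_euclideanSpace.1 (e.hasDerivAt_frameDeriv hξ b g) (q, s)).unique h

variable {p : ℕ} {θ : (Fin n → A) → (Fin n → A) [⋀^Fin p]→L[ℝ] EuclideanSpace ℂ κ}

theorem frameDeriv_formSection_of_ne (hξ : e.formSection θ ∈ smoothFun n (Fib (Idx n d) κ) ρ)
    (b : Idx n d) (g : Fin n → G) {q : Finset (Idx n d)} (h : q.card ≠ p) (s : κ) :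
    e.frameDeriv (e.formSection θ) b g (q, s) = 0 := by
  refine e.frameDeriv_apply hξ b g ?_
  simp only [formSection_eq, formFib_apply_of_ne _ _ h]
  exact hasDerivAt_const _ _

/-- Along the curve `e.move b g` both the form and the frame vectors that are its arguments vary;
`e.linField` is the linear extension of the frame fields. -/
theorem frameDeriv_formSection_apply (hθ : SmoothAlong ρ θ)
    (hξ : e.formSection θ ∈ smoothFun n (Fib (Idx n d) κ) ρ)
    (b : Idx n d) (g : Fin n → G) {q : Finset (Idx n d)} (h : q.card = p) (s : κ) :
    e.frameDeriv (e.formSection θ) b g (q, s) =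
      fderiv ℝ θ (toOps ρ g) (e.frameField b g) (fun i => e.frameField (q.orderEmbOfFin h i) g) s
      + ∑ i, θ (toOps ρ g) (Function.update (fun j => e.frameField (q.orderEmbOfFin h j) g) i
          (e.linField (q.orderEmbOfFin h i) (e.frameField b g))) s := by
  refine e.frameDeriv_apply hξ b g ?_
  simp only [formSection_eq, formFib_apply _ _ h, ← linField_toOps]
  have h1 := HasFDerivAt.continuousAlternatingMap_apply (hθ.differentiableAt g).hasFDerivAt
    (g := fun i x => e.linField (q.orderEmbOfFin h i) x)
    (fun i => (e.linField (q.orderEmbOfFin h i)).hasFDerivAt)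
  have h2 : HasDerivAt (fun t => toOps ρ (e.move b g t)) (e.linField b (toOps ρ g)) 0 :=
    e.hasDerivAt_toOps_move b g
  have h1' := h1
  rw [← e.move_zero b g] at h1'
  have h3 := hasDerivAt_euclideanSpace.1 (h1'.comp_hasDerivAt (0 : ℝ) h2) s
  simp only [e.move_zero] at h3
  simpa using h3

/-- The difference of the flat derivative and the Levi-Civita derivative of `e_a` along `e_b`. -/
noncomputable def secondForm (g : Fin n → G) (b a : Idx n d) : Fin n → A :=
  e.linField a (e.frameField b g) - ∑ c, e.leviCivita b c a • e.frameField c g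

/-- The connection is torsion free. -/
theorem secondForm_comm (g : Fin n → G) (b a : Idx n d) :
    e.secondForm g b a = e.secondForm g a b := by
  -- the torsion of `∇` vanishes
  have h1 : ∑ c, e.leviCivita b c a • e.frameField c g - ∑ c, e.leviCivita a c b • e.frameField c g
      = ∑ c, e.structConst b a c • e.frameField c g := by
    rw [← Finset.sum_sub_distrib]
    exact Finset.sum_congr rfl fun c _ => by rw [← sub_smul, leviCivita_torsion]
  -- the flat connection of the ambient space is torsion free too, so the difference of the flat
  -- derivatives is the bracket of the fields
  have h2 : ∑ c, e.structConst b a c • e.frameField c g =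
      e.linField a (e.frameField b g) - e.linField b (e.frameField a g) := by
    have hsum : ∀ f : Idx n d → (Fin n → A), ∑ b, f b = ∑ i : Fin n, ∑ l : Fin d, f (toLex (i, l)) := by
      intro f
      rw [← Fintype.sum_prod_type', ← Equiv.sum_comp toLex]
    rw [hsum]
    simp only [linField_apply, frameField, structConst_eq, ofLex_toLex]
    by_cases hab : (ofLex b).1 = (ofLex a).1
    · rw [Finset.sum_eq_single (ofLex a).1]
      · simp only [hab, Pi.single_eq_same, if_true, and_self]
        rw [← Pi.single_sub]
        simp only [← Pi.single_smul, ← mul_smul_comm]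
        have h3 : ∀ f : Fin d → A, ∑ l, Pi.single (ofLex a).1 (f l)
            = (Pi.single (ofLex a).1 (∑ l, f l) : Fin n → A) := fun f =>
          (map_sum (AddMonoidHom.single (fun _ : Fin n => A) (ofLex a).1) f Finset.univ).symm
        rw [h3, ← Finset.mul_sum]
        congr 1
        have h4 : ((∑ l, e.lieStruct (ofLex b).2 (ofLex a).2 l • e.basis l : lieAlg ρ) : A)
            = lieBr (e.basis (ofLex b).2) (e.basis (ofLex a).2) :=
          congrArg Subtype.val (e.basis.sum_repr _)
        simp only [Submodule.coe_sum, Submodule.coe_smul] at h4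
        rw [h4]
        simp [lieBr, mul_sub, mul_assoc]
      · intro i _ hi
        refine Finset.sum_eq_zero fun l _ => ?_
        simp [Ne.symm hi]
      · simp
    · rw [Finset.sum_eq_zero fun i _ => Finset.sum_eq_zero fun l _ => by
        simp [hab]]
      rw [Pi.single_eq_of_ne (fun h => hab h.symm), Pi.single_eq_of_ne (fun h => hab h)]
      simp
  unfold secondForm
  rw [h2] at h1
  rw [sub_eq_sub_iff_sub_eq_sub, ← h1]

/-- The connection term acts on forms as a derivation, hence as a sum of products of an exterior and
an interior multiplication. -/
theorem onFib_cliffDeriv_leviCivita (b : Idx n d) (x : Fib (Idx n d) κ) :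
    onFib (cliffDeriv (e.leviCivita b)) x = - ∑ a, onFib (extMul (Pi.single a 1))
      (∑ c, (e.leviCivita b c a : ℂ) • onFib (intMul (Pi.single c 1)) x) := by
  refine fib_ext fun s => ?_
  rw [fibSlice_onFib, cliffDeriv_eq_extDerivation (e.leviCivita_skew b), extDerivation_apply]
  simp only [map_neg, map_sum, fibSlice_onFib, map_smul]
  rw [Finset.sum_comm, ← Finset.sum_neg_distrib]
  refine Finset.sum_congr rfl fun c _ => ?_
  rw [vec_eq_sum_single (colVec (e.leviCivita b) c), ← Finset.sum_neg_distrib]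
  simp only [map_sum, map_smul, LinearMap.sum_apply, LinearMap.smul_apply]
  refine Finset.sum_congr rfl fun a _ => ?_
  rw [colVec, e.leviCivita_skew b a c]
  simp

/-- The covariant derivative of a form: the flat derivative and a correction by the symmetric
tensor `secondForm`. -/
theorem covDeriv_formSection_succ
    {θ : (Fin n → A) → (Fin n → A) [⋀^Fin (p + 1)]→L[ℝ] EuclideanSpace ℂ κ}
    (hθ : SmoothAlong ρ θ) (hξ : e.formSection θ ∈ smoothFun n (Fib (Idx n d) κ) ρ)
    (b : Idx n d) (g : Fin n → G) :
    e.covDeriv (e.formSection θ) b g =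
      formFib (fderiv ℝ θ (toOps ρ g) (e.frameField b g)) (fun a => e.frameField a g) +
      ∑ a, onFib (extMul (Pi.single a 1)) (formFib
        (fun w => θ (toOps ρ g) (Matrix.vecCons (e.secondForm g b a) w))
        (fun a => e.frameField a g)) := by
  have h1 : e.frameDeriv (e.formSection θ) b g =
      formFib (fderiv ℝ θ (toOps ρ g) (e.frameField b g)) (fun a => e.frameField a g) +
      ∑ a, onFib (extMul (Pi.single a 1)) (formFib
        (fun w => θ (toOps ρ g) (Matrix.vecCons (e.linField a (e.frameField b g)) w))
        (fun a => e.frameField a g)) := by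
    ext ⟨q, s⟩
    rw [PiLp.add_apply]
    by_cases hq : q.card = p + 1
    · rw [e.frameDeriv_formSection_apply hθ hξ b g hq, formFib_apply _ _ hq,
        sum_onFib_extMul_contract _ _ _ hq]
    · rw [e.frameDeriv_formSection_of_ne hξ b g hq, formFib_apply_of_ne _ _ hq,
        sum_onFib_extMul_formFib_of_ne _ _ hq, zero_add]
  rw [covDeriv, h1, e.onFib_cliffDeriv_leviCivita, add_assoc, ← sub_eq_add_neg,
    ← Finset.sum_sub_distrib]
  congr 1
  refine Finset.sum_congr rfl fun a _ => ?_
  rw [← map_sub]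
  congr 1
  rw [formSection_eq]
  simp only [onFib_intMul_formFib]
  ext ⟨q, s⟩
  by_cases hq : q.card = p
  · have h2 : ∀ (v : Fin n → A) (w : Fin p → Fin n → A), θ (toOps ρ g) (Matrix.vecCons v w)
        = (θ (toOps ρ g)).curryLeft v w := fun v w => rfl
    simp only [PiLp.sub_apply, formFib_apply _ _ hq, secondForm, h2, map_sub, map_sum,
      map_smul, ContinuousAlternatingMap.sub_apply, ContinuousAlternatingMap.sum_apply,
      ContinuousAlternatingMap.smul_apply, WithLp.ofLp_sum, Finset.sum_apply, PiLp.smul_apply]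
    rfl
  · simp [formFib_apply_of_ne _ _ hq]

theorem covDeriv_formSection_zero
    {θ : (Fin n → A) → (Fin n → A) [⋀^Fin 0]→L[ℝ] EuclideanSpace ℂ κ}
    (hθ : SmoothAlong ρ θ) (hξ : e.formSection θ ∈ smoothFun n (Fib (Idx n d) κ) ρ)
    (b : Idx n d) (g : Fin n → G) :
    e.covDeriv (e.formSection θ) b g =
      formFib (fderiv ℝ θ (toOps ρ g) (e.frameField b g)) (fun a => e.frameField a g) := by
  have h1 : e.frameDeriv (e.formSection θ) b g =
      formFib (fderiv ℝ θ (toOps ρ g) (e.frameField b g)) (fun a => e.frameField a g) := by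
    ext ⟨q, s⟩
    by_cases hq : q.card = 0
    · rw [e.frameDeriv_formSection_apply hθ hξ b g hq, formFib_apply _ _ hq]
      simp
    · rw [e.frameDeriv_formSection_of_ne hξ b g hq, formFib_apply_of_ne _ _ hq]
  have h2 : ∀ c, onFib (intMul (Pi.single c 1)) (e.formSection θ g) = 0 := by
    intro c
    ext ⟨q, s⟩
    rw [onFib_intMul_single_apply]
    split_ifs with hc
    · rfl
    · rw [formSection_eq, formFib_apply_of_ne, mul_zero]
      · rfl
      · simp
  rw [covDeriv, h1, e.onFib_cliffDeriv_leviCivita]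
  simp [h2]

/-- Antisymmetrization kills what is symmetric. -/
theorem sum_onFib_extMul_symm {ι : Type*} [Fintype ι] [LinearOrder ι] (x : ι → ι → Fib ι κ)
    (hx : ∀ a b, x a b = x b a) :
    ∑ b, onFib (extMul (Pi.single b 1)) (∑ a, onFib (extMul (Pi.single a 1)) (x b a)) = 0 := by
  have hc : ∀ (a b : ι) (y : Fib ι κ), onFib (extMul (Pi.single b 1))
      (onFib (extMul (Pi.single a 1)) y) =
      - onFib (extMul (Pi.single a 1)) (onFib (extMul (Pi.single b 1)) y) := fun a b y =>
    fib_ext fun s => by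
      simp only [fibSlice_onFib, map_neg]
      exact extMul_comm _ _ _
  have : IsAddTorsionFree (Fib ι κ) := IsAddTorsionFree.of_module_rat _
  apply self_eq_neg.1
  conv_lhs =>
    simp only [map_sum]
    rw [Finset.sum_comm]
  rw [← Finset.sum_neg_distrib]
  refine Finset.sum_congr rfl fun a _ => ?_
  rw [map_sum, ← Finset.sum_neg_distrib]
  refine Finset.sum_congr rfl fun b _ => ?_
  rw [hc, hx]

/-- The Levi-Civita connection being torsion free, `∑_a e_a ∧ ∇_{e_a}` is the exterior
derivative. -/
theorem extD_formSection (hθ : SmoothAlong ρ θ) (ξ : smoothFun n (Fib (Idx n d) κ) ρ)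
    (hξ : (ξ : (Fin n → G) → Fib (Idx n d) κ) = e.formSection θ) :
    (e.extD ξ : (Fin n → G) → Fib (Idx n d) κ) = e.formSection (extDeriv θ) := by
  have hmem : e.formSection θ ∈ smoothFun n (Fib (Idx n d) κ) ρ := hξ ▸ ξ.2
  funext g
  -- only the flat derivative survives: the correction is symmetric in `a` and `b`
  have key : (∑ b, onFib (extMul (Pi.single b 1)) (e.covDeriv (e.formSection θ) b g)) =
      ∑ b, onFib (extMul (Pi.single b 1)) (formFib
        (fderiv ℝ θ (toOps ρ g) (e.frameField b g)) (fun a => e.frameField a g)) := by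
    cases p with
    | zero => simp only [e.covDeriv_formSection_zero hθ hmem]
    | succ p =>
      simp only [e.covDeriv_formSection_succ hθ hmem, map_add, Finset.sum_add_distrib]
      rw [sum_onFib_extMul_symm _ fun a b => by rw [e.secondForm_comm], add_zero]
  rw [extD, symbolOp_apply, hξ, key]
  ext ⟨q, s⟩
  by_cases hq : q.card = p + 1
  · rw [sum_onFib_extMul_formFib_apply _ _ hq, formSection_eq, formFib_apply _ _ hq]
    rw [show extDeriv θ (toOps ρ g) = .alternatizeUncurryFin (fderiv ℝ θ (toOps ρ g)) from rfl,
      ContinuousAlternatingMap.alternatizeUncurryFin_apply, WithLp.ofLp_sum, Finset.sum_apply]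
    refine Finset.sum_congr rfl fun i _ => ?_
    rw [neg_one_pow_smul_apply]
  · rw [sum_onFib_extMul_formFib_of_ne _ _ hq, formSection_eq, formFib_apply_of_ne _ _ hq]

end OrthonormalFrame

end ExteriorDerivative

/-- The Cauchy-Binet expansion of the determinant of a product, with a sum over all maps `J`. -/
theorem sum_prod_mul_det {α : Type*} [Fintype α] {p : ℕ} (M : Fin p → α → ℝ)
    (N : Fin p → α → ℝ) :
    ∑ J : Fin p → α, (∏ i, M i (J i)) * (Matrix.of fun j i => N j (J i)).det =
      (Matrix.of fun j i => ∑ r, M i r * N j r).det := by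
  classical
  have h := (Matrix.detRowAlternating (n := Fin p) (R := ℝ)).toMultilinearMap.map_sum
    (fun i r => M i r • fun j => N j r)
  have h1 : ∀ X : Fin p → Fin p → ℝ,
      (Matrix.detRowAlternating (n := Fin p) (R := ℝ)).toMultilinearMap X
        = (Matrix.of fun j i => X i j).det := fun X => (Matrix.det_transpose (Matrix.of X)).symm
  simp only [MultilinearMap.map_smul_univ] at h
  simp only [h1, smul_eq_mul] at h
  rw [← h]
  congr 1
  ext j i
  simp

theorem contDiffAt_smul_alternating {E W : Type*} [NormedAddCommGroup E] [NormedSpace ℝ E]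
    [NormedAddCommGroup W] [NormedSpace ℝ W] {p : ℕ} (X : E [⋀^Fin p]→L[ℝ] W) {f : E → ℝ} {x : E}
    (hf : ContDiffAt ℝ ∞ f x) : ContDiffAt ℝ ∞ (fun x => f x • X) x :=
  hf.fun_smul contDiffAt_const

section Coframe

variable {A : Type*} [NormedRing A] [NormedAlgebra ℝ A] {G : Type*} [Group G] {ρ : G →* A}
  [FiniteDimensional ℝ A] {n : ℕ} {B : BiinvariantMetric ρ} {d : ℕ} (e : OrthonormalFrame B d)
  {κ : Type*} [Fintype κ]

namespace OrthonormalFrame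

/-- The coframe dual to the frame `e_a`, extended to a neighbourhood of `Gⁿ`. -/
noncomputable def coframe (a : Idx n d) (x : Fin n → A) : (Fin n → A) →L[ℝ] ℝ :=
  e.coordExt (ofLex a).2 ∘L ContinuousLinearMap.mul ℝ A (Ring.inverse (x (ofLex a).1)) ∘L
    ContinuousLinearMap.proj (ofLex a).1

theorem coframe_apply (a : Idx n d) (x w : Fin n → A) : e.coframe a x w =
    e.coordExt (ofLex a).2 (Ring.inverse (x (ofLex a).1) * w (ofLex a).1) := rfl

theorem coframe_frameField (a b : Idx n d) (g : Fin n → G) :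
    e.coframe a (toOps ρ g) (e.frameField b g) = if a = b then 1 else 0 := by
  rw [coframe_apply, frameField]
  by_cases h : (ofLex a).1 = (ofLex b).1
  · rw [h, Pi.single_eq_same, toOps, ringInverse_rep, ← mul_assoc, rep_inv_mul_rep, one_mul,
      coordExt_coe, Module.Basis.repr_self, Finsupp.single_apply]
    refine if_congr ?_ rfl rfl
    exact ⟨fun h' => ofLex.injective (Prod.ext h h'.symm), fun h' => by rw [h']⟩
  · rw [Pi.single_eq_of_ne h, mul_zero, map_zero, if_neg]
    exact fun h' => h (by rw [h'])

theorem smoothAlong_coframe (a : Idx n d) (w : Fin n → A) :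
    SmoothAlong ρ fun x => e.coframe a x w := fun g => by
  have h1 : ContDiffAt ℝ ∞ (fun x : Fin n → A => Ring.inverse (x (ofLex a).1)) (toOps ρ g) :=
    (contDiffAt_ringInverse_rep (ρ := ρ) (g (ofLex a).1)).comp (toOps ρ g)
      (f := fun x : Fin n → A => x (ofLex a).1) (by fun_prop)
  exact (e.coordExt (ofLex a).2).contDiff.contDiffAt.comp _ (h1.mul contDiffAt_const)

/-- The constant form `w ↦ det (w_j)_{J i}` in the coordinates `J i`, times a unit vector. -/
noncomputable def coordForm [DecidableEq κ] {p : ℕ}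
    (J : Fin p → Fin (Module.finrank ℝ (Fin n → A))) (s : κ) :
    (Fin n → A) [⋀^Fin p]→L[ℝ] EuclideanSpace ℂ κ :=
  (ContinuousLinearMap.toSpanSingleton ℝ (EuclideanSpace.single s (1 : ℂ)
    : EuclideanSpace ℂ κ)).compContinuousAlternatingMap
    { Matrix.detRowAlternating.compLinearMap
        (LinearMap.pi fun i => (Module.finBasis ℝ (Fin n → A)).coord (J i)) with
      cont := by
        have h : ∀ r, Continuous ((Module.finBasis ℝ (Fin n → A)).coord r) := fun r =>
          LinearMap.continuous_of_finiteDimensional _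
        change Continuous fun w : Fin p → Fin n → A => Matrix.det (Matrix.of fun j i =>
          (Module.finBasis ℝ (Fin n → A)).coord (J i) (w j))
        refine Continuous.matrix_det (continuous_matrix fun j i => ?_)
        exact (h _).comp (continuous_apply j) }

theorem coordForm_apply [DecidableEq κ] {p : ℕ}
    (J : Fin p → Fin (Module.finrank ℝ (Fin n → A))) (s : κ) (w : Fin p → Fin n → A) :
    coordForm J s w = (Matrix.of fun j i =>
      (Module.finBasis ℝ (Fin n → A)).repr (w j) (J i)).det • EuclideanSpace.single s (1 : ℂ) := rfl

/-- The form whose only component is the given function at `e_q` and the unit vector `s`. -/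
noncomputable def basicForm [DecidableEq κ] (q : Finset (Idx n d)) (s : κ)
    (f : (Fin n → A) → ℂ) (x : Fin n → A) :
    (Fin n → A) [⋀^Fin q.card]→L[ℝ] EuclideanSpace ℂ κ :=
  ∑ J : Fin q.card → Fin (Module.finrank ℝ (Fin n → A)),
    ((∏ i, e.coframe (q.orderEmbOfFin rfl i) x (Module.finBasis ℝ (Fin n → A) (J i))) • f x) •
      coordForm J s

theorem smoothAlong_basicForm [DecidableEq κ] (q : Finset (Idx n d)) (s : κ)
    {f : (Fin n → A) → ℂ} (hf : SmoothAlong ρ f) : SmoothAlong ρ (e.basicForm q s f) := fun g => by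
  refine ContDiffAt.sum fun J _ => ?_
  have h1 : ContDiffAt ℝ ∞ (fun x => (∏ i, e.coframe (q.orderEmbOfFin rfl i) x
      (Module.finBasis ℝ (Fin n → A) (J i))) • f x) (toOps ρ g) :=
    (contDiffAt_prod fun i _ => e.smoothAlong_coframe _ _ g).fun_smul (hf g)
  -- alternating maps are a real normed space here, so that the real and the imaginary part of the
  -- coefficient are treated separately
  have h2 : ∀ z : ℂ, z • (coordForm J s : (Fin n → A) [⋀^Fin q.card]→L[ℝ] EuclideanSpace ℂ κ) =
      z.re • coordForm J s + z.im • (Complex.I • coordForm J s) := by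
    intro z
    ext v t
    change z * (coordForm J s v : EuclideanSpace ℂ κ) t = z.re • (coordForm J s v) t
      + z.im • (Complex.I * (coordForm J s v) t)
    conv_lhs => rw [← Complex.re_add_im z]
    simp only [Complex.real_smul]
    ring
  refine ContDiffAt.congr_of_eventuallyEq ?_ (Filter.Eventually.of_forall fun x => h2 _)
  exact (contDiffAt_smul_alternating _ (Complex.reCLM.contDiff.contDiffAt.comp _ h1)).add
    (contDiffAt_smul_alternating _ (Complex.imCLM.contDiff.contDiffAt.comp _ h1))

/-- The components of `basicForm` are determinants of the pairing of the coframe with the frame, by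
the Cauchy-Binet formula, and these matrices are identity matrices or have a zero row. -/
theorem formSection_basicForm [DecidableEq κ] (q : Finset (Idx n d)) (s : κ)
    (f : (Fin n → A) → ℂ) (g : Fin n → G) :
    e.formSection (e.basicForm q s f) g = EuclideanSpace.single (q, s) (f (toOps ρ g)) := by
  ext ⟨q', s'⟩
  rw [PiLp.single_apply]
  by_cases hq' : q'.card = q.card
  · rw [formSection_eq, formFib_apply _ _ hq', basicForm]
    have h1 := sum_prod_mul_det (p := q.card)
      (fun i r => e.coframe (q.orderEmbOfFin rfl i) (toOps ρ g)
        (Module.finBasis ℝ (Fin n → A) r))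
      (fun j r => (Module.finBasis ℝ (Fin n → A)).repr
        (e.frameField (q'.orderEmbOfFin hq' j) g) r)
    have h2 : ∀ i j, ∑ r, e.coframe (q.orderEmbOfFin rfl i) (toOps ρ g)
        (Module.finBasis ℝ (Fin n → A) r) * (Module.finBasis ℝ (Fin n → A)).repr
        (e.frameField (q'.orderEmbOfFin hq' j) g) r =
        if q.orderEmbOfFin rfl i = q'.orderEmbOfFin hq' j then 1 else 0 := by
      intro i j
      rw [← e.coframe_frameField (q.orderEmbOfFin rfl i) (q'.orderEmbOfFin hq' j) g]
      conv_rhs => rw [← (Module.finBasis ℝ (Fin n → A)).sum_repr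
        (e.frameField (q'.orderEmbOfFin hq' j) g)]
      simp only [map_sum, map_smul, smul_eq_mul]
      exact Finset.sum_congr rfl fun r _ => mul_comm _ _
    simp only [h2] at h1
    have h3 : (Matrix.of fun j i : Fin q.card =>
        if q.orderEmbOfFin rfl i = q'.orderEmbOfFin hq' j then (1 : ℝ) else 0).det
        = if q' = q then 1 else 0 := by
      split_ifs with hqq
      · subst hqq
        convert Matrix.det_one (n := Fin q'.card) (R := ℝ)
        ext j i
        simp [Matrix.one_apply, eq_comm]
      · obtain ⟨x, hx, hxq⟩ : ∃ x ∈ q', x ∉ q := by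
          by_contra hcon
          push Not at hcon
          exact hqq (Finset.eq_of_subset_of_card_le hcon hq'.ge)
        obtain ⟨j, rfl⟩ : x ∈ Set.range (q'.orderEmbOfFin hq') := by simpa using hx
        refine Matrix.det_eq_zero_of_row_eq_zero j fun i => ?_
        rw [Matrix.of_apply, if_neg]
        intro h
        exact hxq (h ▸ Finset.orderEmbOfFin_mem q rfl i)
    rw [h3] at h1
    simp only [ContinuousAlternatingMap.smul_apply, ContinuousAlternatingMap.sum_apply,
      coordForm_apply, smul_assoc]
    simp only [smul_comm (f (toOps ρ g)), smul_smul]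
    rw [← Finset.sum_smul, h1]
    by_cases hqq : q' = q
    · by_cases hs : s' = s
      · simp [hqq, hs]
      · simp [hqq, hs]
    · simp [hqq]
  · rw [formSection_eq, formFib_apply_of_ne _ _ hq', if_neg]
    intro h
    exact hq' (congrArg (fun r => r.1.card) h)

/-- All smooth sections are sums of sections that come from smooth differential forms. -/
theorem span_formSection :
    Submodule.span ℂ {ξ : smoothFun n (Fib (Idx n d) κ) ρ |
      ∃ (p : ℕ) (θ : (Fin n → A) → (Fin n → A) [⋀^Fin p]→L[ℝ] EuclideanSpace ℂ κ),
        SmoothAlong ρ θ ∧ (ξ : (Fin n → G) → Fib (Idx n d) κ) = e.formSection θ} = ⊤ := by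
  classical
  refine eq_top_iff.2 fun ξ _ => ?_
  obtain ⟨F, hF, hξF⟩ := ξ.2
  -- `T r` keeps the component `r`
  let T : Finset (Idx n d) × κ → Fib (Idx n d) κ →L[ℂ] Fib (Idx n d) κ := fun r =>
    (ContinuousLinearMap.toSpanSingleton ℂ (EuclideanSpace.single r (1 : ℂ)
      : Fib (Idx n d) κ)) ∘L (PiLp.proj 2 (fun _ => ℂ) r)
  have hT : ∀ r x, T r x = EuclideanSpace.single r (x r) := fun r x => by
    ext r'
    simp [T]
  have h1 : ξ = ∑ r, (⟨fun g => T r (ξ.1 g), smoothFun_comp_clm (T r) ξ.2⟩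
      : smoothFun n (Fib (Idx n d) κ) ρ) := by
    ext1
    funext g
    rw [Submodule.coe_sum, Finset.sum_apply]
    simp only [hT]
    ext r
    rw [WithLp.ofLp_sum, Finset.sum_apply]
    simp [PiLp.single_apply]
  rw [h1]
  refine Submodule.sum_mem _ fun r _ => Submodule.subset_span
    ⟨r.1.card, e.basicForm r.1 r.2 (fun x => F x r), e.smoothAlong_basicForm _ _ fun g => ?_, ?_⟩
  · exact (contDiffAt_piLp 2).1 (hF g) r
  · funext g
    rw [formSection_basicForm]
    simp only [hT, hξF]

end OrthonormalFrame

end Coframe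

/-! ### Functoriality of the pull-back -/

section StructureMaps

variable {l m n d : ℕ} {G : Type*} [Group G]

/-- The combinatorial part of a composition `Gⁿ → Gᵐ → Gˡ` of structure maps. -/
def SignedInj.comp (υ : SignedInj l m) (τ : SignedInj m n) : SignedInj l n where
  idx := υ.idx.trans τ.idx
  inverted j := xor (υ.inverted j) (τ.inverted (υ.idx j))

/-- The identity of `Gⁿ`. -/
def SignedInj.id (n : ℕ) : SignedInj n n where
  idx := Function.Embedding.refl _
  inverted _ := false

theorem SignedInj.comp_map (υ : SignedInj l m) (τ : SignedInj m n) (g : Fin n → G) :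
    (υ.comp τ).map g = υ.map (τ.map g) := by
  funext j
  simp only [SignedInj.map, SignedInj.comp, Function.Embedding.trans_apply]
  cases υ.inverted j <;> cases τ.inverted (υ.idx j) <;> simp

theorem SignedInj.id_map (g : Fin n → G) : (SignedInj.id n).map g = g := by
  funext j
  simp [SignedInj.map, SignedInj.id]

theorem sum_idx {M : Type*} [AddCommMonoid M] (f : Idx n d → M) :
    ∑ b, f b = ∑ i : Fin n, ∑ l : Fin d, f (toLex (i, l)) := by
  rw [← Fintype.sum_prod_type', ← Equiv.sum_comp toLex]

variable {A : Type*} [NormedRing A] [NormedAlgebra ℝ A] {ρ : G →* A}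
  [FiniteDimensional ℝ A] {B : BiinvariantMetric ρ} (e : OrthonormalFrame B d)

namespace OrthonormalFrame

theorem lieAd_basis (h : G) (j : Fin d) :
    lieAd ρ h (e.basis j) = ∑ i, e.adMatrix h i j • e.basis i :=
  (e.basis.sum_repr _).symm

theorem adMatrix_mul (h h' : G) : e.adMatrix (h * h') = e.adMatrix h * e.adMatrix h' := by
  ext i j
  have h1 : lieAd ρ (h * h') (e.basis j) = lieAd ρ h (lieAd ρ h' (e.basis j)) := by
    ext1; simp [lieAd, mul_assoc]
  change e.basis.repr (lieAd ρ (h * h') (e.basis j)) i = _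
  rw [h1, lieAd_basis e h' j, map_sum, map_sum, Matrix.mul_apply, Finsupp.finsetSum_apply]
  refine Finset.sum_congr rfl fun k _ => ?_
  rw [map_smul, map_smul, Finsupp.smul_apply, smul_eq_mul, mul_comm]
  rfl

theorem adMatrix_inv (h : G) : e.adMatrix h⁻¹ = (e.adMatrix h).transpose := by
  have h1 : e.adMatrix h⁻¹ * e.adMatrix h = 1 := by
    rw [← adMatrix_mul, inv_mul_cancel, adMatrix_one]
  have h2 : e.adMatrix h * e.adMatrix h⁻¹ = 1 := by
    rw [← adMatrix_mul, mul_inv_cancel, adMatrix_one]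
  calc e.adMatrix h⁻¹ = ((e.adMatrix h).transpose * e.adMatrix h) * e.adMatrix h⁻¹ := by
        rw [e.adMatrix_orthogonal, Matrix.one_mul]
    _ = _ := by rw [Matrix.mul_assoc, h2, Matrix.mul_one]

/-- The diagonal block of the isometry `A_g` at the coordinate `j`. -/
noncomputable def tangentBlock (τ : SignedInj m n) (g : Fin n → G) (j : Fin m) :
    Matrix (Fin d) (Fin d) ℝ :=
  if τ.inverted j then -e.adMatrix (τ.map g j) else 1

theorem tangentMatrix_apply (τ : SignedInj m n) (g : Fin n → G) (b : Idx n d) (a : Idx m d) :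
    e.tangentMatrix τ g b a = if (ofLex b).1 = τ.idx (ofLex a).1 then
      e.tangentBlock τ g (ofLex a).1 (ofLex b).2 (ofLex a).2 else 0 := by
  simp only [tangentMatrix, Matrix.of_apply, tangentBlock]
  split_ifs <;> simp

theorem tangentBlock_comp (υ : SignedInj l m) (τ : SignedInj m n) (g : Fin n → G) (j : Fin l) :
    e.tangentBlock (υ.comp τ) g j =
      e.tangentBlock τ g (υ.idx j) * e.tangentBlock υ (τ.map g) j := by
  simp only [tangentBlock, SignedInj.comp_map]
  simp only [SignedInj.comp]
  by_cases hυ : υ.inverted j = true <;> by_cases hτ : τ.inverted (υ.idx j) = true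
  · have h1 : τ.map g (υ.idx j) = (g (τ.idx (υ.idx j)))⁻¹ := by simp [SignedInj.map, hτ]
    have h2 : υ.map (τ.map g) j = g (τ.idx (υ.idx j)) := by simp [SignedInj.map, hτ, hυ]
    simp only [hυ, hτ, h1, h2, Bool.xor_self, Bool.false_eq_true, if_false, if_true, neg_mul_neg]
    rw [← adMatrix_mul, inv_mul_cancel, adMatrix_one]
  · simp [hυ, hτ]
  · simp [hυ, hτ, SignedInj.map]
  · simp [hυ, hτ]

theorem tangentMatrix_comp (υ : SignedInj l m) (τ : SignedInj m n) (g : Fin n → G) :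
    e.tangentMatrix (υ.comp τ) g = e.tangentMatrix τ g * e.tangentMatrix υ (τ.map g) := by
  ext b a
  rw [Matrix.mul_apply, sum_idx]
  simp only [tangentMatrix_apply, ofLex_toLex]
  rw [Finset.sum_eq_single (υ.idx (ofLex a).1)]
  · simp only [if_true]
    rw [tangentBlock_comp, Matrix.mul_apply]
    by_cases h : (ofLex b).1 = τ.idx (υ.idx (ofLex a).1)
    · simp [h, SignedInj.comp]
    · simp [h, SignedInj.comp]
  · intro i _ hi
    simp [hi]
  · simp

theorem tangentMatrix_id (g : Fin n → G) : e.tangentMatrix (SignedInj.id n) g = 1 := by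
  ext b a
  rw [tangentMatrix_apply, Matrix.one_apply]
  have h1 : e.tangentBlock (SignedInj.id n) g (ofLex a).1 = 1 := by
    simp [tangentBlock, SignedInj.id]
  rw [h1, Matrix.one_apply, SignedInj.id, Function.Embedding.refl_apply]
  by_cases h : b = a
  · subst h; simp
  · rw [if_neg h]
    split_ifs with h1 h2
    · exact absurd (ofLex.injective (Prod.ext h1 h2)) h
    · rfl
    · rfl

variable {κ : Type*} [Fintype κ]

theorem pullback_eq (τ : SignedInj m n) (ξ : (Fin m → G) → Fib (Idx m d) κ) (g : Fin n → G) :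
    e.pullback τ ξ g = onFib (cliffMapLin (e.tangentMatrix τ g)) (ξ (τ.map g)) := by
  rw [pullback, cliffMap_toLinearMap]

theorem pullback_comp (υ : SignedInj l m) (τ : SignedInj m n)
    (ξ : (Fin l → G) → Fib (Idx l d) κ) :
    e.pullback (υ.comp τ) ξ = e.pullback τ (e.pullback υ ξ) := by
  funext g
  rw [pullback_eq, pullback_eq, pullback_eq, tangentMatrix_comp,
    cliffMapLin_mul _ (e.tangentMatrix_orthogonal τ g), onFib_comp, SignedInj.comp_map]

theorem pullback_id (ξ : (Fin n → G) → Fib (Idx n d) κ) :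
    e.pullback (SignedInj.id n) ξ = ξ := by
  funext g
  rw [pullback_eq, tangentMatrix_id, cliffMapLin_one_matrix, onFib_id, SignedInj.id_map]

theorem norm_pullback (τ : SignedInj m n) (ξ : (Fin m → G) → Fib (Idx m d) κ) (g : Fin n → G) :
    ‖e.pullback τ ξ g‖ = ‖ξ (τ.map g)‖ := by
  rw [pullback_eq, norm_onFib_cliffMapLin _ (e.tangentMatrix_orthogonal τ g)]

theorem pullback_add (τ : SignedInj m n) (ξ η : (Fin m → G) → Fib (Idx m d) κ) :
    e.pullback τ (ξ + η) = e.pullback τ ξ + e.pullback τ η := by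
  funext g; simp [pullback_eq]

theorem pullback_smul (τ : SignedInj m n) (c : ℂ) (ξ : (Fin m → G) → Fib (Idx m d) κ) :
    e.pullback τ (c • ξ) = c • e.pullback τ ξ := by
  funext g; simp [pullback_eq]

/-! ### Smoothness of the pull-back -/

/-- The structure map, extended to a map between tuples of operators. -/
noncomputable def _root_.SignedInj.opMap (τ : SignedInj m n) (x : Fin n → A) : Fin m → A :=
  fun j => if τ.inverted j then Ring.inverse (x (τ.idx j)) else x (τ.idx j)

theorem _root_.SignedInj.opMap_toOps (τ : SignedInj m n) (g : Fin n → G) :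
    τ.opMap (toOps ρ g) = toOps ρ (τ.map g) := by
  funext j
  simp only [SignedInj.opMap, SignedInj.map, toOps]
  split_ifs
  · exact ringInverse_rep _
  · rfl

theorem contDiffAt_ringInverse_apply (k : Fin n) (g : Fin n → G) :
    ContDiffAt ℝ ∞ (fun x : Fin n → A => Ring.inverse (x k)) (toOps ρ g) :=
  (contDiffAt_ringInverse_rep (ρ := ρ) (g k)).comp (toOps ρ g)
    (f := fun x : Fin n → A => x k) (by fun_prop)

theorem _root_.SignedInj.smoothAlong_opMap (τ : SignedInj m n) :
    SmoothAlong ρ (τ.opMap (A := A)) := fun g => by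
  rw [contDiffAt_pi]
  intro j
  simp only [SignedInj.opMap]
  split_ifs
  · exact contDiffAt_ringInverse_apply _ g
  · fun_prop

theorem smoothAlong_tangentMatrix (τ : SignedInj m n) (b : Idx n d) (a : Idx m d) :
    ∃ f : (Fin n → A) → ℝ, SmoothAlong ρ f ∧ ∀ g, e.tangentMatrix τ g b a = f (toOps ρ g) := by
  by_cases hb : (ofLex b).1 = τ.idx (ofLex a).1
  · by_cases ha : τ.inverted (ofLex a).1
    · refine ⟨fun x => -e.coordExt (ofLex b).2 (Ring.inverse (x (τ.idx (ofLex a).1)) *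
        (e.basis (ofLex a).2 : A) * x (τ.idx (ofLex a).1)), fun g => ?_, fun g => ?_⟩
      · have h1 := contDiffAt_ringInverse_apply (ρ := ρ) (τ.idx (ofLex a).1) g
        have h2 : ContDiffAt ℝ ∞ (fun x : Fin n → A => x (τ.idx (ofLex a).1)) (toOps ρ g) := by
          fun_prop
        exact ((e.coordExt (ofLex b).2).contDiff.contDiffAt.comp _
          ((h1.mul contDiffAt_const).mul h2)).neg
      · rw [tangentMatrix_apply, if_pos hb, tangentBlock, if_pos ha, Matrix.neg_apply,
          adMatrix_apply]
        simp [SignedInj.map, ha, toOps, ringInverse_rep]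
    · refine ⟨fun _ => (1 : Matrix (Fin d) (Fin d) ℝ) (ofLex b).2 (ofLex a).2,
        fun g => contDiffAt_const, fun g => ?_⟩
      rw [tangentMatrix_apply, if_pos hb, tangentBlock, if_neg ha]
  · refine ⟨fun _ => 0, fun g => contDiffAt_const, fun g => ?_⟩
    rw [tangentMatrix_apply, if_neg hb]

theorem pullback_mem (τ : SignedInj m n) {ξ : (Fin m → G) → Fib (Idx m d) κ}
    (hξ : ξ ∈ smoothFun m (Fib (Idx m d) κ) ρ) :
    e.pullback τ ξ ∈ smoothFun n (Fib (Idx n d) κ) ρ := by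
  obtain ⟨F, hF, hξF⟩ := hξ
  choose f hf hfe using fun b a => e.smoothAlong_tangentMatrix τ b a
  refine ⟨fun x => onFib (cliffMapLin (Matrix.of fun b a => f b a x)) (F (τ.opMap x)),
    fun g => ?_, fun g => ?_⟩
  · have h1 : ContDiffAt ℝ ∞ F (τ.opMap (toOps ρ g)) := by
      rw [τ.opMap_toOps]; exact hF _
    exact ContDiffAt.onFib_cliffMapLin (fun b a => hf b a g)
      (h1.comp _ (τ.smoothAlong_opMap g))
  · have h1 : e.tangentMatrix τ g = Matrix.of fun b a => f b a (toOps ρ g) := by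
      ext b a
      exact hfe b a g
    rw [pullback_eq, hξF, h1]
    simp only [τ.opMap_toOps]

theorem continuous_tangentMatrix [TopologicalSpace G] (hρ : Continuous ρ) (τ : SignedInj m n)
    (b : Idx n d) (a : Idx m d) : Continuous fun g : Fin n → G => e.tangentMatrix τ g b a := by
  obtain ⟨f, hf, hfe⟩ := e.smoothAlong_tangentMatrix τ b a
  have hc : Continuous (toOps (n := n) ρ) := continuous_pi fun i => hρ.comp (continuous_apply i)
  simp only [hfe]
  rw [continuous_iff_continuousAt]
  exact fun g => ContinuousAt.comp (hf g).continuousAt hc.continuousAt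

end OrthonormalFrame

end StructureMaps

/-! ### Naturality of the connection and of the Euler-Dirac operator -/

section Naturality

variable {m n d : ℕ} {G : Type*} [Group G] {A : Type*} [NormedRing A] [NormedAlgebra ℝ A]
  {ρ : G →* A} [FiniteDimensional ℝ A] {B : BiinvariantMetric ρ} (e : OrthonormalFrame B d)

namespace OrthonormalFrame

theorem conj_basis (h : G) (j : Fin d) :
    ρ h * (e.basis j : A) * ρ h⁻¹ = ∑ i, e.adMatrix h i j • (e.basis i : A) := by
  have := congrArg (lieAlg ρ).subtype (e.lieAd_basis h j)
  simp only [map_sum, map_smul] at this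
  exact this

theorem inv_conj_basis (h : G) (j : Fin d) :
    ρ h⁻¹ * (e.basis j : A) * ρ h = ∑ i, e.adMatrix h j i • (e.basis i : A) := by
  have := e.conj_basis h⁻¹ j
  rw [inv_inv, adMatrix_inv] at this
  simpa using this

/-- The adjoint action is by automorphisms of the Lie algebra. -/
theorem sum_adMatrix_lieStruct (h : G) (l p r : Fin d) :
    ∑ u, e.adMatrix h l u * ∑ c, e.adMatrix h p c * e.lieStruct u r c =
      ∑ c, e.lieStruct l c p * e.adMatrix h c r := by
  -- both sides are the `p`-th coordinate of `Ad h [Ad h⁻¹ e_l, e_r] = [e_l, Ad h e_r]`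
  have h1 : ∀ u, ∑ c, e.adMatrix h p c * e.lieStruct u r c = e.coordExt p
      (ρ h * ((e.basis u : A) * e.basis r - e.basis r * e.basis u) * ρ h⁻¹) := by
    intro u
    have h2 : (e.basis u : A) * e.basis r - e.basis r * e.basis u =
        ∑ c, e.lieStruct u r c • (e.basis c : A) := by
      have := congrArg (lieAlg ρ).subtype (e.basis.sum_repr (lieBr (e.basis u) (e.basis r)))
      simp only [map_sum, map_smul] at this
      exact this.symm
    rw [h2, Finset.mul_sum, Finset.sum_mul, map_sum]
    refine Finset.sum_congr rfl fun c _ => ?_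
    rw [mul_smul_comm, smul_mul_assoc, map_smul, adMatrix_apply, smul_eq_mul, mul_comm]
  have h3 : ∀ c, e.lieStruct l c p =
      e.coordExt p ((e.basis l : A) * e.basis c - e.basis c * e.basis l) := by
    intro c
    exact (e.coordExt_coe p (lieBr (e.basis l) (e.basis c))).symm
  have h4 : ∑ u, e.adMatrix h l u • (ρ h * ((e.basis u : A) * e.basis r - e.basis r * e.basis u)
      * ρ h⁻¹) = ρ h * ((∑ u, e.adMatrix h l u • (e.basis u : A)) * e.basis r -
        e.basis r * ∑ u, e.adMatrix h l u • (e.basis u : A)) * ρ h⁻¹ := by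
    simp only [Finset.sum_mul, Finset.mul_sum, mul_sub, sub_mul, smul_mul_assoc, mul_smul_comm,
      smul_sub, Finset.sum_sub_distrib]
  have h5 : ∑ c, e.adMatrix h c r • ((e.basis l : A) * e.basis c - e.basis c * e.basis l) =
      (e.basis l : A) * (∑ c, e.adMatrix h c r • (e.basis c : A)) -
        (∑ c, e.adMatrix h c r • (e.basis c : A)) * e.basis l := by
    simp only [Finset.sum_mul, Finset.mul_sum, smul_mul_assoc, mul_smul_comm,
      smul_sub, Finset.sum_sub_distrib]
  calc ∑ u, e.adMatrix h l u * ∑ c, e.adMatrix h p c * e.lieStruct u r c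
      = e.coordExt p (∑ u, e.adMatrix h l u • (ρ h * ((e.basis u : A) * e.basis r -
          e.basis r * e.basis u) * ρ h⁻¹)) := by
        rw [map_sum]
        exact Finset.sum_congr rfl fun u _ => by rw [h1, map_smul, smul_eq_mul]
    _ = e.coordExt p (∑ c, e.adMatrix h c r • ((e.basis l : A) * e.basis c -
          e.basis c * e.basis l)) := by
        rw [h4, h5, ← inv_conj_basis, ← conj_basis]
        congr 1
        have e1 : ∀ x : A, ρ h * (ρ h⁻¹ * x) = x := fun x => by
          rw [← mul_assoc, rep_mul_rep_inv, one_mul]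
        simp only [mul_sub, sub_mul, mul_assoc, e1, rep_mul_rep_inv, mul_one]
    _ = _ := by
        rw [map_sum]
        exact Finset.sum_congr rfl fun c _ => by rw [h3, map_smul, smul_eq_mul, mul_comm]

theorem move_apply_self (a : Idx n d) (g : Fin n → G) (t : ℝ) :
    e.move a g t (ofLex a).1 = g (ofLex a).1 * e.curve (ofLex a).2 t := by
  simp [move]

theorem move_apply_of_ne (a : Idx n d) (g : Fin n → G) (t : ℝ) {i : Fin n}
    (hi : (ofLex a).1 ≠ i) : e.move a g t i = g i := by
  rw [move, Function.update_of_ne (Ne.symm hi)]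

theorem map_move_of_ne (τ : SignedInj m n) (b : Idx n d) (g : Fin n → G) (t : ℝ) {j : Fin m}
    (hj : (ofLex b).1 ≠ τ.idx j) : τ.map (e.move b g t) j = τ.map g j := by
  simp only [SignedInj.map, e.move_apply_of_ne b g t hj]

theorem map_move_inverted (τ : SignedInj m n) (b : Idx n d) (g : Fin n → G) (t : ℝ) {j : Fin m}
    (hj : (ofLex b).1 = τ.idx j) (hτ : τ.inverted j = true) :
    τ.map (e.move b g t) j = (e.curve (ofLex b).2 t)⁻¹ * τ.map g j := by
  simp only [SignedInj.map, if_pos hτ, ← hj, move_apply_self, mul_inv_rev]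

/-- The differential of a structure map in the orthonormal frames. -/
theorem hasDerivAt_toOps_map_move (τ : SignedInj m n) (b : Idx n d) (g : Fin n → G) :
    HasDerivAt (fun t => toOps ρ (τ.map (e.move b g t)))
      (∑ a, e.tangentMatrix τ g b a • e.frameField a (τ.map g)) 0 := by
  rw [hasDerivAt_pi]
  intro j
  have h0 : (∑ a, e.tangentMatrix τ g b a • e.frameField a (τ.map g)) j =
      ∑ l, (if (ofLex b).1 = τ.idx j then e.tangentBlock τ g j (ofLex b).2 l else 0) •
        (ρ (τ.map g j) * (e.basis l : A)) := by
    rw [Finset.sum_apply, sum_idx, Finset.sum_eq_single j]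
    · refine Finset.sum_congr rfl fun l _ => ?_
      simp only [tangentMatrix_apply, ofLex_toLex, Pi.smul_apply, frameField, Pi.single_eq_same]
      rfl
    · intro i _ hi
      refine Finset.sum_eq_zero fun l _ => ?_
      simp [frameField, Pi.single_eq_of_ne (Ne.symm hi)]
    · simp
  rw [h0]
  simp only [toOps]
  by_cases hj : (ofLex b).1 = τ.idx j
  · simp only [if_pos hj]
    by_cases hτ : τ.inverted j = true
    · simp only [e.map_move_inverted τ b g _ hj hτ, map_mul]
      have h1 : ∑ l, e.tangentBlock τ g j (ofLex b).2 l • (ρ (τ.map g j) * (e.basis l : A)) =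
          -(e.basis (ofLex b).2 : A) * ρ (τ.map g j) := by
        simp only [tangentBlock, if_pos hτ, Matrix.neg_apply, neg_smul, Finset.sum_neg_distrib,
          ← mul_smul_comm, ← Finset.mul_sum]
        rw [← inv_conj_basis, mul_neg, ← mul_assoc, ← mul_assoc, rep_mul_rep_inv, one_mul, neg_mul]
      rw [h1]
      exact (hasDerivAt_rep_inv (e.curve_zero _) (e.hasDerivAt_curve _)).mul_const _
    · have h1 : ∀ t, ρ (τ.map (e.move b g t) j) =
          ρ (τ.map g j) * ρ (e.curve (ofLex b).2 t) := by
        intro t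
        simp only [SignedInj.map, if_neg hτ, ← hj, move_apply_self, map_mul]
      have h2 : ∑ l, e.tangentBlock τ g j (ofLex b).2 l • (ρ (τ.map g j) * (e.basis l : A)) =
          ρ (τ.map g j) * (e.basis (ofLex b).2 : A) := by
        simp [tangentBlock, if_neg hτ, Matrix.one_apply]
      simp only [h1, h2]
      exact (e.hasDerivAt_curve _).const_mul _
  · simp only [if_neg hj, zero_smul, Finset.sum_const_zero, e.map_move_of_ne τ b g _ hj]
    exact hasDerivAt_const _ _

theorem tangentMatrix_mul_apply (τ : SignedInj m n) (g : Fin n → G) (Z : Matrix (Idx m d) (Idx m d) ℝ)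
    (b : Idx n d) (a : Idx m d) (j : Fin m) (hj : (ofLex b).1 = τ.idx j) :
    (e.tangentMatrix τ g * Z) b a =
      ∑ c, e.tangentBlock τ g j (ofLex b).2 c * Z (toLex (j, c)) a := by
  rw [Matrix.mul_apply, sum_idx, Finset.sum_eq_single j]
  · refine Finset.sum_congr rfl fun c _ => ?_
    simp [tangentMatrix_apply, hj]
  · intro i _ hi
    refine Finset.sum_eq_zero fun c _ => ?_
    have : ¬ (ofLex b).1 = τ.idx i := fun h => hi (τ.idx.injective (h.symm.trans hj))
    simp [tangentMatrix_apply, this]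
  · simp

theorem mul_tangentMatrix_apply (τ : SignedInj m n) (g : Fin n → G) (Z : Matrix (Idx n d) (Idx n d) ℝ)
    (b : Idx n d) (a : Idx m d) :
    (Z * e.tangentMatrix τ g) b a =
      ∑ c, Z b (toLex (τ.idx (ofLex a).1, c)) * e.tangentBlock τ g (ofLex a).1 c (ofLex a).2 := by
  rw [Matrix.mul_apply, sum_idx, Finset.sum_eq_single (τ.idx (ofLex a).1)]
  · refine Finset.sum_congr rfl fun c _ => ?_
    simp [tangentMatrix_apply]
  · intro i _ hi
    refine Finset.sum_eq_zero fun c _ => ?_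
    simp [tangentMatrix_apply, hi]
  · simp

/-- The isometries `A_g` are parallel: in the orthonormal frames, `∇_{e_b} A = ∑ A_{ba} A ∇_{e_a}`. -/
theorem hasDerivAt_tangentMatrix_move (τ : SignedInj m n) (b : Idx n d) (g : Fin n → G)
    (b' : Idx n d) (a : Idx m d) :
    HasDerivAt (fun t => e.tangentMatrix τ (e.move b g t) b' a)
      ((∑ a', e.tangentMatrix τ g b a' • (e.tangentMatrix τ g * e.leviCivita a') -
        e.leviCivita b * e.tangentMatrix τ g) b' a) 0 := by
  obtain ⟨i, l⟩ := b
  obtain ⟨i', p⟩ := b'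
  obtain ⟨j, r⟩ := a
  change HasDerivAt (fun t => e.tangentMatrix τ (e.move (toLex (i, l)) g t) (toLex (i', p))
    (toLex (j, r))) ((∑ a', e.tangentMatrix τ g (toLex (i, l)) a' •
      (e.tangentMatrix τ g * e.leviCivita a') -
        e.leviCivita (toLex (i, l)) * e.tangentMatrix τ g) (toLex (i', p)) (toLex (j, r))) 0
  rw [Matrix.sub_apply, mul_tangentMatrix_apply, Matrix.sum_apply]
  simp only [Matrix.smul_apply, ofLex_toLex, leviCivita_eq, structConst_eq]
  -- everything is block diagonal: only the blocks with `i = i' = τ.idx j` contribute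
  have h0 : ∑ a', e.tangentMatrix τ g (toLex (i, l)) a' •
      (e.tangentMatrix τ g * e.leviCivita a') (toLex (i', p)) (toLex (j, r)) =
      if i = τ.idx j ∧ i' = τ.idx j then
        (∑ u, e.tangentBlock τ g j l u * ∑ c, e.tangentBlock τ g j p c * e.lieStruct u r c) / 2
      else 0 := by
    rw [sum_idx, Finset.sum_eq_single j]
    · by_cases hi' : i' = τ.idx j
      · by_cases hi : i = τ.idx j
        · rw [if_pos ⟨hi, hi'⟩, Finset.sum_div]
          refine Finset.sum_congr rfl fun u _ => ?_
          rw [tangentMatrix_mul_apply _ _ _ _ (toLex (i', p)) _ j hi', tangentMatrix_apply, smul_eq_mul,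
            mul_div_assoc, Finset.sum_div]
          simp [hi, leviCivita_eq, structConst_eq, mul_div_assoc]
        · simp [tangentMatrix_apply, hi]
      · rw [if_neg fun h => hi' h.2]
        refine Finset.sum_eq_zero fun u _ => ?_
        rw [Matrix.mul_apply, Finset.sum_eq_zero, smul_zero]
        intro c _
        by_cases hc : (ofLex c).1 = j
        · simp [tangentMatrix_apply, hc, hi']
        · simp [leviCivita_eq, structConst_eq, Ne.symm hc]
    · intro j' _ hj'
      refine Finset.sum_eq_zero fun u _ => ?_
      by_cases hi : i = τ.idx j'
      · by_cases hi' : i' = τ.idx j'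
        · rw [tangentMatrix_mul_apply _ _ _ _ (toLex (i', p)) _ j' hi']
          simp [leviCivita_eq, structConst_eq, hj']
        · rw [Matrix.mul_apply, Finset.sum_eq_zero, smul_zero]
          intro c _
          simp [leviCivita_eq, structConst_eq, hj']
      · simp [tangentMatrix_apply, hi]
    · simp
  rw [h0]
  simp only [tangentMatrix_apply, ofLex_toLex]
  by_cases hi' : i' = τ.idx j
  swap
  · have h1 : ∀ c, (if i = τ.idx j ∧ τ.idx j = i' then e.lieStruct l c p else 0) = 0 := fun c =>
      if_neg fun h => hi' h.2.symm
    refine HasDerivAt.congr_deriv (f' := 0) ((hasDerivAt_const (0 : ℝ) (0 : ℝ)).congr_of_eventuallyEq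
      (Filter.Eventually.of_forall fun t => if_neg hi')) (Eq.symm ?_)
    refine Eq.trans (congrArg₂ (fun x y : ℝ => x - y) (if_neg fun h => hi' (And.right h))
      (Finset.sum_eq_zero fun c _ => ?_)) (sub_zero (0 : ℝ))
    exact (congrArg (fun x => x / 2 * e.tangentBlock τ g j c r) (h1 c)).trans (by simp)
  by_cases hi : i = τ.idx j
  swap
  · simp only [hi, false_and, if_false, zero_div, zero_mul, Finset.sum_const_zero, sub_zero]
    have h1 : ∀ t, e.tangentBlock τ (e.move (toLex (i, l)) g t) j = e.tangentBlock τ g j := by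
      intro t
      simp only [tangentBlock]
      rw [e.map_move_of_ne τ (toLex (i, l)) g t (by simpa using hi)]
    simp only [h1]
    exact hasDerivAt_const _ _
  simp only [hi, hi', and_self, if_true]
  by_cases hτ : τ.inverted j = true
  -- on an inverted coordinate the block is `-Ad`; its derivative is `ad ∘ Ad`, and the two
  -- connections contribute one half each
  · have h1 : ∀ g', e.tangentBlock τ g' j = -e.adMatrix (τ.map g' j) := fun g' => by
      simp only [tangentBlock, if_pos hτ]
    have h2 : ∀ t, τ.map (e.move (toLex (τ.idx j, l)) g t) j =
        (e.curve l t)⁻¹ * τ.map g j := fun t =>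
      e.map_move_inverted τ (toLex (τ.idx j, l)) g t rfl hτ
    simp only [h1, h2, Matrix.neg_apply, adMatrix_mul, adMatrix_inv, Matrix.mul_apply,
      Matrix.transpose_apply, neg_mul, mul_neg, Finset.sum_neg_distrib, neg_neg,
      sum_adMatrix_lieStruct]
    have h3 : (∑ c, e.lieStruct l c p * e.adMatrix (τ.map g j) c r) / 2 -
        -∑ c, e.lieStruct l c p / 2 * e.adMatrix (τ.map g j) c r =
        -∑ c, e.lieStruct l p c * e.adMatrix (τ.map g j) c r := by
      rw [Finset.sum_div, sub_neg_eq_add, ← Finset.sum_add_distrib, ← Finset.sum_neg_distrib]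
      refine Finset.sum_congr rfl fun c _ => ?_
      rw [e.lieStruct_skew l p c]
      ring
    rw [h3]
    exact (HasDerivAt.fun_sum fun c _ => (e.hasDerivAt_adMatrix_curve l c p).mul_const _).neg
  -- on the other coordinates the block is constant and the two connections agree
  · have h1 : ∀ g', e.tangentBlock τ g' j = 1 := fun g' => by
      simp only [tangentBlock, if_neg hτ]
    simp only [h1]
    have h2 : (∑ u, (1 : Matrix (Fin d) (Fin d) ℝ) l u * ∑ c, (1 : Matrix (Fin d) (Fin d) ℝ) p c *
        e.lieStruct u r c) / 2 - ∑ c, e.lieStruct l c p / 2 * (1 : Matrix (Fin d) (Fin d) ℝ) c r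
        = 0 := by
      simp [Matrix.one_apply]
    rw [h2]
    exact hasDerivAt_const _ _

variable {κ : Type*} [Fintype κ]

/-- The covariant derivative of a pull-back is the pull-back of the covariant derivative along the
transported vector, because `Cl(A_g)` is parallel. -/
theorem covDeriv_pullback (τ : SignedInj m n) {ξ : (Fin m → G) → Fib (Idx m d) κ}
    (hξ : ξ ∈ smoothFun m (Fib (Idx m d) κ) ρ) (b : Idx n d) (g : Fin n → G) :
    e.covDeriv (e.pullback τ ξ) b g = ∑ a, (e.tangentMatrix τ g b a : ℂ) •
      onFib (cliffMapLin (e.tangentMatrix τ g)) (e.covDeriv ξ a (τ.map g)) := by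
  obtain ⟨F, hF, hξF⟩ := hξ
  have hd := hF.differentiableAt (τ.map g)
  have h1 : HasDerivAt (fun t => ξ (τ.map (e.move b g t)))
      (∑ a, (e.tangentMatrix τ g b a : ℂ) • e.frameDeriv ξ a (τ.map g)) 0 := by
    have h2 : HasFDerivAt F (fderiv ℝ F (toOps ρ (τ.map g)))
        (toOps ρ (τ.map (e.move b g 0))) := by
      rw [move_zero]; exact hd.hasFDerivAt
    have h3 := h2.comp_hasDerivAt (0 : ℝ) (e.hasDerivAt_toOps_map_move τ b g)
    have h4 : fderiv ℝ F (toOps ρ (τ.map g))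
        (∑ a, e.tangentMatrix τ g b a • e.frameField a (τ.map g)) =
        ∑ a, (e.tangentMatrix τ g b a : ℂ) • e.frameDeriv ξ a (τ.map g) := by
      rw [map_sum]
      refine Finset.sum_congr rfl fun a _ => ?_
      rw [map_smul, e.frameDeriv_eq_fderiv hξF hd, linField_toOps]
      exact (Complex.coe_smul _ _).symm
    rw [h4] at h3
    refine h3.congr_of_eventuallyEq (Filter.Eventually.of_forall fun t => ?_)
    exact hξF _
  have h2 := HasDerivAt.onFib_cliffMapLin (e.hasDerivAt_tangentMatrix_move τ b g) h1
  have h3 := h2.deriv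
  simp only [move_zero, ← pullback_eq, ← frameDeriv_def] at h3
  rw [covDeriv, h3, pullback_eq, ← onFib_comp,
    cliffDeriv_comp_cliffMapLin _ (e.leviCivita_skew b), add_right_comm, ← onFib_add,
    ← cliffTwist_add, sub_add_cancel, cliffTwist_sum, onFib_sum, map_sum, ← Finset.sum_add_distrib]
  refine Finset.sum_congr rfl fun a _ => ?_
  rw [onFib_smul, ← cliffMapLin_comp_cliffDeriv _ (e.tangentMatrix_orthogonal τ g), onFib_comp,
    map_smul, ← smul_add, ← map_add, add_comm, covDeriv]

/-- The Euler-Dirac operator commutes with the pull-back along the structure maps. -/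
theorem eulerDirac_pullback (τ : SignedInj m n) {ξ : (Fin m → G) → Fib (Idx m d) κ}
    (hξ : ξ ∈ smoothFun m (Fib (Idx m d) κ) ρ) :
    e.eulerDirac (e.pullback τ ξ) = e.pullback τ (e.eulerDirac ξ) := by
  funext g
  set A := e.tangentMatrix τ g with hA
  have hAo : A.transpose * A = 1 := e.tangentMatrix_orthogonal τ g
  -- `Cl(A)` is multiplicative, and it sends `e_a` to `∑ A_{ba} e_b`
  have h1 : ∀ (a : Idx m d) (x : Fib (Idx m d) κ),
      ∑ b, (A b a : ℂ) • onFib (LinearMap.mulLeft ℂ (cliffGen b)) (onFib (cliffMapLin A) x) =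
        onFib (cliffMapLin A) (onFib (LinearMap.mulLeft ℂ (cliffGen a)) x) := by
    intro a x
    refine fib_ext fun s => ?_
    simp only [map_sum, map_smul, fibSlice_onFib, LinearMap.mulLeft_apply]
    rw [cliffGen, cliffMapLin_ι_mul A hAo]
    have h2 : (A.map (fun r : ℝ => (r : ℂ))).mulVec (Pi.single a 1) =
        ∑ b, (A b a : ℂ) • (Pi.single b 1 : Idx n d → ℂ) := by
      ext j
      simp [Finset.sum_apply, Pi.single_apply]
    rw [h2, map_sum, Finset.sum_mul]
    refine Finset.sum_congr rfl fun b _ => ?_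
    rw [map_smul, smul_mul_assoc, cliffGen]
  rw [pullback_eq, eulerDirac, eulerDirac, map_sum]
  simp only [e.covDeriv_pullback τ hξ, map_sum, map_smul]
  rw [Finset.sum_comm]
  exact Finset.sum_congr rfl fun a _ => h1 a _

end OrthonormalFrame

end Naturality

/-! ### The pull-back of square integrable sections -/

section Topology

variable {A : Type*} [NormedRing A] [NormedAlgebra ℝ A] [FiniteDimensional ℝ A]
  {G : Type*} [Group G] [TopologicalSpace G] [CompactSpace G] {ρ : G →* A}

theorem t2Space_of_rep (hρ : Continuous ρ) (hρi : Function.Injective ρ) : T2Space G :=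
  T2Space.of_injective_continuous hρi hρ

theorem secondCountableTopology_of_rep (hρ : Continuous ρ) (hρi : Function.Injective ρ) :
    SecondCountableTopology G := by
  have : ProperSpace A := FiniteDimensional.proper ℝ A
  exact (hρ.isClosedEmbedding hρi).isEmbedding.secondCountableTopology

end Topology

section MeasurePreserving

variable {G : Type*} [Group G] [TopologicalSpace G] [IsTopologicalGroup G] [CompactSpace G]
  [MeasurableSpace G] [BorelSpace G] (μ : Measure G) [μ.IsHaarMeasure] [IsProbabilityMeasure μ]
  {m n : ℕ}

theorem measurePreserving_signedInj_map (τ : SignedInj m n) :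
    MeasurePreserving (τ.map (G := G)) (Measure.pi fun _ => μ) (Measure.pi fun _ => μ) := by
  have hinv : μ.IsInvInvariant := isInvInvariant_of_compactSpace μ
  have hτm : Measurable (τ.map (G := G)) := by
    refine measurable_pi_lambda _ fun j => ?_
    simp only [SignedInj.map]
    split_ifs
    · exact (measurable_pi_apply _).inv
    · exact measurable_pi_apply _
  refine ⟨hτm, (Measure.pi_eq fun s hs => ?_).symm⟩
  rw [Measure.map_apply hτm (MeasurableSet.univ_pi hs)]
  let f : Fin m → G → G := fun j x => if τ.inverted j then x⁻¹ else x
  have hf : ∀ j, MeasurePreserving (f j) μ μ := by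
    intro j
    by_cases h : τ.inverted j = true
    · simp only [f, if_pos h]
      exact Measure.measurePreserving_inv μ
    · simp only [f, if_neg h]
      exact MeasurePreserving.id μ
  -- the preimage of the box `∏ s j` is the box `∏ t i`; `t i = G` if the coordinate `i` is deleted
  let t : Fin n → Set G := fun i => ⋂ j, ⋂ _ : τ.idx j = i, f j ⁻¹' s j
  have ht : τ.map ⁻¹' (Set.univ.pi s) = Set.univ.pi t := by
    ext g
    simp only [Set.mem_preimage, Set.mem_pi, Set.mem_univ, true_implies, t, Set.mem_iInter]
    constructor
    · rintro h i j rfl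
      exact h j
    · intro h j
      exact h _ j rfl
  rw [ht, Measure.pi_pi]
  symm
  refine Fintype.prod_of_injective τ.idx τ.idx.injective _ _ (fun i hi => ?_) fun j => ?_
  · have : t i = Set.univ := by
      ext x
      simp only [t, Set.mem_iInter, Set.mem_univ, iff_true]
      intro j hj
      exact absurd ⟨j, hj⟩ hi
    rw [this, measure_univ]
  · have : t (τ.idx j) = f j ⁻¹' s j := by
      ext x
      simp only [t, Set.mem_iInter]
      refine ⟨fun h => h j rfl, fun h j' hj' => ?_⟩
      obtain rfl := τ.idx.injective hj'
      exact h
    rw [this, (hf j).measure_preimage (hs j).nullMeasurableSet]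

end MeasurePreserving

section PullbackL2

variable {A : Type*} [NormedRing A] [NormedAlgebra ℝ A] [FiniteDimensional ℝ A]
  {G : Type*} [Group G] [TopologicalSpace G] [IsTopologicalGroup G] [CompactSpace G]
  [SecondCountableTopology G] [MeasurableSpace G] [BorelSpace G] {ρ : G →* A} (hρ : Continuous ρ)
  {B : BiinvariantMetric ρ} {d : ℕ} (e : OrthonormalFrame B d)
  (μ : Measure G) [μ.IsHaarMeasure] [IsProbabilityMeasure μ]
  {κ : Type*} [Fintype κ] {l m n : ℕ}

namespace OrthonormalFrame

theorem pullback_congr_ae (τ : SignedInj m n) {ξ η : (Fin m → G) → Fib (Idx m d) κ}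
    (h : ξ =ᵐ[Measure.pi fun _ => μ] η) :
    e.pullback τ ξ =ᵐ[Measure.pi fun _ => μ] e.pullback τ η := by
  filter_upwards [(measurePreserving_signedInj_map μ τ).quasiMeasurePreserving.ae h] with g hg
  rw [pullback_eq, pullback_eq, hg]

theorem aestronglyMeasurable_pullback (hρ : Continuous ρ) (τ : SignedInj m n) {ξ : (Fin m → G) → Fib (Idx m d) κ}
    (h : AEStronglyMeasurable ξ (Measure.pi fun _ => μ)) :
    AEStronglyMeasurable (e.pullback τ ξ) (Measure.pi fun _ => μ) := by
  have h1 : Continuous fun p : (Fin n → G) × Fib (Idx m d) κ =>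
      onFib (cliffMapLin (e.tangentMatrix τ p.1)) p.2 :=
    Continuous.onFib_cliffMapLin
      (fun b a => (e.continuous_tangentMatrix hρ τ b a).comp continuous_fst) continuous_snd
  have h2 : AEStronglyMeasurable (fun g : Fin n → G => (g, ξ (τ.map g)))
      (Measure.pi fun _ => μ) :=
    (aestronglyMeasurable_id (α := Fin n → G)).prodMk
      (h.comp_measurePreserving (measurePreserving_signedInj_map μ τ))
  refine (h1.comp_aestronglyMeasurable h2).congr (Filter.Eventually.of_forall fun g => ?_)
  exact (e.pullback_eq τ ξ g).symm

theorem eLpNorm_pullback (τ : SignedInj m n) {ξ : (Fin m → G) → Fib (Idx m d) κ}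
    (h : AEStronglyMeasurable ξ (Measure.pi fun _ => μ)) :
    eLpNorm (e.pullback τ ξ) 2 (Measure.pi fun _ => μ) =
      eLpNorm ξ 2 (Measure.pi fun _ => μ) := by
  rw [← eLpNorm_comp_measurePreserving h (measurePreserving_signedInj_map μ τ)]
  exact eLpNorm_congr_norm_ae (Filter.Eventually.of_forall fun g => e.norm_pullback τ ξ g)

theorem memLp_pullback (hρ : Continuous ρ) (τ : SignedInj m n) (v : SpinorL2 μ m d κ) :
    MemLp (e.pullback τ v) 2 (Measure.pi fun _ => μ) :=
  ⟨e.aestronglyMeasurable_pullback μ hρ τ (Lp.aestronglyMeasurable v), by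
    rw [e.eLpNorm_pullback μ τ (Lp.aestronglyMeasurable v)]; exact Lp.eLpNorm_lt_top v⟩

/-- The isometry `P^*` of the spaces of square integrable sections. -/
noncomputable def pullbackL2 (τ : SignedInj m n) : SpinorL2 μ m d κ →ₗᵢ[ℂ] SpinorL2 μ n d κ where
  toFun v := (e.memLp_pullback μ hρ τ v).toLp _
  map_add' v w := by
    refine Lp.ext ?_
    refine (MemLp.coeFn_toLp _).trans ?_
    refine ((e.pullback_congr_ae μ τ (Lp.coeFn_add v w)).trans ?_).trans (Lp.coeFn_add _ _).symm
    rw [pullback_add]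
    exact ((MemLp.coeFn_toLp _).symm).add ((MemLp.coeFn_toLp _).symm)
  map_smul' c v := by
    refine Lp.ext ?_
    refine (MemLp.coeFn_toLp _).trans ?_
    refine ((e.pullback_congr_ae μ τ (Lp.coeFn_smul c v)).trans ?_).trans (Lp.coeFn_smul _ _).symm
    rw [pullback_smul]
    exact ((MemLp.coeFn_toLp _).symm).const_smul c
  norm_map' v := by
    change ‖(e.memLp_pullback μ hρ τ v).toLp _‖ = _
    rw [Lp.norm_toLp, e.eLpNorm_pullback μ τ (Lp.aestronglyMeasurable v), Lp.norm_def]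

theorem coeFn_pullbackL2 (τ : SignedInj m n) (v : SpinorL2 μ m d κ) :
    e.pullbackL2 hρ μ τ v =ᵐ[Measure.pi fun _ => μ] e.pullback τ v :=
  MemLp.coeFn_toLp (e.memLp_pullback μ hρ τ v)

theorem eq_pullbackL2_iff (τ : SignedInj m n) (v : SpinorL2 μ m d κ) (u : SpinorL2 μ n d κ) :
    u =ᵐ[Measure.pi fun _ => μ] e.pullback τ v ↔ u = e.pullbackL2 hρ μ τ v :=
  ⟨fun h => Lp.ext (h.trans (e.coeFn_pullbackL2 hρ μ τ v).symm),
    fun h => h ▸ e.coeFn_pullbackL2 hρ μ τ v⟩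

theorem pullbackL2_comp (υ : SignedInj l m) (τ : SignedInj m n) (v : SpinorL2 μ l d κ) :
    e.pullbackL2 hρ μ (υ.comp τ) v = e.pullbackL2 hρ μ τ (e.pullbackL2 hρ μ υ v) := by
  rw [← eq_pullbackL2_iff]
  refine (e.coeFn_pullbackL2 hρ μ _ v).trans ?_
  rw [pullback_comp]
  exact e.pullback_congr_ae μ τ (e.coeFn_pullbackL2 hρ μ υ v).symm

theorem pullbackL2_id (v : SpinorL2 μ n d κ) :
    e.pullbackL2 hρ μ (SignedInj.id n) v = v := by
  symm
  rw [← eq_pullbackL2_iff, pullback_id]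

variable (ρ) in
/-- The vector of `L²(Gⁿ, Cl(TGⁿ) ⊗ ℂ^κ)` given by a smooth section. -/
noncomputable def _root_.smoothL2 (hρ : Continuous ρ) (n d : ℕ) (κ : Type*) [Fintype κ] :
    smoothFun n (Fib (Idx n d) κ) ρ →ₗ[ℂ] SpinorL2 μ n d κ :=
  (ContinuousMap.toLp 2 (Measure.pi fun _ => μ) ℂ).toLinearMap ∘ₗ
    { toFun := fun ξ => ⟨ξ.1, smoothFun_continuous hρ ξ.2⟩
      map_add' := fun _ _ => rfl
      map_smul' := fun _ _ => rfl }

theorem _root_.coeFn_smoothL2 (ξ : smoothFun n (Fib (Idx n d) κ) ρ) :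
    smoothL2 ρ μ hρ n d κ ξ =ᵐ[Measure.pi fun _ => μ] (ξ : (Fin n → G) → Fib (Idx n d) κ) :=
  ContinuousMap.coeFn_toLp (𝕜 := ℂ) (Measure.pi fun _ => μ)
    (⟨ξ.1, smoothFun_continuous hρ ξ.2⟩ : C(Fin n → G, Fib (Idx n d) κ))

theorem _root_.eq_smoothL2_iff (ξ : smoothFun n (Fib (Idx n d) κ) ρ) (u : SpinorL2 μ n d κ) :
    u =ᵐ[Measure.pi fun _ => μ] (ξ : (Fin n → G) → Fib (Idx n d) κ) ↔
      u = smoothL2 ρ μ hρ n d κ ξ :=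
  ⟨fun h => Lp.ext (h.trans (coeFn_smoothL2 hρ μ ξ).symm),
    fun h => h ▸ coeFn_smoothL2 hρ μ ξ⟩

theorem _root_.smoothL2_injective : Function.Injective (smoothL2 ρ μ hρ n d κ) := by
  intro ξ η h
  have h1 := ContinuousMap.toLp_injective (p := 2) (𝕜 := ℂ) (Measure.pi fun _ : Fin n => μ) h
  exact Subtype.ext (congrArg (fun f : C(Fin n → G, Fib (Idx n d) κ) => ⇑f) h1)

theorem _root_.inner_smoothL2 (ξ η : smoothFun n (Fib (Idx n d) κ) ρ) :
    inner ℂ (smoothL2 ρ μ hρ n d κ ξ) (smoothL2 ρ μ hρ n d κ η) =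
      ∫ g, inner ℂ (ξ.1 g) (η.1 g) ∂(Measure.pi fun _ => μ) := by
  rw [L2.inner_def]
  refine integral_congr_ae ?_
  filter_upwards [coeFn_smoothL2 hρ μ ξ, coeFn_smoothL2 hρ μ η] with g h1 h2
  rw [h1, h2]

/-- The pull-back of smooth sections. -/
noncomputable def pullbackSmooth (τ : SignedInj m n) (ξ : smoothFun m (Fib (Idx m d) κ) ρ) :
    smoothFun n (Fib (Idx n d) κ) ρ := ⟨e.pullback τ ξ.1, e.pullback_mem τ ξ.2⟩

theorem pullbackL2_smoothL2 (τ : SignedInj m n) (ξ : smoothFun m (Fib (Idx m d) κ) ρ) :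
    e.pullbackL2 hρ μ τ (smoothL2 ρ μ hρ m d κ ξ) =
      smoothL2 ρ μ hρ n d κ (e.pullbackSmooth τ ξ) := by
  symm
  rw [← eq_pullbackL2_iff]
  refine (coeFn_smoothL2 hρ μ _).trans ?_
  exact e.pullback_congr_ae μ τ (coeFn_smoothL2 hρ μ ξ).symm

/-- The Euler-Dirac operator on smooth sections, as a linear map. -/
noncomputable def eulerDiracLin (n : ℕ) (κ : Type*) [Fintype κ] :
    smoothFun n (Fib (Idx n d) κ) ρ →ₗ[ℂ] smoothFun n (Fib (Idx n d) κ) ρ :=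
  e.extD + e.extDAdj

theorem coe_eulerDiracLin (ξ : smoothFun n (Fib (Idx n d) κ) ρ) :
    (e.eulerDiracLin n κ ξ : (Fin n → G) → Fib (Idx n d) κ) = e.eulerDirac ξ.1 :=
  (e.eulerDirac_eq ξ).symm

theorem eulerDiracLin_pullbackSmooth (τ : SignedInj m n)
    (ξ : smoothFun m (Fib (Idx m d) κ) ρ) :
    e.eulerDiracLin n κ (e.pullbackSmooth τ ξ) = e.pullbackSmooth τ (e.eulerDiracLin m κ ξ) := by
  refine Subtype.ext ?_
  change _ = e.pullback τ (e.eulerDiracLin m κ ξ).1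
  rw [coe_eulerDiracLin, coe_eulerDiracLin]
  exact e.eulerDirac_pullback τ ξ.2

theorem inner_smoothL2_eulerDiracLin (ξ η : smoothFun n (Fib (Idx n d) κ) ρ) :
    inner ℂ (smoothL2 ρ μ hρ n d κ (e.eulerDiracLin n κ ξ)) (smoothL2 ρ μ hρ n d κ η) =
      inner ℂ (smoothL2 ρ μ hρ n d κ ξ) (smoothL2 ρ μ hρ n d κ (e.eulerDiracLin n κ η)) := by
  rw [inner_smoothL2, inner_smoothL2, coe_eulerDiracLin, coe_eulerDiracLin]
  exact e.integral_inner_eulerDirac μ hρ ξ.2 η.2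

/-- The Euler-Dirac operator of `L²(Gⁿ, Cl(TGⁿ) ⊗ ℂ^κ)`, with the smooth sections as its domain. -/
noncomputable def diracL2 (n : ℕ) (κ : Type*) [Fintype κ] :
    SpinorL2 μ n d κ →ₗ.[ℂ] SpinorL2 μ n d κ where
  domain := LinearMap.range (smoothL2 ρ μ hρ n d κ)
  toFun := smoothL2 ρ μ hρ n d κ ∘ₗ e.eulerDiracLin n κ ∘ₗ
    (LinearEquiv.ofInjective _ (smoothL2_injective hρ μ)).symm.toLinearMap

theorem smoothL2_mem_domain (ξ : smoothFun n (Fib (Idx n d) κ) ρ) :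
    smoothL2 ρ μ hρ n d κ ξ ∈ (e.diracL2 hρ μ n κ).domain := ⟨ξ, rfl⟩

theorem diracL2_smoothL2 (ξ : smoothFun n (Fib (Idx n d) κ) ρ)
    (h : smoothL2 ρ μ hρ n d κ ξ ∈ (e.diracL2 hρ μ n κ).domain) :
    e.diracL2 hρ μ n κ ⟨smoothL2 ρ μ hρ n d κ ξ, h⟩ =
      smoothL2 ρ μ hρ n d κ (e.eulerDiracLin n κ ξ) := by
  change smoothL2 ρ μ hρ n d κ (e.eulerDiracLin n κ
    ((LinearEquiv.ofInjective _ (smoothL2_injective hρ μ)).symm ⟨_, h⟩)) = _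
  congr 2
  exact (LinearEquiv.ofInjective _ (smoothL2_injective hρ μ)).symm_apply_eq.2 (Subtype.ext rfl)

theorem diracL2_eq {v : SpinorL2 μ n d κ} (hv : v ∈ (e.diracL2 hρ μ n κ).domain)
    {ξ : smoothFun n (Fib (Idx n d) κ) ρ} (h : v = smoothL2 ρ μ hρ n d κ ξ) :
    e.diracL2 hρ μ n κ ⟨v, hv⟩ = smoothL2 ρ μ hρ n d κ (e.eulerDiracLin n κ ξ) := by
  subst h
  exact e.diracL2_smoothL2 hρ μ ξ hv

theorem isEulerDirac_diracL2 : e.IsEulerDirac μ (e.diracL2 hρ μ n κ) := by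
  refine ⟨fun v => ⟨?_, ?_⟩, ?_⟩
  · rintro ⟨ξ, rfl⟩
    exact ⟨ξ.1, ξ.2, coeFn_smoothL2 hρ μ ξ⟩
  · rintro ⟨ξ, hξ, h⟩
    exact ⟨⟨ξ, hξ⟩, ((eq_smoothL2_iff hρ μ ⟨ξ, hξ⟩ v).1 h).symm⟩
  · rintro ⟨v, hv⟩ ξ hξ h
    obtain rfl := (eq_smoothL2_iff hρ μ ⟨ξ, hξ⟩ v).1 h
    rw [diracL2_smoothL2]
    refine (coeFn_smoothL2 hρ μ _).trans ?_
    rw [coe_eulerDiracLin]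

theorem diracL2_pullbackL2 (τ : SignedInj m n) {v : SpinorL2 μ m d κ}
    (hv : v ∈ (e.diracL2 hρ μ m κ).domain) :
    ∃ h : e.pullbackL2 hρ μ τ v ∈ (e.diracL2 hρ μ n κ).domain,
      e.diracL2 hρ μ n κ ⟨e.pullbackL2 hρ μ τ v, h⟩ =
        e.pullbackL2 hρ μ τ (e.diracL2 hρ μ m κ ⟨v, hv⟩) := by
  obtain ⟨ξ, rfl⟩ := id hv
  have h := e.pullbackL2_smoothL2 hρ μ τ ξ
  refine ⟨h ▸ e.smoothL2_mem_domain hρ μ _, ?_⟩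
  rw [e.diracL2_eq hρ μ _ h, diracL2_smoothL2, pullbackL2_smoothL2, eulerDiracLin_pullbackSmooth]

theorem mem_pureSubspace_iff (v : SpinorL2 μ n d κ) : v ∈ e.pureSubspace μ n κ ↔
    ∀ m, m < n → ∀ (τ : SignedInj m n) (w : SpinorL2 μ m d κ),
      inner ℂ (e.pullbackL2 hρ μ τ w) v = 0 := by
  rw [pureSubspace, Submodule.mem_orthogonal]
  constructor
  · intro h m hm τ w
    exact h _ (Submodule.subset_span ⟨m, hm, τ, w, e.coeFn_pullbackL2 hρ μ τ w⟩)
  · intro h u hu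
    induction hu using Submodule.span_induction with
    | mem u hu =>
      obtain ⟨m, hm, τ, w, hu⟩ := hu
      rw [(e.eq_pullbackL2_iff hρ μ τ w u).1 hu]
      exact h m hm τ w
    | zero => simp
    | add x y _ _ hx hy => rw [inner_add_left, hx, hy, add_zero]
    | smul c x _ hx => rw [inner_smul_left, hx, mul_zero]

end OrthonormalFrame

end PullbackL2

/-! ### Product sections -/

section ProductSections

variable {A : Type*} [NormedRing A] [NormedAlgebra ℝ A] [FiniteDimensional ℝ A]
  {G : Type*} [Group G] [TopologicalSpace G]

/-- The smooth complex valued functions on `G`. -/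
def smoothScalars (ρ : G →* A) : StarSubalgebra ℂ C(G, ℂ) where
  carrier := {f | ∃ F : A → ℂ, (∀ g, ContDiffAt ℝ ∞ F (ρ g)) ∧ ∀ g, f g = F (ρ g)}
  mul_mem' := by
    rintro f f' ⟨F, hF, h⟩ ⟨F', hF', h'⟩
    exact ⟨fun x => F x * F' x, fun g => (hF g).mul (hF' g), fun g => by simp [h, h']⟩
  add_mem' := by
    rintro f f' ⟨F, hF, h⟩ ⟨F', hF', h'⟩
    exact ⟨fun x => F x + F' x, fun g => (hF g).add (hF' g), fun g => by simp [h, h']⟩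
  algebraMap_mem' c := ⟨fun _ => c, fun g => contDiffAt_const, fun g => rfl⟩
  star_mem' := by
    rintro f ⟨F, hF, h⟩
    exact ⟨fun x => star (F x), fun g => Complex.conjCLE.contDiff.contDiffAt.comp _ (hF g),
      fun g => by simp [h]⟩

variable {ρ : G →* A} {n d : ℕ} {κ : Type*}

theorem prod_mem_smoothFun (f : Fin n → smoothScalars ρ) :
    (fun g : Fin n → G => ∏ j, (f j).1 (g j)) ∈ smoothFun n ℂ ρ := by
  choose F hF h using fun j => (f j).2
  refine ⟨fun x => ∏ j, F j (x j), fun g => ?_, fun g => ?_⟩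
  · refine contDiffAt_prod fun j _ => ?_
    exact (hF j (g j)).comp (toOps ρ g) (f := fun x : Fin n → A => x j) (by fun_prop)
  · exact Finset.prod_congr rfl fun j _ => h j (g j)

variable [Fintype κ]

open Classical in
/-- The section `g ↦ f₁(g₁) ⋯ fₙ(gₙ) e_S ⊗ w_s`, where `w_s` is a unit vector of `ℂ^κ`. -/
noncomputable def prodSection (f : Fin n → smoothScalars ρ) (q : Finset (Idx n d) × κ) :
    smoothFun n (Fib (Idx n d) κ) ρ :=
  ⟨fun g => (∏ j, (f j).1 (g j)) • EuclideanSpace.single q (1 : ℂ),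
    smoothFun_comp_clm (ContinuousLinearMap.toSpanSingleton ℂ
      (EuclideanSpace.single q (1 : ℂ) : Fib (Idx n d) κ)) (prod_mem_smoothFun f)⟩

open Classical in
theorem prodSection_apply (f : Fin n → smoothScalars ρ) (q : Finset (Idx n d) × κ)
    (g : Fin n → G) : (prodSection f q).1 g =
      (∏ j, (f j).1 (g j)) • EuclideanSpace.single q (1 : ℂ) := rfl

/-- A product of functions of one coordinate, as a continuous function. -/
noncomputable def prodFun (f : Fin n → smoothScalars ρ) : C(Fin n → G, ℂ) :=
  ⟨fun g => ∏ j, (f j).1 (g j), by fun_prop⟩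

/-- The algebra of functions on `Gⁿ` spanned by the products of smooth functions of one
coordinate. -/
noncomputable def prodAlgebra (ρ : G →* A) (n : ℕ) : StarSubalgebra ℂ C(Fin n → G, ℂ) where
  toSubalgebra := (Submodule.span ℂ (Set.range (prodFun (n := n) (ρ := ρ)))).toSubalgebra
    (Submodule.subset_span ⟨1, by ext g; simp [prodFun]⟩) (fun x y hx hy => by
      induction hx, hy using Submodule.span_induction₂ with
      | mem_mem x y hx hy =>
        obtain ⟨f, rfl⟩ := hx
        obtain ⟨f', rfl⟩ := hy
        exact Submodule.subset_span ⟨f * f', by ext g; simp [prodFun, Finset.prod_mul_distrib]⟩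
      | zero_left y hy => simp
      | zero_right x hx => simp
      | add_left x y z _ _ _ h1 h2 => rw [add_mul]; exact add_mem h1 h2
      | add_right x y z _ _ _ h1 h2 => rw [mul_add]; exact add_mem h1 h2
      | smul_left r x y _ _ h => rw [smul_mul_assoc]; exact Submodule.smul_mem _ _ h
      | smul_right r x y _ _ h => rw [mul_smul_comm]; exact Submodule.smul_mem _ _ h)
  star_mem' := by
    intro x hx
    change x ∈ Submodule.span ℂ _ at hx
    change star x ∈ Submodule.span ℂ _
    induction hx using Submodule.span_induction with
    | mem x hx =>
      obtain ⟨f, rfl⟩ := hx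
      exact Submodule.subset_span ⟨star f, by ext g; simp [prodFun]⟩
    | zero => simp
    | add x y _ _ hx hy => rw [star_add]; exact add_mem hx hy
    | smul c x _ hx => rw [star_smul]; exact Submodule.smul_mem _ _ hx

theorem prodAlgebra_separatesPoints (hρ : Continuous ρ) (hρi : Function.Injective ρ) :
    (prodAlgebra ρ n).SeparatesPoints := by
  intro x y hxy
  obtain ⟨j, hj⟩ := Function.ne_iff.1 hxy
  obtain ⟨ℓ, hℓ⟩ := SeparatingDual.exists_separating_of_ne (R := ℝ) (hρi.ne hj)
  let f₀ : smoothScalars ρ := ⟨⟨fun g => ((ℓ (ρ g) : ℝ) : ℂ), by fun_prop⟩,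
    ⟨fun a => ((ℓ a : ℝ) : ℂ), fun g => (Complex.ofRealCLM ∘L ℓ).contDiff.contDiffAt,
      fun g => rfl⟩⟩
  refine ⟨_, ⟨prodFun (Pi.mulSingle j f₀), Submodule.subset_span ⟨_, rfl⟩, rfl⟩, ?_⟩
  have h : ∀ z : Fin n → G, prodFun (Pi.mulSingle j f₀) z = ((ℓ (ρ (z j)) : ℝ) : ℂ) := by
    intro z
    change ∏ i, ((Pi.mulSingle j f₀ : Fin n → smoothScalars ρ) i).1 (z i) = _
    rw [Finset.prod_eq_single j]
    · rw [Pi.mulSingle_eq_same]; rfl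
    · intro i _ hi
      rw [Pi.mulSingle_eq_of_ne hi]; rfl
    · simp
  change prodFun _ x ≠ prodFun _ y
  rw [h, h]
  exact_mod_cast hℓ

variable [IsTopologicalGroup G] [CompactSpace G] [T2Space G]
  [SecondCountableTopology G] [MeasurableSpace G] [BorelSpace G]
  (μ : Measure G) [μ.IsHaarMeasure] [IsProbabilityMeasure μ]

/-- The product sections span a dense subspace, by the Stone-Weierstrass theorem. -/
theorem topologicalClosure_span_prodSection (hρ : Continuous ρ) (hρi : Function.Injective ρ) :
    (Submodule.span ℂ (Set.range fun p : (Fin n → smoothScalars ρ) × (Finset (Idx n d) × κ) =>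
      smoothL2 ρ μ hρ n d κ (prodSection p.1 p.2))).topologicalClosure = ⊤ := by
  classical
  set K := (Submodule.span ℂ (Set.range fun p : (Fin n → smoothScalars ρ) ×
    (Finset (Idx n d) × κ) => smoothL2 ρ μ hρ n d κ (prodSection p.1 p.2))).topologicalClosure
    with hK
  have hKc : IsClosed (K : Set (SpinorL2 μ n d κ)) := Submodule.isClosed_topologicalClosure _
  let T : C(Fin n → G, Fib (Idx n d) κ) →L[ℂ] SpinorL2 μ n d κ :=
    ContinuousMap.toLp 2 (Measure.pi fun _ => μ) ℂ
  let Λ : Finset (Idx n d) × κ → (C(Fin n → G, ℂ) →L[ℂ] SpinorL2 μ n d κ) := fun q =>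
    T ∘L ContinuousLinearMap.compLeftContinuous ℂ _ (ContinuousLinearMap.toSpanSingleton ℂ
      (EuclideanSpace.single q (1 : ℂ) : Fib (Idx n d) κ))
  have h1 : ∀ q f, Λ q f ∈ K := by
    intro q
    have h2 : (Submodule.span ℂ (Set.range (prodFun (n := n) (ρ := ρ)))).topologicalClosure ≤
        K.comap (Λ q).toLinearMap := by
      refine Submodule.topologicalClosure_minimal _ ?_ (hKc.preimage (Λ q).continuous)
      rw [Submodule.span_le]
      rintro _ ⟨f, rfl⟩
      exact Submodule.le_topologicalClosure _ (Submodule.subset_span ⟨(f, q), rfl⟩)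
    intro f
    refine h2 ?_
    have h3 := ContinuousMap.starSubalgebra_topologicalClosure_eq_top_of_separatesPoints
      (prodAlgebra ρ n) (prodAlgebra_separatesPoints hρ hρi)
    have h4 : f ∈ (prodAlgebra ρ n).topologicalClosure := by rw [h3]; trivial
    exact h4
  have h2 : ∀ F : C(Fin n → G, Fib (Idx n d) κ), T F ∈ K := by
    intro F
    have h3 : F = ∑ q, ContinuousLinearMap.compLeftContinuous ℂ _
        (ContinuousLinearMap.toSpanSingleton ℂ
          (EuclideanSpace.single q (1 : ℂ) : Fib (Idx n d) κ))
        (⟨fun g => F g q, by fun_prop⟩ : C(Fin n → G, ℂ)) := by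
      ext g p
      rw [ContinuousMap.sum_apply, WithLp.ofLp_sum, Finset.sum_apply, Finset.sum_eq_single p]
      · simp
      · intro q _ hq
        simp [hq.symm]
      · simp
    rw [h3, map_sum]
    exact sum_mem fun q _ => h1 q _
  rw [eq_top_iff]
  intro v _
  have h3 := ContinuousMap.toLp_denseRange (p := 2) (Fib (Idx n d) κ)
    (Measure.pi fun _ : Fin n => μ) ℂ (by simp)
  have h4 : closure (Set.range T) ⊆ K := hKc.closure_subset_iff.2 (by
    rintro _ ⟨F, rfl⟩; exact h2 F)
  exact h4 (h3 v)

theorem dense_range_smoothL2 (hρ : Continuous ρ) (hρi : Function.Injective ρ) :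
    Dense (LinearMap.range (smoothL2 ρ μ hρ n d κ) : Set (SpinorL2 μ n d κ)) := by
  have h1 := topologicalClosure_span_prodSection (n := n) (d := d) (κ := κ) μ hρ hρi
  rw [← Submodule.dense_iff_topologicalClosure_eq_top] at h1
  refine h1.mono ?_
  rw [SetLike.coe_subset_coe, Submodule.span_le]
  rintro _ ⟨p, rfl⟩
  exact ⟨_, rfl⟩

theorem inner_prodSection (hρ : Continuous ρ) (f f' : Fin n → smoothScalars ρ)
    (q q' : Finset (Idx n d) × κ) [Decidable (q = q')] :
    inner ℂ (smoothL2 ρ μ hρ n d κ (prodSection f q))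
      (smoothL2 ρ μ hρ n d κ (prodSection f' q')) =
      if q = q' then ∏ j, ∫ x, star ((f j).1 x) * (f' j).1 x ∂μ else 0 := by
  classical
  rw [inner_smoothL2]
  have h : ∀ g, inner ℂ ((prodSection f q).1 g : Fib (Idx n d) κ) ((prodSection f' q').1 g) =
      (∏ j, star ((f j).1 (g j)) * (f' j).1 (g j)) * if q = q' then 1 else 0 := by
    intro g
    rw [prodSection_apply, prodSection_apply, inner_smul_left, inner_smul_right,
      EuclideanSpace.inner_single_left, Finset.prod_mul_distrib, map_prod, ← mul_assoc]
    congr 1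
    by_cases hq : q = q' <;> simp [hq]
  simp only [h]
  rw [integral_mul_const, integral_fintype_prod_eq_prod (fun j x => star ((f j).1 x) * (f' j).1 x)]
  split_ifs <;> simp

end ProductSections

/-! ### Projections onto sections that depend on some of the coordinates -/

section Inclusions

variable {l m n d : ℕ}

theorem cliffMapLin_cliffProd_map {ι ι' : Type*} [Fintype ι] [LinearOrder ι] [Fintype ι']
    [LinearOrder ι'] (f : ι ↪ ι') (hf : StrictMono f) {A : Matrix ι' ι ℝ}
    (hA : A.transpose * A = 1) (hfA : ∀ i, colVec A i = Pi.single (f i) 1) (S : Finset ι) :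
    cliffMapLin A (cliffProd S) = cliffProd (S.map f) := by
  induction S using Finset.induction_on_min with
  | empty => simp [cliffProd_empty, cliffMapLin_one]
  | insert a S ha ih =>
    rw [cliffProd_insert_min' ha, cliffMapLin_extMul_single A hA, hfA, ih, Finset.map_insert,
      cliffProd_insert_min']
    intro x hx
    obtain ⟨y, hy, rfl⟩ := Finset.mem_map.1 hx
    exact hf (ha y hy)

/-- The structure map that keeps the coordinates in `U`. -/
def SignedInj.incl (U : Finset (Fin n)) : SignedInj U.card n where
  idx := (U.orderEmbOfFin rfl).toEmbedding
  inverted _ := false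

theorem SignedInj.range_incl (U : Finset (Fin n)) :
    Set.range (SignedInj.incl U).idx = (U : Set (Fin n)) :=
  U.range_orderEmbOfFin rfl

/-- A structure map factors through another one if it uses fewer coordinates. -/
theorem SignedInj.exists_comp (υ : SignedInj l n) (τ : SignedInj m n)
    (h : Set.range υ.idx ⊆ Set.range τ.idx) : ∃ τ' : SignedInj l m, υ = τ'.comp τ := by
  choose f hf using fun j => h ⟨j, rfl⟩
  refine ⟨⟨⟨f, fun i j hij => υ.idx.injective ?_⟩,
    fun j => xor (υ.inverted j) (τ.inverted (f j))⟩, SignedInj.eq_iff.2 fun j => ⟨?_, ?_⟩⟩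
  · rw [← hf, ← hf, hij]
  · exact (hf j).symm
  · change υ.inverted j = xor (xor (υ.inverted j) (τ.inverted (f j))) (τ.inverted (f j))
    rw [Bool.xor_assoc, Bool.xor_self, Bool.xor_false]

/-- The inclusion of the index sets of the frames, for the coordinates in `U`. -/
def inclIdx (d : ℕ) (U : Finset (Fin n)) : Idx U.card d ↪ Idx n d where
  toFun a := toLex ((SignedInj.incl U).idx (ofLex a).1, (ofLex a).2)
  inj' a b h := by
    have h' := Prod.ext_iff.1 (toLex.injective h)
    exact ofLex.injective (Prod.ext ((SignedInj.incl U).idx.injective h'.1) h'.2)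

theorem inclIdx_strictMono (U : Finset (Fin n)) : StrictMono (inclIdx d U) := by
  intro a b h
  rw [Prod.Lex.lt_iff] at h
  change toLex (_, _) < toLex (_, _)
  rw [Prod.Lex.lt_iff]
  rcases h with h | ⟨h, h'⟩
  · exact Or.inl ((U.orderEmbOfFin rfl).strictMono h)
  · refine Or.inr ⟨?_, h'⟩
    change (SignedInj.incl U).idx (ofLex a).1 = (SignedInj.incl U).idx (ofLex b).1
    rw [h]

theorem range_inclIdx (U : Finset (Fin n)) (a : Idx n d) :
    a ∈ Set.range (inclIdx d U) ↔ (ofLex a).1 ∈ U := by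
  constructor
  · rintro ⟨b, rfl⟩
    have : (SignedInj.incl U).idx (ofLex b).1 ∈ (U : Set (Fin n)) := by
      rw [← SignedInj.range_incl]; exact ⟨_, rfl⟩
    exact this
  · intro h
    have h1 : (ofLex a).1 ∈ Set.range (SignedInj.incl U).idx := by
      rw [SignedInj.range_incl]; exact h
    obtain ⟨j, hj⟩ := h1
    exact ⟨toLex (j, (ofLex a).2), ofLex.injective (Prod.ext hj rfl)⟩

end Inclusions

section Projections

variable {A : Type*} [NormedRing A] [NormedAlgebra ℝ A] [FiniteDimensional ℝ A]
  {G : Type*} [Group G] [TopologicalSpace G] {ρ : G →* A}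
  {B : BiinvariantMetric ρ} {d : ℕ} (e : OrthonormalFrame B d)
  {κ : Type*} [Fintype κ] {l m n : ℕ}

namespace OrthonormalFrame

theorem colVec_tangentMatrix_incl (U : Finset (Fin n)) (g : Fin n → G) (a : Idx U.card d) :
    colVec (e.tangentMatrix (SignedInj.incl U) g) a = Pi.single (inclIdx d U a) 1 := by
  ext b
  have h0 : e.tangentBlock (SignedInj.incl U) g (ofLex a).1 = 1 := if_neg (by simp [SignedInj.incl])
  rw [colVec, tangentMatrix_apply, h0]
  by_cases h : b = inclIdx d U a
  · subst h
    rw [if_pos (show (ofLex (inclIdx d U a)).1 = (SignedInj.incl U).idx (ofLex a).1 from rfl),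
      Pi.single_eq_same]
    exact (congrArg Complex.ofReal (Matrix.one_apply_eq (ofLex a).2)).trans Complex.ofReal_one
  · rw [Pi.single_eq_of_ne h]
    by_cases h1 : (ofLex b).1 = (SignedInj.incl U).idx (ofLex a).1
    · have h2 : (ofLex b).2 ≠ (ofLex a).2 := fun h2 => h (ofLex.injective (Prod.ext h1 h2))
      rw [if_pos h1, Matrix.one_apply_ne h2, Complex.ofReal_zero]
    · rw [if_neg h1, Complex.ofReal_zero]

open Classical in
theorem onFib_tangentMatrix_incl_single (U : Finset (Fin n)) (g : Fin n → G)
    (S : Finset (Idx U.card d)) (s : κ) :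
    onFib (cliffMapLin (e.tangentMatrix (SignedInj.incl U) g))
      (EuclideanSpace.single (S, s) (1 : ℂ)) =
      EuclideanSpace.single (S.map (inclIdx d U), s) (1 : ℂ) := by
  ext ⟨T, t⟩
  rw [onFib_apply_sum, Finset.sum_eq_single S]
  · rw [cliffMapLin_cliffProd_map (inclIdx d U) (inclIdx_strictMono U)
      (e.tangentMatrix_orthogonal _ g) (e.colVec_tangentMatrix_incl U g), cliffCoord_cliffProd]
    by_cases h1 : t = s
    · by_cases h2 : S.map (inclIdx d U) = T
      · simp [h1, h2]
      · simp [h1, h2, Ne.symm h2]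
    · simp [h1]
  · intro S' _ hS
    simp [hS]
  · simp

theorem pullbackSmooth_incl_prodSection (U : Finset (Fin n))
    (f : Fin U.card → smoothScalars ρ) (S : Finset (Idx U.card d)) (s : κ) :
    e.pullbackSmooth (SignedInj.incl U) (prodSection f (S, s)) =
      prodSection (Function.extend (SignedInj.incl U).idx f 1) (S.map (inclIdx d U), s) := by
  classical
  refine Subtype.ext (funext fun g => ?_)
  change e.pullback _ _ g = _
  rw [pullback_eq, prodSection_apply, prodSection_apply, map_smul,
    e.onFib_tangentMatrix_incl_single]
  congr 1
  refine Fintype.prod_of_injective (SignedInj.incl U).idx (SignedInj.incl U).idx.injective _ _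
    (fun i hi => ?_) fun j => ?_
  · rw [Function.extend_apply' _ _ _ (by simpa using hi)]
    rfl
  · rw [(SignedInj.incl U).idx.injective.extend_apply]
    simp [SignedInj.map, SignedInj.incl]

variable [IsTopologicalGroup G] [CompactSpace G] [T2Space G]
  [SecondCountableTopology G] [MeasurableSpace G] [BorelSpace G] (hρ : Continuous ρ)
  (μ : Measure G) [μ.IsHaarMeasure] [IsProbabilityMeasure μ]

/-- The adjoint of the isometry `P^*`. -/
noncomputable def pullbackAdj (τ : SignedInj m n) : SpinorL2 μ n d κ →L[ℂ] SpinorL2 μ m d κ :=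
  (e.pullbackL2 hρ μ τ).toContinuousLinearMap.adjoint

theorem inner_pullbackAdj (τ : SignedInj m n) (x : SpinorL2 μ m d κ) (y : SpinorL2 μ n d κ) :
    inner ℂ x (e.pullbackAdj hρ μ τ y) = inner ℂ (e.pullbackL2 hρ μ τ x) y :=
  ContinuousLinearMap.adjoint_inner_right _ _ _

theorem pullbackAdj_inner (τ : SignedInj m n) (x : SpinorL2 μ m d κ) (y : SpinorL2 μ n d κ) :
    inner ℂ (e.pullbackAdj hρ μ τ y) x = inner ℂ y (e.pullbackL2 hρ μ τ x) :=
  ContinuousLinearMap.adjoint_inner_left _ _ _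

theorem pullbackAdj_pullbackL2 (τ : SignedInj m n) (x : SpinorL2 μ m d κ) :
    e.pullbackAdj hρ μ τ (e.pullbackL2 hρ μ τ x) = x :=
  ext_inner_left ℂ fun y => by rw [inner_pullbackAdj, LinearIsometry.inner_map_map]

/-- The orthogonal projection onto the sections that depend on the coordinates in `U` only. -/
noncomputable def projL2 (U : Finset (Fin n)) : SpinorL2 μ n d κ →L[ℂ] SpinorL2 μ n d κ :=
  (e.pullbackL2 hρ μ (SignedInj.incl U)).toContinuousLinearMap ∘L
    e.pullbackAdj hρ μ (SignedInj.incl U)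

theorem projL2_apply (U : Finset (Fin n)) (x : SpinorL2 μ n d κ) : e.projL2 hρ μ U x =
    e.pullbackL2 hρ μ (SignedInj.incl U) (e.pullbackAdj hρ μ (SignedInj.incl U) x) := rfl

theorem inner_projL2 (U : Finset (Fin n)) (x y : SpinorL2 μ n d κ) :
    inner ℂ (e.projL2 hρ μ U x) y = inner ℂ x (e.projL2 hρ μ U y) := by
  rw [projL2_apply, projL2_apply, ← inner_pullbackAdj, ← pullbackAdj_inner]

theorem projL2_pullbackL2 {U : Finset (Fin n)} (τ : SignedInj m n)
    (h : Set.range τ.idx ⊆ U) (x : SpinorL2 μ m d κ) :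
    e.projL2 hρ μ U (e.pullbackL2 hρ μ τ x) = e.pullbackL2 hρ μ τ x := by
  obtain ⟨τ', rfl⟩ := τ.exists_comp (SignedInj.incl U) (by rwa [SignedInj.range_incl])
  rw [pullbackL2_comp, projL2_apply, pullbackAdj_pullbackL2]

open Classical in
/-- The projection integrates over the coordinates outside of `U`, and it keeps the part of the
Clifford algebra which is generated by the components in `U`. -/
theorem projL2_prodSection (hρi : Function.Injective ρ) (U : Finset (Fin n))
    (f : Fin n → smoothScalars ρ) (S : Finset (Idx n d)) (s : κ) :
    e.projL2 hρ μ U (smoothL2 ρ μ hρ n d κ (prodSection f (S, s))) =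
      if ∀ a ∈ S, (ofLex a).1 ∈ U then
        (∏ j, if j ∈ U then 1 else ∫ x, (f j).1 x ∂μ) •
          smoothL2 ρ μ hρ n d κ (prodSection (fun j => if j ∈ U then f j else 1) (S, s))
      else 0 := by
  set τ := SignedInj.incl U with hτ
  have hU : ∀ j, j ∈ U ↔ j ∈ Set.range τ.idx := fun j => by
    rw [hτ, SignedInj.range_incl]; rfl
  -- `S'` is `S` as a set of indices for the coordinates in `U`
  set S' : Finset (Idx U.card d) := S.preimage (inclIdx d U) (inclIdx d U).injective.injOn with hS'
  have hmap : S'.map (inclIdx d U) = S.filter fun a => (ofLex a).1 ∈ U := by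
    ext a
    simp only [Finset.mem_map, hS', Finset.mem_preimage, Finset.mem_filter, ← range_inclIdx]
    constructor
    · rintro ⟨b, hb, rfl⟩
      exact ⟨hb, b, rfl⟩
    · rintro ⟨ha, b, rfl⟩
      exact ⟨b, ha, rfl⟩
  have hadj : e.pullbackAdj hρ μ τ (smoothL2 ρ μ hρ n d κ (prodSection f (S, s))) =
      if ∀ a ∈ S, (ofLex a).1 ∈ U then
        (∏ j, if j ∈ U then 1 else ∫ x, (f j).1 x ∂μ) •
          smoothL2 ρ μ hρ U.card d κ (prodSection (fun j => f (τ.idx j)) (S', s))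
      else 0 := by
    -- it suffices to test against product sections
    have hd := topologicalClosure_span_prodSection (n := U.card) (d := d) (κ := κ) μ hρ hρi
    rw [← Submodule.dense_iff_topologicalClosure_eq_top] at hd
    refine hd.eq_of_inner_right (𝕜 := ℂ) fun v hv => ?_
    induction hv using Submodule.span_induction with
    | zero => simp
    | add x y _ _ hx hy => rw [inner_add_left, inner_add_left, hx, hy]
    | smul c x _ hx => rw [inner_smul_left, inner_smul_left, hx]
    | mem v hv =>
      obtain ⟨⟨h, R, s'⟩, rfl⟩ := hv
      simp only
      rw [inner_pullbackAdj, pullbackL2_smoothL2, pullbackSmooth_incl_prodSection,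
        inner_prodSection]
      split_ifs with h1 h2 h2
      · have hR : R = S' := by
          refine Finset.map_injective (inclIdx d U) ?_
          rw [hmap, (Prod.mk.inj h1).1, Finset.filter_true_of_mem h2]
        rw [inner_smul_right, inner_prodSection, if_pos (show (R, s') = (S', s) from Prod.ext hR (Prod.mk.inj h1).2)]
        rw [mul_comm, Fintype.prod_of_injective τ.idx τ.idx.injective
          (fun j => ∫ x, star ((h j).1 x) * (f (τ.idx j)).1 x ∂μ)
          (fun j => if j ∈ U then
            ∫ x, star ((Function.extend τ.idx h 1 j).1 x) * (f j).1 x ∂μ else 1)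
          (fun i hi => if_neg fun h => hi ((hU i).1 h))
          (fun j => by
            rw [if_pos ((hU _).2 ⟨j, rfl⟩), τ.idx.injective.extend_apply]),
          ← Finset.prod_mul_distrib]
        refine Finset.prod_congr rfl fun j _ => ?_
        by_cases hj : j ∈ U
        · simp [hj]
          rfl
        · simp only [if_neg hj, one_mul]
          rw [Function.extend_apply' _ _ _ (by simpa using fun h => hj ((hU j).2 h))]
          simp
      · exfalso
        refine h2 fun a ha => ?_
        rw [← (Prod.mk.inj h1).1] at ha
        obtain ⟨b, _, rfl⟩ := Finset.mem_map.1 ha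
        exact (range_inclIdx U _).1 ⟨b, rfl⟩
      · have h3 : (R, s') ≠ (S', s) := by
          intro h3
          obtain ⟨hR, hs⟩ := Prod.mk.inj h3
          refine h1 (Prod.ext ?_ hs)
          change R.map _ = S
          rw [hR, hmap, Finset.filter_true_of_mem h2]
        rw [inner_smul_right, inner_prodSection, if_neg h3, mul_zero]
      · simp
  rw [projL2_apply, hadj]
  split_ifs with h1
  · rw [map_smul, pullbackL2_smoothL2, pullbackSmooth_incl_prodSection, hmap,
      Finset.filter_true_of_mem h1]
    congr 3
    funext j
    by_cases hj : j ∈ U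
    · obtain ⟨i, rfl⟩ := (hU j).1 hj
      rw [if_pos hj, τ.idx.injective.extend_apply (fun j => f (τ.idx j))]
    · rw [if_neg hj, Function.extend_apply' _ _ _ (by simpa using fun h => hj ((hU j).2 h))]
      rfl
  · rw [map_zero]

/-- The projections commute, since the integrations over different coordinates do. -/
theorem projL2_projL2 (hρi : Function.Injective ρ) (U V : Finset (Fin n)) (x : SpinorL2 μ n d κ) :
    e.projL2 hρ μ U (e.projL2 hρ μ V x) = e.projL2 hρ μ (U ∩ V) x := by
  classical
  have hd := topologicalClosure_span_prodSection (n := n) (d := d) (κ := κ) μ hρ hρi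
  rw [← Submodule.dense_iff_topologicalClosure_eq_top] at hd
  have h : e.projL2 (κ := κ) hρ μ U ∘L e.projL2 hρ μ V = e.projL2 hρ μ (U ∩ V) := by
    refine ContinuousLinearMap.ext_on hd ?_
    rintro _ ⟨⟨f, S, s⟩, rfl⟩
    simp only [ContinuousLinearMap.comp_apply, projL2_prodSection e hρ μ hρi]
    by_cases hV : ∀ a ∈ S, (ofLex a).1 ∈ V
    · rw [if_pos hV, map_smul, projL2_prodSection e hρ μ hρi]
      by_cases hU : ∀ a ∈ S, (ofLex a).1 ∈ U
      · rw [if_pos hU, if_pos fun a ha => Finset.mem_inter.2 ⟨hU a ha, hV a ha⟩, smul_smul,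
          ← Finset.prod_mul_distrib]
        congr 1
        · refine Finset.prod_congr rfl fun j _ => ?_
          by_cases h1 : j ∈ U <;> by_cases h2 : j ∈ V <;> simp [h1, h2]
        · congr 2
          funext j
          by_cases h1 : j ∈ U <;> by_cases h2 : j ∈ V <;> simp [h1, h2]
      · rw [if_neg hU, smul_zero, if_neg fun h => hU fun a ha => (Finset.mem_inter.1 (h a ha)).1]
    · rw [if_neg hV, map_zero, if_neg fun h => hV fun a ha => (Finset.mem_inter.1 (h a ha)).2]
  exact congrArg (fun T : SpinorL2 μ n d κ →L[ℂ] SpinorL2 μ n d κ => T x) h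

end OrthonormalFrame

end Projections

/-! ### Pure vectors -/

section CommutingProjections

variable {𝕜 E ι : Type*} [NontriviallyNormedField 𝕜] [NormedAddCommGroup E] [NormedSpace 𝕜 E]

/-- For commuting projections `Pₖ`, the product of the `1 - Pₖ` is a projection onto the
intersection of the kernels. -/
theorem exists_proj_of_commute [Finite ι] (P : ι → E →L[𝕜] E) (hP : ∀ i x, P i (P i x) = P i x)
    (hc : ∀ i j x, P i (P j x) = P j (P i x)) (M R : Submodule 𝕜 E) (hM : ∀ i, ∀ x ∈ M, P i x ∈ M)
    (hR : ∀ i x, P i x ∈ R) :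
    ∃ T : E →L[𝕜] E, (∀ i x, P i (T x) = 0) ∧ (∀ x, (∀ i, P i x = 0) → T x = x) ∧
      (∀ x ∈ M, T x ∈ M) ∧ ∀ x, x - T x ∈ R := by
  classical
  have := Fintype.ofFinite ι
  have key : ∀ s : Finset ι, ∃ T : E →L[𝕜] E, (∀ i ∈ s, ∀ x, P i (T x) = 0) ∧
      (∀ x, (∀ i, P i x = 0) → T x = x) ∧ (∀ x ∈ M, T x ∈ M) ∧ ∀ x, x - T x ∈ R := by
    intro s
    induction s using Finset.induction_on with
    | empty => exact ⟨ContinuousLinearMap.id 𝕜 _, by simp, by simp, by simp, by simp⟩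
    | insert k s _ ih =>
      obtain ⟨T, h1, h2, h3, h4⟩ := ih
      refine ⟨T - P k ∘L T, fun j hj v => ?_, fun v hv => ?_, fun x hx => ?_, fun v => ?_⟩
      · change P j (T v - P k (T v)) = 0
        rw [map_sub]
        rcases Finset.mem_insert.1 hj with rfl | hj
        · rw [hP, sub_self]
        · rw [hc, h1 j hj, map_zero, sub_zero]
      · change T v - P k (T v) = v
        rw [h2 v hv, hv, sub_zero]
      · exact M.sub_mem (h3 x hx) (hM _ _ (h3 x hx))
      · change v - (T v - P k (T v)) ∈ R
        rw [← sub_add]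
        exact add_mem (h4 v) (hR _ _)
  obtain ⟨T, h1, h2⟩ := key Finset.univ
  exact ⟨T, fun i => h1 i (Finset.mem_univ i), h2⟩

end CommutingProjections

section Pure

variable {A : Type*} [NormedRing A] [NormedAlgebra ℝ A] [FiniteDimensional ℝ A]
  {G : Type*} [Group G] [TopologicalSpace G] {ρ : G →* A}
  {B : BiinvariantMetric ρ} {d : ℕ} (e : OrthonormalFrame B d)
  {κ : Type*} [Fintype κ] {l m n : ℕ}
  [IsTopologicalGroup G] [CompactSpace G] [T2Space G]
  [SecondCountableTopology G] [MeasurableSpace G] [BorelSpace G] (hρ : Continuous ρ)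
  (μ : Measure G) [μ.IsHaarMeasure] [IsProbabilityMeasure μ]

namespace OrthonormalFrame

/-- A pull-back along a bijection of the coordinates preserves purity. -/
theorem pullbackL2_mem_pureSubspace (τ : SignedInj m n) (hmn : n ≤ m) {w : SpinorL2 μ m d κ}
    (hw : w ∈ e.pureSubspace μ m κ) : e.pullbackL2 hρ μ τ w ∈ e.pureSubspace μ n κ := by
  rw [mem_pureSubspace_iff hρ e] at hw ⊢
  intro l hl υ u
  have hs : Function.Surjective τ.idx := by
    refine ((Fintype.bijective_iff_injective_and_card _).2 ⟨τ.idx.injective, ?_⟩).2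
    simpa using le_antisymm (by simpa using Fintype.card_le_of_embedding τ.idx) hmn
  obtain ⟨υ', rfl⟩ := υ.exists_comp τ (by rw [hs.range_eq]; exact Set.subset_univ _)
  rw [pullbackL2_comp, LinearIsometry.inner_map_map]
  exact hw l (hl.trans_le hmn) υ' u

theorem pullbackAdj_eq_zero_of_pure (τ : SignedInj m n) (hmn : m < n) {w : SpinorL2 μ n d κ}
    (hw : w ∈ e.pureSubspace μ n κ) : e.pullbackAdj hρ μ τ w = 0 := by
  rw [mem_pureSubspace_iff hρ e] at hw
  refine ext_inner_left ℂ fun x => ?_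
  rw [inner_pullbackAdj, hw m hmn, inner_zero_right]

theorem projL2_eq_zero_of_pure {U : Finset (Fin n)} (hU : U ≠ Finset.univ) {w : SpinorL2 μ n d κ}
    (hw : w ∈ e.pureSubspace μ n κ) : e.projL2 hρ μ U w = 0 := by
  have h : U.card < n := by
    have := Finset.card_lt_card (Finset.ssubset_univ_iff.2 hU)
    simpa using this
  rw [projL2_apply, e.pullbackAdj_eq_zero_of_pure hρ μ _ h hw, map_zero]

/-- A vector is pure if it is orthogonal to all that does not depend on some coordinate `k`. -/
theorem mem_pureSubspace_of_projL2 {w : SpinorL2 μ n d κ}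
    (h : ∀ k, e.projL2 hρ μ (Finset.univ.erase k) w = 0) : w ∈ e.pureSubspace μ n κ := by
  rw [mem_pureSubspace_iff hρ e]
  intro m hm τ u
  obtain ⟨k, hk⟩ : ∃ k, k ∉ Set.range τ.idx := by
    by_contra! hc
    have := Fintype.card_le_of_surjective τ.idx hc
    simp at this
    omega
  have h1 : Set.range τ.idx ⊆ (Finset.univ.erase k : Finset (Fin n)) := by
    intro i hi
    rw [Finset.mem_coe, Finset.mem_erase]
    exact ⟨fun hik => hk (hik ▸ hi), Finset.mem_univ _⟩
  rw [← e.projL2_pullbackL2 hρ μ τ h1, inner_projL2, h, inner_zero_right]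

/-- The pull-back of a pure vector is orthogonal to the sections that do not depend on all of its
coordinates. -/
theorem inner_pullbackL2_eq_zero (hρi : Function.Injective ρ) (τ : SignedInj l n)
    (υ : SignedInj m n) (h : ¬ Set.range τ.idx ⊆ Set.range υ.idx) {w : SpinorL2 μ l d κ}
    (hw : w ∈ e.pureSubspace μ l κ) (v : SpinorL2 μ m d κ) :
    inner ℂ (e.pullbackL2 hρ μ τ w) (e.pullbackL2 hρ μ υ v) = 0 := by
  obtain ⟨U, hU⟩ : ∃ U : Finset (Fin n), (U : Set (Fin n)) = Set.range τ.idx :=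
    ⟨Finset.univ.map τ.idx, by simp⟩
  obtain ⟨V, hV⟩ : ∃ V : Finset (Fin n), (V : Set (Fin n)) = Set.range υ.idx :=
    ⟨Finset.univ.map υ.idx, by simp⟩
  -- the projection of one vector to the range of the other depends on fewer than `l` coordinates
  have h1 : (U ∩ V).card < l := by
    have h2 : U ∩ V ⊂ U := by
      refine Finset.ssubset_iff_subset_ne.2 ⟨Finset.inter_subset_left, fun h3 => h ?_⟩
      rw [← hU, ← hV, ← h3]
      simp
    have h3 : U = Finset.univ.map τ.idx := by
      rw [← Finset.coe_inj, hU]; simp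
    have h4 := Finset.card_lt_card h2
    rwa [h3, Finset.card_map, Finset.card_univ, Fintype.card_fin, ← h3] at h4
  obtain ⟨υ', hυ'⟩ := (SignedInj.incl (U ∩ V)).exists_comp τ (by
    rw [SignedInj.range_incl, ← hU]; simp)
  have h2 : e.pullbackL2 hρ μ τ w = e.projL2 hρ μ U (e.pullbackL2 hρ μ τ w) :=
    (e.projL2_pullbackL2 hρ μ τ hU.ge w).symm
  have h3 : e.pullbackL2 hρ μ υ v = e.projL2 hρ μ V (e.pullbackL2 hρ μ υ v) :=
    (e.projL2_pullbackL2 hρ μ υ hV.ge v).symm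
  rw [h2, h3, inner_projL2, projL2_projL2 e hρ μ hρi, projL2_apply, hυ', pullbackL2_comp,
    LinearIsometry.inner_map_map, ← inner_conj_symm, (mem_pureSubspace_iff hρ e μ w).1 hw _ h1,
    map_zero]

variable (ρ d κ) in
/-- The space spanned by the product sections. -/
noncomputable def _root_.prodSpan (hρ : Continuous ρ) (n : ℕ) : Submodule ℂ (SpinorL2 μ n d κ) :=
  Submodule.span ℂ (Set.range fun p : (Fin n → smoothScalars ρ) × (Finset (Idx n d) × κ) =>
    smoothL2 ρ μ hρ n d κ (prodSection p.1 p.2))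

theorem _root_.dense_prodSpan (hρi : Function.Injective ρ) :
    Dense (prodSpan ρ d κ μ hρ n : Set (SpinorL2 μ n d κ)) := by
  rw [Submodule.dense_iff_topologicalClosure_eq_top]
  exact topologicalClosure_span_prodSection μ hρ hρi

theorem _root_.prodSpan_le_range : prodSpan ρ d κ μ hρ n ≤ LinearMap.range (smoothL2 ρ μ hρ n d κ) := by
  rw [prodSpan, Submodule.span_le]
  rintro _ ⟨p, rfl⟩
  exact ⟨_, rfl⟩

theorem projL2_mem_prodSpan (hρi : Function.Injective ρ) (U : Finset (Fin n))
    {x : SpinorL2 μ n d κ} (hx : x ∈ prodSpan ρ d κ μ hρ n) :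
    e.projL2 hρ μ U x ∈ prodSpan ρ d κ μ hρ n := by
  classical
  have h : prodSpan ρ d κ μ hρ n ≤
      (prodSpan ρ d κ μ hρ n).comap (e.projL2 hρ μ U).toLinearMap := by
    conv_lhs => rw [prodSpan]
    rw [Submodule.span_le]
    rintro _ ⟨⟨f, S, s⟩, rfl⟩
    change e.projL2 hρ μ U (smoothL2 ρ μ hρ n d κ (prodSection f (S, s))) ∈ prodSpan ρ d κ μ hρ n
    rw [projL2_prodSection e hρ μ hρi]
    split_ifs
    · exact Submodule.smul_mem _ _ (Submodule.subset_span ⟨(_, _), rfl⟩)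
    · exact zero_mem _
  exact h hx

/-- The projection onto the pure vectors: it preserves the span of the product sections, and it
changes a vector by vectors pulled back from fewer coordinates. -/
theorem exists_pureProj (hρi : Function.Injective ρ) (n : ℕ) :
    ∃ T : SpinorL2 μ n d κ →L[ℂ] SpinorL2 μ n d κ,
      (∀ v, T v ∈ e.pureSubspace μ n κ) ∧ (∀ v ∈ e.pureSubspace μ n κ, T v = v) ∧
      (∀ x ∈ prodSpan ρ d κ μ hρ n, T x ∈ prodSpan ρ d κ μ hρ n) ∧
      ∀ v, v - T v ∈ Submodule.span ℂ {u | ∃ m, m < n ∧ ∃ (τ : SignedInj m n)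
        (w : SpinorL2 μ m d κ), u = e.pullbackL2 hρ μ τ w} := by
  -- the projections that forget one of the coordinates
  obtain ⟨T, h1, h2, h3, h4⟩ := exists_proj_of_commute
    (fun k : Fin n => e.projL2 (κ := κ) hρ μ (Finset.univ.erase k))
    (fun k x => by rw [projL2_projL2 e hρ μ hρi, Finset.inter_self])
    (fun j k x => by
      rw [projL2_projL2 e hρ μ hρi, Finset.inter_comm, ← projL2_projL2 e hρ μ hρi])
    (prodSpan ρ d κ μ hρ n)
    (Submodule.span ℂ {u | ∃ m, m < n ∧ ∃ (τ : SignedInj m n)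
      (w : SpinorL2 μ m d κ), u = e.pullbackL2 hρ μ τ w})
    (fun k x hx => e.projL2_mem_prodSpan hρ μ hρi _ hx)
    (fun k x => Submodule.subset_span ⟨_, by
      have := Finset.card_erase_lt_of_mem (Finset.mem_univ k)
      simpa using this, _, _, projL2_apply ..⟩)
  refine ⟨T, fun v => e.mem_pureSubspace_of_projL2 hρ μ fun k => h1 k v, fun v hv => ?_,
    h3, h4⟩
  exact h2 v fun k => e.projL2_eq_zero_of_pure hρ μ
    (fun h => Finset.notMem_erase k _ (h ▸ Finset.mem_univ k)) hv

/-- All vectors are sums of vectors pulled back from pure ones. -/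
theorem span_pullbackL2_pure (hρi : Function.Injective ρ) (n : ℕ) :
    Submodule.span ℂ {u : SpinorL2 μ n d κ | ∃ (m : ℕ) (τ : SignedInj m n),
      ∃ w ∈ e.pureSubspace μ m κ, u = e.pullbackL2 hρ μ τ w} = ⊤ := by
  induction n using Nat.strong_induction_on with
  | _ n ih =>
    obtain ⟨T, h1, -, -, h4⟩ := e.exists_pureProj (κ := κ) hρ μ hρi n
    rw [eq_top_iff]
    intro v _
    rw [← sub_add_cancel v (T v)]
    refine add_mem ?_ (Submodule.subset_span ⟨n, SignedInj.id n, T v, h1 v,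
      (e.pullbackL2_id hρ μ _).symm⟩)
    refine Submodule.span_le.2 ?_ (h4 v)
    rintro _ ⟨m, hm, τ, w, rfl⟩
    have hw : w ∈ (⊤ : Submodule ℂ (SpinorL2 μ m d κ)) := trivial
    rw [← ih m hm] at hw
    rw [SetLike.mem_coe]
    induction hw using Submodule.span_induction with
    | mem x hx =>
      obtain ⟨l, υ, u, hu, rfl⟩ := hx
      exact Submodule.subset_span ⟨l, υ.comp τ, u, hu, (e.pullbackL2_comp hρ μ υ τ u).symm⟩
    | zero => rw [map_zero]; exact zero_mem _
    | add x y _ _ hx hy => rw [map_add]; exact add_mem hx hy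
    | smul c x _ hx => rw [map_smul]; exact Submodule.smul_mem _ _ hx

/-- The smooth pure vectors are dense in the pure vectors. -/
theorem mem_closure_smooth_of_pure (hρi : Function.Injective ρ) {v : SpinorL2 μ n d κ}
    (hv : v ∈ e.pureSubspace μ n κ) :
    v ∈ closure {x | x ∈ e.pureSubspace μ n κ ∧ ∃ ξ, x = smoothL2 ρ μ hρ n d κ ξ} := by
  obtain ⟨T, h1, h2, h3, -⟩ := e.exists_pureProj (κ := κ) hρ μ hρi n
  rw [← h2 v hv]
  exact map_mem_closure T.continuous (dense_prodSpan hρ μ hρi v) fun x hx =>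
    ⟨h1 x, (prodSpan_le_range hρ μ (h3 x hx)).imp fun _ h => h.symm⟩

/-- The Euler-Dirac operator preserves purity, because it is symmetric and commutes with the
pull-backs. -/
theorem eulerDiracLin_mem_pureSubspace (hρi : Function.Injective ρ)
    {η : smoothFun n (Fib (Idx n d) κ) ρ}
    (hη : smoothL2 ρ μ hρ n d κ η ∈ e.pureSubspace μ n κ) :
    smoothL2 ρ μ hρ n d κ (e.eulerDiracLin n κ η) ∈ e.pureSubspace μ n κ := by
  rw [mem_pureSubspace_iff hρ e] at hη ⊢
  intro m hm τ w
  rw [← inner_pullbackAdj]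
  have h : e.pullbackAdj hρ μ τ (smoothL2 ρ μ hρ n d κ (e.eulerDiracLin n κ η)) = 0 := by
    refine (dense_range_smoothL2 (n := m) (d := d) (κ := κ) μ hρ hρi).eq_of_inner_right (𝕜 := ℂ)
      fun v hv => ?_
    obtain ⟨ζ, rfl⟩ := hv
    rw [inner_pullbackAdj, pullbackL2_smoothL2, ← inner_smoothL2_eulerDiracLin,
      eulerDiracLin_pullbackSmooth, ← pullbackL2_smoothL2, hη m hm, inner_zero_right]
  rw [h, inner_zero_right]

end OrthonormalFrame

end Pure

/-! ### Subsystems of loops -/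

section Subsystems

variable {k : ℕ} {M : Type*} [TopologicalSpace M] [ChartedSpace (EuclideanSpace ℝ (Fin k)) M]
  {x₀ : M} {F₁ F₂ F₃ : Subgroup (Hoop k x₀)} {S₁ : LoopSystem F₁} {S₂ : LoopSystem F₂}
  {S₃ : LoopSystem F₃}

theorem SignedInj.Induced.comp {υ : SignedInj S₁.n S₂.n} {τ : SignedInj S₂.n S₃.n}
    (h : υ.Induced S₁ S₂) (h' : τ.Induced S₂ S₃) : (υ.comp τ).Induced S₁ S₃ := by
  intro j
  rw [h j, h' (υ.idx j)]
  simp only [SignedInj.comp, Function.Embedding.trans_apply]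
  cases υ.inverted j <;> cases τ.inverted (υ.idx j) <;> simp

theorem SignedInj.induced_id (S : LoopSystem F₁) : (SignedInj.id S.n).Induced S S := fun j => by
  simp [SignedInj.id]

theorem SignedInj.Induced.le {τ : SignedInj S₁.n S₂.n} (h : τ.Induced S₁ S₂) : F₁ ≤ F₂ := by
  rw [← S₁.generates, Subgroup.closure_le]
  rintro _ ⟨j, rfl⟩
  simp only [SetLike.mem_coe]
  rw [h j]
  split_ifs
  · exact inv_mem (S₂.hoop_mem _)
  · exact S₂.hoop_mem _

/-- Among the subgroups of `F₃`, the inclusion can be read off from the generating loops used. -/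
theorem SignedInj.Induced.le_of_range_subset {υ : SignedInj S₁.n S₃.n} {τ : SignedInj S₂.n S₃.n}
    (h : υ.Induced S₁ S₃) (h' : τ.Induced S₂ S₃) (hr : Set.range υ.idx ⊆ Set.range τ.idx) :
    F₁ ≤ F₂ := by
  rw [← S₁.generates, Subgroup.closure_le]
  rintro _ ⟨j, rfl⟩
  obtain ⟨i, hi⟩ := hr ⟨j, rfl⟩
  have h1 : (S₃.loop (υ.idx j)).hoop ∈ F₂ := by
    have h2 := S₂.hoop_mem i
    rw [h' i, hi] at h2
    split_ifs at h2
    · exact inv_mem_iff.1 h2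
    · exact h2
  simp only [SetLike.mem_coe]
  rw [h j]
  split_ifs
  · exact inv_mem h1
  · exact h1

/-- The system of some of the loops of a system. -/
def LoopSystem.sub (S : LoopSystem F₁) {m : ℕ} (f : Fin m ↪ Fin S.n) :
    LoopSystem (Subgroup.closure (Set.range fun i => (S.loop (f i)).hoop)) where
  n := m
  loop i := S.loop (f i)
  simple i := S.simple (f i)
  disjoint i j hij := S.disjoint (f i) (f j) (f.injective.ne hij)
  generates := rfl

theorem LoopSystem.induced_sub (S : LoopSystem F₁) {m : ℕ} (f : Fin m ↪ Fin S.n) :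
    SignedInj.Induced (S.sub f) S ⟨f, fun _ => false⟩ := fun j => by
  rw [if_neg (by simp)]
  rfl

variable [T2Space M] [IsManifold (𝓡 k) ∞ M] (gen : ∀ F : LoopSubgroup k x₀, LoopSystem F.1)

/-- The structure map that is induced by an inclusion. -/
noncomputable def inducedMap {E F : LoopSubgroup k x₀} (h : E ≤ F) :
    SignedInj (gen E).n (gen F).n :=
  (SignedInj.exists_induced (gen E) (gen F) h).choose

theorem inducedMap_induced {E F : LoopSubgroup k x₀} (h : E ≤ F) :
    (inducedMap gen h).Induced (gen E) (gen F) :=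
  (SignedInj.exists_induced (gen E) (gen F) h).choose_spec

theorem eq_inducedMap {E F : LoopSubgroup k x₀} (h : E ≤ F)
    {τ : SignedInj (gen E).n (gen F).n} (hτ : τ.Induced (gen E) (gen F)) :
    τ = inducedMap gen h :=
  hτ.unique (inducedMap_induced gen h)

theorem inducedMap_refl (F : LoopSubgroup k x₀) :
    inducedMap gen (le_refl F) = SignedInj.id (gen F).n :=
  (eq_inducedMap gen (le_refl F) (SignedInj.induced_id (gen F))).symm

theorem inducedMap_comp {D E F : LoopSubgroup k x₀} (h : D ≤ E) (h' : E ≤ F) :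
    (inducedMap gen h).comp (inducedMap gen h') = inducedMap gen (h.trans h') :=
  eq_inducedMap gen (h.trans h') ((inducedMap_induced gen h).comp (inducedMap_induced gen h'))

theorem le_of_range_inducedMap_subset {D E F : LoopSubgroup k x₀} (h : D ≤ F) (h' : E ≤ F)
    (hr : Set.range (inducedMap gen h).idx ⊆ Set.range (inducedMap gen h').idx) : D ≤ E :=
  (inducedMap_induced gen h).le_of_range_subset (inducedMap_induced gen h') hr

theorem LoopSubgroup.finite_le (F : LoopSubgroup k x₀) : {E | E ≤ F}.Finite := by
  obtain ⟨S₀⟩ : Nonempty (∀ F : LoopSubgroup k x₀, LoopSystem F.1) :=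
    ⟨fun F => F.2.some⟩
  refine Set.finite_coe_iff.1 (Finite.of_injective
    (fun E : {E | E ≤ F} => Set.range (inducedMap S₀ E.2).idx) fun E E' h => ?_)
  exact Subtype.ext (le_antisymm (le_of_range_inducedMap_subset S₀ E.2 E'.2 h.le)
    (le_of_range_inducedMap_subset S₀ E'.2 E.2 h.ge))

/-- Every structure map into `G^{n(F)}` factors through the structure map of a subgroup of `F`
with as many generating loops. -/
theorem exists_inducedMap_factor (F : LoopSubgroup k x₀) {m : ℕ} (τ : SignedInj m (gen F).n) :
    ∃ (E : LoopSubgroup k x₀) (h : E ≤ F) (υ : SignedInj m (gen E).n),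
      (gen E).n ≤ m ∧ τ = υ.comp (inducedMap gen h) := by
  set S := (gen F).sub τ.idx with hS
  have hind : SignedInj.Induced S (gen F) ⟨τ.idx, fun _ => false⟩ := (gen F).induced_sub τ.idx
  set E : LoopSubgroup k x₀ := ⟨_, ⟨S⟩⟩ with hE
  have hEF : E ≤ F := hind.le
  obtain ⟨α, hα⟩ := SignedInj.exists_induced (gen E) S le_rfl
  obtain ⟨β, hβ⟩ := SignedInj.exists_induced S (gen E) le_rfl
  have h1 := hind.unique (hβ.comp (inducedMap_induced gen hEF))
  have h2 : Set.range τ.idx ⊆ Set.range (inducedMap gen hEF).idx := by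
    rintro _ ⟨j, rfl⟩
    exact ⟨β.idx j, (congrArg (fun σ' : SignedInj m (gen F).n => σ'.idx j) h1).symm⟩
  obtain ⟨υ, hυ⟩ := τ.exists_comp _ h2
  exact ⟨E, hEF, υ,
    (by simpa using Fintype.card_le_of_embedding α.idx : (gen E).n ≤ S.n), hυ⟩

end Subsystems

/-! ### Inductive systems of Hilbert spaces with pure vectors -/

/-- An inductive system of Hilbert spaces in which every space is spanned by the images of the pure
vectors of the previous spaces; the image of a pure vector is orthogonal to the images of the
spaces that do not come later. -/
structure PureSystem (ι : Type*) [PartialOrder ι] (H : ι → Type*) [∀ i, NormedAddCommGroup (H i)]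
    [∀ i, InnerProductSpace ℂ (H i)] where
  map : ∀ {i j : ι}, i ≤ j → H i →ₗᵢ[ℂ] H j
  map_refl : ∀ i (v : H i), map (le_refl i) v = v
  map_map : ∀ {i j l : ι} (h : i ≤ j) (h' : j ≤ l) (v : H i), map h' (map h v) = map (h.trans h') v
  pure : ∀ i, Submodule ℂ (H i)
  finite_le : ∀ j : ι, {i | i ≤ j}.Finite
  span_pure : ∀ j, Submodule.span ℂ {u : H j | ∃ (i : ι) (h : i ≤ j), ∃ w ∈ pure i, u = map h w} = ⊤
  inner_eq_zero : ∀ {i j l : ι} (h : i ≤ l) (h' : j ≤ l), ¬ i ≤ j → ∀ w ∈ pure i, ∀ v,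
    inner ℂ (map h w) (map h' v) = 0

namespace PureSystem

section Inner

variable {ι : Type*} [PartialOrder ι] {H : ι → Type*} [∀ i, NormedAddCommGroup (H i)]
  [∀ i, InnerProductSpace ℂ (H i)] [∀ i, CompleteSpace (H i)] (S : PureSystem ι H)

/-- Pure vectors need not form a closed subspace, so the orthogonal projection goes to the closure. -/
theorem exists_proj_closure_pure (i : ι) : ∃ T : H i →L[ℂ] H i,
    (∀ v, ∀ w ∈ S.pure i, inner ℂ w (T v) = inner ℂ w v) ∧ (∀ w ∈ S.pure i, T w = w) ∧
    (∀ v, (∀ w ∈ S.pure i, inner ℂ w v = 0) → T v = 0) := by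
  have : CompleteSpace (S.pure i).topologicalClosure :=
    (S.pure i).isClosed_topologicalClosure.completeSpace_coe
  refine ⟨(S.pure i).topologicalClosure.starProjection, fun v w hw => ?_, fun w hw => ?_,
    fun v hv => ?_⟩
  · rw [← Submodule.inner_starProjection_left_eq_right,
      Submodule.starProjection_eq_self_iff.2 (subset_closure hw)]
  · exact Submodule.starProjection_eq_self_iff.2 (subset_closure hw)
  · rw [Submodule.starProjection_apply_eq_zero_iff, Submodule.orthogonal_closure]
    exact fun w hw => hv w hw

/-- The orthogonal projection onto the closure of the pure vectors. -/
noncomputable def pureProj (i : ι) : H i →L[ℂ] H i := (S.exists_proj_closure_pure i).choose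

open Classical in
/-- The component in `H i` of a vector of `H j`. -/
noncomputable def component (j i : ι) : H j →L[ℂ] H i :=
  if h : i ≤ j then S.pureProj i ∘L (S.map h).toContinuousLinearMap.adjoint else 0

theorem component_eq (j i : ι) (h : i ≤ j) (v : H j) :
    S.component j i v = S.pureProj i ((S.map h).toContinuousLinearMap.adjoint v) := by
  rw [component, dif_pos h]; rfl

theorem component_eq_zero (j i : ι) (h : ¬ i ≤ j) (v : H j) : S.component j i v = 0 := by
  rw [component, dif_neg h]; rfl

theorem component_map {j l : ι} (h : j ≤ l) (i : ι) (v : H j) :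
    S.component l i (S.map h v) = S.component j i v := by
  by_cases hil : i ≤ l
  · rw [S.component_eq _ _ hil]
    by_cases hij : i ≤ j
    · rw [S.component_eq _ _ hij]
      congr 1
      refine ext_inner_left ℂ fun x => ?_
      rw [ContinuousLinearMap.adjoint_inner_right, ContinuousLinearMap.adjoint_inner_right]
      change inner ℂ (S.map hil x) (S.map h v) = inner ℂ (S.map hij x) v
      rw [← S.map_map hij h, LinearIsometry.inner_map_map]
    · rw [S.component_eq_zero _ _ hij]
      refine (S.exists_proj_closure_pure i).choose_spec.2.2 _ fun w hw => ?_
      rw [ContinuousLinearMap.adjoint_inner_right]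
      exact S.inner_eq_zero hil h hij w hw v
  · rw [S.component_eq_zero _ _ hil, S.component_eq_zero _ _ fun hij => hil (hij.trans h)]

theorem component_self {i : ι} {w : H i} (hw : w ∈ S.pure i) : S.component i i w = w := by
  rw [S.component_eq _ _ le_rfl]
  have h : (S.map (le_refl i)).toContinuousLinearMap.adjoint w = w := by
    refine ext_inner_left ℂ fun x => ?_
    rw [ContinuousLinearMap.adjoint_inner_right]
    exact congrArg (fun y => inner ℂ y w) (S.map_refl i x)
  rw [h]
  exact (S.exists_proj_closure_pure i).choose_spec.2.1 w hw

theorem component_ne {i j : ι} (h : i ≠ j) {w : H i} (hw : w ∈ S.pure i) :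
    S.component i j w = 0 := by
  by_cases hj : j ≤ i
  · rw [S.component_eq _ _ hj]
    have h' : (S.map hj).toContinuousLinearMap.adjoint w = 0 := by
      refine ext_inner_right ℂ fun x => ?_
      rw [ContinuousLinearMap.adjoint_inner_left, inner_zero_left]
      have := S.inner_eq_zero (le_refl i) hj (fun hij => h (le_antisymm hij hj)) w hw x
      rwa [S.map_refl] at this
    rw [h', map_zero]
  · exact S.component_eq_zero _ _ hj w

open Classical in
/-- The components of a vector, as an element of the Hilbert sum. -/
noncomputable def components (j : ι) : H j →ₗ[ℂ] lp H 2 :=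
  ∑ i ∈ (S.finite_le j).toFinset, lp.lsingle 2 i ∘ₗ (S.component j i).toLinearMap

theorem components_apply (j i : ι) (v : H j) : S.components j v i = S.component j i v := by
  classical
  rw [components, LinearMap.sum_apply, lp.coeFn_sum, Finset.sum_apply]
  by_cases h : i ≤ j
  · rw [Finset.sum_eq_single i]
    · simp
    · intro b _ hb
      simp [hb]
    · intro hi
      exact absurd (by simpa using h) hi
  · rw [S.component_eq_zero _ _ h]
    refine Finset.sum_eq_zero fun b hb => ?_
    have hb' : i ≠ b := fun hib => h (hib ▸ by simpa using hb)
    simp [hb']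

theorem components_map {j l : ι} (h : j ≤ l) (v : H j) :
    S.components l (S.map h v) = S.components j v := by
  ext i
  rw [components_apply, components_apply, component_map]

theorem components_of_pure [DecidableEq ι] {i : ι} {w : H i} (hw : w ∈ S.pure i) :
    S.components i w = lp.single 2 i w := by
  ext j
  rw [components_apply]
  by_cases h : j = i
  · subst h
    rw [S.component_self hw]; simp
  · rw [S.component_ne (Ne.symm h) hw]
    simp [h]

variable {V : Type*} [AddCommGroup V] [Module ℂ V] (t : ∀ i, H i →ₗ[ℂ] V)

theorem span_pure_eq_top
    (ht : ∀ {i j : ι} (h : i ≤ j) (v : H i), t j (S.map h v) = t i v)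
    (hspan : Submodule.span ℂ {x | ∃ i v, x = t i v} = ⊤) :
    Submodule.span ℂ {x | ∃ (i : ι), ∃ w ∈ S.pure i, x = t i w} = ⊤ := by
  rw [eq_top_iff, ← hspan, Submodule.span_le]
  rintro _ ⟨j, v, rfl⟩
  have hv : v ∈ (⊤ : Submodule ℂ (H j)) := trivial
  rw [← S.span_pure j] at hv
  have h : Submodule.span ℂ {u : H j | ∃ (i : ι) (h : i ≤ j), ∃ w ∈ S.pure i, u = S.map h w} ≤
      (Submodule.span ℂ {x | ∃ (i : ι), ∃ w ∈ S.pure i, x = t i w}).comap (t j) := by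
    rw [Submodule.span_le]
    rintro _ ⟨i, h, w, hw, rfl⟩
    rw [SetLike.mem_coe, Submodule.mem_comap, ht]
    exact Submodule.subset_span ⟨i, w, hw, rfl⟩
  exact h hv

/-- The algebraic limit embeds into the Hilbert sum: it is the direct sum of the spaces of pure
vectors. -/
theorem exists_injective_components
    (ht : ∀ {i j : ι} (h : i ≤ j) (v : H i), t j (S.map h v) = t i v)
    (hspan : Submodule.span ℂ {x | ∃ i v, x = t i v} = ⊤)
    (hlift : ∀ f : ∀ i, H i →ₗ[ℂ] lp H 2,
      (∀ {i j : ι} (h : i ≤ j) (v : H i), f j (S.map h v) = f i v) →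
      ∃ Ψ : V →ₗ[ℂ] lp H 2, ∀ i v, Ψ (t i v) = f i v) :
    ∃ Ψ : V →ₗ[ℂ] lp H 2, Function.Injective Ψ ∧
    ∀ i v, Ψ (t i v) = S.components i v := by
  classical
  obtain ⟨Ψ, hΨ⟩ := hlift S.components fun h v => S.components_map h v
  refine ⟨Ψ, ?_, hΨ⟩
  -- the components of the image in `V` of a sum of pure vectors are the summands
  let Λ : DirectSum ι (fun i => S.pure i) →ₗ[ℂ] V :=
    DirectSum.toModule ℂ ι V fun i => t i ∘ₗ (S.pure i).subtype
  have hΛ : Function.Surjective Λ := by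
    rw [← LinearMap.range_eq_top, eq_top_iff, ← S.span_pure_eq_top t ht hspan, Submodule.span_le]
    rintro _ ⟨i, w, hw, rfl⟩
    exact ⟨DirectSum.lof ℂ ι (fun i => S.pure i) i ⟨w, hw⟩, by
      rw [DirectSum.toModule_lof]; rfl⟩
  have hx : ∀ (x : DirectSum ι (fun i => S.pure i)) (i : ι), Ψ (Λ x) i = x i := by
    intro x i
    induction x using DirectSum.induction_on with
    | zero => simp
    | add x y hx hy =>
      rw [map_add, map_add, lp.coeFn_add, Pi.add_apply, hx, hy]; rfl
    | of j w =>
      have h1 : Λ (DirectSum.of (fun i => S.pure i) j w) = t j w := by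
        change Λ (DirectSum.lof ℂ ι (fun i => S.pure i) j w) = _
        rw [DirectSum.toModule_lof]
        rfl
      rw [h1, hΨ, S.components_of_pure w.2]
      by_cases h : i = j
      · subst h
        simp
      · rw [DirectSum.of_eq_of_ne _ _ _ h]
        simp [h]
  rw [injective_iff_map_eq_zero]
  intro q hq
  obtain ⟨x, rfl⟩ := hΛ q
  have h0 : x = 0 := by
    refine DFinsupp.ext fun i => Subtype.ext ?_
    have := hx x i
    rw [hq] at this
    exact this.symm
  rw [h0, map_zero]

/-- There is an inner product on the algebraic limit for which the pure vectors of different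
spaces are orthogonal. -/
theorem exists_core
    (ht : ∀ {i j : ι} (h : i ≤ j) (v : H i), t j (S.map h v) = t i v)
    (hspan : Submodule.span ℂ {x | ∃ i v, x = t i v} = ⊤)
    (hlift : ∀ f : ∀ i, H i →ₗ[ℂ] lp H 2,
      (∀ {i j : ι} (h : i ≤ j) (v : H i), f j (S.map h v) = f i v) →
      ∃ Ψ : V →ₗ[ℂ] lp H 2, ∀ i v, Ψ (t i v) = f i v) :
    ∃ c : InnerProductSpace.Core ℂ V,
    (∀ i, ∀ w ∈ S.pure i, ∀ w' ∈ S.pure i, c.inner (t i w) (t i w') = inner ℂ w w') ∧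
    ∀ i j : ι, i ≠ j → ∀ w ∈ S.pure i, ∀ w' ∈ S.pure j, c.inner (t i w) (t j w') = 0 := by
  classical
  obtain ⟨Ψ, hinj, hΨ⟩ := S.exists_injective_components t ht hspan hlift
  refine ⟨{ inner x y := inner ℂ (Ψ x) (Ψ y)
            conj_inner_symm := fun x y => inner_conj_symm _ _
            re_inner_nonneg := fun x => inner_self_nonneg
            add_left := fun x y z => by rw [map_add, inner_add_left]
            smul_left := fun x y r => by rw [map_smul, inner_smul_left]
            definite := fun x hx => hinj (by
              rw [map_zero]; exact inner_self_eq_zero.1 hx) }, ?_, ?_⟩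
  · intro i w hw w' hw'
    change inner ℂ (Ψ (t i w)) (Ψ (t i w')) = _
    rw [hΨ, hΨ, S.components_of_pure hw, S.components_of_pure hw', lp.inner_single_left]
    simp
  · intro i j hij w hw w' hw'
    change inner ℂ (Ψ (t i w)) (Ψ (t j w')) = _
    rw [hΨ, hΨ, S.components_of_pure hw, S.components_of_pure hw', lp.inner_single_left]
    simp [hij]

end Inner

/-- An inner product is determined by its values on a spanning set. -/
theorem _root_.InnerProductSpace.Core.ext_of_span {V : Type*} [AddCommGroup V] [Module ℂ V]
    {c c' : InnerProductSpace.Core ℂ V} {s : Set V} (hs : Submodule.span ℂ s = ⊤)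
    (h : ∀ x ∈ s, ∀ y ∈ s, c.inner x y = c'.inner x y) : c = c' := by
  have h0 : ∀ (c : InnerProductSpace.Core ℂ V) x, c.inner 0 x = 0 := fun c x => by
    have := c.smul_left 0 x 0
    rwa [zero_smul, map_zero, zero_mul] at this
  have h1 : ∀ x ∈ s, ∀ y, c.inner y x = c'.inner y x := by
    intro x hx y
    have hy : y ∈ Submodule.span ℂ s := hs ▸ trivial
    induction hy using Submodule.span_induction with
    | mem y hy => exact h y hy x hx
    | zero => rw [h0, h0]
    | add a b _ _ ha hb => rw [c.add_left, c'.add_left, ha, hb]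
    | smul r a _ ha => rw [c.smul_left, c'.smul_left, ha]
  have h2 : ∀ x y, c.inner x y = c'.inner x y := by
    intro x y
    have hx : x ∈ Submodule.span ℂ s := hs ▸ trivial
    induction hx using Submodule.span_induction with
    | mem x hx => rw [← c.conj_inner_symm, ← c'.conj_inner_symm, h1 x hx]
    | zero => rw [h0, h0]
    | add a b _ _ ha hb => rw [c.add_left, c'.add_left, ha, hb]
    | smul r a _ ha => rw [c.smul_left, c'.smul_left, ha]
  have h3 : c.inner = c'.inner := funext fun x => funext fun y => h2 x y
  obtain ⟨⟨⟨i⟩, _, _, _, _⟩, _⟩ := c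
  obtain ⟨⟨⟨i'⟩, _, _, _, _⟩, _⟩ := c'
  cases h3
  rfl

end PureSystem

/-! ### Operators on a limit -/

namespace PureSystem

variable {ι : Type*} [PartialOrder ι] {H : ι → Type*} [∀ i, NormedAddCommGroup (H i)]
  [∀ i, InnerProductSpace ℂ (H i)] (S : PureSystem ι H)

theorem inner_map_pure {i j l : ι} (h : i ≤ l) (h' : j ≤ l) (hne : i ≠ j) {w : H i}
    (hw : w ∈ S.pure i) {w' : H j} (hw' : w' ∈ S.pure j) :
    inner ℂ (S.map h w) (S.map h' w') = 0 := by
  by_cases hij : i ≤ j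
  · have hji : ¬ j ≤ i := fun hji => hne (le_antisymm hij hji)
    rw [← inner_conj_symm, S.inner_eq_zero h' h hji w' hw', map_zero]
  · exact S.inner_eq_zero h h' hij w hw _

section Limit

variable {X : Type*} [NormedAddCommGroup X] [InnerProductSpace ℂ X] (t : ∀ i, H i →ₗ[ℂ] X)

/-- The spaces of the system embed isometrically into a limit in which the pure vectors of
different spaces are orthogonal. -/
theorem inner_of_inner_pure (ht : ∀ {i j : ι} (h : i ≤ j) (v : H i), t j (S.map h v) = t i v)
    (h1 : ∀ i, ∀ w ∈ S.pure i, ∀ w' ∈ S.pure i, inner ℂ (t i w) (t i w') = inner ℂ w w')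
    (h2 : ∀ i j : ι, i ≠ j → ∀ w ∈ S.pure i, ∀ w' ∈ S.pure j, inner ℂ (t i w) (t j w') = 0)
    (l : ι) (v v' : H l) : inner ℂ (t l v) (t l v') = inner ℂ v v' := by
  have hs : ∀ v : H l, v ∈ Submodule.span ℂ
      {u : H l | ∃ (i : ι) (h : i ≤ l), ∃ w ∈ S.pure i, u = S.map h w} := fun v => by
    rw [S.span_pure]; trivial
  induction hs v using Submodule.span_induction with
  | zero => rw [map_zero, inner_zero_left, inner_zero_left]
  | add x y _ _ hx hy => rw [map_add, inner_add_left, inner_add_left, hx, hy]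
  | smul c x _ hx => rw [map_smul, inner_smul_left, inner_smul_left, hx]
  | mem v hv =>
    obtain ⟨i, h, w, hw, rfl⟩ := hv
    induction hs v' using Submodule.span_induction with
    | zero => rw [map_zero, inner_zero_right, inner_zero_right]
    | add x y _ _ hx hy => rw [map_add, inner_add_right, inner_add_right, hx, hy]
    | smul c x _ hx => rw [map_smul, inner_smul_right, inner_smul_right, hx]
    | mem v' hv' =>
      obtain ⟨j, h', w', hw', rfl⟩ := hv'
      rw [ht, ht]
      by_cases hne : i = j
      · subst hne
        rw [h1 i w hw w' hw', LinearIsometry.inner_map_map]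
      · rw [h2 i j hne w hw w' hw', S.inner_map_pure h h' hne hw hw']

theorem inner_pure_eq_zero (ht : ∀ {i j : ι} (h : i ≤ j) (v : H i), t j (S.map h v) = t i v)
    (h2 : ∀ i j : ι, i ≠ j → ∀ w ∈ S.pure i, ∀ w' ∈ S.pure j, inner ℂ (t i w) (t j w') = 0)
    (i j : ι) (hij : ¬ i ≤ j) (w : H i) (hw : w ∈ S.pure i) (v : H j) :
    inner ℂ (t i w) (t j v) = 0 := by
  have hv : v ∈ Submodule.span ℂ
      {u : H j | ∃ (i : ι) (h : i ≤ j), ∃ w ∈ S.pure i, u = S.map h w} := by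
    rw [S.span_pure]; trivial
  induction hv using Submodule.span_induction with
  | zero => rw [map_zero, inner_zero_right]
  | add x y _ _ hx hy => rw [map_add, inner_add_right, hx, hy, add_zero]
  | smul c x _ hx => rw [map_smul, inner_smul_right, hx, mul_zero]
  | mem v hv =>
    obtain ⟨l, h, w', hw', rfl⟩ := hv
    rw [ht]
    exact h2 i l (fun hil => hij (hil.le.trans h)) w hw w' hw'

end Limit

/-- Compatible symmetric operators that preserve purity descend to a limit of the system. The
well-definedness follows from the symmetry: the limit operator has an adjoint whose domain contains
the dense set of vectors which come from pure vectors in the domains. -/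
theorem existsUnique_limitOperator {X : Type*} [NormedAddCommGroup X] [InnerProductSpace ℂ X]
    (J : ∀ i, H i →ₗᵢ[ℂ] X) (hJ : ∀ {i j : ι} (h : i ≤ j) (v : H i), J j (S.map h v) = J i v)
    (hJ_inner : ∀ i j : ι, ¬ i ≤ j → ∀ w ∈ S.pure i, ∀ v, inner ℂ (J i w) (J j v) = 0)
    (hJ_dense : Dense (Submodule.span ℂ {x | ∃ i v, x = J i v} : Set X))
    (D : ∀ i, H i →ₗ.[ℂ] H i) (hD_dense : ∀ i, Dense ((D i).domain : Set (H i)))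
    (hD_map : ∀ {i j : ι} (h : i ≤ j) (v : (D i).domain), ∃ h' : S.map h v ∈ (D j).domain,
      D j ⟨S.map h v, h'⟩ = S.map h (D i v))
    (hD_symm : ∀ i (v w : (D i).domain), inner ℂ (D i v) (w : H i) = inner ℂ (v : H i) (D i w))
    (hD_pure : ∀ i (v : (D i).domain), (v : H i) ∈ S.pure i → D i v ∈ S.pure i)
    (hD_closure : ∀ i, ∀ w ∈ S.pure i, w ∈ closure {x | x ∈ S.pure i ∧ x ∈ (D i).domain}) :
    ∃! L : X →ₗ.[ℂ] X, Dense (L.domain : Set X) ∧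
      L.domain = Submodule.span ℂ {x | ∃ i, ∃ v : (D i).domain, x = J i v} ∧
      ∀ i (v : (D i).domain), ∃ h : J i v ∈ L.domain, L ⟨J i v, h⟩ = J i (D i v) := by
  set R : Submodule ℂ (X × X) := Submodule.span ℂ
    {p | ∃ i, ∃ v : (D i).domain, p = (J i v, J i (D i v))} with hR
  -- the graph `R` lies in the adjoint of the operator on the pure vectors
  have hadj : ∀ p ∈ R, ∀ i (η : (D i).domain), (η : H i) ∈ S.pure i →
      inner ℂ (J i η) p.2 = inner ℂ (J i (D i η)) p.1 := by
    intro p hp i η hη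
    induction hp using Submodule.span_induction with
    | mem p hp =>
      obtain ⟨j, v, rfl⟩ := hp
      simp only
      by_cases h : i ≤ j
      · obtain ⟨h', h1⟩ := hD_map h η
        rw [← hJ h, ← hJ h, LinearIsometry.inner_map_map, LinearIsometry.inner_map_map, ← h1,
          hD_symm]
      · rw [hJ_inner i j h _ hη, hJ_inner i j h _ (hD_pure i η hη)]
    | zero => simp
    | add p q _ _ hp hq => simp only [Prod.fst_add, Prod.snd_add, inner_add_right, hp, hq]
    | smul c p _ hp => simp only [Prod.smul_fst, Prod.smul_snd, inner_smul_right, hp]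
  have hpure : Dense (Submodule.span ℂ
      {x | ∃ i, ∃ η : (D i).domain, (η : H i) ∈ S.pure i ∧ x = J i η} : Set X) := by
    set T := Submodule.span ℂ
      {x | ∃ i, ∃ η : (D i).domain, (η : H i) ∈ S.pure i ∧ x = J i η} with hT
    have h1 : ∀ i, ∀ w ∈ S.pure i, J i w ∈ T.topologicalClosure := fun i w hw =>
      map_mem_closure (J i).continuous (hD_closure i w hw) fun x hx =>
        Submodule.subset_span ⟨i, ⟨x, hx.2⟩, hx.1, rfl⟩
    have h2 : ∀ j, ⊤ ≤ T.topologicalClosure.comap (J j).toLinearMap := by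
      intro j
      rw [← S.span_pure j, Submodule.span_le]
      rintro _ ⟨i, h, w, hw, rfl⟩
      rw [SetLike.mem_coe, Submodule.mem_comap]
      change J j (S.map h w) ∈ T.topologicalClosure
      rw [hJ]
      exact h1 i w hw
    refine dense_closure.1 (hJ_dense.mono ?_)
    refine SetLike.coe_subset_coe.2 (Submodule.span_le (p := T.topologicalClosure) |>.2 ?_)
    rintro _ ⟨i, v, rfl⟩
    exact h2 i trivial
  have hR0 : ∀ p ∈ R, p.1 = 0 → p.2 = 0 := by
    intro p hp hp1
    refine hpure.eq_zero_of_inner_right (𝕜 := ℂ) fun v hv => ?_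
    induction hv using Submodule.span_induction with
    | mem v hv =>
      obtain ⟨i, η, hη, rfl⟩ := hv
      rw [hadj p hp i η hη, hp1, inner_zero_right]
    | zero => exact inner_zero_left _
    | add x y _ _ hx hy => rw [inner_add_left, hx, hy, add_zero]
    | smul c x _ hx => rw [inner_smul_left, hx, mul_zero]
  have hdom : R.toLinearPMap.domain =
      Submodule.span ℂ {x | ∃ i, ∃ v : (D i).domain, x = J i v} := by
    rw [Submodule.toLinearPMap_domain, hR, Submodule.map_span]
    congr 1
    ext x
    constructor
    · rintro ⟨_, ⟨i, v, rfl⟩, rfl⟩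
      exact ⟨i, v, rfl⟩
    · rintro ⟨i, v, rfl⟩
      exact ⟨_, ⟨i, v, rfl⟩, rfl⟩
  have hmem : ∀ i (v : (D i).domain),
      J i v ∈ Submodule.span ℂ {x | ∃ i, ∃ v : (D i).domain, x = J i v} := fun i v =>
    Submodule.subset_span ⟨i, v, rfl⟩
  have hdense : Dense
      (Submodule.span ℂ {x | ∃ i, ∃ v : (D i).domain, x = J i v} : Set X) := by
    refine dense_closure.1 (hJ_dense.mono ?_)
    refine SetLike.coe_subset_coe.2 (Submodule.span_le
      (p := (Submodule.span ℂ {x | ∃ i, ∃ v : (D i).domain, x = J i v}).topologicalClosure) |>.2 ?_)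
    rintro _ ⟨i, v, rfl⟩
    exact map_mem_closure (J i).continuous (hD_dense i v) fun x hx => hmem i ⟨x, hx⟩
  refine ⟨R.toLinearPMap, ⟨hdom ▸ hdense, hdom, fun i v => ?_⟩, ?_⟩
  · have h : J i v ∈ R.toLinearPMap.domain := hdom ▸ hmem i v
    refine ⟨h, ?_⟩
    have h1 : (J i v, R.toLinearPMap ⟨J i v, h⟩) ∈ R :=
      Submodule.mem_graph_toLinearPMap hR0 ⟨J i v, h⟩
    have h2 : (J i v, J i (D i v)) ∈ R := Submodule.subset_span ⟨i, v, rfl⟩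
    exact sub_eq_zero.1 (hR0 _ (R.sub_mem h1 h2) (sub_self _))
  · rintro L ⟨-, hL, hL'⟩
    have hLR : L.graph = R := by
      have h1 : R ≤ L.graph := by
        rw [hR, Submodule.span_le]
        rintro _ ⟨i, v, rfl⟩
        obtain ⟨h, h'⟩ := hL' i v
        rw [SetLike.mem_coe, LinearPMap.mem_graph_iff]
        exact ⟨⟨_, h⟩, rfl, h'⟩
      refine le_antisymm (fun p hp => ?_) h1
      have hp1 : p.1 ∈ R.toLinearPMap.domain := by
        rw [hdom, ← hL]
        exact LinearPMap.mem_domain_of_mem_graph hp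
      obtain ⟨q, hq, hqp⟩ := hp1
      have h2 : q.2 = p.2 := L.mem_graph_snd_inj (h1 hq) hp hqp
      rwa [← Prod.ext hqp h2]
    refine LinearPMap.eq_of_eq_graph ?_
    rw [hLR, Submodule.toLinearPMap_graph_eq R hR0]

end PureSystem

/-! ### The inductive limit of the spaces of Clifford sections -/

theorem DirectSum.exists_linearMap_lof {R ι V : Type*} [Semiring R] [DecidableEq ι] {H : ι → Type*}
    [∀ i, AddCommMonoid (H i)] [∀ i, Module R (H i)] [AddCommMonoid V] [Module R V]
    (f : ∀ i, H i →ₗ[R] V) :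
    ∃ Ψ : DirectSum ι H →ₗ[R] V, ∀ i v, Ψ (DirectSum.lof R ι H i v) = f i v :=
  ⟨DirectSum.toModule R ι V f, fun i v => DirectSum.toModule_lof R i v⟩

section CliffordLimit

variable {k : ℕ} {M : Type*} [TopologicalSpace M] [T2Space M]
  [ChartedSpace (EuclideanSpace ℝ (Fin k)) M] [IsManifold (𝓡 k) ∞ M] {x₀ : M}
  {A : Type*} [NormedRing A] [NormedAlgebra ℝ A] [FiniteDimensional ℝ A]
  {G : Type*} [Group G] [TopologicalSpace G] {ρ : G →* A}
  {B : BiinvariantMetric ρ} {d : ℕ} (e : OrthonormalFrame B d)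
  {κ : Type*} [Fintype κ]
  [IsTopologicalGroup G] [CompactSpace G] [T2Space G]
  [SecondCountableTopology G] [MeasurableSpace G] [BorelSpace G] (hρ : Continuous ρ)
  {μ : Measure G} [μ.IsHaarMeasure] [IsProbabilityMeasure μ]
  {gen : ∀ F : LoopSubgroup k x₀, LoopSystem F.1}

namespace OrthonormalFrame

variable (gen μ κ) in
/-- The system of the spaces `L²(G^{n(F)}, Cl(TG^{n(F)}) ⊗ ℂ^κ)`. -/
noncomputable def pureSystem (hρi : Function.Injective ρ) :
    PureSystem (LoopSubgroup k x₀) fun F => SpinorL2 μ (gen F).n d κ where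
  map h := e.pullbackL2 hρ μ (inducedMap gen h)
  map_refl F v := by
    rw [inducedMap_refl]
    exact e.pullbackL2_id hρ μ v
  map_map h h' v := by
    rw [← pullbackL2_comp, inducedMap_comp]
  pure F := e.pureSubspace μ (gen F).n κ
  finite_le := LoopSubgroup.finite_le
  span_pure F := by
    rw [eq_top_iff, ← e.span_pullbackL2_pure hρ μ hρi, Submodule.span_le]
    rintro _ ⟨m, τ, w, hw, rfl⟩
    obtain ⟨E, h, υ, hE, rfl⟩ := exists_inducedMap_factor gen F τ
    exact Submodule.subset_span ⟨E, h, _, e.pullbackL2_mem_pureSubspace hρ μ υ hE hw,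
      e.pullbackL2_comp hρ μ _ _ w⟩
  inner_eq_zero h h' hn w hw v :=
    e.inner_pullbackL2_eq_zero hρ μ hρi _ _
      (fun hr => hn (le_of_range_inducedMap_subset gen h h' hr)) hw v

theorem toAlgLimit_pullbackL2 {E F : LoopSubgroup k x₀} (h : E ≤ F)
    (v : SpinorL2 μ (gen E).n d κ) :
    e.toAlgLimit κ gen μ F (e.pullbackL2 hρ μ (inducedMap gen h) v) =
      e.toAlgLimit κ gen μ E v := by
  classical
  refine ((Submodule.Quotient.eq _).2 (Submodule.subset_span ?_)).symm
  exact ⟨E, F, h, _, inducedMap_induced gen h, v, _, e.coeFn_pullbackL2 hρ μ _ v, rfl⟩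

theorem span_toAlgLimit : Submodule.span ℂ
    {x | ∃ (F : LoopSubgroup k x₀) (v : SpinorL2 μ (gen F).n d κ), x = e.toAlgLimit κ gen μ F v} =
      ⊤ := by
  classical
  rw [eq_top_iff]
  rintro x -
  obtain ⟨y, rfl⟩ := Submodule.mkQ_surjective _ x
  induction y using DirectSum.induction_on with
  | zero => rw [map_zero]; exact zero_mem _
  | of F v => exact Submodule.subset_span ⟨F, v, rfl⟩
  | add x y hx hy => rw [map_add]; exact add_mem hx hy

theorem exists_lift_algLimit {V : Type*} [AddCommGroup V] [Module ℂ V]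
    (f : ∀ F : LoopSubgroup k x₀, SpinorL2 μ (gen F).n d κ →ₗ[ℂ] V)
    (hf : ∀ {E F : LoopSubgroup k x₀} (h : E ≤ F) (v : SpinorL2 μ (gen E).n d κ),
      f F (e.pullbackL2 hρ μ (inducedMap gen h) v) = f E v) :
    ∃ Ψ : e.AlgLimit κ gen μ →ₗ[ℂ] V, ∀ F v, Ψ (e.toAlgLimit κ gen μ F v) = f F v := by
  classical
  obtain ⟨Ψ₀, h0⟩ : ∃ Ψ₀ : LimitSum κ gen μ d →ₗ[ℂ] V, ∀ F v,
      Ψ₀ (DirectSum.lof ℂ _ (fun F => SpinorL2 μ (gen F).n d κ) F v) = f F v :=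
    DirectSum.exists_linearMap_lof f
  have hle : e.limitRel κ gen μ ≤ LinearMap.ker Ψ₀ := by
    rw [limitRel, Submodule.span_le]
    rintro _ ⟨F₁, F₂, h, τ, hτ, v, u, hu, rfl⟩
    rw [eq_pullbackL2_iff hρ e μ, eq_inducedMap gen h hτ] at hu
    rw [SetLike.mem_coe, LinearMap.mem_ker, map_sub, sub_eq_zero]
    refine (h0 F₁ v).trans (((h0 F₂ u).trans ?_).symm)
    rw [hu, hf]
  exact ⟨(e.limitRel κ gen μ).liftQ Ψ₀ hle, fun F v => h0 F v⟩

theorem span_toAlgLimit_pure (hρ : Continuous ρ) (hρi : Function.Injective ρ) :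
    Submodule.span ℂ
    {x | ∃ F : LoopSubgroup k x₀, ∃ w ∈ e.pureSubspace μ (gen F).n κ,
      x = e.toAlgLimit κ gen μ F w} = ⊤ :=
  (e.pureSystem κ hρ μ gen hρi).span_pure_eq_top (e.toAlgLimit κ gen μ)
    (fun h v => e.toAlgLimit_pullbackL2 hρ h v) e.span_toAlgLimit

/-- The inner products of pure vectors in the limit. -/
theorem isLimitInner_iff (hρ : Continuous ρ) (hρi : Function.Injective ρ)
    (c : InnerProductSpace.Core ℂ (e.AlgLimit κ gen μ)) : e.IsLimitInner c ↔
    (∀ F, ∀ w ∈ e.pureSubspace μ (gen F).n κ, ∀ w' ∈ e.pureSubspace μ (gen F).n κ,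
      c.inner (e.toAlgLimit κ gen μ F w) (e.toAlgLimit κ gen μ F w') = inner ℂ w w') ∧
    ∀ E F : LoopSubgroup k x₀, E ≠ F → ∀ w ∈ e.pureSubspace μ (gen E).n κ,
      ∀ w' ∈ e.pureSubspace μ (gen F).n κ,
      c.inner (e.toAlgLimit κ gen μ E w) (e.toAlgLimit κ gen μ F w') = 0 := by
  have horth : ∀ {E F F' : LoopSubgroup k x₀} (h : E ≤ F') (h' : F ≤ F'), E ≠ F →
      ∀ w ∈ e.pureSubspace μ (gen E).n κ, ∀ w' ∈ e.pureSubspace μ (gen F).n κ,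
      inner ℂ (e.pullbackL2 hρ μ (inducedMap gen h) w)
        (e.pullbackL2 hρ μ (inducedMap gen h') w') = 0 := fun h h' hne w hw w' hw' =>
    (e.pureSystem κ hρ μ gen hρi).inner_map_pure h h' hne hw hw'
  constructor
  · intro hc
    refine ⟨fun F w hw w' hw' => ?_, fun E F hne w hw w' hw' => ?_⟩
    · rw [(hc F F w hw w' hw').1 F le_rfl le_rfl _ _ (inducedMap_induced gen le_rfl)
        (inducedMap_induced gen le_rfl) _ _ (e.coeFn_pullbackL2 hρ μ _ _)
        (e.coeFn_pullbackL2 hρ μ _ _), LinearIsometry.inner_map_map]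
    · by_cases hF : ∃ F' : LoopSubgroup k x₀, E ≤ F' ∧ F ≤ F'
      · obtain ⟨F', h, h'⟩ := hF
        rw [(hc E F w hw w' hw').1 F' h h' _ _ (inducedMap_induced gen h)
          (inducedMap_induced gen h') _ _ (e.coeFn_pullbackL2 hρ μ _ _)
          (e.coeFn_pullbackL2 hρ μ _ _), horth h h' hne w hw w' hw']
      · exact (hc E F w hw w' hw').2 hF
  · rintro ⟨h1, h2⟩ E F w hw w' hw'
    refine ⟨fun F' h h' τ₁ τ₂ hτ₁ hτ₂ u₁ u₂ hu₁ hu₂ => ?_, fun hn => ?_⟩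
    · rw [eq_pullbackL2_iff hρ e μ, eq_inducedMap gen h hτ₁] at hu₁
      rw [eq_pullbackL2_iff hρ e μ, eq_inducedMap gen h' hτ₂] at hu₂
      rw [hu₁, hu₂]
      by_cases hne : E = F
      · subst hne
        rw [h1 E w hw w' hw', LinearIsometry.inner_map_map]
      · rw [h2 E F hne w hw w' hw', horth h h' hne w hw w' hw']
    · exact h2 E F (fun hEF => hn ⟨F, hEF.le, le_rfl⟩) w hw w' hw'

theorem existsUnique_isLimitInner (hρ : Continuous ρ) (hρi : Function.Injective ρ) :
    ∃! c : InnerProductSpace.Core ℂ (e.AlgLimit κ gen μ), e.IsLimitInner c := by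
  obtain ⟨c, h1, h2⟩ := (e.pureSystem κ hρ μ gen hρi).exists_core (e.toAlgLimit κ gen μ)
    (fun h v => e.toAlgLimit_pullbackL2 hρ h v) e.span_toAlgLimit
    (fun f hf => e.exists_lift_algLimit hρ f hf)
  have hc : e.IsLimitInner c := (e.isLimitInner_iff hρ hρi c).2 ⟨h1, h2⟩
  refine ⟨c, hc, fun c' hc' => ?_⟩
  have hc'' := (e.isLimitInner_iff hρ hρi c').1 hc'
  refine InnerProductSpace.Core.ext_of_span (e.span_toAlgLimit_pure hρ hρi) ?_
  rintro _ ⟨E, w, hw, rfl⟩ _ ⟨F, w', hw', rfl⟩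
  by_cases hne : E = F
  · subst hne
    rw [hc''.1 E w hw w' hw', h1 E w hw w' hw']
  · rw [hc''.2 E F hne w hw w' hw', h2 E F hne w hw w' hw']

end OrthonormalFrame

end CliffordLimit

/-! ### The Euler-Dirac operator of the inductive limit -/

section LimitOperator

variable {k : ℕ} {M : Type*} [TopologicalSpace M] [T2Space M]
  [ChartedSpace (EuclideanSpace ℝ (Fin k)) M] [IsManifold (𝓡 k) ∞ M] {x₀ : M}
  {A : Type*} [NormedRing A] [NormedAlgebra ℝ A] [FiniteDimensional ℝ A]
  {G : Type*} [Group G] [TopologicalSpace G] {ρ : G →* A}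
  {B : BiinvariantMetric ρ} {d : ℕ} (e : OrthonormalFrame B d)
  {κ : Type*} [Fintype κ]
  [IsTopologicalGroup G] [CompactSpace G] [T2Space G]
  [SecondCountableTopology G] [MeasurableSpace G] [BorelSpace G] (hρ : Continuous ρ)
  {μ : Measure G} [μ.IsHaarMeasure] [IsProbabilityMeasure μ]
  {gen : ∀ F : LoopSubgroup k x₀, LoopSystem F.1}

namespace OrthonormalFrame

theorem inner_diracL2 {n : ℕ} (v w : (e.diracL2 hρ μ n κ).domain) :
    inner ℂ (e.diracL2 hρ μ n κ v) (w : SpinorL2 μ n d κ) =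
      inner ℂ (v : SpinorL2 μ n d κ) (e.diracL2 hρ μ n κ w) := by
  obtain ⟨ξ, hξ⟩ := v.2
  obtain ⟨η, hη⟩ := w.2
  have h1 : e.diracL2 hρ μ n κ v = _ := e.diracL2_eq hρ μ v.2 hξ.symm
  have h2 : e.diracL2 hρ μ n κ w = _ := e.diracL2_eq hρ μ w.2 hη.symm
  rw [h1, h2, ← hξ, ← hη]
  exact e.inner_smoothL2_eulerDiracLin hρ μ ξ η

theorem diracL2_mem_pureSubspace (hρi : Function.Injective ρ) {n : ℕ}
    (v : (e.diracL2 hρ μ n κ).domain) (hv : (v : SpinorL2 μ n d κ) ∈ e.pureSubspace μ n κ) :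
    e.diracL2 hρ μ n κ v ∈ e.pureSubspace μ n κ := by
  obtain ⟨ξ, hξ⟩ := v.2
  have h1 : e.diracL2 hρ μ n κ v = _ := e.diracL2_eq hρ μ v.2 hξ.symm
  rw [h1]
  exact e.eulerDiracLin_mem_pureSubspace hρ μ hρi (hξ ▸ hv)

variable {e} in
/-- The embedding of the algebraic limit into its completion. -/
noncomputable def algLimitToHilbertLimit (c : InnerProductSpace.Core ℂ (e.AlgLimit κ gen μ)) :
    e.AlgLimit κ gen μ →ₗ[ℂ] HilbertLimit c :=
  (UniformSpace.Completion.toComplₗᵢ (𝕜 := ℂ) (E := PreLimit c)).toLinearMap ∘ₗ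
    (show e.AlgLimit κ gen μ →ₗ[ℂ] PreLimit c from LinearMap.id)

variable {e} in
/-- `toHilbertLimit`, as a linear map. -/
noncomputable def toHilbertLimitₗ (c : InnerProductSpace.Core ℂ (e.AlgLimit κ gen μ))
    (F : LoopSubgroup k x₀) : SpinorL2 μ (gen F).n d κ →ₗ[ℂ] HilbertLimit c :=
  algLimitToHilbertLimit c ∘ₗ e.toAlgLimit κ gen μ F

theorem inner_toHilbertLimitₗ (c : InnerProductSpace.Core ℂ (e.AlgLimit κ gen μ))
    (E F : LoopSubgroup k x₀) (v : SpinorL2 μ (gen E).n d κ) (w : SpinorL2 μ (gen F).n d κ) :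
    inner ℂ (toHilbertLimitₗ c E v) (toHilbertLimitₗ c F w) =
      c.inner (e.toAlgLimit κ gen μ E v) (e.toAlgLimit κ gen μ F w) :=
  UniformSpace.Completion.inner_coe (𝕜 := ℂ) (E := PreLimit c) _ _

theorem dense_span_toHilbertLimitₗ (c : InnerProductSpace.Core ℂ (e.AlgLimit κ gen μ)) :
    Dense (Submodule.span ℂ {x | ∃ (F : LoopSubgroup k x₀) (v : SpinorL2 μ (gen F).n d κ),
      x = toHilbertLimitₗ c F v} : Set (HilbertLimit c)) := by
  refine (UniformSpace.Completion.denseRange_coe (α := PreLimit c)).mono ?_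
  rintro _ ⟨x, rfl⟩
  have hx : algLimitToHilbertLimit c x ∈ (⊤ : Submodule ℂ _).map (algLimitToHilbertLimit c) :=
    ⟨x, trivial, rfl⟩
  rw [← e.span_toAlgLimit, Submodule.map_span] at hx
  refine Submodule.span_mono ?_ hx
  rintro _ ⟨_, ⟨F, v, rfl⟩, rfl⟩
  exact ⟨F, v, rfl⟩

theorem existsUnique_limitDirac (hρi : Function.Injective ρ)
    {c : InnerProductSpace.Core ℂ (e.AlgLimit κ gen μ)} (hc : e.IsLimitInner c) :
    ∃! L : HilbertLimit c →ₗ.[ℂ] HilbertLimit c,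
      Dense (L.domain : Set (HilbertLimit c)) ∧
      L.domain = Submodule.span ℂ {x | ∃ (F : LoopSubgroup k x₀)
        (v : (e.diracL2 hρ μ (gen F).n κ).domain), x = toHilbertLimit c F v} ∧
      ∀ (F : LoopSubgroup k x₀) (v : (e.diracL2 hρ μ (gen F).n κ).domain),
        ∃ h : toHilbertLimit c F v ∈ L.domain,
          L ⟨toHilbertLimit c F v, h⟩ = toHilbertLimit c F (e.diracL2 hρ μ (gen F).n κ v) := by
  obtain ⟨h1, h2⟩ := (e.isLimitInner_iff hρ hρi c).1 hc
  set S := e.pureSystem κ hρ μ gen hρi with hS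
  have ht : ∀ {E F : LoopSubgroup k x₀} (h : E ≤ F) (v : SpinorL2 μ (gen E).n d κ),
      toHilbertLimitₗ c F (S.map h v) = toHilbertLimitₗ c E v := fun h v =>
    congrArg (fun x : PreLimit c => (x : HilbertLimit c)) (e.toAlgLimit_pullbackL2 hρ h v)
  have h1' : ∀ F, ∀ w ∈ S.pure F, ∀ w' ∈ S.pure F,
      inner ℂ (toHilbertLimitₗ c F w) (toHilbertLimitₗ c F w') = inner ℂ w w' :=
    fun F w hw w' hw' => (e.inner_toHilbertLimitₗ c F F w w').trans (h1 F w hw w' hw')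
  have h2' : ∀ E F : LoopSubgroup k x₀, E ≠ F → ∀ w ∈ S.pure E, ∀ w' ∈ S.pure F,
      inner ℂ (toHilbertLimitₗ c E w) (toHilbertLimitₗ c F w') = 0 :=
    fun E F h w hw w' hw' => (e.inner_toHilbertLimitₗ c E F w w').trans (h2 E F h w hw w' hw')
  let J : ∀ F : LoopSubgroup k x₀, SpinorL2 μ (gen F).n d κ →ₗᵢ[ℂ] HilbertLimit c := fun F =>
    (toHilbertLimitₗ c F).isometryOfInner (S.inner_of_inner_pure (toHilbertLimitₗ c) ht h1' h2' F)
  refine S.existsUnique_limitOperator J ht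
    (S.inner_pure_eq_zero (toHilbertLimitₗ c) ht h2') (e.dense_span_toHilbertLimitₗ c)
    (fun F => e.diracL2 hρ μ (gen F).n κ) (fun F => dense_range_smoothL2 μ hρ hρi)
    (fun h v => e.diracL2_pullbackL2 hρ μ _ v.2) ?_ ?_ ?_
  · exact fun F v w => e.inner_diracL2 hρ v w
  · exact fun F v hv => e.diracL2_mem_pureSubspace hρ hρi v hv
  · intro F w hw
    refine closure_mono ?_ (e.mem_closure_smooth_of_pure hρ μ hρi hw)
    rintro _ ⟨hx, ξ, rfl⟩
    exact ⟨hx, ξ, rfl⟩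

end OrthonormalFrame

end LimitOperator

theorem mainTheorem2
    {k : ℕ} {M : Type*} [TopologicalSpace M] [T2Space M]
    [ChartedSpace (EuclideanSpace ℝ (Fin k)) M] [IsManifold (𝓡 k) ∞ M] (x₀ : M)
    {N : ℕ} {G : Type*} [Group G] [TopologicalSpace G] [IsTopologicalGroup G] [CompactSpace G]
    [MeasurableSpace G] [BorelSpace G]
    (ρ : G →* MatrixOp N) (hρ : Continuous ρ) (hρ_inj : Function.Injective ρ)
    (B : BiinvariantMetric ρ) {d : ℕ} (e : OrthonormalFrame B d)
    (μ : Measure G) [μ.IsHaarMeasure] [IsProbabilityMeasure μ]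
    (κ : Type*) [Fintype κ]
    (gen : ∀ F : LoopSubgroup k x₀, LoopSystem F.1) :
    -- on smooth sections, the Euler-Dirac operator is `d + d*`
    (∀ n : ℕ,
      ∃ dExt dAdj : smoothFun n (Fib (Idx n d) κ) ρ →ₗ[ℂ] smoothFun n (Fib (Idx n d) κ) ρ,
        Submodule.span ℂ {ξ : smoothFun n (Fib (Idx n d) κ) ρ |
          ∃ (p : ℕ) (θ : (Fin n → MatrixOp N) →
              (Fin n → MatrixOp N) [⋀^Fin p]→L[ℝ] EuclideanSpace ℂ κ),
            SmoothAlong ρ θ ∧ (ξ : (Fin n → G) → Fib (Idx n d) κ) = e.formSection θ} = ⊤ ∧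
        (∀ (p : ℕ) (θ : (Fin n → MatrixOp N) →
              (Fin n → MatrixOp N) [⋀^Fin p]→L[ℝ] EuclideanSpace ℂ κ), SmoothAlong ρ θ →
          ∀ ξ : smoothFun n (Fib (Idx n d) κ) ρ,
            (ξ : (Fin n → G) → Fib (Idx n d) κ) = e.formSection θ →
            (dExt ξ : (Fin n → G) → Fib (Idx n d) κ) = e.formSection (extDeriv θ)) ∧
        (∀ ξ η : smoothFun n (Fib (Idx n d) κ) ρ,
          ∫ g, inner ℂ ((dAdj ξ : (Fin n → G) → Fib (Idx n d) κ) g)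
              ((η : (Fin n → G) → Fib (Idx n d) κ) g) ∂(Measure.pi fun _ => μ) =
            ∫ g, inner ℂ ((ξ : (Fin n → G) → Fib (Idx n d) κ) g)
              ((dExt η : (Fin n → G) → Fib (Idx n d) κ) g) ∂(Measure.pi fun _ => μ)) ∧
        ∀ ξ : smoothFun n (Fib (Idx n d) κ) ρ,
          e.eulerDirac (ξ : (Fin n → G) → Fib (Idx n d) κ) =
            ((dExt ξ + dAdj ξ : smoothFun n (Fib (Idx n d) κ) ρ) :
              (Fin n → G) → Fib (Idx n d) κ)) ∧
    -- the inclusions of the system induce maps which delete and invert coordinates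
    (∀ F₁ F₂ : LoopSubgroup k x₀, ∀ hF : F₁.1 ≤ F₂.1,
      ∃! τ : SignedInj (gen F₁).n (gen F₂).n, τ.Induced (gen F₁) (gen F₂) ∧
        ∀ (φ : F₂.1 →* G) (L₁ : Fin (gen F₁).n → F₁.1) (L₂ : Fin (gen F₂).n → F₂.1),
          (∀ j, (L₁ j : Hoop k x₀) = ((gen F₁).loop j).hoop) →
          (∀ i, (L₂ i : Hoop k x₀) = ((gen F₂).loop i).hoop) →
          τ.map (fun i => φ (L₂ i)) = fun j => φ (Subgroup.inclusion hF (L₁ j))) ∧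
    ∃ (D : ∀ n : ℕ, SpinorL2 μ n d κ →ₗ.[ℂ] SpinorL2 μ n d κ)
      (P : ∀ m n : ℕ, SignedInj m n → (SpinorL2 μ m d κ →ₗᵢ[ℂ] SpinorL2 μ n d κ)),
      -- the Euler-Dirac operators, and the embeddings `P^*`
      (∀ n, e.IsEulerDirac μ (D n) ∧ Dense ((D n).domain : Set (SpinorL2 μ n d κ))) ∧
      (∀ m n τ v, P m n τ v =ᵐ[Measure.pi fun _ => μ] e.pullback τ v) ∧
      -- they commute
      (∀ m n τ (v : (D m).domain), ∃ h : P m n τ v ∈ (D n).domain,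
        D n ⟨P m n τ v, h⟩ = P m n τ (D m v)) ∧
      -- the inductive limit exists
      (∃! c : InnerProductSpace.Core ℂ (e.AlgLimit κ gen μ), e.IsLimitInner c) ∧
      -- the operator on the inductive limit
      ∀ c : InnerProductSpace.Core ℂ (e.AlgLimit κ gen μ), e.IsLimitInner c →
        ∃! Dlim : HilbertLimit c →ₗ.[ℂ] HilbertLimit c,
          Dense (Dlim.domain : Set (HilbertLimit c)) ∧
          Dlim.domain = Submodule.span ℂ
            {x | ∃ (F : LoopSubgroup k x₀) (v : (D (gen F).n).domain), x = toHilbertLimit c F v} ∧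
          ∀ (F : LoopSubgroup k x₀) (v : (D (gen F).n).domain),
            ∃ h : toHilbertLimit c F v ∈ Dlim.domain,
              Dlim ⟨toHilbertLimit c F v, h⟩ = toHilbertLimit c F (D (gen F).n v) := by
  have : T2Space G := t2Space_of_rep hρ hρ_inj
  have : SecondCountableTopology G := secondCountableTopology_of_rep hρ hρ_inj
  refine ⟨fun n => ⟨e.extD, e.extDAdj, e.span_formSection, fun p θ hθ ξ hξ =>
      e.extD_formSection hθ ξ hξ, e.integral_inner_extDAdj μ hρ, e.eulerDirac_eq⟩,
    fun F₁ F₂ hF => ?_, fun n => e.diracL2 hρ μ n κ, fun m n τ => e.pullbackL2 hρ μ τ,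
    fun n => ⟨e.isEulerDirac_diracL2 hρ μ, dense_range_smoothL2 μ hρ hρ_inj⟩,
    fun m n τ v => e.coeFn_pullbackL2 hρ μ τ v,
    fun m n τ v => e.diracL2_pullbackL2 hρ μ τ v.2,
    e.existsUnique_isLimitInner hρ hρ_inj,
    fun c hc => e.existsUnique_limitDirac hρ hρ_inj hc⟩
  obtain ⟨τ, hτ⟩ := SignedInj.exists_induced (gen F₁) (gen F₂) hF
  exact ⟨τ, ⟨hτ, fun φ L₁ L₂ h₁ h₂ => hτ.map_hom hF φ L₁ L₂ h₁ h₂⟩, fun τ' h => h.1.unique hτ⟩
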